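/- Conventions. Let $\tau(X)\subset\mathbb C^{n+1}$ be the cone over $X\subset\mathbb P^n$: the points that are $0$ or project into $X$. A set $H\subset\mathbb P^n$ is an *algebraic Levi-flat hypervariety* if it is the image of a real-algebraic complex cone of $\mathbb C^{n+1}$, has real dimension $2n-1$, and at every point near which it is a smooth real hypersurface $\{\rho=0\}$, $d\rho\neq0$, the Levi form of $\rho$ vanishes on the complex tangent space. A *defining polynomial* of $H$ is a real-valued polynomial $P(z,\bar z)=\sum_{|\alpha|=|\beta|=m}c_{\alpha\beta}z^\alpha\bar z^\beta$ of least possible degree with $\tau(H)=\{P=0\}$ (unique up to a real factor if $H$ is irreducible); its *rank* is the rank of the Hermitian matrix $(c_{\alpha\beta})$, and $H$ has rank $r$ if $P$ has rank $r$. A point $p\in H$ is an *algebraic degenerate singularity* (with respect to $P$) if the gradient of $P$ vanishes at $p$ and $z\mapsto P(z,\bar p)$ is identically zero. A point $p\in H$ is a *degenerate singularity* if, in local holomorphic coordinates, for every real-valued real-analytic function $\rho(z,\bar z)$ near $p$ whose zero set near $p$ is $H$, the function $z\mapsto\rho(z,\bar p)$ (obtained by complexifying $\rho$) vanishes identically near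 $p$. Finally $H_{sing}$ is the set of points of $H$ near which $H$ is not a real-analytic submanifold (of any dimension), and $\dim H_{sing}$ is its real dimension as a semialgebraic set. Complex subvarieties of $\mathbb P^n$ are closed and complex-analytic. Theorem. Let $H\subset\mathbb P^n$, $n\ge2$, be an algebraic Levi-flat hypervariety. (i) If $P$ is a defining polynomial of $H$, of rank $r\le n$, then there is a complex subvariety $S\subset H$ of complex dimension at least $n-r$ such that every point of $S$ is an algebraic degenerate singularity of $H$ (with respect to $P$). (ii) If $\dim H_{sing}<2n-2$, then $H$ has a degenerate singularity. (iii) If $\dim H_{sing}=2n-4$, then there is a complex subvariety $S\subset H$ of complex dimension $n-2$ such that every point of $S$ is a degenerate singularity of $H$. -/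

import Mathlib

open scoped LinearAlgebra.Projectivization

noncomputable section

namespace LeviFlatProj

/-- Complex projective space `ℙⁿ`, the set of complex lines in `ℂⁿ⁺¹`. -/
abbrev CP (n : ℕ) : Type := ℙ ℂ (Fin (n + 1) → ℂ)

/-- The `i`-th standard affine chart `ℂⁿ → ℙⁿ`, `w ↦ [w₀ : ⋯ : 1 : ⋯ : wₙ₋₁]` with the entry `1` in
position `i`. The images of these charts are open and cover `ℙⁿ`, and changes of charts are
biholomorphic; local notions on `ℙⁿ` are expressed in these charts. -/
def chart {n : ℕ} (i : Fin (n + 1)) (w : Fin n → ℂ) : CP n :=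
  Projectivization.mk ℂ (Fin.insertNth (α := fun _ => ℂ) i 1 w) (fun h => by
    have h1 := congrFun h i
    simp at h1)

/-! ### Submanifolds and dimension -/

/-- Near `p ∈ X`, the set `X ⊆ ℂⁿ` is a `𝕜`-analytic submanifold of `𝕜`-codimension `k`
(`𝕜 = ℝ`: real-analytic submanifold; `𝕜 = ℂ`: complex submanifold). -/
def IsSubmanifoldAt (𝕜 : Type) [NontriviallyNormedField 𝕜] {n : ℕ} [NormedSpace 𝕜 (Fin n → ℂ)]
    (X : Set (Fin n → ℂ)) (k : ℕ) (p : Fin n → ℂ) : Prop :=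
  p ∈ X ∧ ∃ g : (Fin n → ℂ) → (Fin k → 𝕜), AnalyticAt 𝕜 g p ∧
    Function.Surjective (fderiv 𝕜 g p) ∧ ∀ᶠ z in nhds p, (z ∈ X ↔ g z = 0)

/-- `A ⊆ ℂⁿ` contains a (nonempty, locally closed) `𝕜`-analytic submanifold of
`𝕜`-dimension `d`. -/
def ContainsSubmanifold (𝕜 : Type) [NontriviallyNormedField 𝕜] {n : ℕ}
    [NormedSpace 𝕜 (Fin n → ℂ)] (A : Set (Fin n → ℂ)) (d : ℕ) : Prop :=
  ∃ k : ℕ, k + d = Module.finrank 𝕜 (Fin n → ℂ) ∧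
    ∃ M : Set (Fin n → ℂ), M ⊆ A ∧ ∃ q : Fin n → ℂ, IsSubmanifoldAt 𝕜 M k q

/-- The `𝕜`-dimension of a subset of `ℙⁿ`: the largest dimension of a `𝕜`-analytic submanifold
that it contains (`⊥` for the empty set). For `𝕜 = ℝ` and semialgebraic sets this is the usual
dimension of a semialgebraic set, for `𝕜 = ℂ` and complex subvarieties it is the usual complex
dimension. -/
def dimension (𝕜 : Type) [NontriviallyNormedField 𝕜] {n : ℕ} [NormedSpace 𝕜 (Fin n → ℂ)]
    (A : Set (CP n)) : WithBot ℕ∞ :=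
  ⨆ i : Fin (n + 1), ⨆ d : ℕ, ⨆ _ : ContainsSubmanifold 𝕜 (chart i ⁻¹' A) d,
    (((d : ℕ∞) : WithBot ℕ∞))

/-- `H_sing`: the set of points of `H` near which `H` is not a (real-analytic) submanifold,
of any dimension. -/
def singularSet {n : ℕ} (H : Set (CP n)) : Set (CP n) :=
  {p | p ∈ H ∧ ∀ (i : Fin (n + 1)) (w : Fin n → ℂ), chart i w = p →
    ¬ ∃ k : ℕ, IsSubmanifoldAt ℝ (chart i ⁻¹' H) k w}

/-- `S ⊆ ℙⁿ` is a (closed) complex-analytic subvariety: near every point of `ℙⁿ` it is the common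
zero set of finitely many holomorphic functions. -/
def IsComplexSubvariety {n : ℕ} (S : Set (CP n)) : Prop :=
  ∀ (i : Fin (n + 1)) (w : Fin n → ℂ), ∃ (k : ℕ) (f : (Fin n → ℂ) → (Fin k → ℂ)),
    AnalyticAt ℂ f w ∧ ∀ᶠ z in nhds w, (chart i z ∈ S ↔ f z = 0)

/-! ### Levi-flatness -/

/-- `ρ` is a local defining function of `X ⊆ ℂⁿ` at `p`: a real-valued real-analytic function
near `p` whose zero set near `p` is `X`. -/
def IsLocalDefiningFunction {n : ℕ} (X : Set (Fin n → ℂ)) (p : Fin n → ℂ)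
    (ρ : (Fin n → ℂ) → ℝ) : Prop :=
  AnalyticAt ℝ ρ p ∧ ∀ᶠ z in nhds p, (z ∈ X ↔ ρ z = 0)

/-- The Levi form `∑ⱼₖ (∂²ρ/∂zⱼ∂z̄ₖ)(p) aⱼ āₖ`, written through the real second derivative. -/
def leviForm {n : ℕ} (ρ : (Fin n → ℂ) → ℝ) (p a : Fin n → ℂ) : ℝ :=
  (fderiv ℝ (fderiv ℝ ρ) p a a
    + fderiv ℝ (fderiv ℝ ρ) p (Complex.I • a) (Complex.I • a)) / 4

/-- `X ⊆ ℂⁿ` is Levi-flat: at every point `p` of `X` near which `X` is a smooth real hypersurface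
`{ρ = 0}`, `dρ(p) ≠ 0`, the Levi form of `ρ` vanishes on the complex tangent space
`{a | ∂ρ(p) a = 0}`. -/
def IsLeviFlat {n : ℕ} (X : Set (Fin n → ℂ)) : Prop :=
  ∀ p ∈ X, ∀ ρ : (Fin n → ℂ) → ℝ, IsLocalDefiningFunction X p ρ → fderiv ℝ ρ p ≠ 0 →
    ∀ a : Fin n → ℂ, fderiv ℝ ρ p a = 0 → fderiv ℝ ρ p (Complex.I • a) = 0 →
      leviForm ρ p a = 0

/-! ### Algebraic hypervarieties -/

/-- `V ⊆ ℂᴺ` is real-algebraic: the common zero set of a family of real polynomials in the real and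
imaginary parts of the coordinates. -/
def IsRealAlgebraic {N : ℕ} (V : Set (Fin N → ℂ)) : Prop :=
  ∃ F : Set (MvPolynomial (Fin N ⊕ Fin N) ℝ),
    V = {z | ∀ f ∈ F,
      MvPolynomial.eval (Sum.elim (fun j => (z j).re) (fun j => (z j).im)) f = 0}

/-- `V` is a complex cone. -/
def IsComplexCone {N : ℕ} (V : Set (Fin N → ℂ)) : Prop :=
  ∀ z ∈ V, ∀ c : ℂ, c • z ∈ V

/-- `X ⊆ ℙⁿ` is (real-)algebraic: the image of a real-algebraic complex cone under the projection
`ℂⁿ⁺¹ \ {0} → ℙⁿ`. -/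
def IsAlgebraic {n : ℕ} (X : Set (CP n)) : Prop :=
  ∃ V : Set (Fin (n + 1) → ℂ), IsRealAlgebraic V ∧ IsComplexCone V ∧
    X = {p | ∃ (z : Fin (n + 1) → ℂ) (hz : z ≠ 0), z ∈ V ∧ Projectivization.mk ℂ z hz = p}

/-- An algebraic Levi-flat hypervariety of `ℙⁿ`: an algebraic subset of real codimension one that is
Levi-flat at all points near which it is a smooth hypersurface. -/
structure IsAlgebraicLeviFlatHypervariety {n : ℕ} (H : Set (CP n)) : Prop where
  algebraic : IsAlgebraic H
  codim_one : dimension ℝ H = ((2 * n - 1 : ℕ) : ℕ∞)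
  leviFlat : ∀ i : Fin (n + 1), IsLeviFlat (chart i ⁻¹' H)

/-- The cone `τ(H) ⊆ ℂⁿ⁺¹` over `H`: the points that are zero or project into `H`. -/
def cone {n : ℕ} (H : Set (CP n)) : Set (Fin (n + 1) → ℂ) :=
  {z | ∀ hz : z ≠ 0, Projectivization.mk ℂ z hz ∈ H}

/-- The monomial `z^α`; monomials of degree `m` in `N` variables are indexed by the multisets of
size `m` of variables. -/
def monomialValue {N m : ℕ} (α : Sym (Fin N) m) (z : Fin N → ℂ) : ℂ :=
  ((α : Multiset (Fin N)).map z).prod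

/-- The polarized bihomogeneous polynomial of bidegree `(m, m)` with coefficient matrix `C`:
`P(z, w̄) = ∑ c_{αβ} z^α w̄^β`, the sum over the multi-indices `|α| = |β| = m`. It is real-valued on
`w = z` if and only if `C` is Hermitian. -/
def bihom {N m : ℕ} (C : Matrix (Sym (Fin N) m) (Sym (Fin N) m) ℂ) (z w : Fin N → ℂ) : ℂ :=
  ∑ α, ∑ β, C α β * monomialValue α z * star (monomialValue β w)

/-- `C` is the coefficient matrix of a defining polynomial of `H`: a real-valued bihomogeneous
polynomial `P(z, z̄)`, of the least possible degree, whose zero set is `τ(H)`. The rank of `H` is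
the rank of `C`. -/
structure IsDefiningPolynomial {n m : ℕ} (H : Set (CP n))
    (C : Matrix (Sym (Fin (n + 1)) m) (Sym (Fin (n + 1)) m) ℂ) : Prop where
  isHermitian : C.IsHermitian
  zeroSet : cone H = {z | bihom C z z = 0}
  minimal : ∀ (m' : ℕ) (C' : Matrix (Sym (Fin (n + 1)) m') (Sym (Fin (n + 1)) m') ℂ),
    C'.IsHermitian → cone H = {z | bihom C' z z = 0} → m ≤ m'

/-! ### Degenerate singularities -/

/-- `R(z, ζ)` is the complexification of `ρ` near `p`: it is holomorphic near `(p, p̄)`, and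
`R(z, z̄) = ρ(z)` for `z` near `p`. Every real-analytic `ρ` has one, and its germ is unique. -/
def IsComplexification {n : ℕ} (p : Fin n → ℂ) (ρ : (Fin n → ℂ) → ℝ)
    (R : (Fin n → ℂ) × (Fin n → ℂ) → ℂ) : Prop :=
  AnalyticAt ℂ R (p, star p) ∧ ∀ᶠ z in nhds p, R (z, star z) = (ρ z : ℂ)

/-- `p ∈ H` is a degenerate singularity of `H`: for every local defining function `ρ` of `H` at `p`
the Segre variety of `p` is open, that is, `z ↦ ρ(z, p̄)` vanishes identically near `p`. -/
def IsDegenerateSingularity {n : ℕ} (H : Set (CP n)) (p : CP n) : Prop :=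
  p ∈ H ∧ ∀ (i : Fin (n + 1)) (w : Fin n → ℂ), chart i w = p →
    ∀ ρ : (Fin n → ℂ) → ℝ, IsLocalDefiningFunction (chart i ⁻¹' H) w ρ →
      ∀ R : (Fin n → ℂ) × (Fin n → ℂ) → ℂ, IsComplexification w ρ R →
        ∀ᶠ z in nhds w, R (z, star w) = 0

/-- `p ∈ H` is an algebraic degenerate singularity of `H`, for the defining polynomial `P` with
coefficient matrix `C`: the gradient of `P` vanishes at `p`, and `z ↦ P(z, p̄)` is identically
zero. -/
def IsAlgebraicDegenerateSingularity {n m : ℕ} (H : Set (CP n))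
    (C : Matrix (Sym (Fin (n + 1)) m) (Sym (Fin (n + 1)) m) ℂ) (p : CP n) : Prop :=
  p ∈ H ∧ ∀ (v : Fin (n + 1) → ℂ) (hv : v ≠ 0), Projectivization.mk ℂ v hv = p →
    fderiv ℝ (fun z => bihom C z z) v = 0 ∧ ∀ z : Fin (n + 1) → ℂ, bihom C z v = 0

end LeviFlatProj

end

/-!
The rank statement is linear algebra and dimension theory. Let `C` be the matrix of the defining
polynomial `P(z, z̄)`. The forms whose coefficients are the columns of `C` span a space of dimension
`r = rank C`, so their common zero locus in `ℙⁿ` has dimension at least `n - r`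
(`le_dimension_zeroLocus`, which rests on Krull's height theorem through
`exists_common_zero_ne_zero`). At a point `p` of this locus all forms `∑ c_{αβ} z^α` vanish; hence
`P(·, p̄) = 0` by Hermitian symmetry and the gradient of `P` vanishes at `p`
(`isAlgebraicDegenerateSingularity_of_vanishing`).

The other two statements rest on the fact that `H` contains a real one-parameter family of distinct
irreducible algebraic hypersurfaces, depending analytically on the parameter
(`exists_algebraicLeaves`). Near a suitable point (`exists_regular_point`) `H` has a real polynomial
defining function `R(z, z̄)` with nonzero differential. The leaf of the Levi foliation through `p`
is the Segre variety `{R(·, p̄) = 0}` (`exists_leaf_graph`). To see that the Segre variety stays in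
`H`, one shows that the Levi form of `R` on tangent vectors, as a polynomial in `z` and `ζ`, is divisible
by the irreducible factor of `R` that defines `H` (`exists_factor_dvd_tangentialLevi`). This bounds
the mixed derivatives of `R` by its first derivatives and its values (`exists_mixedDeriv_bound`),
and a uniqueness argument for the Goursat problem applies (`eq_zero_of_mixedDeriv_bound`). Since
Segre varieties satisfy equations of bounded degree, the leaves have equations of a least degree
`d`; for an interval of parameters these are irreducible, they can be chosen analytically in the
parameter (`exists_analytic_section`), and by polarization their whole zero sets lie in the cone
over `H` (`mem_cone_of_vanishing`).

Now let `ρ` be a local defining function of `H` with complexification `R(z, ζ)`, and let `p` be a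
point on `k + 1` distinct leaves. Then `R(·, p̄)` vanishes at `p` to order at least `k + 1`
(`norm_le_of_vanishing_on_hypersurfaces`). A general
complex line close to `p` meets each leaf in a point close to `p`, and polarization along the leaves
makes `R(·, p̄)` vanish at such points (`exists_root_of_polar_vanishing`); so on the line `R(·, p̄)`
is bounded by the product of the distances to these points, and the line tends to one through `p`.
Two leaves therefore meet only in singular points (`AlgebraicLeaves.mem_singularSet`),
and a point on infinitely many leaves is a degenerate singularity
(`AlgebraicLeaves.isDegenerateSingularity`).

Finally, two leaves and `n - 2` hyperplanes have a common point, which can be chosen analytically in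
the two real parameters `(s, t)` of the leaves and in the coefficients `M` of the hyperplanes
(`AlgebraicLeaves.exists_isIntersectionFamily`). All these points are singular. The dependence on
`M` alone accounts for `2n - 4` real dimensions of `H_sing`, and a dependence of rank `k` on
`(s, t)` adds `k` to this. If `dim H_sing < 2n - 2`, the rank is at most one, so infinitely many pairs
`(s, t)` give the same point (`exists_infinite_fibre`), which then lies on infinitely many leaves.
If `dim H_sing = 2n - 4`, the point does not depend on `(s, t)` at all. So infinitely many leaves
have a common zero locus that meets the linear subspaces `M` of codimension `n - 2` near a given
one; it has complex dimension at least `n - 2`, and no more because it lies in `H_sing`.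
-/

open scoped LinearAlgebra.Projectivization

noncomputable section

namespace LeviFlatProj

open Filter Topology Set

/-! ### Implicit functions and immersions -/

section Analysis

variable {𝕜 : Type} [RCLike 𝕜] {E : Type*} [NormedAddCommGroup E] [NormedSpace 𝕜 E]

/-- The analytic implicit function theorem for one equation in one unknown of a field `𝕜'`
(such as one complex unknown depending on real parameters), with local uniqueness. -/
theorem exists_analytic_implicit [CompleteSpace E] {𝕜' : Type*} [NontriviallyNormedField 𝕜']
    [NormedAlgebra 𝕜 𝕜'] [CompleteSpace 𝕜'] {F : E × 𝕜' → 𝕜'} {e₀ : E} {x₀ d : 𝕜'}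
    (hF : AnalyticAt 𝕜 F (e₀, x₀)) (h0 : F (e₀, x₀) = 0)
    (hd : HasDerivAt (fun x => F (e₀, x)) d x₀) (hd0 : d ≠ 0) :
    ∃ φ : E → 𝕜', AnalyticAt 𝕜 φ e₀ ∧ φ e₀ = x₀ ∧ (∀ᶠ e in 𝓝 e₀, F (e, φ e) = 0) ∧
      ∀ᶠ u in 𝓝 (e₀, x₀), F u = 0 → φ u.1 = u.2 := by
  have cdf : ContDiffAt 𝕜 ⊤ F (e₀, x₀) := hF.contDiffAt
  have hcomp : fderiv 𝕜 F (e₀, x₀) ∘L .inr 𝕜 E 𝕜' =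
      ((ContinuousLinearEquiv.unitsEquivAut 𝕜' (Units.mk0 d hd0)).restrictScalars 𝕜 :
        𝕜' →L[𝕜] 𝕜') := by
    have h1 : HasFDerivAt (fun x => F (e₀, x)) (fderiv 𝕜 F (e₀, x₀) ∘L .inr 𝕜 E 𝕜') x₀ := by
      have := (hF.differentiableAt.hasFDerivAt).comp x₀
        ((hasFDerivAt_prodMk_right (𝕜 := 𝕜) e₀ x₀))
      exact this
    have h2 := hd.hasFDerivAt.restrictScalars 𝕜
    rw [h1.unique h2]
    ext x
    simp [mul_comm]
  have hinv : (fderiv 𝕜 F (e₀, x₀) ∘L .inr 𝕜 E 𝕜').IsInvertible := ⟨_, hcomp.symm⟩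
  refine ⟨cdf.implicitFunction (by simp) hinv, ?_, ?_, ?_, ?_⟩
  · exact (cdf.contDiffAt_implicitFunction (by simp) hinv).analyticAt
  · exact cdf.implicitFunction_apply_self (by simp) hinv
  · filter_upwards [cdf.eventually_apply_implicitFunction (by simp) hinv] with e he
    rw [he, h0]
  · filter_upwards [cdf.eventually_apply_eq_iff_implicitFunction (by simp) hinv] with u hu h
    exact hu.1 (by rw [h, h0])

/-- A set that contains the image of an analytic immersion of a `d`-dimensional space contains a
`d`-dimensional submanifold. -/
theorem ContainsSubmanifold.of_immersion [FiniteDimensional 𝕜 E] {n : ℕ}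
    [NormedSpace 𝕜 (Fin n → ℂ)] [FiniteDimensional 𝕜 (Fin n → ℂ)] {A : Set (Fin n → ℂ)}
    {p : E → Fin n → ℂ} {u₀ : E} (hp : AnalyticAt 𝕜 p u₀)
    (hinj : Function.Injective (fderiv 𝕜 p u₀)) (hA : ∀ᶠ u in 𝓝 u₀, p u ∈ A) {d : ℕ}
    (hd : Module.finrank 𝕜 E = d) : ContainsSubmanifold 𝕜 A d := by
  have : CompleteSpace E := FiniteDimensional.complete 𝕜 E
  have : CompleteSpace (Fin n → ℂ) := inferInstance
  set p' := fderiv 𝕜 p u₀ with hp'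
  obtain ⟨Q, hQ⟩ := Submodule.exists_isCompl (LinearMap.range (p' : E →ₗ[𝕜] (Fin n → ℂ)))
  set Φ : E × Q → (Fin n → ℂ) := fun x => p x.1 + (x.2 : Fin n → ℂ) with hΦ
  have hΦan : AnalyticAt 𝕜 Φ (u₀, 0) := by
    refine AnalyticAt.add ?_ ?_
    · exact hp.comp_of_eq analyticAt_fst rfl
    · exact (Q.subtypeL.analyticAt _).comp_of_eq analyticAt_snd rfl
  set L : (E × Q) →ₗ[𝕜] (Fin n → ℂ) := LinearMap.coprod (p' : E →ₗ[𝕜] (Fin n → ℂ)) Q.subtype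
  have hLinj : Function.Injective L := by
    rw [← LinearMap.ker_eq_bot]
    refine LinearMap.ker_eq_bot'.2 ?_
    rintro ⟨u, v⟩ h
    simp only [L, LinearMap.coprod_apply, ContinuousLinearMap.coe_coe, Submodule.subtype_apply] at h
    have h1 : (v : Fin n → ℂ) ∈ LinearMap.range (p' : E →ₗ[𝕜] (Fin n → ℂ)) :=
      ⟨-u, by simp [eq_neg_of_add_eq_zero_right h]⟩
    have h2 : (v : Fin n → ℂ) = 0 := by
      have := hQ.disjoint.le_bot ⟨h1, v.2⟩
      simpa using this
    have h3 : p' u = 0 := by simpa [h2] using h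
    have h4 : u = 0 := hinj (by simpa using h3)
    simp [h4, Subtype.ext_iff, h2]
  have hLsurj : Function.Surjective L := by
    intro z
    have hz : z ∈ LinearMap.range (p' : E →ₗ[𝕜] (Fin n → ℂ)) ⊔ Q := by
      rw [hQ.sup_eq_top]; trivial
    obtain ⟨a, ⟨u, rfl⟩, b, hb, rfl⟩ := Submodule.mem_sup.1 hz
    exact ⟨(u, ⟨b, hb⟩), by simp [L]⟩
  let e : (E × Q) ≃L[𝕜] (Fin n → ℂ) :=
    (LinearEquiv.ofBijective L ⟨hLinj, hLsurj⟩).toContinuousLinearEquiv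
  have hder : HasStrictFDerivAt Φ (e : (E × Q) →L[𝕜] (Fin n → ℂ)) (u₀, 0) := by
    have h1 : HasStrictFDerivAt Φ (p' ∘L .fst 𝕜 E Q + Q.subtypeL ∘L .snd 𝕜 E Q) (u₀, 0) := by
      refine HasStrictFDerivAt.add ?_ ?_
      · exact HasStrictFDerivAt.comp (u₀, (0 : Q)) hp.hasStrictFDerivAt hasStrictFDerivAt_fst
      · exact (Q.subtypeL ∘L .snd 𝕜 E Q).hasStrictFDerivAt
    have h2 : (e : (E × Q) →L[𝕜] (Fin n → ℂ)) =
        p' ∘L .fst 𝕜 E Q + Q.subtypeL ∘L .snd 𝕜 E Q := ContinuousLinearMap.ext fun x => rfl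
    rwa [h2]
  set Ψ := hder.toOpenPartialHomeomorph Φ with hΨ
  have hsrc : (u₀, (0 : Q)) ∈ Ψ.source := hder.mem_toOpenPartialHomeomorph_source
  have hΨcoe : ⇑Ψ = Φ := rfl
  have hq : Ψ (u₀, 0) = p u₀ := by simp [hΨcoe, hΦ]
  have hsymm : AnalyticAt 𝕜 Ψ.symm (p u₀) := by
    rw [← hq]
    exact Ψ.analyticAt_symm' hsrc (by rw [hΨcoe]; exact hΦan)
      (by rw [hΨcoe]; exact hder.hasFDerivAt.fderiv)
  have hsymm0 : Ψ.symm (p u₀) = (u₀, 0) := by rw [← hq]; exact Ψ.left_inv hsrc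
  have htgt : p u₀ ∈ Ψ.target := by rw [← hq]; exact Ψ.map_source hsrc
  set k := Module.finrank 𝕜 Q with hk
  let c : Q ≃L[𝕜] (Fin k → 𝕜) := ContinuousLinearEquiv.ofFinrankEq (by simp [hk])
  refine ⟨k, ?_, {z | z ∈ A ∧ z ∈ Ψ.target ∧ c (Ψ.symm z).2 = 0}, fun z hz => hz.1, p u₀, ?_, ?_⟩
  · rw [← e.toLinearEquiv.finrank_eq, Module.finrank_prod, hd, add_comm]
  · exact ⟨hA.self_of_nhds, htgt, by simp [hsymm0]⟩
  · refine ⟨fun z => c (Ψ.symm z).2, ?_, ?_, ?_⟩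
    · exact (c.analyticAt _).comp (analyticAt_snd.comp hsymm)
    · have h1 : HasFDerivAt (fun z => c (Ψ.symm z).2)
          ((c : Q →L[𝕜] (Fin k → 𝕜)) ∘L .snd 𝕜 E Q ∘L fderiv 𝕜 Ψ.symm (p u₀)) (p u₀) :=
        c.hasFDerivAt.comp _ (hasFDerivAt_snd.comp _ hsymm.differentiableAt.hasFDerivAt)
      have h2 : HasFDerivAt (fun x => Ψ.symm (Φ x))
          (fderiv 𝕜 Ψ.symm (p u₀) ∘L (e : (E × Q) →L[𝕜] (Fin n → ℂ))) (u₀, 0) := by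
        refine HasFDerivAt.comp _ ?_ hder.hasFDerivAt
        have : Φ (u₀, 0) = p u₀ := hq
        rw [this]
        exact hsymm.differentiableAt.hasFDerivAt
      have h3 : HasFDerivAt (fun x => Ψ.symm (Φ x)) (.id 𝕜 (E × Q)) (u₀, 0) := by
        refine (hasFDerivAt_id _).congr_of_eventuallyEq ?_
        filter_upwards [Ψ.open_source.mem_nhds hsrc] with x hx using Ψ.left_inv hx
      have h4 := h2.unique h3
      rw [h1.fderiv]
      intro y
      refine ⟨e (0, c.symm y), ?_⟩
      have h5 := congrArg (fun T => T (0, c.symm y)) h4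
      simp only [ContinuousLinearMap.comp_apply, ContinuousLinearMap.id_apply,
        ContinuousLinearEquiv.coe_coe] at h5
      simp [h5]
    · have hmem : ∀ᶠ z in 𝓝 (p u₀), p (Ψ.symm z).1 ∈ A := by
        have h1 : Tendsto (fun z => (Ψ.symm z).1) (𝓝 (p u₀)) (𝓝 u₀) := by
          have := (continuousAt_fst.comp hsymm.continuousAt : ContinuousAt (Prod.fst ∘ Ψ.symm) _)
          have h2 := this.tendsto
          simpa [hsymm0, Function.comp_def] using h2
        exact h1.eventually hA
      filter_upwards [hmem, Ψ.open_target.mem_nhds htgt] with z hz hzt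
      constructor
      · exact fun h => h.2.2
      · intro h
        have h2 : (Ψ.symm z).2 = 0 := by simpa using h
        have h3 : z = p (Ψ.symm z).1 := by
          conv_lhs => rw [← Ψ.right_inv hzt]
          simp [hΨcoe, hΦ, h2]
        exact ⟨h3 ▸ hz, hzt, h⟩

end Analysis

/-! ### Polarization -/

/-- Polarization: a function `Q (z, w̄)`, holomorphic in `z` and `w̄`, that vanishes on the diagonal
`z = w` of a holomorphically parametrized set vanishes for all pairs of points of that set.
The parameters `a` and `b` are the values at `i` and `-i` of an affine line `m + λ d`, and on it
the claim is the identity theorem for the real axis. -/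
theorem polarization {E G : Type*} [NormedAddCommGroup E] [NormedSpace ℂ E]
    [NormedAddCommGroup G] [NormedSpace ℂ G] [StarAddMonoid G] [NormedStarGroup G]
    [StarModule ℂ G] {D : Set E} (hDo : IsOpen D) (hDc : Convex ℝ D) {g : E → G}
    (hg : DifferentiableOn ℂ g D) {Q : G × G → ℂ}
    (hQ : ∀ a ∈ D, ∀ b ∈ D, DifferentiableAt ℂ Q (g a, star (g b)))
    (h0 : ∀ a ∈ D, Q (g a, star (g a)) = 0) :
    ∀ a ∈ D, ∀ b ∈ D, Q (g a, star (g b)) = 0 := by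
  intro a ha b hb
  set m : E := (2⁻¹ : ℂ) • (a + b)
  set d : E := (-(Complex.I * 2⁻¹) : ℂ) • (a - b)
  have hI : m + Complex.I • d = a := by
    simp only [m, d, smul_smul]
    have : Complex.I * -(Complex.I * 2⁻¹) = (2⁻¹ : ℂ) := by
      rw [mul_neg, ← mul_assoc, Complex.I_mul_I]; ring
    rw [this, ← smul_add]
    rw [show a + b + (a - b) = (2 : ℂ) • a by rw [two_smul]; abel, smul_smul]
    norm_num
  have hI' : m + (-Complex.I) • d = b := by
    simp only [m, d, smul_smul]
    have : -Complex.I * -(Complex.I * 2⁻¹) = -(2⁻¹ : ℂ) := by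
      rw [neg_mul_neg, ← mul_assoc, Complex.I_mul_I]; ring
    rw [this, neg_smul, ← smul_neg, ← smul_add]
    rw [show a + b + -(a - b) = (2 : ℂ) • b by rw [two_smul]; abel, smul_smul]
    norm_num
  set ℓ : ℂ → E := fun t => m + t • d with hℓ
  have hℓd : Differentiable ℂ ℓ := by fun_prop
  let ℓr : ℂ →ᵃ[ℝ] E :=
    { toFun := ℓ
      linear := ((LinearMap.toSpanSingleton ℂ E d).restrictScalars ℝ)
      map_vadd' := by
        intro p v
        simp [hℓ, add_smul]; abel }
  set Ω₁ : Set ℂ := ℓ ⁻¹' D with hΩ₁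
  have hΩ₁o : IsOpen Ω₁ := hDo.preimage hℓd.continuous
  have hΩ₁c : Convex ℝ Ω₁ := hDc.affine_preimage ℓr
  set Ω₂ : Set ℂ := (starRingEnd ℂ) ⁻¹' Ω₁
  have hΩ₂o : IsOpen Ω₂ := hΩ₁o.preimage Complex.continuous_conj
  have hΩ₂c : Convex ℝ Ω₂ := hΩ₁c.linear_preimage (Complex.conjAe.toLinearMap)
  set Ω := Ω₁ ∩ Ω₂
  have hIΩ : Complex.I ∈ Ω := by
    refine ⟨?_, ?_⟩
    · change ℓ Complex.I ∈ D; simp only [hℓ]; rw [hI]; exact ha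
    · change ℓ _ ∈ D; simp only [hℓ, Complex.conj_I]; rw [hI']; exact hb
  have hIΩ' : -Complex.I ∈ Ω := by
    refine ⟨?_, ?_⟩
    · change ℓ (-Complex.I) ∈ D; simp only [hℓ]; rw [hI']; exact hb
    · change ℓ _ ∈ D; simp only [hℓ, map_neg, Complex.conj_I, neg_neg]; rw [hI]; exact ha
  have hΩo : IsOpen Ω := hΩ₁o.inter hΩ₂o
  have hΩc : Convex ℝ Ω := hΩ₁c.inter hΩ₂c
  have h0Ω : (0 : ℂ) ∈ Ω := by
    have := hΩc.midpoint_mem hIΩ hIΩ'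
    simpa [midpoint_eq_smul_add] using this
  set φ : ℂ → ℂ := fun t => Q (g (ℓ t), star (g (ℓ (star t)))) with hφ
  have hφd : DifferentiableOn ℂ φ Ω := by
    intro t ht
    have h1 : DifferentiableAt ℂ (fun t => g (ℓ t)) t :=
      ((hg _ ht.1).differentiableAt (hDo.mem_nhds ht.1)).comp t (hℓd t)
    have h2 : DifferentiableAt ℂ (fun t => g (ℓ t)) (star t) :=
      ((hg _ ht.2).differentiableAt (hDo.mem_nhds ht.2)).comp _ (hℓd _)
    have h3 : DifferentiableAt ℂ (fun t => star (g (ℓ (star t)))) t := by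
      have := h2.star_star
      simpa [Function.comp_def] using this
    exact ((hQ _ ht.1 _ ht.2).comp t (h1.prodMk h3)).differentiableWithinAt
  have hφa : AnalyticOnNhd ℂ φ Ω := hφd.analyticOnNhd hΩo
  have hzero : Set.EqOn φ 0 Ω := by
    refine hφa.eqOn_zero_of_preconnected_of_frequently_eq_zero hΩc.isPreconnected h0Ω ?_
    have hreal : ∀ᶠ t : ℝ in 𝓝[≠] 0, φ (t : ℂ) = 0 := by
      have : ∀ᶠ t : ℝ in 𝓝 0, ((t : ℂ)) ∈ Ω :=
        (Complex.continuous_ofReal.tendsto' 0 0 (by simp)).eventually (hΩo.mem_nhds h0Ω)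
      filter_upwards [this.filter_mono nhdsWithin_le_nhds] with t ht
      have : star (t : ℂ) = t := Complex.conj_ofReal t
      simp only [hφ, this]
      exact h0 _ ht.1
    have htend : Tendsto (fun t : ℝ => (t : ℂ)) (𝓝[≠] 0) (𝓝[≠] 0) := by
      refine tendsto_nhdsWithin_iff.2 ⟨?_, ?_⟩
      · exact (Complex.continuous_ofReal.tendsto' 0 0 (by simp)).mono_left nhdsWithin_le_nhds
      · filter_upwards [self_mem_nhdsWithin] with t ht using by simpa using ht
    exact htend.frequently hreal.frequently
  have := hzero hIΩ
  simp only [hφ, hℓ, Pi.zero_apply] at this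
  rw [show star Complex.I = -Complex.I from Complex.conj_I, hI, hI'] at this
  exact this

/-! ### Complexification of real-analytic functions -/

/-- Every real-analytic function on `ℂⁿ` has a complexification. Its power series at `w` in the real
coordinates `Re (zⱼ - wⱼ)`, `Im (zⱼ - wⱼ)` is evaluated at the complex values `(aⱼ + bⱼ) / 2` and
`(aⱼ - bⱼ) / 2i` of these coordinates, with `a = z - w` and `b = ζ - w̄`. -/
theorem exists_isComplexification {n : ℕ} {w : Fin n → ℂ} {ρ : (Fin n → ℂ) → ℝ}
    (hρ : AnalyticAt ℝ ρ w) : ∃ R, IsComplexification w ρ R := by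
  obtain ⟨p, r, hp⟩ := hρ
  let e : Fin n ⊕ Fin n → (Fin n → ℂ) :=
    Sum.elim (fun j => Pi.single j 1) (fun j => Pi.single j Complex.I)
  let c : Fin n ⊕ Fin n → ((Fin n → ℂ) × (Fin n → ℂ)) →L[ℂ] ℂ :=
    Sum.elim
      (fun j => (2⁻¹ : ℂ) • (.proj j ∘L .fst ℂ _ _ + .proj j ∘L .snd ℂ _ _))
      (fun j => (-(Complex.I * 2⁻¹) : ℂ) • (.proj j ∘L .fst ℂ _ _ - .proj j ∘L .snd ℂ _ _))
  have he : ∀ κ, ‖e κ‖ ≤ 1 := by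
    rintro (j | j) <;> refine (pi_norm_le_iff_of_nonneg zero_le_one).2 fun l => ?_ <;>
      simp only [e, Sum.elim_inl, Sum.elim_inr, Pi.single_apply] <;> split_ifs <;> simp
  have hproj1 : ∀ j : Fin n, ∀ x : (Fin n → ℂ) × (Fin n → ℂ), ‖x.1 j‖ ≤ ‖x‖ := fun j x =>
    (norm_le_pi_norm x.1 j).trans (norm_fst_le x)
  have hproj2 : ∀ j : Fin n, ∀ x : (Fin n → ℂ) × (Fin n → ℂ), ‖x.2 j‖ ≤ ‖x‖ := fun j x =>
    (norm_le_pi_norm x.2 j).trans (norm_snd_le x)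
  have hc : ∀ κ, ‖c κ‖ ≤ 1 := by
    rintro (j | j)
    · refine ContinuousLinearMap.opNorm_le_bound _ zero_le_one fun x => ?_
      have := norm_add_le (x.1 j) (x.2 j)
      have h1 := hproj1 j x
      have h2 := hproj2 j x
      change ‖(2⁻¹ : ℂ) * (x.1 j + x.2 j)‖ ≤ 1 * ‖x‖
      rw [norm_mul, norm_inv, RCLike.norm_ofNat]
      linarith
    · refine ContinuousLinearMap.opNorm_le_bound _ zero_le_one fun x => ?_
      have := norm_sub_le (x.1 j) (x.2 j)
      have h1 := hproj1 j x
      have h2 := hproj2 j x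
      change ‖(-(Complex.I * 2⁻¹) : ℂ) * (x.1 j - x.2 j)‖ ≤ 1 * ‖x‖
      rw [norm_mul, norm_neg, norm_mul, Complex.norm_I, norm_inv, RCLike.norm_ofNat]
      linarith
  have hexp : ∀ a : Fin n → ℂ, a = ∑ κ, (c κ (a, star a)).re • e κ := by
    intro a
    ext l
    simp only [Fintype.sum_sum_type, c, e, Sum.elim_inl, Sum.elim_inr,
      Finset.sum_apply, Pi.smul_apply, Pi.single_apply]
    simp [Complex.ext_iff]
    constructor <;> ring
  have hcre : ∀ κ, ∀ a : Fin n → ℂ, c κ (a, star a) = ((c κ (a, star a)).re : ℂ) := by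
    rintro (j | j) a <;> simp [c, Complex.ext_iff]
  let q : FormalMultilinearSeries ℂ ((Fin n → ℂ) × (Fin n → ℂ)) ℂ := fun m =>
    ∑ κ : Fin m → Fin n ⊕ Fin n, ((p m (fun i => e (κ i)) : ℝ) : ℂ) •
      (ContinuousMultilinearMap.mkPiAlgebraFin ℂ m ℂ).compContinuousLinearMap (fun i => c (κ i))
  have hqn : ∀ m, ‖q m‖ ≤ ‖p m‖ * (2 * n + 1) ^ m := by
    intro m
    have hterm : ∀ κ : Fin m → Fin n ⊕ Fin n, ‖((p m (fun i => e (κ i)) : ℝ) : ℂ) •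
      (ContinuousMultilinearMap.mkPiAlgebraFin ℂ m ℂ).compContinuousLinearMap
        (fun i => c (κ i))‖ ≤ ‖p m‖ := by
      intro κ
      refine (norm_smul _ _).le.trans ?_
      have h1 : ‖((p m (fun i => e (κ i)) : ℝ) : ℂ)‖ ≤ ‖p m‖ := by
        rw [Complex.norm_real]
        refine ((p m).le_opNorm _).trans ?_
        refine mul_le_of_le_one_right (norm_nonneg _) ?_
        exact Finset.prod_le_one (fun _ _ => norm_nonneg _) (fun i _ => he _)
      have h2 : ‖(ContinuousMultilinearMap.mkPiAlgebraFin ℂ m ℂ).compContinuousLinearMap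
          (fun i => c (κ i))‖ ≤ 1 := by
        refine (ContinuousMultilinearMap.norm_compContinuousLinearMap_le _ _).trans ?_
        rw [ContinuousMultilinearMap.norm_mkPiAlgebraFin, one_mul]
        exact Finset.prod_le_one (fun _ _ => norm_nonneg _) (fun i _ => hc _)
      calc _ ≤ ‖p m‖ * 1 := mul_le_mul h1 h2 (norm_nonneg _) (norm_nonneg _)
        _ = _ := mul_one _
    refine (norm_sum_le_of_le _ fun κ _ => hterm κ).trans ?_
    rw [Finset.sum_const, nsmul_eq_mul, mul_comm]
    refine mul_le_mul_of_nonneg_left ?_ (norm_nonneg _)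
    simp only [Finset.card_univ, Fintype.card_fun, Fintype.card_fin, Fintype.card_sum]
    push_cast
    exact pow_le_pow_left₀ (by positivity) (by linarith) _
  have hqrad : 0 < q.radius := by
    obtain ⟨r', hr', hr'r⟩ := ENNReal.lt_iff_exists_nnreal_btwn.1 hp.r_pos
    have hr'0 : 0 < r' := by simpa using hr'
    obtain ⟨C, hC, hCb⟩ := p.norm_mul_pow_le_of_lt_radius (hr'r.trans_le hp.r_le)
    have hlt : (0 : ENNReal) < ((r' / (2 * n + 1) : NNReal) : ENNReal) := by
      simp only [ENNReal.coe_pos]; positivity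
    refine hlt.trans_le (q.le_radius_of_bound C fun m => ?_)
    refine le_trans ?_ (hCb m)
    push_cast
    rw [div_pow, mul_div_assoc', div_le_iff₀ (by positivity)]
    calc ‖q m‖ * (r' : ℝ) ^ m ≤ (‖p m‖ * (2 * n + 1) ^ m) * (r' : ℝ) ^ m := by
          gcongr; exact hqn m
      _ = _ := by ring
  have hqs := q.hasFPowerSeriesOnBall hqrad
  refine ⟨fun x => q.sum (x - (w, star w)), ?_, ?_⟩
  · refine AnalyticAt.comp_of_eq (y := 0) hqs.analyticAt ?_ (by simp)
    exact analyticAt_id.sub analyticAt_const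
  · have hterm : ∀ (a : Fin n → ℂ) (m : ℕ), q m (fun _ => (a, star a)) =
        ((p m (fun _ => a) : ℝ) : ℂ) := by
      intro a m
      have h1 : p m (fun _ => a) =
          ∑ κ : Fin m → Fin n ⊕ Fin n, (∏ i, (c (κ i) (a, star a)).re) *
            p m (fun i => e (κ i)) := by
        conv_lhs => rw [show (fun _ : Fin m => a) =
          fun _ : Fin m => ∑ κ, (c κ (a, star a)).re • e κ from funext fun _ => hexp a]
        rw [ContinuousMultilinearMap.map_sum]
        refine Finset.sum_congr rfl fun κ _ => ?_
        rw [ContinuousMultilinearMap.map_smul_univ, smul_eq_mul]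
      rw [h1]
      simp only [q, sum_apply, smul_apply,
        ContinuousMultilinearMap.compContinuousLinearMap_apply,
        ContinuousMultilinearMap.mkPiAlgebraFin_apply, smul_eq_mul]
      push_cast
      refine Finset.sum_congr rfl fun κ _ => ?_
      rw [mul_comm, List.prod_ofFn]
      congr 1
      exact Finset.prod_congr rfl fun i _ => hcre _ _
    have hcont : Tendsto (fun z : Fin n → ℂ => (z - w, star (z - w))) (𝓝 w)
        (𝓝 (0 : (Fin n → ℂ) × (Fin n → ℂ))) := by
      have : Continuous (fun z : Fin n → ℂ => (z - w, star (z - w))) := by fun_prop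
      exact this.tendsto' _ _ (by simp)
    have hcont2 : Tendsto (fun z : Fin n → ℂ => z - w) (𝓝 w) (𝓝 0) := by
      have : Continuous (fun z : Fin n → ℂ => z - w) := by fun_prop
      exact this.tendsto' _ _ (by simp)
    filter_upwards [hcont.eventually (Metric.eball_mem_nhds _ hqrad),
      hcont2.eventually (Metric.eball_mem_nhds _ hp.r_pos)] with z hz1 hz2
    have h1 := hqs.hasSum hz1
    have h2 := hp.hasSum hz2
    simp only [zero_add, hterm] at h1
    rw [add_sub_cancel] at h2
    have h3 : HasSum (fun m => ((p m (fun _ => z - w) : ℝ) : ℂ)) ((ρ z : ℝ) : ℂ) := by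
      exact_mod_cast h2
    have : ((z, star z) : (Fin n → ℂ) × (Fin n → ℂ)) - (w, star w) = (z - w, star (z - w)) := by
      simp
    rw [this]
    exact h1.unique h3

/-! ### Analytic solutions of polynomial systems with analytic coefficients -/

/-- A proper ideal of polynomials over a field of characteristic zero has a zero in a finite
extension, and hence a zero with coordinates `g i (θ)` for a root `θ` of a monic separable
polynomial `μ`. This is Zariski's lemma and the primitive element theorem. -/
theorem exists_separable_root_of_ne_top {K : Type*} [Field K] [CharZero K] {σ : Type*} [Finite σ]
    {I : Ideal (MvPolynomial σ K)} (hI : I ≠ ⊤) :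
    ∃ (μ a b : Polynomial K) (g : σ → Polynomial K), μ.Monic ∧ 0 < μ.natDegree ∧
      a * μ + b * Polynomial.derivative μ = 1 ∧ ∀ p ∈ I, μ ∣ MvPolynomial.aeval g p := by
  obtain ⟨𝔪, h𝔪, hI𝔪⟩ := Ideal.exists_le_maximal _ hI
  let L := MvPolynomial σ K ⧸ 𝔪
  let : Field L := Ideal.Quotient.field 𝔪
  have : Module.Finite K L := finite_of_finite_type_of_isJacobsonRing K L
  let pb : PowerBasis K L := Field.powerBasisOfFiniteOfSeparable K L
  have hg : ∀ i : σ, ∃ g : Polynomial K,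
      Ideal.Quotient.mk 𝔪 (MvPolynomial.X i) = Polynomial.aeval pb.gen g :=
    fun i => pb.exists_eq_aeval' _
  choose g hg using hg
  have hsep : (minpoly K pb.gen).Separable := Algebra.IsSeparable.isSeparable K pb.gen
  obtain ⟨a, b, hab⟩ := hsep
  refine ⟨minpoly K pb.gen, a, b, g, minpoly.monic pb.isIntegral_gen,
    minpoly.natDegree_pos pb.isIntegral_gen, hab, fun p hp => minpoly.dvd K pb.gen ?_⟩
  have h1 : (Polynomial.aeval pb.gen).comp (MvPolynomial.aeval g) =
      Ideal.Quotient.mkₐ K 𝔪 := by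
    ext i
    simp only [AlgHom.comp_apply, MvPolynomial.aeval_X]
    exact (hg i).symm
  have h2 := congrArg (fun f => f p) h1
  simp only [AlgHom.comp_apply] at h2
  rw [h2, Ideal.Quotient.mkₐ_eq_mk, Ideal.Quotient.eq_zero_iff_mem]
  exact hI𝔪 hp

/-- A system of polynomial equations over a domain of characteristic zero either has a nonzero
constant in its ideal, or is solved, over a localization at one element, by a simple root of a monic
separable polynomial `μ`: `exists_separable_root_of_ne_top` over the fraction field, with
denominators cleared. -/
theorem exists_const_mem_or_exists_root {A : Type*} [CommRing A] [IsDomain A] [CharZero A]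
    {σ κ : Type*} [Finite σ] (P : κ → MvPolynomial σ A) (K : Type*) [Field K] [Algebra A K]
    [IsFractionRing A K] :
    (∃ δ : A, δ ≠ 0 ∧ MvPolynomial.C δ ∈ Ideal.span (Set.range P)) ∨
    ∃ δ : A, δ ≠ 0 ∧ ∃ (μ a b : Polynomial (Localization.Away δ))
      (g : σ → Polynomial (Localization.Away δ)), μ.Monic ∧ 0 < μ.natDegree ∧
      a * μ + b * Polynomial.derivative μ = 1 ∧
      ∀ k, μ ∣ MvPolynomial.eval₂ (Polynomial.C.comp (algebraMap A (Localization.Away δ))) g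
        (P k) := by
  classical
  have : CharZero K := charZero_of_injective_algebraMap (IsFractionRing.injective A K)
  let := MvPolynomial.algebraMvPolynomial (σ := σ) (R := A) (S := K)
  set I := Ideal.span (Set.range P)
  by_cases htop : I.map (algebraMap (MvPolynomial σ A) (MvPolynomial σ K)) = ⊤
  · left
    have h := (IsLocalization.map_algebraMap_ne_top_iff_disjoint
      ((nonZeroDivisors A).map (MvPolynomial.C (σ := σ))) (MvPolynomial σ K) I).not.1
      (not_not.2 htop)
    rw [Set.not_disjoint_iff] at h
    obtain ⟨_, ⟨δ, hδ, rfl⟩, hx⟩ := h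
    exact ⟨δ, nonZeroDivisors.ne_zero hδ, hx⟩
  right
  obtain ⟨μK, aK, bK, gK, hmon, hdeg, hab, hdvd⟩ := exists_separable_root_of_ne_top htop
  have := Fintype.ofFinite σ
  set S : Finset K :=
    μK.coeffs ∪ (aK.coeffs ∪ (bK.coeffs ∪ Finset.univ.biUnion fun i => (gK i).coeffs)) with hS
  obtain ⟨⟨δ, hδ⟩, hδs⟩ := IsLocalization.exist_integer_multiples_of_finset (nonZeroDivisors A) S
  have hδ0 : δ ≠ 0 := nonZeroDivisors.ne_zero hδ
  let B := Localization.Away δ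
  have hunit : IsUnit (algebraMap A K δ) :=
    ((map_ne_zero_iff _ (IsFractionRing.injective A K)).2 hδ0).isUnit
  let j : B →+* K := IsLocalization.Away.lift δ hunit
  have hj : ∀ a, j (algebraMap A B a) = algebraMap A K a := fun a =>
    IsLocalization.Away.lift_eq δ hunit a
  have hjinj : Function.Injective j := by
    rw [injective_iff_map_eq_zero]
    intro x hx
    obtain ⟨⟨a, s⟩, hs⟩ := IsLocalization.surj (Submonoid.powers δ) x
    have h1 : j (algebraMap A B a) = 0 := by rw [← hs, map_mul, hx, zero_mul]
    rw [hj] at h1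
    have h2 : a = 0 := (map_eq_zero_iff _ (IsFractionRing.injective A K)).1 h1
    have h3 := IsLocalization.map_units B s
    simp only [h2, map_zero] at hs
    exact h3.mul_left_eq_zero.1 hs
  have hlift : ∀ f : Polynomial K, f.coeffs ⊆ S → f ∈ Polynomial.lifts j := by
    intro f hf
    rw [Polynomial.lifts_iff_coeff_lifts]
    intro m
    by_cases hm : f.coeff m = 0
    · exact ⟨0, by simp [hm]⟩
    obtain ⟨a, ha⟩ := hδs _ (hf (Polynomial.coeff_mem_coeffs hm))
    refine ⟨IsLocalization.mk' B a (⟨δ, Submonoid.mem_powers δ⟩ : Submonoid.powers δ), ?_⟩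
    have h1 : j (algebraMap A B δ) * j (IsLocalization.mk' B a
        (⟨δ, Submonoid.mem_powers δ⟩ : Submonoid.powers δ)) = j (algebraMap A B a) := by
      rw [← map_mul]; congr 1
      exact IsLocalization.mk'_spec' B a (⟨δ, Submonoid.mem_powers δ⟩ : Submonoid.powers δ)
    rw [hj, hj, ha, Algebra.smul_def] at h1
    exact hunit.mul_left_cancel h1
  obtain ⟨μ, hμ, hμd, hμm⟩ := Polynomial.lifts_and_natDegree_eq_and_monic
    (hlift μK Finset.subset_union_left) hmon
  obtain ⟨a, ha⟩ := (Polynomial.mem_lifts _).1 (hlift aK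
    (Finset.subset_union_left.trans Finset.subset_union_right))
  obtain ⟨b, hb⟩ := (Polynomial.mem_lifts _).1 (hlift bK
    ((Finset.subset_union_left.trans Finset.subset_union_right).trans Finset.subset_union_right))
  have hgl : ∀ i, ∃ g : Polynomial B, g.map j = gK i := fun i =>
    (Polynomial.mem_lifts _).1 (hlift (gK i) (by
      intro x hx
      exact Finset.mem_union_right _ (Finset.mem_union_right _ (Finset.mem_union_right _
        (Finset.mem_biUnion.2 ⟨i, Finset.mem_univ _, hx⟩)))))
  choose g hgm using hgl
  refine ⟨δ, hδ0, μ, a, b, g, hμm, by omega, ?_, ?_⟩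
  · apply Polynomial.map_injective j hjinj
    rw [Polynomial.map_add, Polynomial.map_mul, Polynomial.map_mul, ← Polynomial.derivative_map,
      ha, hb, hμ, Polynomial.map_one]
    exact hab
  · intro k
    rw [← Polynomial.map_dvd_map j hjinj hμm, hμ]
    have h1 : Polynomial.map j (MvPolynomial.eval₂ (Polynomial.C.comp (algebraMap A B)) g (P k)) =
        MvPolynomial.aeval gK (algebraMap (MvPolynomial σ A) (MvPolynomial σ K) (P k)) := by
      change (Polynomial.mapRingHom j) _ = _
      rw [MvPolynomial.hom_eval₂]
      rw [MvPolynomial.aeval_def, MvPolynomial.algebraMap_def, MvPolynomial.eval₂_map]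
      have : (fun i => Polynomial.mapRingHom j (g i)) = gK := funext hgm
      simp only [this]
      congr 1
      ext x
      simp [hj]
    rw [h1]
    exact hdvd _ (Ideal.mem_map_of_mem _ (Ideal.subset_span ⟨k, rfl⟩))

variable (𝕜 : Type) [RCLike 𝕜] [NormedAlgebra 𝕜 ℂ] {E : Type*} [NormedAddCommGroup E]
  [NormedSpace 𝕜 E]

/-- The ring of complex-valued `𝕜`-analytic functions on `U`. -/
def analyticRing (U : Set E) : Subring (U → ℂ) where
  carrier := {f | ∃ F : E → ℂ, AnalyticOnNhd 𝕜 F U ∧ ∀ x : U, f x = F x}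
  mul_mem' := by
    rintro f g ⟨F, hF, hf⟩ ⟨G, hG, hg⟩
    exact ⟨F * G, hF.mul hG, fun x => by simp [hf, hg]⟩
  one_mem' := ⟨1, analyticOnNhd_const, fun x => rfl⟩
  add_mem' := by
    rintro f g ⟨F, hF, hf⟩ ⟨G, hG, hg⟩
    exact ⟨F + G, hF.add hG, fun x => by simp [hf, hg]⟩
  zero_mem' := ⟨0, analyticOnNhd_const, fun x => rfl⟩
  neg_mem' := by
    rintro f ⟨F, hF, hf⟩
    exact ⟨-F, hF.neg, fun x => by simp [hf]⟩

/-- Evaluation of analytic functions at a point. -/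
def analyticRing.ev {U : Set E} (u : U) : analyticRing 𝕜 U →+* ℂ :=
  (Pi.evalRingHom (fun _ : U => ℂ) u).comp (analyticRing 𝕜 U).subtype

variable {𝕜}

/-- By the identity theorem, the analytic functions on a connected open set have no zero
divisors. -/
theorem analyticRing.isDomain {U : Set E} (hUc : IsPreconnected U) (hUo : IsOpen U)
    (hne : U.Nonempty) : IsDomain (analyticRing 𝕜 U) := by
  have : Nonempty U := hne.to_subtype
  have : Nontrivial (analyticRing 𝕜 U) := ⟨0, 1, fun h => by
    have := congrFun (congrArg Subtype.val h) (Classical.arbitrary U)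
    simp at this⟩
  have : NoZeroDivisors (analyticRing 𝕜 U) := by
    refine ⟨?_⟩
    rintro ⟨f, F, hF, hf⟩ ⟨g, G, hG, hg⟩ h
    have hfg : ∀ x : U, F x * G x = 0 := fun x => by
      have := congrFun (congrArg Subtype.val h) x
      simpa [hf, hg] using this
    by_cases hF0 : ∀ x : U, F x = 0
    · left
      ext x
      simp [hf, hF0]
    · right
      push Not at hF0
      obtain ⟨x₀, hx₀⟩ := hF0
      have h1 : ∀ᶠ y in 𝓝 (x₀ : E), G y = 0 := by
        filter_upwards [(hF x₀ x₀.2).continuousAt.eventually_ne hx₀, hUo.mem_nhds x₀.2]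
          with y hy hyU
        exact (mul_eq_zero.1 (hfg ⟨y, hyU⟩)).resolve_left hy
      have h2 := hG.eqOn_zero_of_preconnected_of_eventuallyEq_zero hUc x₀.2 h1
      ext x
      simp only [hg, ZeroMemClass.coe_zero, Pi.zero_apply]
      exact h2 x.2
  exact NoZeroDivisors.to_isDomain _

instance {U : Set E} [Nonempty U] : CharZero (analyticRing 𝕜 U) :=
  ⟨fun a b h => by
    have := congrArg (analyticRing.ev 𝕜 (Classical.arbitrary U)) h
    simpa using this⟩

variable (𝕜)

/-- `F u z` is a polynomial in `z` whose coefficients are `𝕜`-analytic functions of `u ∈ U`. -/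
inductive IsPolyFamily (U : Set E) {σ : Type*} : (E → (σ → ℂ) → ℂ) → Prop
  | coeff {f : E → ℂ} (hf : AnalyticOnNhd 𝕜 f U) : IsPolyFamily U fun u _ => f u
  | coord (i : σ) : IsPolyFamily U fun _ z => z i
  | add {F G} (hF : IsPolyFamily U F) (hG : IsPolyFamily U G) :
      IsPolyFamily U fun u z => F u z + G u z
  | mul {F G} (hF : IsPolyFamily U F) (hG : IsPolyFamily U G) :
      IsPolyFamily U fun u z => F u z * G u z

variable {𝕜}

theorem IsPolyFamily.exists_mvPolynomial {U : Set E} {σ : Type*} {F : E → (σ → ℂ) → ℂ}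
    (hF : IsPolyFamily 𝕜 U F) : ∃ P : MvPolynomial σ (analyticRing 𝕜 U),
      ∀ (u : U) z, F u z = MvPolynomial.eval₂ (analyticRing.ev 𝕜 u) z P := by
  induction hF with
  | @coeff f hf =>
    exact ⟨MvPolynomial.C ⟨fun u => f u, f, hf, fun _ => rfl⟩, fun u z => by
      simp [analyticRing.ev]⟩
  | coord i => exact ⟨MvPolynomial.X i, fun u z => by simp⟩
  | add _ _ h1 h2 =>
    obtain ⟨P, hP⟩ := h1
    obtain ⟨Q, hQ⟩ := h2
    exact ⟨P + Q, fun u z => by simp [hP, hQ]⟩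
  | mul _ _ h1 h2 =>
    obtain ⟨P, hP⟩ := h1
    obtain ⟨Q, hQ⟩ := h2
    exact ⟨P * Q, fun u z => by simp [hP, hQ]⟩

theorem IsPolyFamily.const {U : Set E} {σ : Type*} (c : ℂ) :
    IsPolyFamily 𝕜 U fun (_ : E) (_ : σ → ℂ) => c :=
  .coeff analyticOnNhd_const

theorem IsPolyFamily.sum {U : Set E} {σ ι : Type*} {F : ι → E → (σ → ℂ) → ℂ} {s : Finset ι}
    (h : ∀ i ∈ s, IsPolyFamily 𝕜 U (F i)) : IsPolyFamily 𝕜 U fun u z => ∑ i ∈ s, F i u z := by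
  classical
  induction s using Finset.induction_on with
  | empty => simpa using IsPolyFamily.const 0
  | insert a s ha ih =>
    simp only [Finset.sum_insert ha]
    exact (h a (by simp)).add (ih fun i hi => h i (by simp [hi]))

theorem IsPolyFamily.neg {U : Set E} {σ : Type*} {F : E → (σ → ℂ) → ℂ}
    (hF : IsPolyFamily 𝕜 U F) : IsPolyFamily 𝕜 U fun u z => -F u z := by
  simpa using (IsPolyFamily.const (-1)).mul hF

theorem IsPolyFamily.sub {U : Set E} {σ : Type*} {F G : E → (σ → ℂ) → ℂ}
    (hF : IsPolyFamily 𝕜 U F) (hG : IsPolyFamily 𝕜 U G) :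
    IsPolyFamily 𝕜 U fun u z => F u z - G u z := by
  simpa [sub_eq_add_neg] using hF.add hG.neg

theorem IsPolyFamily.eval {U : Set E} {σ τ : Type*} (p : MvPolynomial τ ℂ)
    {F : τ → E → (σ → ℂ) → ℂ} (hF : ∀ i, IsPolyFamily 𝕜 U (F i)) :
    IsPolyFamily 𝕜 U fun u z => MvPolynomial.eval (fun i => F i u z) p := by
  induction p using MvPolynomial.induction_on with
  | C a => simpa using IsPolyFamily.const a
  | add p q hp hq => simpa using hp.add hq
  | mul_X p i hp => simpa using hp.mul (hF i)

/-- A system of polynomial equations with analytic coefficients that is solvable for each value of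
the parameter has a solution that depends analytically on the parameter in some nonempty open
set. -/
theorem exists_analytic_section [CompleteSpace E] {U : Set E} (hUo : IsOpen U)
    (hUc : IsPreconnected U) (hne : U.Nonempty) {σ κ : Type*} [Fintype σ]
    {F : κ → E → (σ → ℂ) → ℂ} (hF : ∀ k, IsPolyFamily 𝕜 U (F k))
    (hsol : ∀ u ∈ U, ∃ z, ∀ k, F k u z = 0) :
    ∃ U' ⊆ U, IsOpen U' ∧ U'.Nonempty ∧ ∃ z : E → σ → ℂ, AnalyticOnNhd 𝕜 z U' ∧
      ∀ u ∈ U', ∀ k, F k u (z u) = 0 := by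
  classical
  have : Nonempty U := hne.to_subtype
  have : IsDomain (analyticRing 𝕜 U) := analyticRing.isDomain hUc hUo hne
  choose P hP using fun k => (hF k).exists_mvPolynomial
  have hnz : ∀ δ : analyticRing 𝕜 U, δ ≠ 0 → ∃ u : U, analyticRing.ev 𝕜 u δ ≠ 0 := by
    intro δ hδ
    by_contra! h
    exact hδ (Subtype.ext (funext fun u => h u))
  rcases exists_const_mem_or_exists_root P (FractionRing (analyticRing 𝕜 U)) with ⟨δ, hδ, hmem⟩ |
    ⟨δ, hδ, μ, a, b, g, hμm, hμd, hab, hdvd⟩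
  -- a nonzero constant in the ideal of the system would make it unsolvable at some parameter
  · obtain ⟨u, hu⟩ := hnz δ hδ
    obtain ⟨z, hz⟩ := hsol u u.2
    have h1 : Ideal.span (Set.range P) ≤
        RingHom.ker (MvPolynomial.eval₂Hom (analyticRing.ev 𝕜 u) z) := by
      rw [Ideal.span_le]
      rintro _ ⟨k, rfl⟩
      simpa [RingHom.mem_ker, ← hP] using hz k
    have h2 := h1 hmem
    simp [RingHom.mem_ker] at h2
    exact absurd h2 hu
  -- after inverting `δ`, the unknowns are polynomials in a root of the separable polynomial `μ`
  obtain ⟨Fδ, hFδ, hδF⟩ := δ.2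
  obtain ⟨u₀, hu₀⟩ := hnz δ hδ
  set U₁ : Set E := {u | u ∈ U ∧ Fδ u ≠ 0} with hU₁
  have hevδ : ∀ u : U, analyticRing.ev 𝕜 u δ = Fδ u := hδF
  have hU₁o : IsOpen U₁ := by
    rw [isOpen_iff_mem_nhds]
    rintro u ⟨huU, hu⟩
    filter_upwards [hUo.mem_nhds huU, (hFδ u huU).continuousAt.eventually_ne hu] with y h1 h2
    exact ⟨h1, h2⟩
  have hu₀1 : (u₀ : E) ∈ U₁ := ⟨u₀.2, by rwa [← hevδ]⟩
  let B := Localization.Away δ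
  let φ : U₁ → B →+* ℂ := fun u => IsLocalization.Away.lift (S := B) δ
    (g := analyticRing.ev 𝕜 (⟨u.1, u.2.1⟩ : U)) (by rw [hevδ]; exact isUnit_iff_ne_zero.2 u.2.2)
  have hφ : ∀ (u : U₁) (x : analyticRing 𝕜 U), φ u (algebraMap _ B x) =
      analyticRing.ev 𝕜 (⟨u.1, u.2.1⟩ : U) x := fun u x => IsLocalization.Away.lift_eq _ _ _
  have hval : ∀ x : B, ∃ f : E → ℂ, AnalyticOnNhd 𝕜 f U₁ ∧ ∀ u : U₁, φ u x = f u := by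
    intro x
    obtain ⟨⟨a, s⟩, hs⟩ := IsLocalization.surj (Submonoid.powers δ) x
    obtain ⟨m, hm⟩ := s.2
    obtain ⟨Fa, hFa, haF⟩ := a.2
    refine ⟨fun u => Fa u / Fδ u ^ m, ?_, ?_⟩
    · intro u hu
      exact (hFa u hu.1).div ((hFδ u hu.1).pow m) (pow_ne_zero _ hu.2)
    · intro u
      have h1 := congrArg (φ u) hs
      simp only [map_mul, ← hm, map_pow, hφ, hevδ] at h1
      rw [eq_div_iff (pow_ne_zero _ u.2.2), h1]
      exact haF _
  choose f hfa hf using hval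
  -- the polynomial with coefficients in the localization as a function of parameter and unknown
  let Ψ : Polynomial B → E × ℂ → ℂ := fun q x =>
    ∑ j ∈ Finset.range (q.natDegree + 1), f (q.coeff j) x.1 * x.2 ^ j
  have hΨ : ∀ (q : Polynomial B) (u : U₁) (x : ℂ), Ψ q (u, x) = (q.map (φ u)).eval x := by
    intro q u x
    rw [Polynomial.eval_map, Polynomial.eval₂_eq_sum_range]
    simp [Ψ, hf]
  have hΨa : ∀ (q : Polynomial B) (u : U₁) (x : ℂ), AnalyticAt 𝕜 (Ψ q) (u, x) := by
    intro q u x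
    refine Finset.analyticAt_fun_sum _ fun j _ => ?_
    refine AnalyticAt.mul ?_ ?_
    · exact (hfa _ u u.2).comp_of_eq analyticAt_fst rfl
    · exact AnalyticAt.pow analyticAt_snd j
  set v₀ : U₁ := ⟨u₀, hu₀1⟩
  obtain ⟨x₀, hx₀⟩ : ∃ x, (μ.map (φ v₀)).eval x = 0 := by
    refine Complex.exists_root ?_
    rw [hμm.degree_map]
    exact Polynomial.natDegree_pos_iff_degree_pos.1 hμd
  have hder : HasDerivAt (fun x => Ψ μ (v₀, x)) ((Polynomial.derivative (μ.map (φ v₀))).eval x₀)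
      x₀ := by
    simp only [hΨ]
    exact (μ.map (φ v₀)).hasDerivAt x₀
  have hder0 : (Polynomial.derivative (μ.map (φ v₀))).eval x₀ ≠ 0 := by
    intro h
    have := congrArg (fun q => (q.map (φ v₀)).eval x₀) hab
    rw [Polynomial.derivative_map] at h
    simp [h, hx₀] at this
  -- the root `x₀` of `μ` is simple, so it continues analytically to nearby parameters
  obtain ⟨θ, hθa, hθ0, hθ, -⟩ := exists_analytic_implicit (hΨa μ v₀ x₀)
    (by rw [hΨ, hx₀]) hder hder0
  have hz : AnalyticAt 𝕜 (fun u => fun i => Ψ (g i) (u, θ u)) (u₀ : E) := by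
    rw [analyticAt_pi_iff]
    intro i
    exact AnalyticAt.comp_of_eq (g := Ψ (g i)) (f := fun u => (u, θ u)) (hΨa (g i) v₀ x₀)
      (analyticAt_id.prod hθa) (by rw [← hθ0])
  obtain ⟨W, hW, hWo, hu₀W⟩ := eventually_nhds_iff.1
    ((hz.eventually_analyticAt.and hθ).and (hU₁o.mem_nhds hu₀1))
  refine ⟨W, fun u hu => (hW u hu).2.1, hWo, ⟨u₀, hu₀W⟩, _, fun u hu => (hW u hu).1.1, ?_⟩
  intro u hu k
  obtain ⟨⟨-, h1⟩, h2⟩ := hW u hu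
  have h3 : ∀ q : Polynomial B, Ψ q (u, θ u) = (q.map (φ ⟨u, h2⟩)).eval (θ u) :=
    fun q => hΨ q ⟨u, h2⟩ _
  obtain ⟨c, hc⟩ := hdvd k
  have h4 := congrArg (fun q => (q.map (φ ⟨u, h2⟩)).eval (θ u)) hc
  simp only [Polynomial.map_mul, Polynomial.eval_mul, ← h3 μ, h1, zero_mul] at h4
  have h5 : F k u (fun i => Ψ (g i) (u, θ u)) = _ := hP k ⟨u, h2.1⟩ _
  refine h5.trans (Eq.trans ?_ h4)
  change _ = Polynomial.evalRingHom (θ u) (Polynomial.mapRingHom (φ ⟨u, h2⟩) _)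
  rw [MvPolynomial.hom_eval₂, MvPolynomial.hom_eval₂]
  congr 1
  · ext x
    simp only [RingHom.comp_apply, Polynomial.coe_mapRingHom, Polynomial.map_C,
      Polynomial.coe_evalRingHom, Polynomial.eval_C]
    exact (hφ ⟨u, h2⟩ x).symm
  · funext i
    exact h3 (g i)

/-! ### Elimination along a direction -/

section Elimination

variable {𝕜 : Type*} [Field 𝕜] {σ : Type*}

/-- The substitution `X ↦ X + T v` of the variables, with values in the polynomials in a new
variable `T` over the polynomials in the old variables. -/
def shift (v : σ → 𝕜) : MvPolynomial σ 𝕜 →ₐ[𝕜] Polynomial (MvPolynomial σ 𝕜) :=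
  MvPolynomial.aeval fun i => Polynomial.C (MvPolynomial.X i) +
    Polynomial.C (MvPolynomial.C (v i)) * Polynomial.X

@[simp]
theorem shift_X (v : σ → 𝕜) (i : σ) : shift v (MvPolynomial.X i) =
    Polynomial.C (MvPolynomial.X i) + Polynomial.C (MvPolynomial.C (v i)) * Polynomial.X :=
  MvPolynomial.aeval_X _ _

@[simp]
theorem shift_C (v : σ → 𝕜) (c : 𝕜) :
    shift v (MvPolynomial.C c) = Polynomial.C (MvPolynomial.C c) :=
  (shift v).commutes c

theorem eval_map_shift (v y : σ → 𝕜) (x : 𝕜) (A : MvPolynomial σ 𝕜) :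
    ((shift v A).map (MvPolynomial.eval y)).eval x = MvPolynomial.eval (y + x • v) A := by
  have : ((Polynomial.evalRingHom x).comp ((Polynomial.mapRingHom (MvPolynomial.eval y)).comp
      (shift v : MvPolynomial σ 𝕜 →+* _))) = MvPolynomial.eval (y + x • v) := by
    refine MvPolynomial.ringHom_ext (fun c => ?_) (fun i => ?_)
    · simp
    · simp only [RingHom.coe_comp, RingHom.coe_coe, Function.comp_apply, shift_X]
      simp [mul_comm x]
  exact congrArg (fun f => f A) this

/-- The shift extended to polynomials in the variable `T`. -/
def shiftExt (v : σ → 𝕜) : Polynomial (MvPolynomial σ 𝕜) →+* Polynomial (MvPolynomial σ 𝕜) :=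
  Polynomial.eval₂RingHom (shift v : MvPolynomial σ 𝕜 →+* _) Polynomial.X

theorem shiftExt_comp_neg (v : σ → 𝕜) : (shiftExt v).comp (shiftExt (-v)) = RingHom.id _ := by
  refine Polynomial.ringHom_ext' ?_ ?_
  · refine MvPolynomial.ringHom_ext (fun c => ?_) (fun i => ?_)
    · simp [shiftExt]
    · simp only [shiftExt, RingHom.coe_comp, RingHom.coe_coe, Function.comp_apply,
        Polynomial.coe_eval₂RingHom, Polynomial.eval₂_C, Polynomial.eval₂_add, Polynomial.eval₂_mul,
        Polynomial.eval₂_X, shift_X, shift_C, RingHom.id_apply, Pi.neg_apply, map_neg,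
        Polynomial.eval₂_neg]
      ring
  · simp [shiftExt]

/-- The shift as an automorphism. -/
def shiftEquiv (v : σ → 𝕜) : Polynomial (MvPolynomial σ 𝕜) ≃+* Polynomial (MvPolynomial σ 𝕜) :=
  RingEquiv.ofRingHom (shiftExt v) (shiftExt (-v)) (shiftExt_comp_neg v)
    (by simpa using shiftExt_comp_neg (-v))

theorem shiftEquiv_C (v : σ → 𝕜) (A : MvPolynomial σ 𝕜) :
    shiftEquiv v (Polynomial.C A) = shift v A := by
  simp [shiftEquiv, shiftExt]

theorem shift_dvd_shift_iff (v : σ → 𝕜) (A D : MvPolynomial σ 𝕜) :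
    shift v A ∣ shift v D ↔ A ∣ D := by
  rw [← shiftEquiv_C, ← shiftEquiv_C, map_dvd_iff (shiftEquiv v), Polynomial.C_dvd_iff_dvd_coeff]
  constructor
  · intro h
    simpa using h 0
  · intro h i
    rw [Polynomial.coeff_C]
    split_ifs
    · exact h
    · exact dvd_zero _

theorem prime_shift [Finite σ] (v : σ → 𝕜) {A : MvPolynomial σ 𝕜} (hA : Irreducible A) :
    Prime (shift v A) := by
  rw [← shiftEquiv_C, MulEquiv.prime_iff, Polynomial.prime_C_iff]
  exact hA.prime

/-- A prime polynomial `f` of positive degree over a domain and a polynomial `g` that it does not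
divide generate an ideal that contains a nonzero constant. -/
theorem exists_C_mem_of_prime {R : Type*} [CommRing R] [IsDomain R] {f g : Polynomial R}
    (hf : Prime f) (hdeg : 0 < f.natDegree) (hfg : ¬ f ∣ g) :
    ∃ a b : Polynomial R, ∃ r : R, r ≠ 0 ∧ a * f + b * g = Polynomial.C r := by
  set K := FractionRing R
  let : Algebra (Polynomial R) (Polynomial K) := Polynomial.algebra R K
  have hloc : IsLocalization ((nonZeroDivisors R).map (Polynomial.C (R := R))) (Polynomial K) :=
    Polynomial.isLocalization _ _
  set M := (nonZeroDivisors R).map (Polynomial.C (R := R))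
  have hM : ∀ m ∈ M, m ≠ 0 ∧ m.natDegree = 0 := by
    rintro _ ⟨r, hr, rfl⟩
    exact ⟨by simpa using nonZeroDivisors.ne_zero hr, Polynomial.natDegree_C r⟩
  have hfM : ∀ m ∈ M, ¬ f ∣ m := by
    intro m hm hd
    have := Polynomial.natDegree_le_of_dvd hd (hM m hm).1
    rw [(hM m hm).2] at this
    omega
  have hdisj : Disjoint (M : Set (Polynomial R)) (Ideal.span {f} : Ideal (Polynomial R)) := by
    rw [Set.disjoint_left]
    intro m hm hmf
    exact hfM m hm (Ideal.mem_span_singleton.1 hmf)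
  have hprime : (Ideal.span {f} : Ideal (Polynomial R)).IsPrime :=
    (Ideal.span_singleton_prime hf.ne_zero).2 hf
  have hprime2 := IsLocalization.isPrime_of_isPrime_disjoint M (Polynomial K) _ hprime hdisj
  rw [Ideal.map_span, Set.image_singleton] at hprime2
  have hinj : Function.Injective (algebraMap (Polynomial R) (Polynomial K)) :=
    Polynomial.map_injective _ (IsFractionRing.injective R K)
  have hf0 : algebraMap (Polynomial R) (Polynomial K) f ≠ 0 := by
    rw [Ne, map_eq_zero_iff _ hinj]; exact hf.ne_zero
  have hirr : Irreducible (algebraMap (Polynomial R) (Polynomial K) f) :=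
    ((Ideal.span_singleton_prime hf0).1 hprime2).irreducible
  have hnd : ¬ algebraMap (Polynomial R) (Polynomial K) f ∣
      algebraMap (Polynomial R) (Polynomial K) g := by
    intro h
    rw [← Ideal.mem_span_singleton, ← Set.image_singleton, ← Ideal.map_span,
      IsLocalization.algebraMap_mem_map_algebraMap_iff M] at h
    obtain ⟨m, hm, hmg⟩ := h
    rcases hf.dvd_or_dvd (Ideal.mem_span_singleton.1 hmg) with h1 | h1
    · exact hfM m hm h1
    · exact hfg h1
  have hcop := hirr.coprime_iff_not_dvd.2 hnd
  have htop : (Ideal.span {f, g} : Ideal (Polynomial R)).map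
      (algebraMap (Polynomial R) (Polynomial K)) = ⊤ := by
    rw [Ideal.map_span, Set.image_pair]
    obtain ⟨a, b, hab⟩ := hcop
    rw [Ideal.eq_top_iff_one, Ideal.mem_span_pair]
    exact ⟨a, b, hab⟩
  have h := (IsLocalization.map_algebraMap_ne_top_iff_disjoint M (Polynomial K) _).not.1
    (not_not.2 htop)
  rw [Set.not_disjoint_iff] at h
  obtain ⟨_, ⟨r, hr, rfl⟩, hx⟩ := h
  obtain ⟨a, b, hab⟩ := Ideal.mem_span_pair.1 hx
  exact ⟨a, b, r, nonZeroDivisors.ne_zero hr, hab⟩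

theorem natDegree_shift_pos (v : σ → 𝕜) {A : MvPolynomial σ 𝕜} {y : σ → 𝕜} {x : 𝕜}
    (h : MvPolynomial.eval (y + x • v) A ≠ MvPolynomial.eval y A) :
    0 < (shift v A).natDegree := by
  by_contra! hdeg
  obtain ⟨c, hc⟩ := Polynomial.natDegree_eq_zero.1 (Nat.le_zero.1 hdeg)
  apply h
  have h0 := eval_map_shift v y 0 A
  rw [zero_smul, add_zero] at h0
  rw [← eval_map_shift, ← h0, ← hc]
  simp

/-- Elimination: if `A` is irreducible, not constant along the direction `v`, and does not divide
`D`, then the projection along `v` of the common zeros of `A` and `D` lies in a hypersurface. -/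
theorem exists_eliminant [Finite σ] {A D : MvPolynomial σ 𝕜} (hA : Irreducible A) (v : σ → 𝕜)
    (hv : ∃ y : σ → 𝕜, ∃ x : 𝕜, MvPolynomial.eval (y + x • v) A ≠ MvPolynomial.eval y A)
    (hAD : ¬ A ∣ D) :
    ∃ r : MvPolynomial σ 𝕜, r ≠ 0 ∧ ∀ (y : σ → 𝕜) (x : 𝕜), MvPolynomial.eval (y + x • v) A = 0 →
      MvPolynomial.eval (y + x • v) D = 0 → MvPolynomial.eval y r = 0 := by
  obtain ⟨y, x, hyx⟩ := hv
  obtain ⟨a, b, r, hr, hab⟩ := exists_C_mem_of_prime (prime_shift v hA) (natDegree_shift_pos v hyx)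
    ((shift_dvd_shift_iff v A D).not.2 hAD)
  refine ⟨r, hr, fun y x hAy hDy => ?_⟩
  have := congrArg (fun q => (q.map (MvPolynomial.eval y)).eval x) hab
  simpa [eval_map_shift, hAy, hDy] using this.symm

/-- Divisibility by an irreducible polynomial `A` follows from vanishing on a set `M` of zeros of
`A` whose translates in one direction are Zariski dense. -/
theorem dvd_of_vanishing [Finite σ] {A D : MvPolynomial σ 𝕜} (hA : Irreducible A) {M : Set (σ → 𝕜)}
    {v : σ → 𝕜} {T : Set 𝕜}
    (hM : ∀ r : MvPolynomial σ 𝕜,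
      (∀ m ∈ M, ∀ x ∈ T, MvPolynomial.eval (m + x • v) r = 0) → r = 0)
    (hAM : ∀ m ∈ M, MvPolynomial.eval m A = 0) (hDM : ∀ m ∈ M, MvPolynomial.eval m D = 0) :
    A ∣ D := by
  by_contra hAD
  by_cases hv : ∃ y : σ → 𝕜, ∃ x : 𝕜, MvPolynomial.eval (y + x • v) A ≠ MvPolynomial.eval y A
  · obtain ⟨r, hr, h⟩ := exists_eliminant hA v hv hAD
    refine hr (hM r fun m hm x _ => h (m + x • v) (-x) ?_ ?_)
    · simpa [add_assoc] using hAM m hm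
    · simpa [add_assoc] using hDM m hm
  · push Not at hv
    exact hA.ne_zero (hM A fun m hm x _ => by rw [hv, hAM m hm])

/-- The derivative in the direction `v`, as a derivation of the polynomial ring. -/
def dirDeriv (v : σ → 𝕜) : Derivation 𝕜 (MvPolynomial σ 𝕜) (MvPolynomial σ 𝕜) :=
  MvPolynomial.mkDerivation 𝕜 fun i => MvPolynomial.C (v i)

@[simp]
theorem dirDeriv_X (v : σ → 𝕜) (i : σ) :
    dirDeriv v (MvPolynomial.X i) = MvPolynomial.C (v i) :=
  MvPolynomial.mkDerivation_X _ _ _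

theorem derivative_shift (v : σ → 𝕜) (A : MvPolynomial σ 𝕜) :
    Polynomial.derivative (shift v A) = shift v (dirDeriv v A) := by
  induction A using MvPolynomial.induction_on with
  | C a => simp
  | add p q hp hq => simp [hp, hq]
  | mul_X p i hp =>
    rw [map_mul, Polynomial.derivative_mul, hp, Derivation.leibniz, map_add, smul_eq_mul,
      smul_eq_mul, map_mul, map_mul, dirDeriv_X]
    have h2 : Polynomial.derivative (shift v (MvPolynomial.X i)) =
        Polynomial.C (MvPolynomial.C (v i)) := by
      simp
    rw [shift_C, h2]
    ring

/-- An irreducible polynomial that is not constant along `v` does not divide its derivative in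
the direction `v`. -/
theorem not_dvd_dirDeriv [CharZero 𝕜] {A : MvPolynomial σ 𝕜} {v : σ → 𝕜}
    (hv : ∃ y : σ → 𝕜, ∃ x : 𝕜, MvPolynomial.eval (y + x • v) A ≠ MvPolynomial.eval y A) :
    ¬ A ∣ dirDeriv v A := by
  obtain ⟨y, x, hyx⟩ := hv
  have hdeg := natDegree_shift_pos v hyx
  rw [← shift_dvd_shift_iff v, ← derivative_shift]
  intro h
  by_cases h0 : Polynomial.derivative (shift v A) = 0
  · have := Polynomial.derivative_eq_zero.1 h0
    omega
  · have h1 := Polynomial.natDegree_le_of_dvd h h0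
    have h2 := Polynomial.natDegree_derivative_lt hdeg.ne'
    omega

end Elimination

/-! ### Common zeros of few polynomials -/

/-- Fewer than `N` polynomials in `N` variables over `ℂ` that vanish at `0` have another common
zero: by Krull's height theorem, an isolated common zero has height at most the number of
equations. -/
theorem exists_common_zero_ne_zero {N r : ℕ} (hr : r < N) (f : Fin r → MvPolynomial (Fin N) ℂ)
    (hf : ∀ i, MvPolynomial.eval 0 (f i) = 0) :
    ∃ z : Fin N → ℂ, z ≠ 0 ∧ ∀ i, MvPolynomial.eval z (f i) = 0 := by
  by_contra! hcon
  have hdim : ringKrullDim (MvPolynomial (Fin N) ℂ) = N := by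
    rw [MvPolynomial.ringKrullDim_of_isNoetherianRing]; simp
  obtain ⟨J, hJ, hJh⟩ : ∃ J : Ideal (MvPolynomial (Fin N) ℂ), J.IsMaximal ∧
      (r : ℕ∞) < J.height := by
    by_contra! h
    have := (ringKrullDim_le_iff_isMaximal_height_le (R := MvPolynomial (Fin N) ℂ)
      ((r : ℕ∞) : WithBot ℕ∞)).2 (fun I hI => by exact_mod_cast h I hI)
    rw [hdim] at this
    have h2 : N ≤ r := by exact_mod_cast this
    omega
  obtain ⟨a, rfl⟩ := MvPolynomial.isMaximal_iff_eq_vanishingIdeal_singleton.1 hJ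
  -- translate the system so that its only zero is the point `a` of large height
  set τ : MvPolynomial (Fin N) ℂ →ₐ[ℂ] MvPolynomial (Fin N) ℂ :=
    MvPolynomial.aeval fun i => MvPolynomial.X i - MvPolynomial.C (a i)
  have hτ : ∀ p z, MvPolynomial.eval z (τ p) = MvPolynomial.eval (z - a) p := by
    intro p z
    have : (MvPolynomial.eval z).comp (τ : MvPolynomial (Fin N) ℂ →+* _) =
        MvPolynomial.eval (z - a) := by
      refine MvPolynomial.ringHom_ext (fun c => ?_) (fun i => ?_) <;> simp [τ]
    exact congrArg (fun f => f p) this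
  set s : Set (MvPolynomial (Fin N) ℂ) := Set.range fun i => τ (f i)
  have hs : s.Finite := Set.finite_range _
  have hloc : MvPolynomial.zeroLocus ℂ (Ideal.span s) = {a} := by
    rw [MvPolynomial.zeroLocus_span]
    ext z
    simp only [s, Set.mem_range, forall_exists_index, forall_apply_eq_imp_iff, Set.mem_ofPred_eq,
      Set.mem_singleton_iff]
    constructor
    · intro h
      by_contra hza
      obtain ⟨i, hi⟩ := hcon (z - a) (sub_ne_zero.2 hza)
      exact hi (by rw [← hτ]; simpa using h i)
    · rintro rfl i
      have : MvPolynomial.eval z (τ (f i)) = 0 := by rw [hτ, sub_self]; exact hf i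
      simpa using this
  have hrad := MvPolynomial.vanishingIdeal_zeroLocus_eq_radical (K := ℂ) (Ideal.span s)
  rw [hloc] at hrad
  have hmin : MvPolynomial.vanishingIdeal ℂ {a} ∈ (Ideal.span s).minimalPrimes := by
    have := hJ.isPrime
    rw [← Ideal.radical_minimalPrimes, ← hrad, Ideal.minimalPrimes_eq_subsingleton_self]
    rfl
  have h1 := Ideal.height_le_card_of_mem_minimalPrimes_span hs hmin
  have h2 : s.ncard ≤ r := by
    change (Set.range fun i => τ (f i)).ncard ≤ r
    rw [← Set.image_univ]
    refine (Set.ncard_image_le Set.finite_univ).trans ?_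
    simp [Set.ncard_univ]
  have h3 : ((s.ncard : ℕ) : ℕ∞) ≤ r := by exact_mod_cast h2
  exact absurd (hJh.trans_le (h1.trans h3)) (lt_irrefl _)

/-! ### Families of polynomials in one variable -/

/-- The roots of norm less than `η` of the polynomial `P`. -/
def smallRoots (η : ℝ) (P : Polynomial ℂ) : Finset ℂ :=
  P.roots.toFinset.filter fun x => ‖x‖ < η

theorem mem_smallRoots {η : ℝ} {P : Polynomial ℂ} (hP : P ≠ 0) {x : ℂ} :
    x ∈ smallRoots η P ↔ P.eval x = 0 ∧ ‖x‖ < η := by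
  simp [smallRoots, hP]

/-- Near a parameter at which all roots are simple and none has norm `η`, the roots of norm less
than `η` are given by analytic functions of the parameter. -/
theorem exists_analytic_smallRoots {P : ℂ → Polynomial ℂ} {e₁ : ℂ} {d : ℕ}
    (hP : ∀ x, AnalyticAt ℂ (fun p : ℂ × ℂ => (P p.1).eval p.2) (e₁, x))
    (hdeg : ∀ e, (P e).natDegree = d) (hne : ∀ e, P e ≠ 0)
    (hsimple : ∀ x, (P e₁).eval x = 0 → (P e₁).derivative.eval x ≠ 0) {η : ℝ}
    (hη : ∀ x, ‖x‖ = η → (P e₁).eval x ≠ 0) :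
    ∃ φ : ℂ → ℂ → ℂ, (∀ x ∈ smallRoots η (P e₁), AnalyticAt ℂ (φ x) e₁ ∧ φ x e₁ = x) ∧
      ∀ᶠ e in 𝓝 e₁, Set.InjOn (fun x => φ x e) (smallRoots η (P e₁)) ∧
        smallRoots η (P e) = (smallRoots η (P e₁)).image fun x => φ x e := by
  classical
  have hex : ∀ x, ∃ φ : ℂ → ℂ, (P e₁).eval x = 0 → AnalyticAt ℂ φ e₁ ∧ φ e₁ = x ∧
      ∀ᶠ e in 𝓝 e₁, (P e).eval (φ e) = 0 := by
    intro x
    by_cases hx : (P e₁).eval x = 0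
    · obtain ⟨φ, h1, h2, h3, -⟩ := exists_analytic_implicit (𝕜 := ℂ) (hP x) hx
        ((P e₁).hasDerivAt x) (hsimple x hx)
      exact ⟨φ, fun _ => ⟨h1, h2, h3⟩⟩
    · exact ⟨fun _ => 0, fun h => absurd h hx⟩
  choose φ hφ using hex
  set Z := (P e₁).roots.toFinset
  have hZ : ∀ x, x ∈ Z ↔ (P e₁).eval x = 0 := fun x => by simp [Z, hne]
  have hcard : Z.card = d := by
    rw [Multiset.toFinset_card_of_nodup, ← hdeg e₁,
      ← (IsAlgClosed.splits (P e₁)).natDegree_eq_card_roots]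
    refine Multiset.nodup_iff_count_le_one.2 fun x => ?_
    rw [Polynomial.count_roots]
    by_contra! h
    obtain ⟨h1, h2⟩ := (Polynomial.one_lt_rootMultiplicity_iff_isRoot (hne e₁)).1 h
    exact hsimple x h1 h2
  have hinj : ∀ᶠ e in 𝓝 e₁, Set.InjOn (fun x => φ x e) Z := by
    have : ∀ᶠ e in 𝓝 e₁, ∀ x ∈ Z, ∀ y ∈ Z, x ≠ y → φ x e ≠ φ y e := by
      rw [Filter.eventually_all_finset]
      intro x hx
      rw [Filter.eventually_all_finset]
      intro y hy
      by_cases hxy : x = y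
      · simp [hxy]
      · obtain ⟨h1, h2, -⟩ := hφ x ((hZ x).1 hx)
        obtain ⟨h3, h4, -⟩ := hφ y ((hZ y).1 hy)
        have hsub : φ x e₁ - φ y e₁ ≠ 0 := by rw [h2, h4]; exact sub_ne_zero.2 hxy
        filter_upwards [(h1.continuousAt.sub h3.continuousAt).eventually_ne hsub] with e he _
        exact sub_ne_zero.1 he
    filter_upwards [this] with e he x hx y hy hxy
    by_contra h
    exact he x hx y hy h hxy
  have hroot : ∀ᶠ e in 𝓝 e₁, ∀ x ∈ Z, (P e).eval (φ x e) = 0 := by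
    rw [Filter.eventually_all_finset]
    exact fun x hx => (hφ x ((hZ x).1 hx)).2.2
  have hnorm : ∀ᶠ e in 𝓝 e₁, ∀ x ∈ Z, (‖φ x e‖ < η ↔ ‖x‖ < η) := by
    rw [Filter.eventually_all_finset]
    intro x hx
    obtain ⟨h1, h2, -⟩ := hφ x ((hZ x).1 hx)
    have hc : Tendsto (fun e => ‖φ x e‖) (𝓝 e₁) (𝓝 ‖x‖) := by
      have := h1.continuousAt.norm
      rwa [ContinuousAt, h2] at this
    rcases lt_trichotomy ‖x‖ η with h | h | h
    · filter_upwards [hc.eventually_lt_const h] with e he using ⟨fun _ => h, fun _ => he⟩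
    · exact absurd ((hZ x).1 hx) (hη x h)
    · filter_upwards [hc.eventually_const_lt h] with e he
      exact ⟨fun h' => absurd h' he.not_gt, fun h' => absurd h' h.not_gt⟩
  have hsub : smallRoots η (P e₁) ⊆ Z := Finset.filter_subset _ _
  refine ⟨φ, fun x hx => ?_, ?_⟩
  · obtain ⟨h1, h2, -⟩ := hφ x ((hZ x).1 (hsub hx))
    exact ⟨h1, h2⟩
  · filter_upwards [hinj, hroot, hnorm] with e h1 h2 h3
    refine ⟨h1.mono (by exact_mod_cast hsub), ?_⟩
    have hall : (P e).roots.toFinset = Z.image fun x => φ x e := by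
      symm
      apply Finset.eq_of_subset_of_card_le
      · intro y hy
        obtain ⟨x, hx, rfl⟩ := Finset.mem_image.1 hy
        simpa [hne] using h2 x hx
      · rw [Finset.card_image_of_injOn h1, hcard, ← hdeg e]
        exact (Multiset.toFinset_card_le _).trans (Polynomial.card_roots' _)
    ext y
    simp only [smallRoots, Finset.mem_filter, hall, Finset.mem_image]
    constructor
    · rintro ⟨⟨x, hx, rfl⟩, hy⟩
      exact ⟨x, ⟨hx, (h3 x hx).1 hy⟩, rfl⟩
    · rintro ⟨x, ⟨hx, hx2⟩, rfl⟩
      exact ⟨⟨x, hx, rfl⟩, (h3 x hx).2 hx2⟩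

/-- A polynomial with small value at `0` has a small root. -/
theorem exists_root_of_norm_eval_lt {P : Polynomial ℂ} {η : ℝ} (hη : 0 ≤ η)
    (h : ‖P.eval 0‖ < ‖P.leadingCoeff‖ * η ^ P.natDegree) : ∃ x, P.eval x = 0 ∧ ‖x‖ < η := by
  by_contra! hcon
  have hP : P ≠ 0 := by
    rintro rfl
    simp at h
  have hs := IsAlgClosed.splits P
  have hev : P.eval 0 = P.leadingCoeff * (P.roots.map fun a => 0 - a).prod := by
    conv_lhs => rw [hs.eq_prod_roots]
    simp [Polynomial.eval_multiset_prod]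
  refine h.not_ge ?_
  rw [hev, norm_mul]
  refine mul_le_mul_of_nonneg_left ?_ (norm_nonneg _)
  rw [hs.natDegree_eq_card_roots]
  have : ∀ s : Multiset ℂ, (∀ x ∈ s, η ≤ ‖x‖) → η ^ s.card ≤ ‖(s.map fun a => 0 - a).prod‖ := by
    intro s
    induction s using Multiset.induction_on with
    | empty => simp
    | cons a s ih =>
      intro hs
      rw [Multiset.card_cons, Multiset.map_cons, Multiset.prod_cons, norm_mul, pow_succ']
      refine mul_le_mul ?_ (ih fun x hx => hs x (Multiset.mem_cons_of_mem hx)) (by positivity)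
        (norm_nonneg _)
      simpa using hs a (Multiset.mem_cons_self a s)
  exact this _ fun x hx => hcon x (Polynomial.isRoot_of_mem_roots hx)

/-- Let `S` be holomorphic near `0` and vanish at `(p, p̄)` for all `p = (ε, x)` on the curve
`P_ε(x) = 0`. Then for small real `ε > 0` some small root `x` of `P_ε` satisfies
`S((ε, x), 0) = 0`.

The product of all `S((ε, x), (ε', ȳ))` over the small roots `x` of `P_ε` and `y` of `P_ε'` is a
real-analytic function of `(ε, ε')`. It vanishes near the diagonal by polarization along the local
branches of the roots, hence identically; then `ε'` tends to `0`. -/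
theorem exists_root_of_polar_vanishing {P : ℂ → Polynomial ℂ} {d : ℕ} {c : ℂ}
    (hP : ∀ p, AnalyticAt ℂ (fun p : ℂ × ℂ => (P p.1).eval p.2) p)
    (hdeg : ∀ e, (P e).natDegree = d) (hlead : ∀ e, (P e).leadingCoeff = c) (hc : c ≠ 0)
    (h0 : (P 0).eval 0 = 0)
    (hsimple : ∀ᶠ e in 𝓝[≠] 0, ∀ x, (P e).eval x = 0 → (P e).derivative.eval x ≠ 0)
    {S : (ℂ × ℂ) × (ℂ × ℂ) → ℂ} (hS : AnalyticAt ℂ S 0)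
    (hvan : ∀ᶠ p : ℂ × ℂ in 𝓝 0, (P p.1).eval p.2 = 0 → S (p, star p) = 0)
    {η : ℝ} (hη : 0 < η) :
    ∀ᶠ ε : ℝ in 𝓝[>] 0, ∃ x : ℂ, ‖x‖ ≤ η ∧ (P ε).eval x = 0 ∧ S ((ε, x), 0) = 0 := by
  classical
  have hne : ∀ e, P e ≠ 0 := fun e h => hc (by rw [← hlead e, h, Polynomial.leadingCoeff_zero])
  have hPc : Continuous fun p : ℂ × ℂ => (P p.1).eval p.2 :=
    continuous_iff_continuousAt.2 fun p => (hP p).continuousAt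
  obtain ⟨ρ, hρ, hSρ, hvanρ⟩ : ∃ ρ > 0, (∀ p q : ℂ × ℂ, ‖p‖ < ρ → ‖q‖ < ρ →
      AnalyticAt ℂ S (p, q)) ∧ ∀ p : ℂ × ℂ, ‖p‖ < ρ → (P p.1).eval p.2 = 0 → S (p, star p) = 0 := by
    obtain ⟨r1, hr1, h1⟩ := Metric.eventually_nhds_iff_ball.1 hS.eventually_analyticAt
    obtain ⟨r2, hr2, h2⟩ := Metric.eventually_nhds_iff_ball.1 hvan
    refine ⟨min r1 r2, lt_min hr1 hr2, fun p q hp hq => h1 _ ?_, fun p hp => h2 _ ?_⟩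
    · rw [mem_ball_zero_iff, Prod.norm_def]
      exact max_lt (hp.trans_le (min_le_left _ _)) (hq.trans_le (min_le_left _ _))
    · rw [mem_ball_zero_iff]
      exact hp.trans_le (min_le_right _ _)
  -- a radius for which `0` is the only small root at the parameter `0`
  obtain ⟨η', hη', hη'η, hη'ρ, hroot0⟩ : ∃ η' > 0, η' ≤ η ∧ η' < ρ ∧
      ∀ x, ‖x‖ ≤ η' → (P 0).eval x = 0 → x = 0 := by
    have hfin : ∀ᶠ x in 𝓝 (0 : ℂ), x ∉ (P 0).roots.toFinset.erase 0 := by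
      refine (Finset.isClosed _).isOpen_compl.mem_nhds ?_
      simp
    obtain ⟨r, hr, h⟩ := Metric.eventually_nhds_iff_ball.1 hfin
    refine ⟨min (min η (ρ / 2)) (r / 2), by positivity, (min_le_left _ _).trans (min_le_left _ _),
      ?_, fun x hx hx0 => ?_⟩
    · exact ((min_le_left _ _).trans (min_le_right _ _)).trans_lt (by linarith)
    · by_contra hne0
      refine h x ?_ (by simp [hne0, hne, hx0])
      rw [mem_ball_zero_iff]
      exact (hx.trans (min_le_right _ _)).trans_lt (by linarith)
  -- near the parameter `0` no root crosses the circle `‖x‖ = η'`, some root lies inside, and the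
  -- roots are simple away from the parameter `0` itself
  obtain ⟨ε₀, hε₀, hε₀ρ, hgood⟩ : ∃ ε₀ > 0, ε₀ < ρ ∧ ∀ e : ℂ, ‖e‖ < ε₀ →
      (∀ x, ‖x‖ = η' → (P e).eval x ≠ 0) ∧ (∃ x, (P e).eval x = 0 ∧ ‖x‖ < η') ∧
      (e ≠ 0 → ∀ x, (P e).eval x = 0 → (P e).derivative.eval x ≠ 0) := by
    have h1 : ∀ᶠ e in 𝓝 (0 : ℂ), ∀ x ∈ Metric.sphere (0 : ℂ) η', (P e).eval x ≠ 0 := by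
      refine (isCompact_sphere (0 : ℂ) η').eventually_forall_of_forall_eventually fun x hx => ?_
      refine hPc.continuousAt.eventually_ne ?_
      intro h
      have hx' : ‖x‖ = η' := by simpa using hx
      have := hroot0 x hx'.le h
      rw [this, norm_zero] at hx'
      exact hη'.ne hx'
    have h2 : ∀ᶠ e in 𝓝 (0 : ℂ), ‖(P e).eval 0‖ < ‖c‖ * η' ^ d := by
      have : Tendsto (fun e => ‖(P e).eval 0‖) (𝓝 0) (𝓝 0) := by
        have := (hPc.comp (Continuous.prodMk_left (0 : ℂ))).norm.tendsto 0
        simpa [h0] using this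
      exact this.eventually_lt_const (by positivity)
    rw [eventually_nhdsWithin_iff] at hsimple
    obtain ⟨r, hr, h⟩ := Metric.eventually_nhds_iff_ball.1 (h1.and (h2.and hsimple))
    refine ⟨min r (ρ / 2), by positivity, (min_le_right _ _).trans_lt (by linarith), fun e he => ?_⟩
    obtain ⟨ha, hb, hc'⟩ := h e (by rw [mem_ball_zero_iff]; exact he.trans_le (min_le_left _ _))
    refine ⟨fun x hx => ha x (by simpa using hx), ?_, fun he0 => hc' he0⟩
    exact exists_root_of_norm_eval_lt hη'.le (by rwa [hlead, hdeg])
  set T : ℂ → Finset ℂ := fun e => smallRoots η' (P e)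
  have hTmem : ∀ e x, x ∈ T e ↔ (P e).eval x = 0 ∧ ‖x‖ < η' := fun e x => mem_smallRoots (hne e)
  have hloc : ∀ e₁ : ℂ, ‖e₁‖ < ε₀ → e₁ ≠ 0 → _ := fun e₁ h1 h2 =>
    exists_analytic_smallRoots (P := P) (e₁ := e₁) (d := d) (fun x => hP _) hdeg hne
      ((hgood e₁ h1).2.2 h2) (hgood e₁ h1).1
  have hnorm : ∀ e x : ℂ, ‖e‖ < ε₀ → ‖x‖ < η' → ‖(e, x)‖ < ρ := fun e x he hx =>
    max_lt (he.trans hε₀ρ) (hx.trans hη'ρ)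
  have hnorm' : ∀ e x : ℂ, ‖e‖ < ε₀ → ‖x‖ < η' → ‖star ((e, x) : ℂ × ℂ)‖ < ρ := fun e x he hx => by
    rw [norm_star]; exact hnorm e x he hx
  -- the product over all pairs is symmetric in the roots, hence free of the choice of branches
  set Θ : ℝ × ℝ → ℂ := fun t => ∏ x ∈ T t.1, ∏ y ∈ T t.2, S (((t.1 : ℂ), x), star ((t.2 : ℂ), y))
  set Q : Set (ℝ × ℝ) := Set.Ioo 0 ε₀ ×ˢ Set.Ioo 0 ε₀
  have hre : ∀ t ∈ Set.Ioo 0 ε₀, ‖(t : ℂ)‖ < ε₀ ∧ (t : ℂ) ≠ 0 := by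
    intro t ht
    refine ⟨?_, by exact_mod_cast ht.1.ne'⟩
    rw [Complex.norm_real, Real.norm_of_nonneg ht.1.le]
    exact ht.2
  have hΘ : AnalyticOnNhd ℝ Θ Q := by
    rintro ⟨s, t⟩ ⟨hs, ht⟩
    obtain ⟨hs1, hs2⟩ := hre s hs
    obtain ⟨ht1, ht2⟩ := hre t ht
    obtain ⟨φ, hφ, hφe⟩ := hloc s hs1 hs2
    obtain ⟨ψ, hψ, hψe⟩ := hloc t ht1 ht2
    have hfst : Tendsto (fun u : ℝ × ℝ => (u.1 : ℂ)) (𝓝 (s, t)) (𝓝 (s : ℂ)) :=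
      (Complex.continuous_ofReal.comp continuous_fst).tendsto (s, t)
    have hsnd : Tendsto (fun u : ℝ × ℝ => (u.2 : ℂ)) (𝓝 (s, t)) (𝓝 (t : ℂ)) :=
      (Complex.continuous_ofReal.comp continuous_snd).tendsto (s, t)
    have heq : (fun u : ℝ × ℝ => ∏ x ∈ T s, ∏ y ∈ T t,
        S (((u.1 : ℂ), φ x u.1), star ((u.2 : ℂ), ψ y u.2))) =ᶠ[𝓝 (s, t)] Θ := by
      filter_upwards [hfst.eventually hφe, hsnd.eventually hψe] with u hu1 hu2
      simp only [Θ, T]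
      rw [hu1.2, Finset.prod_image hu1.1]
      refine Finset.prod_congr rfl fun x _ => ?_
      rw [hu2.2, Finset.prod_image hu2.1]
    refine AnalyticAt.congr ?_ heq
    refine Finset.analyticAt_fun_prod _ fun x hx => Finset.analyticAt_fun_prod _ fun y hy => ?_
    obtain ⟨hx1, hx2⟩ := hφ x hx
    obtain ⟨hy1, hy2⟩ := hψ y hy
    have e1 : AnalyticAt ℝ (fun u : ℝ × ℝ => (u.1 : ℂ)) (s, t) :=
      (Complex.ofRealCLM.analyticAt s).comp_of_eq analyticAt_fst rfl
    have e2 : AnalyticAt ℝ (fun u : ℝ × ℝ => (u.2 : ℂ)) (s, t) :=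
      (Complex.ofRealCLM.analyticAt t).comp_of_eq analyticAt_snd rfl
    have e3 : AnalyticAt ℝ (fun u : ℝ × ℝ => φ x u.1) (s, t) :=
      (hx1.restrictScalars (𝕜 := ℝ)).comp_of_eq e1 rfl
    have e4 : AnalyticAt ℝ (fun u : ℝ × ℝ => ψ y u.2) (s, t) :=
      (hy1.restrictScalars (𝕜 := ℝ)).comp_of_eq e2 rfl
    have hstar : ∀ z, AnalyticAt ℝ (star : ℂ × ℂ → ℂ × ℂ) z := fun z =>
      ((starL' ℝ : (ℂ × ℂ) ≃L[ℝ] (ℂ × ℂ)) : (ℂ × ℂ) →L[ℝ] (ℂ × ℂ)).analyticAt z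
    have hSx : AnalyticAt ℂ S (((s : ℂ), x), star ((t : ℂ), y)) :=
      hSρ _ _ (hnorm _ _ hs1 ((hTmem _ _).1 hx).2) (hnorm' _ _ ht1 ((hTmem _ _).1 hy).2)
    refine (hSx.restrictScalars (𝕜 := ℝ)).comp_of_eq
      ((e1.prod e3).prod ((hstar _).comp_of_eq (e2.prod e4) rfl)) ?_
    simp [hx2, hy2]
  have hQc : IsPreconnected Q := isPreconnected_Ioo.prod isPreconnected_Ioo
  -- polarization along one branch makes one factor vanish near a diagonal point
  have hΘ0 : Set.EqOn Θ 0 Q := by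
    set t : ℝ := ε₀ / 2
    have ht : t ∈ Set.Ioo 0 ε₀ := ⟨by simp only [t]; linarith, by simp only [t]; linarith⟩
    obtain ⟨ht1, ht2⟩ := hre t ht
    obtain ⟨φ, hφ, hφe⟩ := hloc t ht1 ht2
    obtain ⟨x, hx⟩ := (hgood _ ht1).2.1
    have hx' : x ∈ T t := (hTmem _ _).2 hx
    obtain ⟨hx1, hx2⟩ := hφ x hx'
    have hmem : ∀ᶠ e in 𝓝 (t : ℂ), AnalyticAt ℂ (φ x) e ∧ φ x e ∈ T e ∧ ‖e‖ < ε₀ := by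
      filter_upwards [hx1.eventually_analyticAt, hφe,
        continuous_norm.continuousAt.eventually_lt_const ht1] with e h1 h2 h3
      refine ⟨h1, ?_, h3⟩
      simp only [T]
      rw [h2.2]
      exact Finset.mem_image_of_mem _ hx'
    obtain ⟨r, hr, hball⟩ := Metric.eventually_nhds_iff_ball.1 hmem
    have hpol := polarization (D := Metric.ball (t : ℂ) r) Metric.isOpen_ball
      (convex_ball _ _) (g := fun e => (e, φ x e)) (Q := S)
      (fun e he => (differentiableAt_id.prodMk
        (hball e he).1.differentiableAt).differentiableWithinAt)
      (fun a ha b hb => (hSρ _ _ (hnorm _ _ (hball a ha).2.2 ((hTmem _ _).1 (hball a ha).2.1).2)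
        (hnorm' _ _ (hball b hb).2.2 ((hTmem _ _).1 (hball b hb).2.1).2)).differentiableAt)
      (fun a ha => hvanρ _ (hnorm _ _ (hball a ha).2.2 ((hTmem _ _).1 (hball a ha).2.1).2)
        ((hTmem _ _).1 (hball a ha).2.1).1)
    refine hΘ.eqOn_zero_of_preconnected_of_eventuallyEq_zero hQc (z₀ := (t, t)) ⟨ht, ht⟩ ?_
    have hb : ∀ᶠ e in 𝓝 (t : ℂ), e ∈ Metric.ball (t : ℂ) r := Metric.ball_mem_nhds _ hr
    have hfst : Tendsto (fun u : ℝ × ℝ => (u.1 : ℂ)) (𝓝 (t, t)) (𝓝 (t : ℂ)) :=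
      (Complex.continuous_ofReal.comp continuous_fst).tendsto (t, t)
    have hsnd : Tendsto (fun u : ℝ × ℝ => (u.2 : ℂ)) (𝓝 (t, t)) (𝓝 (t : ℂ)) :=
      (Complex.continuous_ofReal.comp continuous_snd).tendsto (t, t)
    filter_upwards [hfst.eventually hb, hsnd.eventually hb] with u h1 h2
    exact Finset.prod_eq_zero (hball _ h1).2.1 (Finset.prod_eq_zero (hball _ h2).2.1
      (hpol _ h1 _ h2))
  -- let the second parameter tend to `0`: its roots tend to `0`, and those of `P ε`
  -- are finitely many
  filter_upwards [Ioo_mem_nhdsGT hε₀] with ε hε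
  obtain ⟨hε1, hε2⟩ := hre ε hε
  set u : ℕ → ℝ := fun m => ε₀ / (m + 2)
  have hu : ∀ m, u m ∈ Set.Ioo 0 ε₀ := fun m => ⟨by positivity, by
    simp only [u]
    rw [div_lt_iff₀ (by positivity)]
    nlinarith [(Nat.cast_nonneg m : (0 : ℝ) ≤ m)]⟩
  have hu0 : Tendsto u atTop (𝓝 0) := by
    refine tendsto_const_nhds.div_atTop ?_
    exact tendsto_atTop_add_const_right _ _ tendsto_natCast_atTop_atTop
  have hxy : ∀ m, ∃ q : ℂ × ℂ, (q.1 ∈ T ε ∧ q.2 ∈ T (u m)) ∧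
      S (((ε : ℂ), q.1), star ((u m : ℂ), q.2)) = 0 := by
    intro m
    have h := hΘ0 (show (ε, u m) ∈ Q from ⟨hε, hu m⟩)
    obtain ⟨x, hx, h⟩ := Finset.prod_eq_zero_iff.1 h
    obtain ⟨y, hy, h⟩ := Finset.prod_eq_zero_iff.1 h
    exact ⟨(x, y), ⟨hx, hy⟩, h⟩
  choose q hq hqS using hxy
  have hqmem : ∀ m, q m ∈ (T ε : Set ℂ) ×ˢ Metric.closedBall (0 : ℂ) η' := fun m =>
    ⟨(hq m).1, by rw [mem_closedBall_zero_iff]; exact ((hTmem _ _).1 (hq m).2).2.le⟩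
  have hcomp : IsCompact ((T ε : Set ℂ) ×ˢ Metric.closedBall (0 : ℂ) η') :=
    (T ε).finite_toSet.isCompact.prod (isCompact_closedBall _ _)
  obtain ⟨⟨x, y⟩, ⟨hx, hy⟩, κ, hκ, hlim⟩ := hcomp.tendsto_subseq hqmem
  have hlim1 : Tendsto (fun m => (q (κ m)).1) atTop (𝓝 x) :=
    (continuous_fst.tendsto _).comp hlim
  have hlim2 : Tendsto (fun m => (q (κ m)).2) atTop (𝓝 y) :=
    (continuous_snd.tendsto _).comp hlim
  have hlimu : Tendsto (fun m => (u (κ m) : ℂ)) atTop (𝓝 0) := by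
    have := (Complex.continuous_ofReal.tendsto 0).comp (hu0.comp hκ.tendsto_atTop)
    simpa [Function.comp_def] using this
  have hy0 : y = 0 := by
    refine hroot0 y (mem_closedBall_zero_iff.1 hy) ?_
    have h1 : Tendsto (fun m => (P (u (κ m))).eval (q (κ m)).2) atTop (𝓝 ((P 0).eval y)) :=
      (hPc.tendsto (0, y)).comp (hlimu.prodMk_nhds hlim2)
    have h2 : ∀ m, (P (u (κ m))).eval (q (κ m)).2 = 0 := fun m => ((hTmem _ _).1 (hq (κ m)).2).1
    simp only [h2] at h1
    exact tendsto_nhds_unique h1 tendsto_const_nhds |>.symm ▸ rfl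
  subst hy0
  obtain ⟨hx1, hx2⟩ := (hTmem _ _).1 hx
  refine ⟨x, hx2.le.trans hη'η, hx1, ?_⟩
  have hSc : ContinuousAt S (((ε : ℂ), x), 0) :=
    (hSρ _ _ (hnorm _ _ hε1 hx2) (by simpa using hρ)).continuousAt
  have h1 : Tendsto (fun m => (((ε : ℂ), (q (κ m)).1), star ((u (κ m) : ℂ), (q (κ m)).2))) atTop
      (𝓝 (((ε : ℂ), x), 0)) := by
    refine (tendsto_const_nhds.prodMk_nhds hlim1).prodMk_nhds ?_
    have := (continuous_star.tendsto ((0, 0) : ℂ × ℂ)).comp (hlimu.prodMk_nhds hlim2)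
    rwa [show star ((0, 0) : ℂ × ℂ) = 0 from star_zero _] at this
  have h2 := hSc.tendsto.comp h1
  simp only [Function.comp_def, hqS] at h2
  exact tendsto_nhds_unique h2 tendsto_const_nhds

/-- A bounded holomorphic function with many zeros near the centre of a disc is small. -/
theorem norm_le_prod_of_zeros {δ M : ℝ} (s : Finset ℂ) {f : ℂ → ℂ}
    (hf : DifferentiableOn ℂ f (Metric.ball 0 δ)) (hM : ∀ x ∈ Metric.ball (0 : ℂ) δ, ‖f x‖ ≤ M)
    (hs : ∀ a ∈ s, ‖a‖ ≤ δ / 2 ∧ f a = 0) {x : ℂ} (hx : x ∈ Metric.ball (0 : ℂ) δ) :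
    ‖f x‖ ≤ M * ∏ a ∈ s, (4 / δ * ‖x - a‖) := by
  have hδ : 0 < δ := by
    rw [mem_ball_zero_iff] at hx
    exact (norm_nonneg x).trans_lt hx
  induction s using Finset.induction_on generalizing f M with
  | empty => simpa using hM x hx
  | insert a s has ih =>
    obtain ⟨ha1, ha2⟩ := hs a (Finset.mem_insert_self a s)
    have haball : a ∈ Metric.ball (0 : ℂ) δ := by
      rw [mem_ball_zero_iff]; linarith
    have hM0 : 0 ≤ M := (norm_nonneg _).trans (hM a haball)
    set g := dslope f a
    have hg : DifferentiableOn ℂ g (Metric.ball 0 δ) :=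
      (Complex.differentiableOn_dslope (Metric.isOpen_ball.mem_nhds haball)).2 hf
    have hfg : ∀ z, f z = (z - a) * g z := by
      intro z
      have := sub_smul_dslope f a z
      rw [ha2, sub_zero, smul_eq_mul] at this
      exact this.symm
    have hgM : ∀ z ∈ Metric.ball (0 : ℂ) δ, ‖g z‖ ≤ 4 / δ * M := by
      intro z hz
      rw [mem_ball_zero_iff] at hz
      obtain ⟨r, hr1, hr2⟩ := exists_between (max_lt hz (show 3 * δ / 4 < δ by linarith))
      have hrz : ‖z‖ < r := (le_max_left _ _).trans_lt hr1
      have hr3 : 3 * δ / 4 < r := (le_max_right _ _).trans_lt hr1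
      have hcl : Metric.closedBall (0 : ℂ) r ⊆ Metric.ball 0 δ :=
        Metric.closedBall_subset_ball hr2
      have hr0 : r ≠ 0 := by linarith
      refine Complex.norm_le_of_forall_mem_frontier_norm_le (U := Metric.ball 0 r)
        Metric.isBounded_ball ?_ ?_ (subset_closure (mem_ball_zero_iff.2 hrz))
      · refine (hg.mono ?_).diffContOnCl
        rwa [closure_ball _ hr0]
      · intro y hy
        rw [frontier_ball _ hr0, mem_sphere_zero_iff_norm] at hy
        have hyM := hM y (hcl (by rw [mem_closedBall_zero_iff]; exact hy.le))
        have hya : δ / 4 ≤ ‖y - a‖ := by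
          have := norm_sub_norm_le y a
          linarith
        rw [hfg, norm_mul] at hyM
        have h4 : δ / 4 * ‖g y‖ ≤ M := (mul_le_mul_of_nonneg_right hya (norm_nonneg _)).trans hyM
        rw [div_mul_eq_mul_div, le_div_iff₀ hδ]
        linarith
    have hgs : ∀ b ∈ s, ‖b‖ ≤ δ / 2 ∧ g b = 0 := by
      intro b hb
      obtain ⟨hb1, hb2⟩ := hs b (Finset.mem_insert_of_mem hb)
      refine ⟨hb1, ?_⟩
      rw [hfg] at hb2
      refine (mul_eq_zero.1 hb2).resolve_left (sub_ne_zero.2 ?_)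
      rintro rfl
      exact has hb
    have := ih hg hgM hgs
    rw [hfg, norm_mul, Finset.prod_insert has]
    calc ‖x - a‖ * ‖g x‖ ≤ ‖x - a‖ * (4 / δ * M * ∏ b ∈ s, (4 / δ * ‖x - b‖)) :=
          mul_le_mul_of_nonneg_left this (norm_nonneg _)
      _ = _ := by ring

/-! ### Polynomials and homogeneous polynomials -/

/-- A polynomial over `ℝ` or `ℂ` that vanishes on a nonempty open set is zero. -/
theorem mvPolynomial_eq_zero_of_eventually {𝕜 σ : Type*} [NontriviallyNormedField 𝕜] [Fintype σ]
    {w : σ → 𝕜} {p : MvPolynomial σ 𝕜} (h : ∀ᶠ z in 𝓝 w, MvPolynomial.eval z p = 0) : p = 0 := by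
  rw [nhds_pi, Filter.eventually_iff, Filter.mem_pi'] at h
  obtain ⟨I, t, ht, hI⟩ := h
  refine MvPolynomial.funext_set t (fun i => ?_) fun z hz => ?_
  · exact infinite_of_mem_nhds (w i) (ht i)
  · rw [map_zero]
    exact hI fun i _ => hz i (Set.mem_univ i)

theorem exists_eval_ne_zero_near {𝕜 σ : Type*} [NontriviallyNormedField 𝕜] [Fintype σ]
    {p : MvPolynomial σ 𝕜} (hp : p ≠ 0) (w : σ → 𝕜) :
    ∃ᶠ z in 𝓝 w, MvPolynomial.eval z p ≠ 0 := fun h =>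
  hp (mvPolynomial_eq_zero_of_eventually (by simpa using h))

theorem polynomial_eventually_ne_zero {p : Polynomial ℂ} (hp : p ≠ 0) (a : ℂ) :
    ∀ᶠ e in 𝓝[≠] a, p.eval e ≠ 0 := by
  rw [eventually_nhdsWithin_iff]
  have h : ∀ᶠ x in 𝓝 a, x ∉ p.roots.toFinset.erase a :=
    (Finset.isClosed _).isOpen_compl.mem_nhds (by simp)
  filter_upwards [h] with x hx hxa h0
  exact hx (by simpa [hp, h0] using hxa)

theorem eval_smul_of_isHomogeneous {𝕜 σ : Type*} [Field 𝕜] {p : MvPolynomial σ 𝕜} {d : ℕ}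
    (hp : p.IsHomogeneous d) (c : 𝕜) (z : σ → 𝕜) :
    MvPolynomial.eval (c • z) p = c ^ d * MvPolynomial.eval z p := by
  rw [MvPolynomial.eval_eq, MvPolynomial.eval_eq, Finset.mul_sum]
  refine Finset.sum_congr rfl fun s hs => ?_
  have hdeg : ∑ i ∈ s.support, s i = d := by
    exact (hp.degree_eq_sum_deg_support hs).symm
  have h2 : ∏ i ∈ s.support, (c • z) i ^ s i = c ^ d * ∏ i ∈ s.support, z i ^ s i := by
    rw [← hdeg, ← Finset.prod_pow_eq_pow_sum, ← Finset.prod_mul_distrib]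
    exact Finset.prod_congr rfl fun i _ => by rw [Pi.smul_apply, smul_eq_mul, mul_pow]
  rw [h2]
  ring

section Shift

variable {𝕜 : Type*} [Field 𝕜] {σ : Type*}

/-- The polynomial `x ↦ A (y + x v)` of a monomial `A` has degree at most `deg A`, and `A(v)` is its
coefficient in this degree. -/
theorem shift_monomial (v : σ → 𝕜) (s : σ →₀ ℕ) :
    (shift v (MvPolynomial.monomial s 1)).natDegree ≤ s.degree ∧
      (shift v (MvPolynomial.monomial s 1)).coeff s.degree =
        MvPolynomial.C (MvPolynomial.eval v (MvPolynomial.monomial s 1)) := by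
  induction s using Finsupp.induction_linear with
  | zero =>
    have : (MvPolynomial.monomial 0 1 : MvPolynomial σ 𝕜) = 1 := rfl
    simp [this]
  | add s t hs ht =>
    have : (MvPolynomial.monomial (s + t) 1 : MvPolynomial σ 𝕜) =
        MvPolynomial.monomial s 1 * MvPolynomial.monomial t 1 := by
      rw [MvPolynomial.monomial_mul, one_mul]
    rw [this, map_mul, map_add Finsupp.degree,
      Polynomial.coeff_mul_add_eq_of_natDegree_le hs.1 ht.1,
      hs.2, ht.2, map_mul, map_mul]
    exact ⟨Polynomial.natDegree_mul_le.trans (add_le_add hs.1 ht.1), rfl⟩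
  | single i n =>
    have h1 : (shift v (MvPolynomial.X i)).natDegree ≤ 1 := by
      rw [shift_X]
      compute_degree
    have h2 : (shift v (MvPolynomial.X i)).coeff 1 = MvPolynomial.C (v i) := by
      simp
    rw [← MvPolynomial.X_pow_eq_monomial, map_pow, Finsupp.degree_single]
    constructor
    · exact Polynomial.natDegree_pow_le.trans (by nlinarith)
    · have := Polynomial.coeff_pow_of_natDegree_le (m := n) h1
      rw [mul_one] at this
      rw [this, h2]
      simp

/-- For a homogeneous polynomial `A` of degree `d`, the coefficient of `T ^ d` in `A(X + T v)` is
`A(v)`. -/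
theorem shift_of_isHomogeneous (v : σ → 𝕜) {A : MvPolynomial σ 𝕜} {d : ℕ}
    (hA : A.IsHomogeneous d) :
    (shift v A).natDegree ≤ d ∧ (shift v A).coeff d = MvPolynomial.C (MvPolynomial.eval v A) := by
  have hmon : ∀ s ∈ A.support, s.degree = d := fun s hs => by
    rw [hA.degree_eq_sum_deg_support hs]
    rfl
  have hsum : A = ∑ s ∈ A.support, MvPolynomial.C (A.coeff s) * MvPolynomial.monomial s 1 := by
    conv_lhs => rw [A.as_sum]
    exact Finset.sum_congr rfl fun s _ => by rw [MvPolynomial.C_mul_monomial, mul_one]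
  have hs : shift v A = ∑ s ∈ A.support, Polynomial.C (MvPolynomial.C (A.coeff s)) *
      shift v (MvPolynomial.monomial s 1) := by
    conv_lhs => rw [hsum]
    simp
  constructor
  · rw [hs]
    refine Polynomial.natDegree_sum_le_of_forall_le _ _ fun s hs => ?_
    refine (Polynomial.natDegree_C_mul_le _ _).trans ?_
    rw [← hmon s hs]
    exact (shift_monomial v s).1
  · rw [hs, Polynomial.finsetSum_coeff]
    conv_rhs => rw [hsum]
    rw [map_sum, map_sum]
    refine Finset.sum_congr rfl fun s hs => ?_
    rw [Polynomial.coeff_C_mul, ← hmon s hs, (shift_monomial v s).2, map_mul, map_mul,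
      MvPolynomial.eval_C]

end Shift

/-! ### Zeros of a holomorphic function on several hypersurfaces -/

section Count

variable {σ : Type*} {k : ℕ} {w : σ → ℂ} {A : Fin (k + 1) → MvPolynomial σ ℂ}
  {d : Fin (k + 1) → ℕ}

/-- The restriction of a polynomial `A` to the line through `w + e u` in the direction `v`. -/
def lineRestrict (A : MvPolynomial σ ℂ) (w u v : σ → ℂ) (e : ℂ) : Polynomial ℂ :=
  (shift v A).map (MvPolynomial.eval (w + e • u))

theorem eval_lineRestrict (A : MvPolynomial σ ℂ) (w u v : σ → ℂ) (e x : ℂ) :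
    (lineRestrict A w u v e).eval x = MvPolynomial.eval (w + e • u + x • v) A :=
  eval_map_shift _ _ _ _

theorem natDegree_lineRestrict {A : MvPolynomial σ ℂ} {d : ℕ} (hA : A.IsHomogeneous d)
    (w u : σ → ℂ) {v : σ → ℂ} (hv : MvPolynomial.eval v A ≠ 0) (e : ℂ) :
    (lineRestrict A w u v e).natDegree = d ∧
      (lineRestrict A w u v e).leadingCoeff = MvPolynomial.eval v A := by
  obtain ⟨h1, h2⟩ := shift_of_isHomogeneous v hA
  have hc : (lineRestrict A w u v e).coeff d = MvPolynomial.eval v A := by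
    rw [lineRestrict, Polynomial.coeff_map, h2, MvPolynomial.eval_C]
  have hd : (lineRestrict A w u v e).natDegree = d :=
    le_antisymm (Polynomial.natDegree_map_le.trans h1)
      (Polynomial.le_natDegree_of_ne_zero (by rwa [hc]))
  exact ⟨hd, by rw [Polynomial.leadingCoeff, hd, hc]⟩

theorem exists_shift_ne {A : MvPolynomial σ ℂ} {d : ℕ} (hA : A.IsHomogeneous d) (hd : 0 < d)
    {v : σ → ℂ} (hv : MvPolynomial.eval v A ≠ 0) :
    ∃ y : σ → ℂ, ∃ x : ℂ, MvPolynomial.eval (y + x • v) A ≠ MvPolynomial.eval y A := by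
  refine ⟨0, 1, ?_⟩
  have h0 : MvPolynomial.eval (0 : σ → ℂ) A = 0 := by
    have := eval_smul_of_isHomogeneous hA 0 (0 : σ → ℂ)
    rwa [zero_pow hd.ne', zero_mul, zero_smul] at this
  rw [h0]
  simpa using hv

variable [Fintype σ]

/-- For a general direction `u`, all but finitely many lines `w + e u + ℂ v` meet the hypersurfaces
`A j = 0` transversally and in disjoint sets. -/
theorem exists_transversal_direction (hhom : ∀ j, (A j).IsHomogeneous (d j)) (hd : ∀ j, 0 < d j)
    (hirr : ∀ j, Irreducible (A j)) (hnd : ∀ i j, i ≠ j → ¬ A i ∣ A j) (w : σ → ℂ) {v : σ → ℂ}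
    (hv : ∀ j, MvPolynomial.eval v (A j) ≠ 0) :
    ∃ u : σ → ℂ, ∀ᶠ e in 𝓝[≠] (0 : ℂ),
      (∀ j x, (lineRestrict (A j) w u v e).eval x = 0 →
        (lineRestrict (A j) w u v e).derivative.eval x ≠ 0) ∧
      ∀ i j, i ≠ j → ∀ x, (lineRestrict (A i) w u v e).eval x = 0 →
        (lineRestrict (A j) w u v e).eval x ≠ 0 := by
  classical
  have hne : ∀ j, ∃ y : σ → ℂ, ∃ x : ℂ,
      MvPolynomial.eval (y + x • v) (A j) ≠ MvPolynomial.eval y (A j) := fun j =>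
    exists_shift_ne (hhom j) (hd j) (hv j)
  choose r hr0 hr using fun j => exists_eliminant (hirr j) v (hne j) (not_dvd_dirDeriv (hne j))
  have hq : ∀ p : Fin (k + 1) × Fin (k + 1), ∃ q : MvPolynomial σ ℂ, q ≠ 0 ∧ (p.1 ≠ p.2 →
      ∀ (y : σ → ℂ) (x : ℂ), MvPolynomial.eval (y + x • v) (A p.1) = 0 →
        MvPolynomial.eval (y + x • v) (A p.2) = 0 → MvPolynomial.eval y q = 0) := by
    intro p
    by_cases hp : p.1 = p.2
    · exact ⟨1, one_ne_zero, fun h => absurd hp h⟩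
    · obtain ⟨q, hq1, hq2⟩ := exists_eliminant (hirr p.1) v (hne p.1) (hnd _ _ hp)
      exact ⟨q, hq1, fun _ => hq2⟩
  choose q hq0 hq using hq
  set Q : MvPolynomial σ ℂ := (∏ j, r j) * ∏ p, q p
  have hQ : Q ≠ 0 := mul_ne_zero (Finset.prod_ne_zero_iff.2 fun j _ => hr0 j)
    (Finset.prod_ne_zero_iff.2 fun p _ => hq0 p)
  obtain ⟨z, hz⟩ := (exists_eval_ne_zero_near hQ w).exists
  refine ⟨z - w, ?_⟩
  have hpoly : (shift (z - w) Q).map (MvPolynomial.eval w) ≠ 0 := by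
    intro h
    have := eval_map_shift (z - w) w 1 Q
    rw [h, one_smul, add_sub_cancel, Polynomial.eval_zero] at this
    exact hz this.symm
  filter_upwards [polynomial_eventually_ne_zero hpoly 0] with e he
  rw [eval_map_shift, map_mul, map_prod, map_prod] at he
  have he1 := Finset.prod_ne_zero_iff.1 (left_ne_zero_of_mul he)
  have he2 := Finset.prod_ne_zero_iff.1 (right_ne_zero_of_mul he)
  refine ⟨fun j x h0 h1 => he1 j (Finset.mem_univ _) ?_, fun i j hij x h0 h1 =>
    he2 (i, j) (Finset.mem_univ _) ?_⟩
  · rw [eval_lineRestrict] at h0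
    rw [lineRestrict, Polynomial.derivative_map, derivative_shift, eval_map_shift] at h1
    exact hr j _ x h0 h1
  · rw [eval_lineRestrict] at h0 h1
    exact hq (i, j) hij _ x h0 h1

/-- Let `R` be holomorphic near `(w, w̄)`, and let `R(z, z̄)` vanish on `k + 1` irreducible
hypersurfaces through `w`. Then `R(z, w̄)` vanishes at `w` to order at least `k + 1`. -/
theorem norm_le_of_vanishing_on_hypersurfaces (hhom : ∀ j, (A j).IsHomogeneous (d j))
    (hd : ∀ j, 0 < d j) (hirr : ∀ j, Irreducible (A j)) (hnd : ∀ i j, i ≠ j → ¬ A i ∣ A j)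
    (hw : ∀ j, MvPolynomial.eval w (A j) = 0) {R : (σ → ℂ) × (σ → ℂ) → ℂ}
    (hR : AnalyticAt ℂ R (w, star w))
    (hvan : ∀ j, ∀ᶠ z in 𝓝 w, MvPolynomial.eval z (A j) = 0 → R (z, star z) = 0) :
    ∃ C : ℝ, ∀ᶠ z in 𝓝 w, ‖R (z, star w)‖ ≤ C * ‖z - w‖ ^ (k + 1) := by
  classical
  obtain ⟨ρ, hρ, hRρ⟩ : ∃ ρ > 0, ∀ z : σ → ℂ, ‖z‖ < ρ →
      AnalyticAt ℂ R (w + z, star w) ∧ ‖R (w + z, star w)‖ ≤ ‖R (w, star w)‖ + 1 := by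
    have hc : Tendsto (fun z : σ → ℂ => (w + z, star w)) (𝓝 0) (𝓝 (w, star w)) := by
      have : Continuous fun z : σ → ℂ => (w + z, star w) := by fun_prop
      simpa using this.tendsto 0
    have h2 : ∀ᶠ p in 𝓝 (w, star w), ‖R p‖ < ‖R (w, star w)‖ + 1 :=
      hR.continuousAt.norm.eventually_lt_const (lt_add_one _)
    obtain ⟨ρ, hρ, h⟩ := Metric.eventually_nhds_iff_ball.1
      (hc.eventually (hR.eventually_analyticAt.and h2))
    exact ⟨ρ, hρ, fun z hz => ⟨(h z (by simpa using hz)).1, (h z (by simpa using hz)).2.le⟩⟩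
  set M := ‖R (w, star w)‖ + 1
  set δ := ρ / 4
  have hδ : 0 < δ := by positivity
  set C := M * (4 / δ) ^ (k + 1)
  -- the estimate on one line in a general direction
  have hline : ∀ v : σ → ℂ, ‖v‖ < 2 → (∀ j, MvPolynomial.eval v (A j) ≠ 0) → ∀ x : ℂ, ‖x‖ < δ →
      ‖R (w + x • v, star w)‖ ≤ C * ‖x‖ ^ (k + 1) := by
    intro v hv2 hv x hx
    obtain ⟨u, hu⟩ := exists_transversal_direction hhom hd hirr hnd w hv
    set S : (ℂ × ℂ) × (ℂ × ℂ) → ℂ := fun p => R (w + p.1.1 • u + p.1.2 • v,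
      star w + p.2.1 • star u + p.2.2 • star v)
    have hS : AnalyticAt ℂ S 0 := by
      refine hR.comp_of_eq (f := fun p : (ℂ × ℂ) × (ℂ × ℂ) => (w + p.1.1 • u + p.1.2 • v,
        star w + p.2.1 • star u + p.2.2 • star v)) ?_ (by simp)
      have e1 : AnalyticAt ℂ (fun p : (ℂ × ℂ) × (ℂ × ℂ) => p.1) 0 := analyticAt_fst
      have e2 : AnalyticAt ℂ (fun p : (ℂ × ℂ) × (ℂ × ℂ) => p.2) 0 := analyticAt_snd
      have h11 := analyticAt_fst.comp_of_eq e1 rfl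
      have h12 := analyticAt_snd.comp_of_eq e1 rfl
      have h21 := analyticAt_fst.comp_of_eq e2 rfl
      have h22 := analyticAt_snd.comp_of_eq e2 rfl
      exact ((analyticAt_const.add (h11.smul analyticAt_const)).add
        (h12.smul analyticAt_const)).prod
        ((analyticAt_const.add (h21.smul analyticAt_const)).add (h22.smul analyticAt_const))
    have hroot : ∀ η > 0, ∀ᶠ ε : ℝ in 𝓝[>] 0, ∀ j, ∃ y : ℂ, ‖y‖ ≤ η ∧
        (lineRestrict (A j) w u v ε).eval y = 0 ∧ R (w + (ε : ℂ) • u + y • v, star w) = 0 := by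
      intro η hη
      rw [eventually_all]
      intro j
      have := exists_root_of_polar_vanishing (P := lineRestrict (A j) w u v) (d := d j)
        (c := MvPolynomial.eval v (A j)) (S := S) (fun p => ?_)
        (fun e => (natDegree_lineRestrict (hhom j) w u (hv j) e).1)
        (fun e => (natDegree_lineRestrict (hhom j) w u (hv j) e).2) (hv j)
        (by rw [eval_lineRestrict]; simpa using hw j) (hu.mono fun e he => he.1 j) hS ?_ hη
      · simpa [S] using this
      · simp only [eval_lineRestrict]
        refine AnalyticAt.aeval_mvPolynomial (A := ℂ) (fun i => ?_) (A j)
        simp only [Pi.add_apply, Pi.smul_apply, smul_eq_mul]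
        exact (analyticAt_const.add (analyticAt_fst.mul analyticAt_const)).add
          (analyticAt_snd.mul analyticAt_const)
      · have hc : Tendsto (fun p : ℂ × ℂ => w + p.1 • u + p.2 • v) (𝓝 0) (𝓝 w) := by
          have : Continuous fun p : ℂ × ℂ => w + p.1 • u + p.2 • v := by fun_prop
          simpa using this.tendsto 0
        filter_upwards [hc.eventually (hvan j)] with p hp h0
        rw [eval_lineRestrict] at h0
        have := hp h0
        simpa [S, star_add, star_smul] using this
    have hG : ∀ z : σ → ℂ, ‖z‖ < ρ → ContinuousAt (fun z => R (w + z, star w)) z := fun z hz =>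
      (hRρ z hz).1.continuousAt.comp (f := fun z : σ → ℂ => (w + z, star w)) (by fun_prop)
    have hxv : ∀ x : ℂ, ‖x‖ < δ → ‖x • v‖ < ρ / 2 := by
      intro x hx
      rw [norm_smul]
      have : ‖x‖ * ‖v‖ ≤ ‖x‖ * 2 := mul_le_mul_of_nonneg_left hv2.le (norm_nonneg _)
      simp only [δ] at hx
      linarith
    have hest : ∀ η ∈ Set.Ioo 0 (δ / 2), ‖R (w + x • v, star w)‖ ≤
        M * (4 / δ * (‖x‖ + η)) ^ (k + 1) := by
      intro η hη
      have hlim : Tendsto (fun ε : ℝ => ‖R (w + ((ε : ℂ) • u + x • v), star w)‖) (𝓝[>] 0)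
          (𝓝 ‖R (w + x • v, star w)‖) := by
        have h1 : Tendsto (fun ε : ℝ => (ε : ℂ) • u + x • v) (𝓝 0) (𝓝 (x • v)) := by
          have : Continuous fun ε : ℝ => (ε : ℂ) • u + x • v := by fun_prop
          simpa using this.tendsto 0
        exact ((hG (x • v) ((hxv x hx).trans (by linarith))).norm.tendsto.comp h1).mono_left
          nhdsWithin_le_nhds
      refine le_of_tendsto hlim ?_
      have hnear : ∀ᶠ ε : ℝ in 𝓝[>] 0, ‖(ε : ℂ) • u‖ < ρ / 2 := by
        have h1 : Tendsto (fun ε : ℝ => ‖(ε : ℂ) • u‖) (𝓝 0) (𝓝 0) := by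
          have : Continuous fun ε : ℝ => ‖(ε : ℂ) • u‖ := by fun_prop
          simpa using this.tendsto 0
        exact (h1.mono_left nhdsWithin_le_nhds).eventually_lt_const (by positivity)
      have hne : Tendsto (fun ε : ℝ => (ε : ℂ)) (𝓝[>] 0) (𝓝[≠] 0) := by
        refine tendsto_nhdsWithin_iff.2 ⟨?_, ?_⟩
        · have := Complex.continuous_ofReal.tendsto 0
          simp only [Complex.ofReal_zero] at this
          exact this.mono_left nhdsWithin_le_nhds
        · filter_upwards [self_mem_nhdsWithin] with ε hε
          have : (ε : ℝ) ≠ 0 := ne_of_gt hε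
          simpa using this
      filter_upwards [hroot η hη.1, hnear, hne.eventually hu] with ε h1 h2 h3
      choose y hy1 hy2 hy3 using h1
      have hyinj : Function.Injective y := by
        intro i j hij
        by_contra h
        exact h3.2 i j h (y i) (hy2 i) (hij ▸ hy2 j)
      have hball : ∀ t ∈ Metric.ball (0 : ℂ) δ, ‖(ε : ℂ) • u + t • v‖ < ρ := by
        intro t ht
        have := norm_add_le ((ε : ℂ) • u) (t • v)
        have := hxv t (by simpa using ht)
        linarith
      have := norm_le_prod_of_zeros (δ := δ) (M := M) (Finset.univ.image y)
        (f := fun t => R (w + ((ε : ℂ) • u + t • v), star w)) (fun t ht => ?_)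
        (fun t ht => (hRρ _ (hball t ht)).2) (fun a ha => ?_) (x := x) (by simpa using hx)
      · rw [Finset.prod_image fun i _ j _ h => hyinj h] at this
        refine this.trans (mul_le_mul_of_nonneg_left ?_ (by positivity))
        refine (Finset.prod_le_prod (fun _ _ => by positivity) (g := fun _ => 4 / δ * (‖x‖ + η))
          fun i _ => ?_).trans (by simp)
        refine mul_le_mul_of_nonneg_left ?_ (by positivity)
        exact (norm_sub_le _ _).trans (by linarith [hy1 i])
      · refine DifferentiableAt.differentiableWithinAt ?_
        exact (hRρ _ (hball t ht)).1.differentiableAt.comp t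
          (f := fun t : ℂ => (w + ((ε : ℂ) • u + t • v), star w)) (by fun_prop)
      · obtain ⟨i, -, rfl⟩ := Finset.mem_image.1 ha
        refine ⟨(hy1 i).trans hη.2.le, ?_⟩
        rw [← add_assoc]
        exact hy3 i
    have hlim : Tendsto (fun η : ℝ => M * (4 / δ * (‖x‖ + η)) ^ (k + 1)) (𝓝[>] 0)
        (𝓝 (C * ‖x‖ ^ (k + 1))) := by
      have h : Continuous fun η : ℝ => M * (4 / δ * (‖x‖ + η)) ^ (k + 1) := by fun_prop
      have h2 := (h.tendsto 0).mono_left (nhdsWithin_le_nhds (s := Set.Ioi 0))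
      rwa [add_zero, mul_pow, ← mul_assoc] at h2
    exact ge_of_tendsto hlim (by
      filter_upwards [Ioo_mem_nhdsGT (half_pos hδ)] with η hη using hest η hη)
  -- all directions by continuity
  have hall : ∀ v : σ → ℂ, ‖v‖ ≤ 1 → ∀ x : ℂ, ‖x‖ < δ →
      ‖R (w + x • v, star w)‖ ≤ C * ‖x‖ ^ (k + 1) := by
    intro v hv x hx
    have hA0 : ∏ j, A j ≠ 0 := Finset.prod_ne_zero_iff.2 fun j _ => (hirr j).ne_zero
    have hfreq := (exists_eval_ne_zero_near hA0 v).and_eventually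
      (continuous_norm.continuousAt.eventually_lt_const (show ‖v‖ < 2 by linarith))
    have hcont : ContinuousAt (fun v => ‖R (w + x • v, star w)‖) v := by
      refine ContinuousAt.norm (ContinuousAt.comp (g := R)
        (f := fun v : σ → ℂ => (w + x • v, star w)) (hRρ _ ?_).1.continuousAt (by fun_prop))
      rw [norm_smul]
      have : ‖x‖ * ‖v‖ ≤ ‖x‖ * 1 := mul_le_mul_of_nonneg_left hv (norm_nonneg _)
      simp only [δ] at hx
      linarith
    refine le_of_tendsto_of_frequently hcont (hfreq.mono fun v' h => ?_)
    rw [map_prod] at h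
    exact hline v' h.2 (fun j => Finset.prod_ne_zero_iff.1 h.1 j (Finset.mem_univ _)) x hx
  refine ⟨C, ?_⟩
  filter_upwards [Metric.ball_mem_nhds w hδ] with z hz
  by_cases hzw : z = w
  · subst hzw
    simpa using hall 0 (by simp) 0 (by simpa using hδ)
  · have hpos : 0 < ‖z - w‖ := norm_pos_iff.2 (sub_ne_zero.2 hzw)
    have h1 : ((‖z - w‖ : ℝ) : ℂ) ≠ 0 := by exact_mod_cast hpos.ne'
    have := hall ((((‖z - w‖ : ℝ) : ℂ))⁻¹ • (z - w)) ?_ (‖z - w‖ : ℝ) ?_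
    · rw [smul_smul, mul_inv_cancel₀ h1, one_smul, add_sub_cancel] at this
      simpa using this
    · rw [norm_smul, norm_inv, Complex.norm_real, norm_norm, inv_mul_cancel₀ hpos.ne']
    · rw [Complex.norm_real, norm_norm]
      simpa [dist_eq_norm] using hz

end Count

/-! ### Affine charts and cones -/

section Charts

variable {n : ℕ}

/-- The representative of the point `chart i w` whose entry in position `i` is `1`. -/
def affineLift (i : Fin (n + 1)) (w : Fin n → ℂ) : Fin (n + 1) → ℂ :=
  Fin.insertNth (α := fun _ => ℂ) i 1 w

/-- The affine coordinates, in the chart `i`, of the point with homogeneous coordinates `Z`. -/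
def dehomog (i : Fin (n + 1)) (Z : Fin (n + 1) → ℂ) : Fin n → ℂ :=
  fun l => Z (i.succAbove l) / Z i

@[simp]
theorem affineLift_apply_same (i : Fin (n + 1)) (w : Fin n → ℂ) : affineLift i w i = 1 := by
  simp [affineLift]

@[simp]
theorem affineLift_apply_succAbove (i : Fin (n + 1)) (w : Fin n → ℂ) (l : Fin n) :
    affineLift i w (i.succAbove l) = w l := by
  simp [affineLift]

theorem affineLift_ne_zero (i : Fin (n + 1)) (w : Fin n → ℂ) : affineLift i w ≠ 0 := fun h => by
  have := congrFun h i
  simp at this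

theorem chart_eq_mk (i : Fin (n + 1)) (w : Fin n → ℂ) :
    chart i w = Projectivization.mk ℂ (affineLift i w) (affineLift_ne_zero i w) := rfl

theorem affineLift_dehomog {i : Fin (n + 1)} {Z : Fin (n + 1) → ℂ} (hZ : Z i ≠ 0) :
    affineLift i (dehomog i Z) = (Z i)⁻¹ • Z := by
  funext j
  refine Fin.succAboveCases i ?_ (fun l => ?_) j
  · simp [hZ]
  · simp [dehomog, div_eq_inv_mul]

theorem dehomog_affineLift (i : Fin (n + 1)) (w : Fin n → ℂ) :
    dehomog i (affineLift i w) = w := by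
  funext l
  simp [dehomog]

theorem mem_cone_iff {H : Set (CP n)} {z : Fin (n + 1) → ℂ} (hz : z ≠ 0) :
    z ∈ cone H ↔ Projectivization.mk ℂ z hz ∈ H :=
  ⟨fun h => h hz, fun h _ => h⟩

theorem chart_mem_iff {H : Set (CP n)} {i : Fin (n + 1)} {w : Fin n → ℂ} :
    chart i w ∈ H ↔ affineLift i w ∈ cone H := by
  rw [chart_eq_mk, mem_cone_iff]

theorem mk_eq_chart_iff {z : Fin (n + 1) → ℂ} {hz : z ≠ 0} {i : Fin (n + 1)} {w : Fin n → ℂ} :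
    chart i w = Projectivization.mk ℂ z hz ↔ ∃ c : ℂ, c • z = affineLift i w := by
  rw [chart_eq_mk, Projectivization.mk_eq_mk_iff']

theorem chart_dehomog {i : Fin (n + 1)} {Z : Fin (n + 1) → ℂ} (hZ0 : Z ≠ 0) (hZ : Z i ≠ 0) :
    chart i (dehomog i Z) = Projectivization.mk ℂ Z hZ0 :=
  mk_eq_chart_iff.2 ⟨(Z i)⁻¹, (affineLift_dehomog hZ).symm⟩

theorem continuous_affineLift (i : Fin (n + 1)) : Continuous (affineLift (n := n) i) := by
  refine continuous_pi fun j => ?_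
  refine Fin.succAboveCases i ?_ (fun l => ?_) j
  · simpa using continuous_const
  · simpa using continuous_apply l

theorem affineLift_sub (i : Fin (n + 1)) (z w : Fin n → ℂ) :
    ‖affineLift i z - affineLift i w‖ ≤ ‖z - w‖ := by
  refine (pi_norm_le_iff_of_nonneg (norm_nonneg _)).2 fun j => ?_
  refine Fin.succAboveCases i ?_ (fun l => ?_) j
  · simp
  · simpa using norm_le_pi_norm (z - w) l

theorem star_affineLift (i : Fin (n + 1)) (w : Fin n → ℂ) :
    star (affineLift i w) = affineLift i (star w) := by
  funext j
  refine Fin.succAboveCases i ?_ (fun l => ?_) j <;> simp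

theorem star_dehomog (i : Fin (n + 1)) (Z : Fin (n + 1) → ℂ) :
    star (dehomog i Z) = dehomog i (star Z) := by
  funext l
  simp [dehomog]

theorem analyticAt_dehomog {i : Fin (n + 1)} {Z : Fin (n + 1) → ℂ} (hZ : Z i ≠ 0) :
    AnalyticAt ℂ (dehomog i) Z := by
  refine analyticAt_pi_iff.2 fun l => ?_
  have h : ∀ j, AnalyticAt ℂ (fun Z : Fin (n + 1) → ℂ => Z j) Z := fun j =>
    (ContinuousLinearMap.proj (R := ℂ) (φ := fun _ : Fin (n + 1) => ℂ) j).analyticAt Z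
  exact (h _).div (h _) hZ

theorem eval_eq_zero_of_smul_eq {A : MvPolynomial (Fin (n + 1)) ℂ} {d : ℕ}
    (hA : A.IsHomogeneous d) {z z' : Fin (n + 1) → ℂ} (h0 : MvPolynomial.eval z A = 0) {c : ℂ}
    (hc : c • z = z') : MvPolynomial.eval z' A = 0 := by
  rw [← hc, eval_smul_of_isHomogeneous hA, h0, mul_zero]

theorem le_dimension {𝕜 : Type} [NontriviallyNormedField 𝕜] [NormedSpace 𝕜 (Fin n → ℂ)]
    {H : Set (CP n)} {i : Fin (n + 1)} {d : ℕ} (h : ContainsSubmanifold 𝕜 (chart i ⁻¹' H) d) :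
    ((d : ℕ∞) : WithBot ℕ∞) ≤ dimension 𝕜 H :=
  le_iSup_of_le i (le_iSup_of_le d (le_iSup_of_le h le_rfl))

theorem finrank_real_pi_complex (n : ℕ) : Module.finrank ℝ (Fin n → ℂ) = 2 * n := by
  rw [Module.finrank_pi_fintype]
  simp [Complex.finrank_real_complex, mul_comm]

end Charts

/-! ### Points on several algebraic leaves -/

section Leaves

variable {n k : ℕ} {A : Fin (k + 1) → MvPolynomial (Fin (n + 1)) ℂ} {d : Fin (k + 1) → ℕ}

/-- In an affine chart: if `R(z, z̄)` vanishes on `k + 1` distinct irreducible hypersurfaces through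
`w`, then `R(z, w̄)` vanishes at `w` to order at least `k + 1`. -/
theorem norm_le_of_vanishing_on_hypersurfaces_chart (hhom : ∀ j, (A j).IsHomogeneous (d j))
    (hd : ∀ j, 0 < d j) (hirr : ∀ j, Irreducible (A j)) (hnd : ∀ i j, i ≠ j → ¬ A i ∣ A j)
    {i : Fin (n + 1)} {w : Fin n → ℂ} (hw : ∀ j, MvPolynomial.eval (affineLift i w) (A j) = 0)
    {R : (Fin n → ℂ) × (Fin n → ℂ) → ℂ} (hR : AnalyticAt ℂ R (w, star w))
    (hvan : ∀ j, ∀ᶠ z in 𝓝 w, MvPolynomial.eval (affineLift i z) (A j) = 0 → R (z, star z) = 0) :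
    ∃ C : ℝ, ∀ᶠ z in 𝓝 w, ‖R (z, star w)‖ ≤ C * ‖z - w‖ ^ (k + 1) := by
  set R' : (Fin (n + 1) → ℂ) × (Fin (n + 1) → ℂ) → ℂ := fun p =>
    R (dehomog i p.1, dehomog i p.2) with hR'
  have h1 : affineLift i w i ≠ 0 := by simp
  have h2 : star (affineLift i w) i ≠ 0 := by simp
  have hR'a : AnalyticAt ℂ R' (affineLift i w, star (affineLift i w)) := by
    refine hR.comp_of_eq (f := fun p : (Fin (n + 1) → ℂ) × (Fin (n + 1) → ℂ) =>
      (dehomog i p.1, dehomog i p.2))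
      (((analyticAt_dehomog h1).comp_of_eq analyticAt_fst rfl).prod
        ((analyticAt_dehomog h2).comp_of_eq analyticAt_snd rfl)) ?_
    rw [← star_dehomog, dehomog_affineLift]
  have hcont : Tendsto (dehomog i) (𝓝 (affineLift i w)) (𝓝 w) := by
    have := (analyticAt_dehomog h1).continuousAt.tendsto
    rwa [dehomog_affineLift] at this
  have hnz : ∀ᶠ Z : Fin (n + 1) → ℂ in 𝓝 (affineLift i w), Z i ≠ 0 :=
    (continuous_apply i).continuousAt.eventually_ne h1
  obtain ⟨C, hC⟩ := norm_le_of_vanishing_on_hypersurfaces hhom hd hirr hnd hw hR'a (fun j => by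
    filter_upwards [hcont.eventually (hvan j), hnz] with Z hZ hZi hZA
    have := hZ (by
      rw [affineLift_dehomog hZi, eval_smul_of_isHomogeneous (hhom j), hZA, mul_zero])
    simpa only [hR', star_dehomog] using this)
  refine ⟨C, ?_⟩
  filter_upwards [((continuous_affineLift i).tendsto w).eventually hC] with z hz
  simp only [hR', star_affineLift, dehomog_affineLift] at hz
  have hn : ‖affineLift i z - affineLift i w‖ = ‖z - w‖ := by
    refine le_antisymm (affineLift_sub i z w) ?_
    refine (pi_norm_le_iff_of_nonneg (norm_nonneg _)).2 fun l => ?_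
    simpa using norm_le_pi_norm (affineLift i z - affineLift i w) (i.succAbove l)
  rwa [hn] at hz

/-- A holomorphic function that vanishes to infinite order at a point vanishes near it. -/
theorem eventually_eq_zero_of_norm_le_pow {E : Type*} [NormedAddCommGroup E] [NormedSpace ℂ E]
    {G : E → ℂ} {w : E} (hG : AnalyticAt ℂ G w)
    (h : ∀ k : ℕ, ∃ C : ℝ, ∀ᶠ z in 𝓝 w, ‖G z‖ ≤ C * ‖z - w‖ ^ (k + 1)) :
    ∀ᶠ z in 𝓝 w, G z = 0 := by
  obtain ⟨r, hr, hball⟩ := Metric.eventually_nhds_iff_ball.1 hG.eventually_analyticAt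
  filter_upwards [Metric.ball_mem_nhds w (half_pos hr)] with z hz
  rw [mem_ball_iff_norm] at hz
  set g : ℂ → ℂ := fun x => G (w + x • (z - w))
  have hmem : ∀ x ∈ Metric.ball (0 : ℂ) 2, w + x • (z - w) ∈ Metric.ball w r := by
    intro x hx
    rw [mem_ball_zero_iff] at hx
    rw [mem_ball_iff_norm, add_sub_cancel_left, norm_smul]
    nlinarith [norm_nonneg x, norm_nonneg (z - w)]
  have hgd : DifferentiableOn ℂ g (Metric.ball 0 2) := fun x hx =>
    ((hball _ (hmem x hx)).differentiableAt.comp x (f := fun x : ℂ => w + x • (z - w))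
      (by fun_prop)).differentiableWithinAt
  have hg : AnalyticOnNhd ℂ g (Metric.ball 0 2) := hgd.analyticOnNhd Metric.isOpen_ball
  have h0 : (0 : ℂ) ∈ Metric.ball (0 : ℂ) 2 := by simp
  have hev : ∀ᶠ x in 𝓝 (0 : ℂ), g x = 0 := by
    by_contra hne
    obtain ⟨m, u, hu, hu0, hue⟩ := (hg 0 h0).exists_eventuallyEq_pow_smul_nonzero_iff.2 hne
    obtain ⟨C, hC⟩ := h m
    have hc : Tendsto (fun x : ℂ => w + x • (z - w)) (𝓝 0) (𝓝 w) := by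
      have : Continuous fun x : ℂ => w + x • (z - w) := by fun_prop
      simpa using this.tendsto 0
    have hle : ∀ᶠ x in 𝓝[≠] (0 : ℂ), ‖u x‖ ≤ C * ‖z - w‖ ^ (m + 1) * ‖x‖ := by
      rw [eventually_nhdsWithin_iff]
      filter_upwards [hue, hc.eventually hC] with x h1 h2 hx
      have hx' : 0 < ‖x‖ := norm_pos_iff.2 hx
      have h3 : ‖g x‖ ≤ C * (‖x‖ * ‖z - w‖) ^ (m + 1) := by
        have := h2
        rwa [add_sub_cancel_left, norm_smul] at this
      rw [h1, sub_zero, smul_eq_mul, norm_mul, norm_pow] at h3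
      have h4 : ‖x‖ ^ m * ‖u x‖ ≤ ‖x‖ ^ m * (C * ‖z - w‖ ^ (m + 1) * ‖x‖) := by
        refine h3.trans (le_of_eq ?_)
        ring
      exact le_of_mul_le_mul_left h4 (pow_pos hx' m)
    have hl1 : Tendsto (fun x => ‖u x‖) (𝓝[≠] 0) (𝓝 ‖u 0‖) :=
      hu.continuousAt.norm.tendsto.mono_left nhdsWithin_le_nhds
    have hl2 : Tendsto (fun x : ℂ => C * ‖z - w‖ ^ (m + 1) * ‖x‖) (𝓝[≠] 0) (𝓝 0) := by
      have : Continuous fun x : ℂ => C * ‖z - w‖ ^ (m + 1) * ‖x‖ := by fun_prop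
      have := (this.tendsto 0).mono_left (nhdsWithin_le_nhds (s := {0}ᶜ))
      simpa using this
    have := le_of_tendsto_of_tendsto hl1 hl2 hle
    exact hu0 (norm_le_zero_iff.1 this)
  have := hg.eqOn_zero_of_preconnected_of_eventuallyEq_zero
    (convex_ball _ _).isPreconnected h0 hev (show (1 : ℂ) ∈ Metric.ball (0 : ℂ) 2 by simp)
  simpa [g] using this

/-- A point that lies, for every `k`, on `k` distinct algebraic leaves of `H` is a degenerate
singularity. -/
theorem isDegenerateSingularity_of_leaves {H : Set (CP n)} {z : Fin (n + 1) → ℂ} (hz : z ≠ 0)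
    (h : ∀ k : ℕ, ∃ (A : Fin (k + 1) → MvPolynomial (Fin (n + 1)) ℂ) (d : Fin (k + 1) → ℕ),
      (∀ j, (A j).IsHomogeneous (d j)) ∧ (∀ j, 0 < d j) ∧ (∀ j, Irreducible (A j)) ∧
      (∀ i j, i ≠ j → ¬ A i ∣ A j) ∧ (∀ j, MvPolynomial.eval z (A j) = 0) ∧
      ∀ j Z, MvPolynomial.eval Z (A j) = 0 → Z ∈ cone H) :
    IsDegenerateSingularity H (Projectivization.mk ℂ z hz) := by
  constructor
  · obtain ⟨A, d, -, -, -, -, h1, h2⟩ := h 0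
    exact (mem_cone_iff hz).1 (h2 0 z (h1 0))
  · intro i w hw ρ hρ R hR
    obtain ⟨c, hc⟩ := mk_eq_chart_iff.1 hw
    have hRw : AnalyticAt ℂ (fun z => R (z, star w)) w :=
      hR.1.comp_of_eq (f := fun z : Fin n → ℂ => (z, star w))
        (analyticAt_id.prod analyticAt_const) rfl
    refine eventually_eq_zero_of_norm_le_pow hRw fun k => ?_
    obtain ⟨A, d, hhom, hd, hirr, hnd, h1, h2⟩ := h k
    refine norm_le_of_vanishing_on_hypersurfaces_chart hhom hd hirr hnd (i := i)
      (fun j => eval_eq_zero_of_smul_eq (hhom j) (h1 j) hc) hR.1 fun j => ?_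
    filter_upwards [hρ.2, hR.2] with Z hZ1 hZ2 hZA
    rw [hZ2, hZ1.1 (chart_mem_iff.2 (h2 j _ hZA)), Complex.ofReal_zero]

/-- A real-analytic function whose complexification `R(z, w̄)` vanishes to second order at `w` has a
critical point at `w`. -/
theorem fderiv_eq_zero_of_isComplexification {w : Fin n → ℂ} {ρ : (Fin n → ℂ) → ℝ}
    {R : (Fin n → ℂ) × (Fin n → ℂ) → ℂ} (hR : IsComplexification w ρ R) {C : ℝ}
    (hC : ∀ᶠ z in 𝓝 w, ‖R (z, star w)‖ ≤ C * ‖z - w‖ ^ 2) : fderiv ℝ ρ w = 0 := by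
  set L := fderiv ℂ R (w, star w)
  have hRd : HasFDerivAt R L (w, star w) := hR.1.differentiableAt.hasFDerivAt
  -- the derivative in the first variable vanishes
  have hL1 : ∀ a, L (a, 0) = 0 := by
    have h1 : HasFDerivAt (fun z => R (z, star w)) (L.comp (ContinuousLinearMap.inl ℂ _ _)) w := by
      have h2 : HasFDerivAt (fun z : Fin n → ℂ => (z, star w))
          (ContinuousLinearMap.inl ℂ (Fin n → ℂ) (Fin n → ℂ)) w :=
        (hasFDerivAt_id w).prodMk (hasFDerivAt_const _ _)
      exact HasFDerivAt.comp (g := R) w hRd h2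
    have h3 : HasFDerivAt (fun z => R (z, star w)) (0 : (Fin n → ℂ) →L[ℂ] ℂ) w := by
      have hb : (fun z => R (z, star w)) =O[𝓝 w] fun z => ‖z - w‖ ^ 2 :=
        Asymptotics.IsBigO.of_bound C (hC.mono fun z hz => by simpa using hz)
      exact hb.hasFDerivAt (by norm_num)
    intro a
    have := congrArg (fun T : (Fin n → ℂ) →L[ℂ] ℂ => T a) (h1.unique h3)
    simpa using this
  -- the real derivative of `z ↦ R(z, z̄)`
  set T : (Fin n → ℂ) →L[ℝ] ℂ := (L.restrictScalars ℝ).comp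
    ((ContinuousLinearMap.id ℝ (Fin n → ℂ)).prod
      ((starL' ℝ : (Fin n → ℂ) ≃L[ℝ] (Fin n → ℂ)) : (Fin n → ℂ) →L[ℝ] (Fin n → ℂ)))
  have hT : HasFDerivAt (fun z => R (z, star z)) T w := by
    have h2 : HasFDerivAt (𝕜 := ℝ) (fun z : Fin n → ℂ => (z, star z))
        ((ContinuousLinearMap.id ℝ (Fin n → ℂ)).prod
          ((starL' ℝ : (Fin n → ℂ) ≃L[ℝ] (Fin n → ℂ)) : (Fin n → ℂ) →L[ℝ] (Fin n → ℂ))) w :=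
      ((ContinuousLinearMap.id ℝ (Fin n → ℂ)).prod
          ((starL' ℝ : (Fin n → ℂ) ≃L[ℝ] (Fin n → ℂ)) : (Fin n → ℂ) →L[ℝ] (Fin n → ℂ))).hasFDerivAt
    exact HasFDerivAt.comp (g := R) w (hRd.restrictScalars ℝ) h2
  have hT' : HasFDerivAt (fun z => (ρ z : ℂ)) T w := hT.congr_of_eventuallyEq
    (hR.2.mono fun z hz => hz.symm)
  have hre : HasFDerivAt ρ (Complex.reCLM.comp T) w := by
    have := (Complex.reCLM.hasFDerivAt (x := (ρ w : ℂ))).comp w hT'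
    simpa [Function.comp_def] using this
  have him : ∀ a, (T a).im = 0 := by
    have h1 : HasFDerivAt (fun _ : Fin n → ℂ => (0 : ℝ)) (Complex.imCLM.comp T) w := by
      have := (Complex.imCLM.hasFDerivAt (x := (ρ w : ℂ))).comp w hT'
      simpa [Function.comp_def] using this
    intro a
    have := congrArg (fun S : (Fin n → ℂ) →L[ℝ] ℝ => S a) (h1.unique (hasFDerivAt_const 0 w))
    simpa using this
  have hTa : ∀ a, T a = L (0, star a) := by
    intro a
    have : ((a, star a) : (Fin n → ℂ) × (Fin n → ℂ)) = (a, 0) + (0, star a) := by simp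
    change L (a, star a) = _
    rw [this, map_add, hL1, zero_add]
  rw [hre.fderiv]
  ext a
  have h1 : T (Complex.I • a) = -Complex.I * T a := by
    rw [hTa, hTa, star_smul, Complex.star_def, Complex.conj_I, ← smul_eq_mul, ← map_smul]
    simp
  have h2 := him (Complex.I • a)
  rw [h1] at h2
  simpa using h2

/-- A point on two different algebraic leaves of `H` is a singular point of `H`. -/
theorem mem_singularSet_of_leaves {H : Set (CP n)} (hn : 0 < n)
    (hdim : dimension ℝ H = ((2 * n - 1 : ℕ) : ℕ∞))
    {A B : MvPolynomial (Fin (n + 1)) ℂ} {d e : ℕ} (hA : A.IsHomogeneous d)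
    (hB : B.IsHomogeneous e) (hd : 0 < d) (he : 0 < e) (hAi : Irreducible A) (hBi : Irreducible B)
    (hAB : ¬ A ∣ B) (hAH : ∀ Z, MvPolynomial.eval Z A = 0 → Z ∈ cone H)
    (hBH : ∀ Z, MvPolynomial.eval Z B = 0 → Z ∈ cone H) {z : Fin (n + 1) → ℂ} (hz : z ≠ 0)
    (hzA : MvPolynomial.eval z A = 0) (hzB : MvPolynomial.eval z B = 0) :
    Projectivization.mk ℂ z hz ∈ singularSet H := by
  refine ⟨(mem_cone_iff hz).1 (hAH z hzA), fun i w hw => ?_⟩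
  obtain ⟨c, hc⟩ := mk_eq_chart_iff.1 hw
  rintro ⟨k, hk⟩
  rcases Nat.eq_zero_or_pos k with rfl | hk0
  · have h1 : ContainsSubmanifold ℝ (chart i ⁻¹' H) (2 * n) :=
      ⟨0, by rw [finrank_real_pi_complex, zero_add], _, subset_rfl, w, hk⟩
    have h2 := le_dimension h1
    rw [hdim] at h2
    have h3 : 2 * n ≤ 2 * n - 1 := by exact_mod_cast h2
    omega
  · obtain ⟨-, g, hg, hsurj, hXg⟩ := hk
    set ρ : (Fin n → ℂ) → ℝ := fun z => g z ⟨0, hk0⟩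
    have hρ : AnalyticAt ℝ ρ w := (analyticAt_pi_iff.1 hg) _
    have hρd : fderiv ℝ ρ w ≠ 0 := by
      obtain ⟨a, ha⟩ := hsurj (Pi.single ⟨0, hk0⟩ 1)
      intro h0
      have h1 : fderiv ℝ ρ w = (ContinuousLinearMap.proj (R := ℝ) (φ := fun _ : Fin k => ℝ)
          ⟨0, hk0⟩).comp (fderiv ℝ g w) :=
        ((ContinuousLinearMap.proj (R := ℝ) (φ := fun _ : Fin k => ℝ)
          ⟨0, hk0⟩).hasFDerivAt.comp w hg.differentiableAt.hasFDerivAt).fderiv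
      have h2 := congrArg (fun S : (Fin n → ℂ) →L[ℝ] ℝ => S a) (h1.symm.trans h0)
      simp [ha] at h2
    obtain ⟨R, hR⟩ := exists_isComplexification hρ
    have hvan : ∀ᶠ z in 𝓝 w, chart i z ∈ H → R (z, star z) = 0 := by
      filter_upwards [hXg, hR.2] with Z h1 h2 h3
      rw [h2]
      have := congrFun (h1.1 h3) ⟨0, hk0⟩
      simpa [ρ] using this
    obtain ⟨C, hC⟩ := norm_le_of_vanishing_on_hypersurfaces_chart (k := 1) (A := ![A, B])
      (d := ![d, e]) (i := i) (w := w) (R := R)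
      (Fin.forall_fin_two.2 ⟨hA, hB⟩) (Fin.forall_fin_two.2 ⟨hd, he⟩)
      (Fin.forall_fin_two.2 ⟨hAi, hBi⟩)
      (Fin.forall_fin_two.2 ⟨Fin.forall_fin_two.2 ⟨fun h => absurd rfl h, fun _ => hAB⟩,
        Fin.forall_fin_two.2 ⟨fun _ h => hAB (hBi.dvd_symm hAi h), fun h => absurd rfl h⟩⟩)
      (Fin.forall_fin_two.2 ⟨eval_eq_zero_of_smul_eq hA hzA hc, eval_eq_zero_of_smul_eq hB hzB hc⟩)
      hR.1
      (Fin.forall_fin_two.2 ⟨hvan.mono fun Z h1 h2 => h1 (chart_mem_iff.2 (hAH _ h2)),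
        hvan.mono fun Z h1 h2 => h1 (chart_mem_iff.2 (hBH _ h2))⟩)
    exact hρd (fderiv_eq_zero_of_isComplexification hR hC)

end Leaves

/-! ### Directional derivatives of polynomials -/

section DirDeriv

variable {𝕜 : Type*} [Field 𝕜] {σ : Type*}

theorem dirDeriv_add (u v : σ → 𝕜) (p : MvPolynomial σ 𝕜) :
    dirDeriv (u + v) p = dirDeriv u p + dirDeriv v p := by
  have : dirDeriv (u + v) = dirDeriv u + dirDeriv v :=
    MvPolynomial.derivation_ext fun i => by simp
  rw [this, Derivation.add_apply]

theorem dirDeriv_smul (c : 𝕜) (v : σ → 𝕜) (p : MvPolynomial σ 𝕜) :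
    dirDeriv (c • v) p = c • dirDeriv v p := by
  have : dirDeriv (c • v) = c • dirDeriv v :=
    MvPolynomial.derivation_ext fun i => by simp [MvPolynomial.smul_eq_C_mul]
  rw [this, Derivation.smul_apply]

theorem dirDeriv_comm (u v : σ → 𝕜) (p : MvPolynomial σ 𝕜) :
    dirDeriv u (dirDeriv v p) = dirDeriv v (dirDeriv u p) := by
  have : ⁅dirDeriv u, dirDeriv v⁆ = (0 : Derivation 𝕜 (MvPolynomial σ 𝕜) (MvPolynomial σ 𝕜)) :=
    MvPolynomial.derivation_ext fun i => by simp [Derivation.commutator_apply]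
  have h := congrArg (fun D : Derivation 𝕜 (MvPolynomial σ 𝕜) (MvPolynomial σ 𝕜) => D p) this
  simpa [Derivation.commutator_apply, sub_eq_zero] using h

/-- The chain rule for a polynomial along a curve. -/
theorem hasDerivAt_eval_curve {𝕜 σ : Type*} [NontriviallyNormedField 𝕜] [NormedAlgebra 𝕜 ℂ]
    {c : 𝕜 → σ → ℂ} {c' : σ → ℂ} {t : 𝕜} (hc : ∀ i, HasDerivAt (fun t => c t i) (c' i) t)
    (p : MvPolynomial σ ℂ) :
    HasDerivAt (fun t => MvPolynomial.eval (c t) p)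
      (MvPolynomial.eval (c t) (dirDeriv c' p)) t := by
  induction p using MvPolynomial.induction_on with
  | C a => simpa using hasDerivAt_const t a
  | add p q hp hq =>
    simp only [map_add]
    exact hp.add hq
  | mul_X p i hp =>
    have := hp.mul (hc i)
    simp only [map_mul, MvPolynomial.eval_X, Derivation.leibniz, dirDeriv_X, smul_eq_mul, map_add,
      MvPolynomial.eval_C]
    refine this.congr_deriv ?_
    ring

end DirDeriv

/-! ### Real-valued polynomials in `z` and `z̄` -/

section Polar

variable {n : ℕ}

/-- The value `R(z, ζ)` of a polynomial in two sets of `n` variables. -/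
def polarEval (R : MvPolynomial (Fin n ⊕ Fin n) ℂ) (z ζ : Fin n → ℂ) : ℂ :=
  MvPolynomial.eval (Sum.elim z ζ) R

/-- The derivative of `R(z, ζ)` in the direction `a` of `z` and the direction `b` of `ζ`. -/
def polarDeriv (a b : Fin n → ℂ) (R : MvPolynomial (Fin n ⊕ Fin n) ℂ) :
    MvPolynomial (Fin n ⊕ Fin n) ℂ :=
  dirDeriv (Sum.elim a b) R

@[simp]
theorem polarEval_add (R S : MvPolynomial (Fin n ⊕ Fin n) ℂ) (z ζ : Fin n → ℂ) :
    polarEval (R + S) z ζ = polarEval R z ζ + polarEval S z ζ := map_add _ _ _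

@[simp]
theorem polarEval_sub (R S : MvPolynomial (Fin n ⊕ Fin n) ℂ) (z ζ : Fin n → ℂ) :
    polarEval (R - S) z ζ = polarEval R z ζ - polarEval S z ζ := map_sub _ _ _

@[simp]
theorem polarEval_mul (R S : MvPolynomial (Fin n ⊕ Fin n) ℂ) (z ζ : Fin n → ℂ) :
    polarEval (R * S) z ζ = polarEval R z ζ * polarEval S z ζ := map_mul _ _ _

@[simp]
theorem polarEval_smul (c : ℂ) (R : MvPolynomial (Fin n ⊕ Fin n) ℂ) (z ζ : Fin n → ℂ) :
    polarEval (c • R) z ζ = c * polarEval R z ζ := by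
  simp [polarEval]

theorem polarDeriv_eq (a b : Fin n → ℂ) (R : MvPolynomial (Fin n ⊕ Fin n) ℂ) :
    polarDeriv a b R = polarDeriv a 0 R + polarDeriv 0 b R := by
  have h : (Sum.elim a b : Fin n ⊕ Fin n → ℂ) =
      Sum.elim a (0 : Fin n → ℂ) + Sum.elim (0 : Fin n → ℂ) b := by
    funext i
    cases i <;> simp
  rw [polarDeriv, h, dirDeriv_add]
  rfl

theorem polarDeriv_add (a b c d : Fin n → ℂ) (R : MvPolynomial (Fin n ⊕ Fin n) ℂ) :
    polarDeriv (a + b) (c + d) R = polarDeriv a c R + polarDeriv b d R := by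
  have h : Sum.elim (a + b) (c + d) = Sum.elim a c + Sum.elim b d := by
    funext i
    cases i <;> simp
  rw [polarDeriv, h, dirDeriv_add]
  rfl

theorem polarDeriv_smul (c : ℂ) (a b : Fin n → ℂ) (R : MvPolynomial (Fin n ⊕ Fin n) ℂ) :
    polarDeriv (c • a) (c • b) R = c • polarDeriv a b R := by
  have h : Sum.elim (c • a) (c • b) = c • Sum.elim a b := by
    funext i
    cases i <;> simp
  rw [polarDeriv, h, dirDeriv_smul]
  rfl

theorem polarDeriv_smul_left (c : ℂ) (a : Fin n → ℂ) (R : MvPolynomial (Fin n ⊕ Fin n) ℂ) :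
    polarDeriv (c • a) 0 R = c • polarDeriv a 0 R := by
  rw [← polarDeriv_smul, smul_zero]

theorem polarDeriv_smul_right (c : ℂ) (b : Fin n → ℂ) (R : MvPolynomial (Fin n ⊕ Fin n) ℂ) :
    polarDeriv 0 (c • b) R = c • polarDeriv 0 b R := by
  rw [← polarDeriv_smul, smul_zero]

theorem polarDeriv_add_left (a b : Fin n → ℂ) (R : MvPolynomial (Fin n ⊕ Fin n) ℂ) :
    polarDeriv (a + b) 0 R = polarDeriv a 0 R + polarDeriv b 0 R := by
  rw [← polarDeriv_add, add_zero]

theorem polarDeriv_add_right (a b : Fin n → ℂ) (R : MvPolynomial (Fin n ⊕ Fin n) ℂ) :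
    polarDeriv 0 (a + b) R = polarDeriv 0 a R + polarDeriv 0 b R := by
  rw [← polarDeriv_add, add_zero]

theorem polarDeriv_map_add (a b : Fin n → ℂ) (R S : MvPolynomial (Fin n ⊕ Fin n) ℂ) :
    polarDeriv a b (R + S) = polarDeriv a b R + polarDeriv a b S := map_add _ _ _

theorem polarDeriv_map_smul (a b : Fin n → ℂ) (c : ℂ) (S : MvPolynomial (Fin n ⊕ Fin n) ℂ) :
    polarDeriv a b (c • S) = c • polarDeriv a b S :=
  (dirDeriv _).map_smul _ _

theorem polarDeriv_mul (a b : Fin n → ℂ) (R S : MvPolynomial (Fin n ⊕ Fin n) ℂ) :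
    polarDeriv a b (R * S) = R * polarDeriv a b S + S * polarDeriv a b R :=
  Derivation.leibniz _ _ _

theorem polarDeriv_comm (a b c d : Fin n → ℂ) (R : MvPolynomial (Fin n ⊕ Fin n) ℂ) :
    polarDeriv a b (polarDeriv c d R) = polarDeriv c d (polarDeriv a b R) :=
  dirDeriv_comm _ _ _

/-- The chain rule for `R(z(t), ζ(t))`. -/
theorem hasDerivAt_polarEval {𝕜 : Type*} [NontriviallyNormedField 𝕜] [NormedAlgebra 𝕜 ℂ]
    {z ζ : 𝕜 → Fin n → ℂ} {z' ζ' : Fin n → ℂ} {t : 𝕜}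
    (hz : ∀ i, HasDerivAt (fun t => z t i) (z' i) t)
    (hζ : ∀ i, HasDerivAt (fun t => ζ t i) (ζ' i) t) (R : MvPolynomial (Fin n ⊕ Fin n) ℂ) :
    HasDerivAt (fun t => polarEval R (z t) (ζ t)) (polarEval (polarDeriv z' ζ' R) (z t) (ζ t)) t :=
  hasDerivAt_eval_curve (c := fun t => Sum.elim (z t) (ζ t)) (c' := Sum.elim z' ζ')
    (fun i => by
      cases i with
      | inl i => exact hz i
      | inr i => exact hζ i) R

theorem analyticAt_polarEval {𝕜 E : Type*} [NontriviallyNormedField 𝕜] [NormedAlgebra 𝕜 ℂ]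
    [NormedAddCommGroup E] [NormedSpace 𝕜 E] {z ζ : E → Fin n → ℂ} {e : E}
    (hz : ∀ i, AnalyticAt 𝕜 (fun e => z e i) e) (hζ : ∀ i, AnalyticAt 𝕜 (fun e => ζ e i) e)
    (R : MvPolynomial (Fin n ⊕ Fin n) ℂ) :
    AnalyticAt 𝕜 (fun e => polarEval R (z e) (ζ e)) e := by
  induction R using MvPolynomial.induction_on with
  | C a => simpa [polarEval] using analyticAt_const
  | add p q hp hq =>
    simp only [polarEval_add]
    exact hp.add hq
  | mul_X p i hp =>
    simp only [polarEval_mul]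
    refine hp.mul ?_
    cases i with
    | inl i => simpa [polarEval] using hz i
    | inr i => simpa [polarEval] using hζ i

theorem continuous_polarEval (R : MvPolynomial (Fin n ⊕ Fin n) ℂ) :
    Continuous fun p : (Fin n → ℂ) × (Fin n → ℂ) => polarEval R p.1 p.2 := by
  have h : Continuous fun p : (Fin n → ℂ) × (Fin n → ℂ) => Sum.elim p.1 p.2 :=
    continuous_pi fun i => by
      cases i with
      | inl i => exact (continuous_apply i).comp continuous_fst
      | inr i => exact (continuous_apply i).comp continuous_snd
  exact R.continuous_eval.comp h

/-- A polynomial in `z` and `ζ` is determined by its values at `ζ = z̄`, for `z` in an open set. -/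
theorem eq_zero_of_polarEval_star {w : Fin n → ℂ} {R : MvPolynomial (Fin n ⊕ Fin n) ℂ}
    (h : ∀ᶠ z in 𝓝 w, polarEval R z (star z) = 0) : R = 0 := by
  obtain ⟨r, hr, hball⟩ := Metric.eventually_nhds_iff_ball.1 h
  have hfst : ∀ (p : (Fin n → ℂ) × (Fin n → ℂ)) i,
      AnalyticAt ℂ (fun p : (Fin n → ℂ) × (Fin n → ℂ) => p.1 i) p := fun p i =>
    ((ContinuousLinearMap.proj (R := ℂ) (φ := fun _ : Fin n => ℂ) i).analyticAt _).comp_of_eq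
      analyticAt_fst rfl
  have hsnd : ∀ (p : (Fin n → ℂ) × (Fin n → ℂ)) i,
      AnalyticAt ℂ (fun p : (Fin n → ℂ) × (Fin n → ℂ) => p.2 i) p := fun p i =>
    ((ContinuousLinearMap.proj (R := ℂ) (φ := fun _ : Fin n => ℂ) i).analyticAt _).comp_of_eq
      analyticAt_snd rfl
  have hpol := polarization (D := Metric.ball w r) Metric.isOpen_ball (convex_ball _ _)
    (g := fun z : Fin n → ℂ => z) differentiableOn_id (Q := fun p => polarEval R p.1 p.2)
    (fun a _ b _ => (analyticAt_polarEval (hfst _) (hsnd _) R).differentiableAt) hball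
  refine mvPolynomial_eq_zero_of_eventually (w := Sum.elim w (star w)) ?_
  have h1 : Tendsto (fun x : Fin n ⊕ Fin n → ℂ => x ∘ Sum.inl) (𝓝 (Sum.elim w (star w))) (𝓝 w) := by
    have : Continuous fun x : Fin n ⊕ Fin n → ℂ => x ∘ Sum.inl := by fun_prop
    simpa using this.tendsto (Sum.elim w (star w))
  have h2 : Tendsto (fun x : Fin n ⊕ Fin n → ℂ => star (x ∘ Sum.inr)) (𝓝 (Sum.elim w (star w)))
      (𝓝 w) := by
    have : Continuous fun x : Fin n ⊕ Fin n → ℂ => star (x ∘ Sum.inr) := by fun_prop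
    simpa using this.tendsto (Sum.elim w (star w))
  filter_upwards [h1.eventually (Metric.ball_mem_nhds w hr),
    h2.eventually (Metric.ball_mem_nhds w hr)] with x hx1 hx2
  have := hpol _ hx1 _ hx2
  rw [star_star] at this
  simpa [polarEval] using this

/-- The polynomial `R` is real-valued at `ζ = z̄`. -/
def IsRealPolar (R : MvPolynomial (Fin n ⊕ Fin n) ℂ) : Prop :=
  ∀ z : Fin n → ℂ, (polarEval R z (star z)).im = 0

theorem hasDerivAt_polarEval_line (R : MvPolynomial (Fin n ⊕ Fin n) ℂ) (z a : Fin n → ℂ) (x : ℝ) :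
    HasDerivAt (fun x : ℝ => polarEval R (z + (x : ℂ) • a) (star (z + (x : ℂ) • a)))
      (polarEval (polarDeriv a (star a) R) (z + (x : ℂ) • a) (star (z + (x : ℂ) • a))) x := by
  refine hasDerivAt_polarEval (fun i => ?_) (fun i => ?_) R
  · have h : HasDerivAt (fun x : ℝ => (x : ℂ)) 1 x := Complex.ofRealCLM.hasDerivAt
    simpa using (h.mul_const (a i)).const_add (z i)
  · have h : HasDerivAt (fun x : ℝ => (x : ℂ)) 1 x := Complex.ofRealCLM.hasDerivAt
    simpa using (h.mul_const (star (a i))).const_add (star (z i))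

theorem IsRealPolar.polarDeriv {R : MvPolynomial (Fin n ⊕ Fin n) ℂ} (hR : IsRealPolar R)
    (a : Fin n → ℂ) : IsRealPolar (polarDeriv a (star a) R) := by
  intro z
  have h1 := hasDerivAt_polarEval_line R z a 0
  have h2 := Complex.imCLM.hasFDerivAt.comp_hasDerivAt (0 : ℝ) h1
  have h3 : (fun x : ℝ => (polarEval R (z + (x : ℂ) • a) (star (z + (x : ℂ) • a))).im) =
      fun _ => 0 := funext fun x => hR _
  have h4 : HasDerivAt (fun x : ℝ => (polarEval R (z + (x : ℂ) • a) (star (z + (x : ℂ) • a))).im)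
      (polarEval (LeviFlatProj.polarDeriv a (star a) R) (z + ((0 : ℝ) : ℂ) • a)
        (star (z + ((0 : ℝ) : ℂ) • a))).im 0 := h2
  rw [h3] at h4
  simpa using h4.unique (hasDerivAt_const _ _)

/-- The symmetry `conj R(z, ζ) = R(ζ̄, z̄)` of the polarization of a real-valued polynomial. It holds
on the diagonal `ζ = z̄`, which determines both sides. -/
theorem IsRealPolar.star_polarEval {R : MvPolynomial (Fin n ⊕ Fin n) ℂ} (hR : IsRealPolar R)
    (z ζ : Fin n → ℂ) : star (polarEval R z ζ) = polarEval R (star ζ) (star z) := by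
  set S := MvPolynomial.rename Sum.swap (MvPolynomial.map (starRingEnd ℂ) R)
  have hS : ∀ z ζ, polarEval S z ζ = star (polarEval R (star ζ) (star z)) := by
    intro z ζ
    simp only [S, polarEval, MvPolynomial.eval_rename, MvPolynomial.eval_map]
    have h1 : Sum.elim z ζ ∘ Sum.swap = fun i => starRingEnd ℂ (Sum.elim (star ζ) (star z) i) := by
      funext i
      cases i <;> simp
    rw [h1]
    have h2 : (MvPolynomial.eval₂Hom (starRingEnd ℂ)
        fun i => starRingEnd ℂ (Sum.elim (star ζ) (star z) i)) =
        (starRingEnd ℂ).comp (MvPolynomial.eval (Sum.elim (star ζ) (star z))) :=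
      MvPolynomial.ringHom_ext (fun c => by simp) (fun i => by simp)
    exact congrArg (fun f => f R) h2
  have h0 : S - R = 0 := by
    refine eq_zero_of_polarEval_star (w := 0) (Eventually.of_forall fun z => ?_)
    rw [polarEval_sub, hS, star_star, sub_eq_zero]
    exact Complex.conj_eq_iff_im.2 (hR z)
  have := hS (star ζ) (star z)
  rw [star_star, star_star, sub_eq_zero.1 h0] at this
  exact this.symm

theorem IsRealPolar.polarDeriv_right {R : MvPolynomial (Fin n ⊕ Fin n) ℂ} (hR : IsRealPolar R)
    (a z : Fin n → ℂ) : polarEval (LeviFlatProj.polarDeriv 0 (star a) R) z (star z) =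
      star (polarEval (LeviFlatProj.polarDeriv a 0 R) z (star z)) := by
  have h1 := hR.polarDeriv a z
  have h2 := hR.polarDeriv (Complex.I • a) z
  rw [polarDeriv_eq, polarEval_add] at h1
  rw [polarDeriv_eq, star_smul, polarDeriv_smul_left, polarDeriv_smul_right, polarEval_add,
    polarEval_smul, polarEval_smul] at h2
  simp only [Complex.star_def, Complex.conj_I, Complex.add_im, Complex.mul_im, Complex.I_re,
    Complex.I_im, Complex.neg_re, Complex.neg_im, zero_mul, one_mul, zero_add, neg_zero] at h1 h2
  apply Complex.ext
  · simp only [Complex.star_def, Complex.conj_re]; linarith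
  · simp only [Complex.star_def, Complex.conj_im]; linarith

/-- The real function `R(z, z̄)`. -/
def polarFun (R : MvPolynomial (Fin n ⊕ Fin n) ℂ) (z : Fin n → ℂ) : ℝ :=
  (polarEval R z (star z)).re

theorem analyticAt_polarFun (R : MvPolynomial (Fin n ⊕ Fin n) ℂ) (z : Fin n → ℂ) :
    AnalyticAt ℝ (polarFun R) z := by
  have h1 : ∀ i, AnalyticAt ℝ (fun z : Fin n → ℂ => z i) z := fun i =>
    (ContinuousLinearMap.proj (R := ℝ) (φ := fun _ : Fin n => ℂ) i).analyticAt z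
  have h2 : ∀ i, AnalyticAt ℝ (fun z : Fin n → ℂ => star z i) z := fun i =>
    ((starL' ℝ : ℂ ≃L[ℝ] ℂ) : ℂ →L[ℝ] ℂ).analyticAt (z i) |>.comp_of_eq (h1 i) rfl
  exact (Complex.reCLM.analyticAt _).comp_of_eq (analyticAt_polarEval h1 h2 R) rfl

theorem fderiv_polarFun (R : MvPolynomial (Fin n ⊕ Fin n) ℂ) (z a : Fin n → ℂ) :
    fderiv ℝ (polarFun R) z a = polarFun (polarDeriv a (star a) R) z := by
  have h1 : HasDerivAt (fun x : ℝ => z + (x : ℂ) • a) a 0 := by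
    have h : HasDerivAt (fun x : ℝ => (x : ℂ)) 1 0 := Complex.ofRealCLM.hasDerivAt
    simpa using (h.smul_const a).const_add z
  have hd : HasFDerivAt (polarFun R) (fderiv ℝ (polarFun R) z) (z + ((0 : ℝ) : ℂ) • a) := by
    simpa using (analyticAt_polarFun R z).differentiableAt.hasFDerivAt
  have h2 := hd.comp_hasDerivAt (0 : ℝ) h1
  have h3 := Complex.reCLM.hasFDerivAt.comp_hasDerivAt (0 : ℝ) (hasDerivAt_polarEval_line R z a 0)
  have h4 := h2.unique h3
  rw [h4]
  simp [polarFun]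

theorem fderiv_fderiv_polarFun (R : MvPolynomial (Fin n ⊕ Fin n) ℂ) (z a b : Fin n → ℂ) :
    fderiv ℝ (fderiv ℝ (polarFun R)) z a b =
      polarFun (polarDeriv a (star a) (polarDeriv b (star b) R)) z := by
  have hd : DifferentiableAt ℝ (fderiv ℝ (polarFun R)) z :=
    (analyticAt_polarFun R z).fderiv.differentiableAt
  have h1 : fderiv ℝ (fun z => fderiv ℝ (polarFun R) z b) z a =
      fderiv ℝ (fderiv ℝ (polarFun R)) z a b := by
    rw [fderiv_clm_apply hd (differentiableAt_const b)]
    simp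
  rw [← h1]
  have h2 : (fun z => fderiv ℝ (polarFun R) z b) = polarFun (polarDeriv b (star b) R) :=
    funext fun z => fderiv_polarFun R z b
  rw [h2, fderiv_polarFun]

/-- The Levi form of the real function `R(z, z̄)` is the mixed derivative of `R(z, ζ)`. -/
theorem leviForm_polarFun {R : MvPolynomial (Fin n ⊕ Fin n) ℂ} (hR : IsRealPolar R)
    (p a : Fin n → ℂ) : (leviForm (polarFun R) p a : ℂ) =
      polarEval (polarDeriv a 0 (polarDeriv 0 (star a) R)) p (star p) := by
  have hsq : polarDeriv a (star a) (polarDeriv a (star a) R) +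
      polarDeriv (Complex.I • a) (star (Complex.I • a))
        (polarDeriv (Complex.I • a) (star (Complex.I • a)) R) =
      (4 : ℂ) • polarDeriv a 0 (polarDeriv 0 (star a) R) := by
    have hI : star (Complex.I • a) = (-Complex.I) • star a := by
      rw [star_smul, Complex.star_def, Complex.conj_I]
    rw [hI]
    simp only [polarDeriv_eq a (star a), polarDeriv_eq (Complex.I • a) (-Complex.I • star a),
      polarDeriv_smul_left, polarDeriv_smul_right, polarDeriv_map_add, polarDeriv_map_smul,
      smul_smul]
    rw [polarDeriv_comm 0 (star a) a 0]
    simp only [Complex.I_mul_I, neg_mul, mul_neg, neg_neg, neg_smul, one_smul]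
    module
  have hreal : ∀ S : MvPolynomial (Fin n ⊕ Fin n) ℂ, IsRealPolar S →
      (polarFun S p : ℂ) = polarEval S p (star p) := fun S hS =>
    Complex.ext (by simp [polarFun]) (by simpa [polarFun] using (hS p).symm)
  rw [leviForm, fderiv_fderiv_polarFun, fderiv_fderiv_polarFun]
  push_cast
  rw [hreal _ ((hR.polarDeriv _).polarDeriv _), hreal _ ((hR.polarDeriv _).polarDeriv _),
    ← polarEval_add, hsq, polarEval_smul]
  ring

end Polar

/-! ### A regular point of a real-algebraic hypersurface -/

/-- Iterated Rolle theorem, for a sequence of functions each of which is the derivative of the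
preceding one. -/
theorem exists_zero_of_zeros (u : ℕ → ℝ → ℝ) (hu : ∀ j x, HasDerivAt (u j) (u (j + 1) x) x) (k : ℕ)
    {x₀ x₁ : ℝ} (hne : x₀ ≠ x₁) (h0 : u 0 x₀ = 0) (h1 : ∀ j < k, u j x₁ = 0) :
    ∃ c ∈ Set.uIcc x₀ x₁, u k c = 0 := by
  induction k generalizing u x₀ with
  | zero => exact ⟨x₀, Set.left_mem_uIcc, h0⟩
  | succ k ih =>
    have hc : ∀ s, ContinuousOn (u 0) s := fun s x _ => (hu 0 x).continuousAt.continuousWithinAt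
    have h1' : u 0 x₁ = 0 := h1 0 (Nat.succ_pos k)
    obtain ⟨c, hcmem, hcne, hc0⟩ : ∃ c ∈ Set.uIcc x₀ x₁, c ≠ x₁ ∧ u 1 c = 0 := by
      rcases lt_or_gt_of_ne hne with h | h
      · obtain ⟨c, hc1, hc2⟩ := exists_hasDerivAt_eq_zero h (hc _) (h0.trans h1'.symm)
          fun x _ => hu 0 x
        exact ⟨c, Set.Icc_subset_uIcc (Set.Ioo_subset_Icc_self hc1), hc1.2.ne, hc2⟩
      · obtain ⟨c, hc1, hc2⟩ := exists_hasDerivAt_eq_zero h (hc _) (h1'.trans h0.symm)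
          fun x _ => hu 0 x
        exact ⟨c, Set.Icc_subset_uIcc' (Set.Ioo_subset_Icc_self hc1), hc1.1.ne', hc2⟩
    obtain ⟨c', hc', h⟩ := ih (fun j => u (j + 1)) (fun j x => hu (j + 1) x) hcne hc0
      fun j hj => h1 (j + 1) (by omega)
    exact ⟨c', Set.uIcc_subset_uIcc_right hcmem hc', h⟩

section Regular

variable {n : ℕ}

/-- A real hypersurface `h = 0` meets the real lines in a transversal direction `v`. -/
theorem exists_line_hits {h : (Fin n → ℂ) → ℝ} {m v : Fin n → ℂ} (hh : AnalyticAt ℝ h m)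
    (h0 : h m = 0) (hv : fderiv ℝ h m v ≠ 0) :
    ∃ φ : (Fin n → ℂ) → ℝ, AnalyticAt ℝ φ m ∧ φ m = 0 ∧
      ∀ᶠ z in 𝓝 m, h (z + (φ z : ℂ) • v) = 0 := by
  have hlin : AnalyticAt ℝ (fun p : (Fin n → ℂ) × ℝ => p.1 + (p.2 : ℂ) • v) (m, 0) :=
    analyticAt_fst.add
      ((((Complex.ofRealCLM.smulRight v).analyticAt _).comp_of_eq analyticAt_snd rfl).congr
        (Eventually.of_forall fun p => by simp))
  have hder : HasDerivAt (fun x : ℝ => h (m + (x : ℂ) • v)) (fderiv ℝ h m v) 0 := by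
    have h1 : HasDerivAt (fun x : ℝ => m + (x : ℂ) • v) v 0 := by
      have h : HasDerivAt (fun x : ℝ => (x : ℂ)) 1 0 := Complex.ofRealCLM.hasDerivAt
      simpa using (h.smul_const v).const_add m
    have hd : HasFDerivAt h (fderiv ℝ h m) (m + ((0 : ℝ) : ℂ) • v) := by
      simpa using hh.differentiableAt.hasFDerivAt
    exact hd.comp_hasDerivAt (0 : ℝ) h1
  obtain ⟨φ, h1, h2, h3, -⟩ := exists_analytic_implicit (𝕜 := ℝ) (𝕜' := ℝ)
    (F := fun p : (Fin n → ℂ) × ℝ => h (p.1 + (p.2 : ℂ) • v)) (e₀ := m) (x₀ := 0)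
    (hh.comp_of_eq hlin (by simp)) (by simpa using h0) hder hv
  exact ⟨φ, h1, h2, h3⟩

/-- A real polynomial in the real and imaginary parts of `z` is a polynomial in `z` and `z̄`. -/
theorem exists_polarEval_eq (f : MvPolynomial (Fin n ⊕ Fin n) ℝ) :
    ∃ R : MvPolynomial (Fin n ⊕ Fin n) ℂ, ∀ z : Fin n → ℂ, polarEval R z (star z) =
      ((MvPolynomial.eval (Sum.elim (fun j => (z j).re) (fun j => (z j).im)) f : ℝ) : ℂ) := by
  set Z : Fin n → MvPolynomial (Fin n ⊕ Fin n) ℂ := fun j => MvPolynomial.X (Sum.inl j)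
  set W : Fin n → MvPolynomial (Fin n ⊕ Fin n) ℂ := fun j => MvPolynomial.X (Sum.inr j)
  have hZ : ∀ (z ζ : Fin n → ℂ) j, polarEval (Z j) z ζ = z j := fun z ζ j => by
    simp [Z, polarEval]
  have hW : ∀ (z ζ : Fin n → ℂ) j, polarEval (W j) z ζ = ζ j := fun z ζ j => by
    simp [W, polarEval]
  refine ⟨MvPolynomial.eval₂ (MvPolynomial.C.comp Complex.ofRealHom)
    (Sum.elim (fun j => (2⁻¹ : ℂ) • (Z j + W j)) fun j => (-(Complex.I / 2)) • (Z j - W j)) f,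
    fun z => ?_⟩
  have hhom : ((MvPolynomial.eval (Sum.elim z (star z))).comp
      (MvPolynomial.eval₂Hom (MvPolynomial.C.comp Complex.ofRealHom)
        (Sum.elim (fun j => (2⁻¹ : ℂ) • (Z j + W j)) fun j => (-(Complex.I / 2)) • (Z j - W j)))) =
      Complex.ofRealHom.comp (MvPolynomial.eval (Sum.elim (fun j => (z j).re)
        (fun j => (z j).im))) := by
    refine MvPolynomial.ringHom_ext (fun c => by simp) fun j => ?_
    cases j with
    | inl j =>
      have : polarEval ((2⁻¹ : ℂ) • (Z j + W j)) z (star z) = ((z j).re : ℂ) := by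
        rw [polarEval_smul, polarEval_add, hZ, hW, Pi.star_apply, Complex.star_def,
          Complex.add_conj]
        push_cast
        ring
      simpa [polarEval] using this
    | inr j =>
      have : polarEval ((-(Complex.I / 2)) • (Z j - W j)) z (star z) = ((z j).im : ℂ) := by
        rw [polarEval_smul, polarEval_sub, hZ, hW, Pi.star_apply, Complex.star_def,
          Complex.sub_conj]
        push_cast
        linear_combination (-((z j).im : ℂ)) * Complex.I_sq
      simpa [polarEval] using this
  exact congrArg (fun g => g f) hhom

/-- Restriction of a polynomial in `z` and `z̄` to an affine chart. -/
theorem exists_polarEval_affineLift (R : MvPolynomial (Fin (n + 1) ⊕ Fin (n + 1)) ℂ)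
    (i : Fin (n + 1)) : ∃ S : MvPolynomial (Fin n ⊕ Fin n) ℂ, ∀ w ζ : Fin n → ℂ,
      polarEval S w ζ = polarEval R (affineLift i w) (affineLift i ζ) := by
  refine ⟨MvPolynomial.aeval (Sum.elim
    (Fin.insertNth (α := fun _ => MvPolynomial (Fin n ⊕ Fin n) ℂ) i 1
      fun l => MvPolynomial.X (Sum.inl l))
    (Fin.insertNth (α := fun _ => MvPolynomial (Fin n ⊕ Fin n) ℂ) i 1
      fun l => MvPolynomial.X (Sum.inr l))) R, fun w ζ => ?_⟩
  have hhom : (MvPolynomial.eval (Sum.elim w ζ)).comp (MvPolynomial.aeval (Sum.elim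
      (Fin.insertNth (α := fun _ => MvPolynomial (Fin n ⊕ Fin n) ℂ) i 1
        fun l => MvPolynomial.X (Sum.inl l))
      (Fin.insertNth (α := fun _ => MvPolynomial (Fin n ⊕ Fin n) ℂ) i 1
        fun l => MvPolynomial.X (Sum.inr l))) :
        MvPolynomial (Fin (n + 1) ⊕ Fin (n + 1)) ℂ →ₐ[ℂ] MvPolynomial (Fin n ⊕ Fin n) ℂ).toRingHom =
      MvPolynomial.eval (Sum.elim (affineLift i w) (affineLift i ζ)) := by
    refine MvPolynomial.ringHom_ext (fun c => by simp) fun j => ?_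
    rcases j with j | j <;> refine Fin.succAboveCases i ?_ (fun l => ?_) j <;> simp
  exact congrArg (fun g => g R) hhom

theorem exists_containsSubmanifold_of_dimension {H : Set (CP n)} (hn : 0 < n)
    (hdim : dimension ℝ H = ((2 * n - 1 : ℕ) : ℕ∞)) :
    ∃ i, ContainsSubmanifold ℝ (chart i ⁻¹' H) (2 * n - 1) := by
  by_contra! hcon
  have h1 : dimension ℝ H ≤ ((2 * n - 2 : ℕ) : ℕ∞) := by
    refine iSup_le fun i => iSup_le fun d => iSup_le fun h => ?_
    have h2 := le_dimension h
    rw [hdim] at h2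
    have h3 : d ≤ 2 * n - 1 := by exact_mod_cast h2
    have h4 : d ≠ 2 * n - 1 := by
      rintro rfl
      exact hcon i h
    have h5 : d ≤ 2 * n - 2 := by omega
    exact_mod_cast h5
  rw [hdim] at h1
  have h2 : 2 * n - 1 ≤ 2 * n - 2 := by exact_mod_cast h1
  omega

theorem derivative_iterate_shift {𝕜 σ : Type*} [Field 𝕜] (v : σ → 𝕜) (A : MvPolynomial σ 𝕜)
    (k : ℕ) : Polynomial.derivative^[k] (shift v A) = shift v ((dirDeriv v)^[k] A) := by
  induction k with
  | zero => rfl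
  | succ k ih => rw [Function.iterate_succ_apply', Function.iterate_succ_apply', ih,
      derivative_shift]

/-- A polynomial all of whose derivatives in the direction `v` vanish at `y` vanishes on the line
through `y` in the direction `v`. -/
theorem eval_line_eq_zero {𝕜 σ : Type*} [Field 𝕜] [CharZero 𝕜] {v y : σ → 𝕜}
    {A : MvPolynomial σ 𝕜} (h : ∀ k, MvPolynomial.eval y ((dirDeriv v)^[k] A) = 0) (x : 𝕜) :
    MvPolynomial.eval (y + x • v) A = 0 := by
  have h0 : (shift v A).map (MvPolynomial.eval y) = 0 := by
    ext k
    have h1 := h k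
    have h2 := eval_map_shift v y 0 ((dirDeriv v)^[k] A)
    rw [zero_smul, add_zero, h1, ← derivative_iterate_shift, ← Polynomial.iterate_derivative_map,
      ← Polynomial.coeff_zero_eq_eval_zero, Polynomial.coeff_iterate_derivative, zero_add,
      Nat.descFactorial_self, nsmul_eq_mul] at h2
    simpa [Nat.factorial_ne_zero] using h2
  rw [← eval_map_shift, h0, Polynomial.eval_zero]

theorem IsRealPolar.polarFun_eq_zero_iff {R : MvPolynomial (Fin n ⊕ Fin n) ℂ} (hR : IsRealPolar R)
    {z : Fin n → ℂ} : polarFun R z = 0 ↔ polarEval R z (star z) = 0 := by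
  rw [polarFun, Complex.ext_iff]
  simp [hR z]

theorem continuous_polarEval_star (R : MvPolynomial (Fin n ⊕ Fin n) ℂ) :
    Continuous fun z : Fin n → ℂ => polarEval R z (star z) := by
  have h : Continuous fun z : Fin n → ℂ => (z, star z) := by fun_prop
  have h2 := Continuous.comp (continuous_polarEval R) h
  simpa only [Function.comp_def] using h2

theorem smul_add_smul_line (z v : Fin n → ℂ) (x : ℝ) {a b : ℝ} (hab : a + b = 1) :
    a • z + b • (z + (x : ℂ) • v) = z + ((a • (0 : ℝ) + b • x : ℝ) : ℂ) • v := by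
  have hab' : (a : ℂ) + b = 1 := by exact_mod_cast hab
  funext j
  simp only [Pi.add_apply, Pi.smul_apply, Complex.real_smul, smul_eq_mul, mul_zero, zero_add,
    Complex.ofReal_mul]
  linear_combination z j * hab'

/-- Near some of its points, an algebraic hypervariety `H` is a smooth real hypersurface, with a
polynomial defining function in an affine chart.

If `f` is an equation of `H` and `k` is the least order for which the `k`-th derivative of `f` in a
transversal direction does not vanish identically on a piece of hypersurface in `H`, then the
`(k - 1)`-st derivative is a defining function with nonzero differential. -/
theorem exists_regular_point {H : Set (CP n)} (hn : 0 < n) (halg : IsAlgebraic H)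
    (hdim : dimension ℝ H = ((2 * n - 1 : ℕ) : ℕ∞)) :
    ∃ (i : Fin (n + 1)) (R : MvPolynomial (Fin n ⊕ Fin n) ℂ) (q v : Fin n → ℂ), IsRealPolar R ∧
      chart i q ∈ H ∧ (∀ᶠ z in 𝓝 q, chart i z ∈ H ↔ polarEval R z (star z) = 0) ∧
      polarEval (polarDeriv v (star v) R) q (star q) ≠ 0 := by
  obtain ⟨i, k₁, hk₁, M, hMX, q₀, hq₀M, g, hg, hgsurj, hMg⟩ :=
    exists_containsSubmanifold_of_dimension hn hdim
  rw [finrank_real_pi_complex] at hk₁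
  obtain rfl : k₁ = 1 := by omega
  -- the equation `h` of a hypersurface piece and a transversal direction `v`
  set h : (Fin n → ℂ) → ℝ := fun z => g z 0
  have hh : AnalyticAt ℝ h q₀ := (analyticAt_pi_iff.1 hg) 0
  have hfd : ∀ a, fderiv ℝ h q₀ a = fderiv ℝ g q₀ a 0 := by
    intro a
    have h1 : fderiv ℝ h q₀ = (ContinuousLinearMap.proj (R := ℝ) (φ := fun _ : Fin 1 => ℝ)
        0).comp (fderiv ℝ g q₀) :=
      ((ContinuousLinearMap.proj (R := ℝ) (φ := fun _ : Fin 1 => ℝ)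
        0).hasFDerivAt.comp q₀ hg.differentiableAt.hasFDerivAt).fderiv
    rw [h1]
    rfl
  obtain ⟨v, hv⟩ := hgsurj fun _ => 1
  have hv : fderiv ℝ h q₀ v ≠ 0 := by
    rw [hfd, hv]
    exact one_ne_zero
  have hMh : ∀ᶠ z in 𝓝 q₀, (z ∈ M ↔ h z = 0) := by
    filter_upwards [hMg] with z hz
    rw [hz]
    constructor
    · intro h0
      simp [h, h0]
    · intro h0
      funext j
      rw [Subsingleton.elim j 0]
      exact h0
  obtain ⟨r, hr, hball⟩ : ∃ r > 0, ∀ z ∈ Metric.ball q₀ r,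
      AnalyticAt ℝ h z ∧ fderiv ℝ h z v ≠ 0 ∧ (z ∈ M ↔ h z = 0) := by
    have h2 : ∀ᶠ z in 𝓝 q₀, fderiv ℝ h z v ≠ 0 := by
      have : ContinuousAt (fun z => fderiv ℝ h z v) q₀ :=
        hh.fderiv.continuousAt.clm_apply continuousAt_const
      exact this.eventually_ne hv
    exact Metric.eventually_nhds_iff_ball.1 (hh.eventually_analyticAt.and (h2.and hMh))
  have hq₀ : q₀ ∈ Metric.ball q₀ r := Metric.mem_ball_self hr
  -- the lines in the direction `v` near a point of the hypersurface piece
  have hline : ∀ m ∈ M ∩ Metric.ball q₀ r, ∃ φ : (Fin n → ℂ) → ℝ, φ m = 0 ∧ ContinuousAt φ m ∧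
      ∀ᶠ z in 𝓝 m, z + (φ z : ℂ) • v ∈ M ∩ Metric.ball q₀ r := by
    rintro m ⟨hmM, hmB⟩
    obtain ⟨hm1, hm2, hm3⟩ := hball m hmB
    obtain ⟨φ, hφ1, hφ2, hφ3⟩ := exists_line_hits hm1 (hm3.1 hmM) hm2
    refine ⟨φ, hφ2, hφ1.continuousAt, ?_⟩
    have hc : ContinuousAt (fun z => z + (φ z : ℂ) • v) m :=
      continuousAt_id.add (((Complex.continuous_ofReal.continuousAt).comp
        hφ1.continuousAt).smul continuousAt_const)
    have hm' : m + (φ m : ℂ) • v ∈ Metric.ball q₀ r := by simpa [hφ2] using hmB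
    filter_upwards [hφ3, hc.eventually (Metric.isOpen_ball.mem_nhds hm')] with z hz1 hz2
    exact ⟨(hball _ hz2).2.2.2 hz1, hz2⟩
  -- some equation of `H` does not vanish identically on this chart, because `dim H < 2n`
  obtain ⟨V, ⟨F, hF⟩, hVc, hHV⟩ := halg
  have hXV : ∀ w, chart i w ∈ H ↔ affineLift i w ∈ V := by
    intro w
    rw [hHV]
    constructor
    · rintro ⟨z, hz, hzV, hzw⟩
      obtain ⟨c, hc⟩ := mk_eq_chart_iff.1 hzw.symm
      rw [← hc]
      exact hVc z hzV c
    · intro hw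
      exact ⟨_, affineLift_ne_zero i w, hw, rfl⟩
  choose P₀ hP₀ using fun f => exists_polarEval_eq (n := n + 1) f
  choose P₁ hP₁ using fun R => exists_polarEval_affineLift (n := n) R i
  set P := fun f => P₁ (P₀ f)
  have hP : ∀ f w, polarEval (P f) w (star w) =
      ((MvPolynomial.eval (Sum.elim (fun j => (affineLift i w j).re)
        (fun j => (affineLift i w j).im)) f : ℝ) : ℂ) := fun f w => by
    rw [hP₁, ← star_affineLift, hP₀]
  have hPreal : ∀ f, IsRealPolar (P f) := fun f z => by rw [hP, Complex.ofReal_im]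
  have hX : ∀ w, chart i w ∈ H ↔ ∀ f ∈ F, polarEval (P f) w (star w) = 0 := by
    intro w
    rw [hXV, hF]
    refine forall₂_congr fun f _ => ?_
    rw [hP, Complex.ofReal_eq_zero]
  obtain ⟨f, hfF, hf0⟩ : ∃ f ∈ F, P f ≠ 0 := by
    by_contra! hcon
    have huniv : chart i ⁻¹' H = Set.univ := by
      ext w
      simp only [Set.mem_preimage, Set.mem_univ, iff_true]
      rw [hX]
      intro f hf
      rw [hcon f hf]
      simp [polarEval]
    have h1 : ContainsSubmanifold ℝ (chart i ⁻¹' H) (2 * n) := by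
      refine ⟨0, by rw [finrank_real_pi_complex, zero_add], Set.univ, by rw [huniv], 0, trivial,
        fun _ => 0, analyticAt_const, fun y => ⟨0, Subsingleton.elim _ _⟩,
        Eventually.of_forall fun z => by simp⟩
    have h2 := le_dimension h1
    rw [hdim] at h2
    have h3 : 2 * n ≤ 2 * n - 1 := by exact_mod_cast h2
    omega
  set R₀ := P f
  set D : MvPolynomial (Fin n ⊕ Fin n) ℂ → MvPolynomial (Fin n ⊕ Fin n) ℂ := polarDeriv v (star v)
  have hDreal : ∀ j, IsRealPolar (D^[j] R₀) := by
    intro j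
    induction j with
    | zero => exact hPreal f
    | succ j ih =>
      rw [Function.iterate_succ_apply']
      exact ih.polarDeriv v
  have hXR : ∀ w, chart i w ∈ H → polarEval R₀ w (star w) = 0 := fun w hw => (hX w).1 hw f hfF
  -- the least order of a derivative that does not vanish on the piece
  have hex : ∃ k, ∃ m ∈ M ∩ Metric.ball q₀ r, polarEval (D^[k] R₀) m (star m) ≠ 0 := by
    by_contra! hcon
    obtain ⟨φ, -, -, hφ⟩ := hline q₀ ⟨hq₀M, hq₀⟩
    refine hf0 (eq_zero_of_polarEval_star (w := q₀) (hφ.mono fun z hz => ?_))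
    have h1 := eval_line_eq_zero (A := R₀)
      (y := Sum.elim (z + (φ z : ℂ) • v) (star (z + (φ z : ℂ) • v))) (v := Sum.elim v (star v))
      (fun k => hcon k _ hz) (-(φ z : ℂ))
    have h2 : (Sum.elim (z + (φ z : ℂ) • v) (star (z + (φ z : ℂ) • v)) +
        (-(φ z : ℂ)) • Sum.elim v (star v) : Fin n ⊕ Fin n → ℂ) = Sum.elim z (star z) := by
      funext j
      cases j <;> simp
    rwa [h2] at h1
  classical
  obtain ⟨k, ⟨m, hm, hmk⟩, hmin⟩ := (⟨Nat.find hex, Nat.find_spec hex, fun j hj =>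
    Nat.find_min hex hj⟩ : ∃ k, (∃ m ∈ M ∩ Metric.ball q₀ r, polarEval (D^[k] R₀) m (star m) ≠ 0) ∧
      ∀ j < k, ¬ ∃ m ∈ M ∩ Metric.ball q₀ r, polarEval (D^[j] R₀) m (star m) ≠ 0)
  have hlt : ∀ j < k, ∀ z ∈ M ∩ Metric.ball q₀ r, polarEval (D^[j] R₀) z (star z) = 0 := by
    intro j hj z hz
    have := hmin j hj
    push Not at this
    exact this z hz
  have hk0 : k ≠ 0 := by
    intro h0
    refine hmk ?_
    rw [h0]
    exact hXR m (hMX hm.1)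
  obtain ⟨k', hk'⟩ := Nat.exists_eq_succ_of_ne_zero hk0
  have hlast : D (D^[k'] R₀) = D^[k] R₀ := by rw [hk', Function.iterate_succ_apply']
  refine ⟨i, D^[k'] R₀, m, v, hDreal k', hMX hm.1, ?_, ?_⟩
  -- on each line in the direction `v` near `m` the `k`-th derivative has no zero, so by Rolle's
  -- theorem the lower derivatives vanish only at the point of the hypersurface piece
  · obtain ⟨φ, hφ0, hφc, hφ⟩ := hline m hm
    have hcont : Continuous fun z : Fin n → ℂ => polarEval (D^[k] R₀) z (star z) :=
      continuous_polarEval_star _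
    obtain ⟨r', hr', hball'⟩ := Metric.eventually_nhds_iff_ball.1
      (hcont.continuousAt.eventually_ne hmk)
    have hc : ContinuousAt (fun z => z + (φ z : ℂ) • v) m :=
      continuousAt_id.add (((Complex.continuous_ofReal.continuousAt).comp hφc).smul
        continuousAt_const)
    have hnear := hc.eventually (Metric.isOpen_ball.mem_nhds (show m + (φ m : ℂ) • v ∈
      Metric.ball m r' by simpa [hφ0] using hr'))
    filter_upwards [hφ, hnear, Metric.ball_mem_nhds m hr',
      Metric.isOpen_ball.mem_nhds hm.2] with z hz1 hz2 hz3 hz4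
    set u : ℕ → ℝ → ℝ := fun j x => polarFun (D^[j] R₀) (z + (x : ℂ) • v)
    have hu : ∀ j x, HasDerivAt (u j) (u (j + 1) x) x := by
      intro j x
      have := Complex.reCLM.hasFDerivAt.comp_hasDerivAt x
        (hasDerivAt_polarEval_line (D^[j] R₀) z v x)
      simp only [u]
      rw [Function.iterate_succ_apply']
      exact this
    have hu1 : ∀ j < k, u j (φ z) = 0 := fun j hj =>
      (hDreal j).polarFun_eq_zero_iff.2 (hlt j hj _ hz1)
    have hseg : ∀ x ∈ Set.uIcc 0 (φ z), u k x ≠ 0 := by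
      intro x hx h0
      refine hball' (z + (x : ℂ) • v) ?_ ((hDreal k).polarFun_eq_zero_iff.1 h0)
      obtain ⟨a, b, ha, hb, hab, rfl⟩ : x ∈ segment ℝ 0 (φ z) := by rwa [segment_eq_uIcc]
      have := (convex_ball m r') hz3 hz2 ha hb hab
      rwa [smul_add_smul_line z v (φ z) hab] at this
    have hzM : φ z = 0 → z ∈ M := fun h0 => by simpa [h0] using hz1.1
    constructor
    · intro hzH
      have h0 : φ z = 0 := by
        by_contra hne
        obtain ⟨c, hc, hc0⟩ := exists_zero_of_zeros u hu k (x₀ := 0) (x₁ := φ z) (Ne.symm hne)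
          ((hDreal 0).polarFun_eq_zero_iff.2 (by simpa using hXR z hzH)) hu1
        exact hseg c hc hc0
      exact hlt k' (by omega) z ⟨hzM h0, hz4⟩
    · intro hz0
      have h0 : φ z = 0 := by
        by_contra hne
        obtain ⟨c, hc, hc0⟩ := exists_zero_of_zeros (fun j => u (j + k')) (fun j x => by
            have := hu (j + k') x
            rwa [add_right_comm] at this) 1 (x₀ := 0) (x₁ := φ z)
          (Ne.symm hne) (by
            simp only [zero_add]
            exact (hDreal k').polarFun_eq_zero_iff.2 (by simpa using hz0))
          (fun j hj => by
            obtain rfl : j = 0 := by omega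
            simp only [zero_add]
            exact hu1 k' (by omega))
        rw [show 1 + k' = k by omega] at hc0
        exact hseg c hc hc0
      exact hMX (hzM h0)
  · change polarEval (D (D^[k'] R₀)) m (star m) ≠ 0
    rw [hlast]
    exact hmk

end Regular

/-! ### The Levi form on the complexification -/

section Levi

variable {n : ℕ}

theorem polarDeriv_left_eq_sum (a : Fin n → ℂ) (R : MvPolynomial (Fin n ⊕ Fin n) ℂ) :
    polarDeriv a 0 R = ∑ j, a j • polarDeriv (Pi.single j 1) 0 R := by
  have h : ∀ s : Finset (Fin n), polarDeriv (∑ j ∈ s, a j • Pi.single j (1 : ℂ)) 0 R =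
      ∑ j ∈ s, a j • polarDeriv (Pi.single j 1) 0 R := by
    intro s
    classical
    induction s using Finset.induction_on with
    | empty =>
      have := polarDeriv_smul_left 0 0 R
      simpa using this
    | insert j s hj ih =>
      rw [Finset.sum_insert hj, Finset.sum_insert hj, polarDeriv_add_left, ih, polarDeriv_smul_left]
  have ha : a = ∑ j, a j • Pi.single j (1 : ℂ) := by
    simpa using (pi_eq_sum_univ' a)
  conv_lhs => rw [ha]
  exact h _

theorem polarDeriv_right_eq_sum (b : Fin n → ℂ) (R : MvPolynomial (Fin n ⊕ Fin n) ℂ) :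
    polarDeriv 0 b R = ∑ j, b j • polarDeriv 0 (Pi.single j 1) R := by
  have h : ∀ s : Finset (Fin n), polarDeriv 0 (∑ j ∈ s, b j • Pi.single j (1 : ℂ)) R =
      ∑ j ∈ s, b j • polarDeriv 0 (Pi.single j 1) R := by
    intro s
    classical
    induction s using Finset.induction_on with
    | empty =>
      have := polarDeriv_smul_right 0 0 R
      simpa using this
    | insert j s hj ih =>
      rw [Finset.sum_insert hj, Finset.sum_insert hj, polarDeriv_add_right, ih,
        polarDeriv_smul_right]
  have hb : b = ∑ j, b j • Pi.single j (1 : ℂ) := by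
    simpa using (pi_eq_sum_univ' b)
  conv_lhs => rw [hb]
  exact h _

theorem polarEval_sum {ι : Type*} (s : Finset ι) (F : ι → MvPolynomial (Fin n ⊕ Fin n) ℂ)
    (z ζ : Fin n → ℂ) : polarEval (∑ j ∈ s, F j) z ζ = ∑ j ∈ s, polarEval (F j) z ζ :=
  map_sum _ _ _

/-- The polynomial `R_v R_v̄ R_{aβ} - R_a R_v̄ R_{vβ} - R_v R_β R_{av̄} + R_a R_β R_{vv̄}`. It is
the mixed derivative `∂_{a'} ∂_{β'} R` of `R(z, ζ)` in the directions `a' = R_v a - R_a v` and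
`β' = R_v̄ β - R_β v̄`, which are tangent to the level sets of `R(·, ζ)` and of `R(z, ·)`. -/
def tangentialLevi (R : MvPolynomial (Fin n ⊕ Fin n) ℂ) (v a β : Fin n → ℂ) :
    MvPolynomial (Fin n ⊕ Fin n) ℂ :=
  polarDeriv v 0 R * polarDeriv 0 (star v) R * polarDeriv a 0 (polarDeriv 0 β R)
    - polarDeriv a 0 R * polarDeriv 0 (star v) R * polarDeriv v 0 (polarDeriv 0 β R)
    - polarDeriv v 0 R * polarDeriv 0 β R * polarDeriv a 0 (polarDeriv 0 (star v) R)
    + polarDeriv a 0 R * polarDeriv 0 β R * polarDeriv v 0 (polarDeriv 0 (star v) R)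

/-- At a smooth point of a Levi-flat hypersurface the mixed derivatives vanish on complex tangent
vectors. -/
theorem mixedDeriv_eq_zero_of_tangent {X : Set (Fin n → ℂ)} (hX : IsLeviFlat X)
    {R : MvPolynomial (Fin n ⊕ Fin n) ℂ} (hR : IsRealPolar R) {p v : Fin n → ℂ} (hp : p ∈ X)
    (hXR : ∀ᶠ z in 𝓝 p, z ∈ X ↔ polarEval R z (star z) = 0)
    (hv : polarEval (polarDeriv v (star v) R) p (star p) ≠ 0) {a b : Fin n → ℂ}
    (ha : polarEval (polarDeriv a 0 R) p (star p) = 0)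
    (hb : polarEval (polarDeriv b 0 R) p (star p) = 0) :
    polarEval (polarDeriv a 0 (polarDeriv 0 (star b) R)) p (star p) = 0 := by
  have hdiag : ∀ a : Fin n → ℂ, polarEval (polarDeriv a 0 R) p (star p) = 0 →
      polarEval (polarDeriv a 0 (polarDeriv 0 (star a) R)) p (star p) = 0 := by
    intro a ha
    have hf : ∀ c : ℂ, fderiv ℝ (polarFun R) p (c • a) = 0 := by
      intro c
      rw [fderiv_polarFun, polarFun, polarDeriv_eq, polarEval_add, hR.polarDeriv_right,
        polarDeriv_smul_left, polarEval_smul, ha]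
      simp
    have h0 := hX p hp (polarFun R) ⟨analyticAt_polarFun R p, hXR.mono fun z hz => by
        rw [hz, hR.polarFun_eq_zero_iff]⟩ (fun h => hv (by
          have h1 := fderiv_polarFun R p v
          rw [h] at h1
          exact ((hR.polarDeriv v).polarFun_eq_zero_iff).1 h1.symm)) a
      (by simpa using hf 1) (hf Complex.I)
    rw [← leviForm_polarFun hR, h0, Complex.ofReal_zero]
  -- polarization of the Hermitian form: its values at `a`, `b`, `a + b` and `a + i b` vanish
  have h1 := hdiag a ha
  have h2 := hdiag b hb
  have h3 := hdiag (a + b) (by rw [polarDeriv_add_left, polarEval_add, ha, hb, add_zero])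
  have h4 := hdiag (a + Complex.I • b) (by
    rw [polarDeriv_add_left, polarDeriv_smul_left, polarEval_add, polarEval_smul, ha, hb, mul_zero,
      add_zero])
  simp only [star_add, star_smul, polarDeriv_add_left, polarDeriv_add_right, polarDeriv_smul_left,
    polarDeriv_smul_right, polarDeriv_map_add, polarDeriv_map_smul, polarEval_add, polarEval_smul,
    h1, h2, Complex.star_def, Complex.conj_I, smul_add] at h3 h4
  have hI : Complex.I ≠ 0 := Complex.I_ne_zero
  have h5 : Complex.I * (polarEval (polarDeriv a 0 (polarDeriv 0 (star b) R)) p (star p)) * 2 =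
      0 := by
    linear_combination Complex.I * h3 - h4
  simpa using h5

/-- At a smooth point of a Levi-flat hypersurface `tangentialLevi R v a β` vanishes: it is the mixed
derivative in the tangent vectors `R_v a - R_a v` and `R_v̄ β - R_β v̄`. -/
theorem tangentialLevi_eq_zero {X : Set (Fin n → ℂ)} (hX : IsLeviFlat X)
    {R : MvPolynomial (Fin n ⊕ Fin n) ℂ} (hR : IsRealPolar R) {p v : Fin n → ℂ} (hp : p ∈ X)
    (hXR : ∀ᶠ z in 𝓝 p, z ∈ X ↔ polarEval R z (star z) = 0)
    (hv : polarEval (polarDeriv v (star v) R) p (star p) ≠ 0) (a β : Fin n → ℂ) :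
    polarEval (tangentialLevi R v a β) p (star p) = 0 := by
  set c : (Fin n → ℂ) → ℂ := fun a => polarEval (polarDeriv a 0 R) p (star p) with hc
  have htan : ∀ a, polarEval (polarDeriv (c v • a - c a • v) 0 R) p (star p) = 0 := by
    intro a
    rw [sub_eq_add_neg, ← neg_smul, polarDeriv_add_left, polarDeriv_smul_left,
      polarDeriv_smul_left, polarEval_add, polarEval_smul, polarEval_smul]
    simp only [hc]
    ring
  have h := mixedDeriv_eq_zero_of_tangent hX hR hp hXR hv (htan a) (htan (star β))
  have hcr : ∀ a, polarEval (polarDeriv 0 a R) p (star p) = star (c (star a)) := by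
    intro a
    rw [← hR.polarDeriv_right, star_star]
  rw [sub_eq_add_neg, ← neg_smul, sub_eq_add_neg, ← neg_smul] at h
  simp only [star_add, star_smul, star_star, star_neg, polarDeriv_add_left, polarDeriv_add_right,
    polarDeriv_smul_left, polarDeriv_smul_right, polarDeriv_map_add, polarDeriv_map_smul,
    polarEval_add, polarEval_smul, smul_add] at h
  simp only [tangentialLevi, polarEval_add, polarEval_sub, polarEval_mul, hcr, star_star]
  simp only [hc] at h ⊢
  linear_combination h

theorem exists_irreducible_factor_vanishing {σ : Type*} [Finite σ] {R : MvPolynomial σ ℂ}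
    (hR : R ≠ 0) {x : σ → ℂ} (hx : MvPolynomial.eval x R = 0) :
    ∃ A B : MvPolynomial σ ℂ, Irreducible A ∧ R = A * B ∧ MvPolynomial.eval x A = 0 := by
  obtain ⟨f, hf, hfR⟩ := WfDvdMonoid.exists_factors R hR
  obtain ⟨u, hu⟩ := hfR
  have hu0 : MvPolynomial.eval x (u : MvPolynomial σ ℂ) ≠ 0 :=
    (u.isUnit.map (MvPolynomial.eval x)).ne_zero
  rw [← hu, map_mul, map_multiset_prod, mul_eq_zero, or_iff_left hu0, Multiset.prod_eq_zero_iff,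
    Multiset.mem_map] at hx
  obtain ⟨A, hA, hA0⟩ := hx
  obtain ⟨B, hB⟩ := (Multiset.dvd_prod hA).trans (Dvd.intro _ hu)
  exact ⟨A, B, hf A hA, hB, hA0⟩

/-- The polynomials `tangentialLevi R v a β` are divisible by the irreducible factor of `R` that
defines the hypersurface. -/
theorem exists_factor_dvd_tangentialLevi {X : Set (Fin n → ℂ)} (hX : IsLeviFlat X)
    {R : MvPolynomial (Fin n ⊕ Fin n) ℂ} (hR : IsRealPolar R) {q v : Fin n → ℂ} (hq : q ∈ X)
    (hXR : ∀ᶠ z in 𝓝 q, z ∈ X ↔ polarEval R z (star z) = 0)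
    (hv : polarEval (polarDeriv v (star v) R) q (star q) ≠ 0) :
    ∃ A B : MvPolynomial (Fin n ⊕ Fin n) ℂ, R = A * B ∧ polarEval B q (star q) ≠ 0 ∧
      ∀ a β, A ∣ tangentialLevi R v a β := by
  have hq0 : polarEval R q (star q) = 0 := hXR.self_of_nhds.1 hq
  have hR0 : R ≠ 0 := by
    rintro rfl
    simp [polarDeriv, polarEval] at hv
  obtain ⟨A, B, hA, hAB, hA0⟩ := exists_irreducible_factor_vanishing hR0 hq0
  have hA0 : polarEval A q (star q) = 0 := hA0
  have hB : polarEval B q (star q) ≠ 0 := by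
    intro hB
    rw [hAB, polarDeriv_mul, polarEval_add, polarEval_mul, polarEval_mul, hA0, hB] at hv
    simp at hv
  refine ⟨A, B, hAB, hB, fun a β => ?_⟩
  have hgood : ∀ᶠ z in 𝓝 q, z ∈ X → polarEval A z (star z) = 0 ∧
      polarEval (tangentialLevi R v a β) z (star z) = 0 := by
    filter_upwards [hXR.eventually_nhds,
      (continuous_polarEval_star B).continuousAt.eventually_ne hB,
      (continuous_polarEval_star _).continuousAt.eventually_ne hv] with z hz1 hz2 hz3 hzX
    refine ⟨?_, tangentialLevi_eq_zero hX hR hzX hz1 hz3 a β⟩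
    have := hz1.self_of_nhds.1 hzX
    rw [hAB, polarEval_mul] at this
    exact (mul_eq_zero.1 this).resolve_right hz2
  obtain ⟨r, hr, hball⟩ := Metric.eventually_nhds_iff_ball.1 (hgood.and hXR)
  refine dvd_of_vanishing hA (M := (fun z => Sum.elim z (star z)) '' (X ∩ Metric.ball q r))
    (v := Sum.elim v (star v)) (T := Set.range fun x : ℝ => (x : ℂ)) (fun S hS => ?_) ?_ ?_
  -- the real translates of the hypersurface in the direction `v` cover a neighbourhood of `q`
  · have hf : fderiv ℝ (polarFun R) q v ≠ 0 := by
      rw [fderiv_polarFun]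
      exact (hR.polarDeriv v).polarFun_eq_zero_iff.not.2 hv
    obtain ⟨φ, h1, h2, h3⟩ := exists_line_hits (analyticAt_polarFun R q)
      (hR.polarFun_eq_zero_iff.2 hq0) hf
    have hc : ContinuousAt (fun z => z + (φ z : ℂ) • v) q :=
      continuousAt_id.add (((Complex.continuous_ofReal.continuousAt).comp h1.continuousAt).smul
        continuousAt_const)
    have hnear := hc.eventually (Metric.isOpen_ball.mem_nhds (show q + (φ q : ℂ) • v ∈
      Metric.ball q r by simpa [h2] using hr))
    refine eq_zero_of_polarEval_star (w := q) ?_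
    filter_upwards [h3, hnear] with z hz1 hz2
    have hzX : z + (φ z : ℂ) • v ∈ X := (hball _ hz2).2.2 (hR.polarFun_eq_zero_iff.1 hz1)
    have := hS _ ⟨_, ⟨hzX, hz2⟩, rfl⟩ (-(φ z) : ℂ) ⟨-(φ z), by simp⟩
    have h2 : (Sum.elim (z + (φ z : ℂ) • v) (star (z + (φ z : ℂ) • v)) +
        (-(φ z : ℂ)) • Sum.elim v (star v) : Fin n ⊕ Fin n → ℂ) = Sum.elim z (star z) := by
      funext j
      cases j <;> simp
    rwa [h2] at this
  · rintro _ ⟨z, ⟨hzX, hz⟩, rfl⟩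
    exact ((hball z hz).1 hzX).1
  · rintro _ ⟨z, ⟨hzX, hz⟩, rfl⟩
    exact ((hball z hz).1 hzX).2

section Continuity

variable {Y : Type*} [TopologicalSpace Y] {z ζ a b : Y → Fin n → ℂ}

theorem continuous_polarEval_comp (hz : Continuous z) (hζ : Continuous ζ)
    (R : MvPolynomial (Fin n ⊕ Fin n) ℂ) : Continuous fun y => polarEval R (z y) (ζ y) := by
  have := Continuous.comp (continuous_polarEval R) (hz.prodMk hζ)
  simpa only [Function.comp_def] using this

theorem continuous_polarDeriv_left (hz : Continuous z) (hζ : Continuous ζ) (ha : Continuous a)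
    (R : MvPolynomial (Fin n ⊕ Fin n) ℂ) :
    Continuous fun y => polarEval (polarDeriv (a y) 0 R) (z y) (ζ y) := by
  have h : (fun y => polarEval (polarDeriv (a y) 0 R) (z y) (ζ y)) = fun y =>
      ∑ j, a y j * polarEval (polarDeriv (Pi.single j 1) 0 R) (z y) (ζ y) := by
    funext y
    rw [polarDeriv_left_eq_sum, polarEval_sum]
    exact Finset.sum_congr rfl fun j _ => polarEval_smul _ _ _ _
  rw [h]
  exact continuous_finsetSum _ fun j _ => ((continuous_apply j).comp ha).mul
    (continuous_polarEval_comp hz hζ _)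

theorem continuous_polarDeriv_right (hz : Continuous z) (hζ : Continuous ζ) (hb : Continuous b)
    (R : MvPolynomial (Fin n ⊕ Fin n) ℂ) :
    Continuous fun y => polarEval (polarDeriv 0 (b y) R) (z y) (ζ y) := by
  have h : (fun y => polarEval (polarDeriv 0 (b y) R) (z y) (ζ y)) = fun y =>
      ∑ j, b y j * polarEval (polarDeriv 0 (Pi.single j 1) R) (z y) (ζ y) := by
    funext y
    rw [polarDeriv_right_eq_sum, polarEval_sum]
    exact Finset.sum_congr rfl fun j _ => polarEval_smul _ _ _ _
  rw [h]
  exact continuous_finsetSum _ fun j _ => ((continuous_apply j).comp hb).mul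
    (continuous_polarEval_comp hz hζ _)

theorem continuous_mixedDeriv (hz : Continuous z) (hζ : Continuous ζ) (ha : Continuous a)
    (hb : Continuous b) (R : MvPolynomial (Fin n ⊕ Fin n) ℂ) :
    Continuous fun y => polarEval (polarDeriv (a y) 0 (polarDeriv 0 (b y) R)) (z y) (ζ y) := by
  have h : (fun y => polarEval (polarDeriv (a y) 0 (polarDeriv 0 (b y) R)) (z y) (ζ y)) = fun y =>
      ∑ j, a y j *
        polarEval (polarDeriv 0 (b y) (polarDeriv (Pi.single j 1) 0 R)) (z y) (ζ y) := by
    funext y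
    rw [polarDeriv_left_eq_sum, polarEval_sum]
    refine Finset.sum_congr rfl fun j _ => ?_
    rw [polarEval_smul, polarDeriv_comm (Pi.single j 1) 0 0 (b y) R]
  rw [h]
  exact continuous_finsetSum _ fun j _ => ((continuous_apply j).comp ha).mul
    (continuous_polarDeriv_right hz hζ hb _)

end Continuity

theorem tangentialLevi_eq_sum (R : MvPolynomial (Fin n ⊕ Fin n) ℂ) (v a β : Fin n → ℂ) :
    tangentialLevi R v a β =
      ∑ j, ∑ k, (a j * β k) • tangentialLevi R v (Pi.single j 1) (Pi.single k 1) := by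
  have h1 : ∀ a, tangentialLevi R v a β = ∑ j, a j • tangentialLevi R v (Pi.single j 1) β := by
    intro a
    simp only [tangentialLevi]
    rw [polarDeriv_left_eq_sum a, polarDeriv_left_eq_sum a, polarDeriv_left_eq_sum a]
    simp only [Finset.sum_mul, Finset.mul_sum, ← Finset.sum_sub_distrib, ← Finset.sum_add_distrib,
      smul_add, smul_sub, smul_mul_assoc, mul_smul_comm]
  have h2 : ∀ a, tangentialLevi R v a β = ∑ k, β k • tangentialLevi R v a (Pi.single k 1) := by
    intro a
    simp only [tangentialLevi]
    rw [polarDeriv_comm a 0 0 β, polarDeriv_comm v 0 0 β, polarDeriv_right_eq_sum β,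
      polarDeriv_right_eq_sum β, polarDeriv_right_eq_sum β]
    simp only [polarDeriv_comm _ 0 0 (Pi.single _ 1) R]
    simp only [Finset.sum_mul, Finset.mul_sum, ← Finset.sum_sub_distrib, ← Finset.sum_add_distrib,
      smul_add, smul_sub, smul_mul_assoc, mul_smul_comm]
  rw [h1]
  refine Finset.sum_congr rfl fun j _ => ?_
  rw [h2, Finset.smul_sum]
  exact Finset.sum_congr rfl fun k _ => smul_smul _ _ _

theorem exists_bound_near_of_compact {Y Z : Type*} [TopologicalSpace Y] [TopologicalSpace Z]
    {F : Y × Z → ℂ} (hF : Continuous F) {K : Set Z} (hK : IsCompact K) (y : Y) :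
    ∃ C : ℝ, 0 ≤ C ∧ ∀ᶠ y' in 𝓝 y, ∀ z ∈ K, ‖F (y', z)‖ ≤ C := by
  obtain ⟨C, hC⟩ := hK.exists_bound_of_continuousOn
    ((hF.comp (Continuous.prodMk_right y)).continuousOn)
  refine ⟨max C 0 + 1, by positivity, ?_⟩
  refine hK.eventually_forall_of_forall_eventually fun z hz => ?_
  have : ‖F (y, z)‖ < max C 0 + 1 := ((hC z hz).trans (le_max_left _ _)).trans_lt (lt_add_one _)
  exact (hF.norm.continuousAt.eventually_lt_const this).mono fun _ h => h.le

/-- On a Levi-flat hypersurface the mixed derivatives of the complexified defining function are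
controlled by its first derivatives and its values. -/
theorem exists_mixedDeriv_bound {X : Set (Fin n → ℂ)} (hX : IsLeviFlat X)
    {R : MvPolynomial (Fin n ⊕ Fin n) ℂ} (hR : IsRealPolar R) {q v : Fin n → ℂ} (hq : q ∈ X)
    (hXR : ∀ᶠ z in 𝓝 q, z ∈ X ↔ polarEval R z (star z) = 0)
    (hv : polarEval (polarDeriv v (star v) R) q (star q) ≠ 0) (M : ℝ) :
    ∃ C : ℝ, 0 ≤ C ∧ ∀ᶠ p : (Fin n → ℂ) × (Fin n → ℂ) in 𝓝 (q, star q), ∀ a β, ‖a‖ ≤ M → ‖β‖ ≤ M →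
      ‖polarEval (polarDeriv a 0 (polarDeriv 0 β R)) p.1 p.2‖ ≤
        C * (‖polarEval (polarDeriv a 0 R) p.1 p.2‖ + ‖polarEval (polarDeriv 0 β R) p.1 p.2‖ +
          ‖polarEval R p.1 p.2‖) := by
  obtain ⟨A, B, hAB, hB, hdvd⟩ := exists_factor_dvd_tangentialLevi hX hR hq hXR hv
  choose S hS using fun j k => hdvd (Pi.single j 1) (Pi.single k 1)
  have hvv : polarEval (polarDeriv v 0 R) q (star q) ≠ 0 ∧
      polarEval (polarDeriv 0 (star v) R) q (star q) ≠ 0 := by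
    rw [hR.polarDeriv_right]
    have : polarEval (polarDeriv v 0 R) q (star q) ≠ 0 := by
      intro h0
      rw [polarDeriv_eq, polarEval_add, hR.polarDeriv_right, h0] at hv
      simp at hv
    exact ⟨this, star_ne_zero.2 this⟩
  -- the relation `B · tangentialLevi R v a β = R · ∑ aⱼ βₖ Sⱼₖ`, solved for `R_{aβ}`, gives
  -- `N R_{aβ} = R_a (…) + R_β (…) + R (…)` with continuous coefficients, bounded near `(q, q̄)`
  set K : Set ((Fin n → ℂ) × (Fin n → ℂ)) := Metric.closedBall 0 M ×ˢ Metric.closedBall 0 M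
  have hK : IsCompact K := (isCompact_closedBall _ _).prod (isCompact_closedBall _ _)
  have z1 : Continuous fun x : ((Fin n → ℂ) × (Fin n → ℂ)) × (Fin n → ℂ) × (Fin n → ℂ) =>
      x.1.1 := by fun_prop
  have z2 : Continuous fun x : ((Fin n → ℂ) × (Fin n → ℂ)) × (Fin n → ℂ) × (Fin n → ℂ) =>
      x.1.2 := by fun_prop
  have z3 : Continuous fun x : ((Fin n → ℂ) × (Fin n → ℂ)) × (Fin n → ℂ) × (Fin n → ℂ) =>
      x.2.1 := by fun_prop
  have z4 : Continuous fun x : ((Fin n → ℂ) × (Fin n → ℂ)) × (Fin n → ℂ) × (Fin n → ℂ) =>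
      x.2.2 := by fun_prop
  have cB := continuous_polarEval_comp z1 z2 B
  have c1 := continuous_polarEval_comp z1 z2 (polarDeriv v 0 R)
  have c2 := continuous_polarEval_comp z1 z2 (polarDeriv 0 (star v) R)
  have c3 := continuous_polarEval_comp z1 z2 (polarDeriv v 0 (polarDeriv 0 (star v) R))
  have c4 := continuous_polarDeriv_right z1 z2 z4 R
  have c5 := continuous_mixedDeriv z1 z2 (continuous_const (y := v)) z4 R
  have c6 := continuous_mixedDeriv z1 z2 z3 (continuous_const (y := star v)) R
  have c7 : Continuous fun x : ((Fin n → ℂ) × (Fin n → ℂ)) × (Fin n → ℂ) × (Fin n → ℂ) =>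
      ∑ j, ∑ k, x.2.1 j * x.2.2 k * polarEval (S j k) x.1.1 x.1.2 := by
    refine continuous_finsetSum _ fun j _ => continuous_finsetSum _ fun k _ => ?_
    exact (((continuous_apply j).comp z3).mul ((continuous_apply k).comp z4)).mul
      (continuous_polarEval_comp z1 z2 _)
  obtain ⟨C1, hC1, h1⟩ := exists_bound_near_of_compact (cB.mul ((c2.mul c5).sub (c4.mul c3))) hK
    (q, star q)
  obtain ⟨C2, hC2, h2⟩ := exists_bound_near_of_compact (cB.mul (c1.mul c6)) hK (q, star q)
  obtain ⟨C3, hC3, h3⟩ := exists_bound_near_of_compact c7 hK (q, star q)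
  set N : (Fin n → ℂ) × (Fin n → ℂ) → ℂ := fun p => polarEval B p.1 p.2 *
    (polarEval (polarDeriv v 0 R) p.1 p.2 * polarEval (polarDeriv 0 (star v) R) p.1 p.2)
  have hN : Continuous N := (continuous_polarEval B).mul
    ((continuous_polarEval (polarDeriv v 0 R)).mul (continuous_polarEval (polarDeriv 0 (star v) R)))
  have hN0 : 0 < ‖N (q, star q)‖ := norm_pos_iff.2 (mul_ne_zero hB (mul_ne_zero hvv.1 hvv.2))
  have h4 : ∀ᶠ p in 𝓝 (q, star q), ‖N (q, star q)‖ / 2 < ‖N p‖ :=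
    hN.norm.continuousAt.eventually_const_lt (by linarith)
  set c := ‖N (q, star q)‖ / 2
  have hc : 0 < c := half_pos hN0
  refine ⟨(C1 + C2 + C3) / c, by positivity, ?_⟩
  filter_upwards [h1, h2, h3, h4] with p hp1 hp2 hp3 hp4 a β ha hβ
  have hmem : (a, β) ∈ K := ⟨by simpa using ha, by simpa using hβ⟩
  have e1 : ‖polarEval B p.1 p.2 * (polarEval (polarDeriv 0 (star v) R) p.1 p.2 *
      polarEval (polarDeriv v 0 (polarDeriv 0 β R)) p.1 p.2 - polarEval (polarDeriv 0 β R) p.1 p.2 *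
      polarEval (polarDeriv v 0 (polarDeriv 0 (star v) R)) p.1 p.2)‖ ≤ C1 := hp1 (a, β) hmem
  have e2 : ‖polarEval B p.1 p.2 * (polarEval (polarDeriv v 0 R) p.1 p.2 *
      polarEval (polarDeriv a 0 (polarDeriv 0 (star v) R)) p.1 p.2)‖ ≤ C2 := hp2 (a, β) hmem
  have e3 : ‖∑ j, ∑ k, a j * β k * polarEval (S j k) p.1 p.2‖ ≤ C3 := hp3 (a, β) hmem
  have hRp : polarEval R p.1 p.2 = polarEval A p.1 p.2 * polarEval B p.1 p.2 := by
    conv_lhs => rw [hAB]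
    rw [polarEval_mul]
  have hE : polarEval B p.1 p.2 * polarEval (tangentialLevi R v a β) p.1 p.2 =
      polarEval R p.1 p.2 * ∑ j, ∑ k, a j * β k * polarEval (S j k) p.1 p.2 := by
    rw [tangentialLevi_eq_sum, polarEval_sum, Finset.mul_sum, Finset.mul_sum]
    refine Finset.sum_congr rfl fun j _ => ?_
    rw [polarEval_sum, Finset.mul_sum, Finset.mul_sum]
    refine Finset.sum_congr rfl fun k _ => ?_
    rw [polarEval_smul, hS, polarEval_mul, hRp]
    ring
  simp only [tangentialLevi, polarEval_add, polarEval_sub, polarEval_mul] at hE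
  have hid : N p * polarEval (polarDeriv a 0 (polarDeriv 0 β R)) p.1 p.2 =
      polarEval (polarDeriv a 0 R) p.1 p.2 * (polarEval B p.1 p.2 *
        (polarEval (polarDeriv 0 (star v) R) p.1 p.2 *
          polarEval (polarDeriv v 0 (polarDeriv 0 β R)) p.1 p.2 -
        polarEval (polarDeriv 0 β R) p.1 p.2 *
          polarEval (polarDeriv v 0 (polarDeriv 0 (star v) R)) p.1 p.2)) +
      polarEval (polarDeriv 0 β R) p.1 p.2 * (polarEval B p.1 p.2 *
        (polarEval (polarDeriv v 0 R) p.1 p.2 *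
          polarEval (polarDeriv a 0 (polarDeriv 0 (star v) R)) p.1 p.2)) +
      polarEval R p.1 p.2 * ∑ j, ∑ k, a j * β k * polarEval (S j k) p.1 p.2 := by
    rw [← hE]
    simp only [N]
    ring
  have hle : c * ‖polarEval (polarDeriv a 0 (polarDeriv 0 β R)) p.1 p.2‖ ≤
      ‖polarEval (polarDeriv a 0 R) p.1 p.2‖ * C1 +
        ‖polarEval (polarDeriv 0 β R) p.1 p.2‖ * C2 + ‖polarEval R p.1 p.2‖ * C3 := by
    refine (mul_le_mul_of_nonneg_right hp4.le (norm_nonneg _)).trans ?_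
    rw [← norm_mul, hid]
    refine (norm_add₃_le).trans ?_
    rw [norm_mul (polarEval (polarDeriv a 0 R) p.1 p.2),
      norm_mul (polarEval (polarDeriv 0 β R) p.1 p.2), norm_mul (polarEval R p.1 p.2)]
    exact add_le_add_three (mul_le_mul_of_nonneg_left e1 (norm_nonneg _))
      (mul_le_mul_of_nonneg_left e2 (norm_nonneg _)) (mul_le_mul_of_nonneg_left e3 (norm_nonneg _))
  rw [div_mul_eq_mul_div, le_div_iff₀ hc, mul_comm _ c]
  refine hle.trans ?_
  have i1 := norm_nonneg (polarEval (polarDeriv a 0 R) p.1 p.2)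
  have i2 := norm_nonneg (polarEval (polarDeriv 0 β R) p.1 p.2)
  have i3 := norm_nonneg (polarEval R p.1 p.2)
  nlinarith [mul_nonneg i1 hC2, mul_nonneg i1 hC3, mul_nonneg i2 hC1, mul_nonneg i2 hC3,
    mul_nonneg i3 hC1, mul_nonneg i3 hC2]

end Levi

/-! ### The leaves of the Levi foliation -/

theorem norm_le_of_hasDerivAt_of_zero {f f' : ℂ → ℂ} {r B : ℝ}
    (hf : ∀ x ∈ Metric.ball (0 : ℂ) r, HasDerivAt f (f' x) x) (h0 : f 0 = 0)
    (hB : ∀ x ∈ Metric.ball (0 : ℂ) r, ‖f' x‖ ≤ B) {x : ℂ} (hx : x ∈ Metric.ball (0 : ℂ) r) :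
    ‖f x‖ ≤ B * r := by
  have hr : 0 < r := (norm_nonneg x).trans_lt (mem_ball_zero_iff.1 hx)
  have hB0 : 0 ≤ B := (norm_nonneg _).trans (hB x hx)
  have := (convex_ball (0 : ℂ) r).norm_image_sub_le_of_norm_hasDerivWithin_le
    (fun y hy => (hf y hy).hasDerivWithinAt) hB (Metric.mem_ball_self hr) hx
  rw [h0, sub_zero, sub_zero] at this
  exact this.trans (mul_le_mul_of_nonneg_left (mem_ball_zero_iff.1 hx).le hB0)

/-- Uniqueness in the Goursat problem: a function of two variables that vanishes on both axes and
whose mixed derivative is bounded by its first derivatives and its values vanishes near `0`. -/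
theorem eq_zero_of_mixedDeriv_bound {K K₁ K₂ K₁₂ : ℂ → ℂ → ℂ} {r B C : ℝ} (hr : 0 < r)
    (h1 : ∀ τ ∈ Metric.ball (0 : ℂ) r, ∀ σ ∈ Metric.ball (0 : ℂ) r,
      HasDerivAt (fun τ => K τ σ) (K₁ τ σ) τ)
    (h2 : ∀ τ ∈ Metric.ball (0 : ℂ) r, ∀ σ ∈ Metric.ball (0 : ℂ) r,
      HasDerivAt (fun σ => K τ σ) (K₂ τ σ) σ)
    (h12 : ∀ τ ∈ Metric.ball (0 : ℂ) r, ∀ σ ∈ Metric.ball (0 : ℂ) r,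
      HasDerivAt (fun σ => K₁ τ σ) (K₁₂ τ σ) σ)
    (h21 : ∀ τ ∈ Metric.ball (0 : ℂ) r, ∀ σ ∈ Metric.ball (0 : ℂ) r,
      HasDerivAt (fun τ => K₂ τ σ) (K₁₂ τ σ) τ)
    (h0l : ∀ σ ∈ Metric.ball (0 : ℂ) r, K 0 σ = 0) (h0r : ∀ τ ∈ Metric.ball (0 : ℂ) r, K τ 0 = 0)
    (hB : ∀ τ ∈ Metric.ball (0 : ℂ) r, ∀ σ ∈ Metric.ball (0 : ℂ) r,
      ‖K₁ τ σ‖ + ‖K₂ τ σ‖ + ‖K τ σ‖ ≤ B) (hC : 0 ≤ C)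
    (hbd : ∀ τ ∈ Metric.ball (0 : ℂ) r, ∀ σ ∈ Metric.ball (0 : ℂ) r,
      ‖K₁₂ τ σ‖ ≤ C * (‖K₁ τ σ‖ + ‖K₂ τ σ‖ + ‖K τ σ‖)) :
    ∃ r' > 0, ∀ τ ∈ Metric.ball (0 : ℂ) r', ∀ σ ∈ Metric.ball (0 : ℂ) r', K τ σ = 0 := by
  set s := min r (1 / (2 * (2 * C + 1)))
  have hs : 0 < s := by positivity
  have hsr : Metric.ball (0 : ℂ) s ⊆ Metric.ball 0 r := Metric.ball_subset_ball (min_le_left _ _)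
  have hs2 : (2 * C + 1) * s ≤ 1 / 2 := by
    have : s ≤ 1 / (2 * (2 * C + 1)) := min_le_right _ _
    rw [le_div_iff₀ (by positivity)] at this
    linarith
  have h0 : (0 : ℂ) ∈ Metric.ball (0 : ℂ) r := Metric.mem_ball_self hr
  have h0s : (0 : ℂ) ∈ Metric.ball (0 : ℂ) s := Metric.mem_ball_self hs
  have hK₁0 : ∀ τ ∈ Metric.ball (0 : ℂ) r, K₁ τ 0 = 0 := by
    intro τ hτ
    have e1 : (fun τ => K τ 0) =ᶠ[𝓝 τ] fun _ => 0 := by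
      filter_upwards [Metric.isOpen_ball.mem_nhds hτ] with t ht using h0r t ht
    exact ((h1 τ hτ 0 h0).congr_of_eventuallyEq e1.symm).unique (hasDerivAt_const τ 0)
  have hK₂0 : ∀ σ ∈ Metric.ball (0 : ℂ) r, K₂ 0 σ = 0 := by
    intro σ hσ
    have e1 : (fun σ => K 0 σ) =ᶠ[𝓝 σ] fun _ => 0 := by
      filter_upwards [Metric.isOpen_ball.mem_nhds hσ] with t ht using h0l t ht
    exact ((h2 0 h0 σ hσ).congr_of_eventuallyEq e1.symm).unique (hasDerivAt_const σ 0)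
  have hB0 : 0 ≤ B := le_trans (by positivity) (hB 0 h0 0 h0)
  have hiter : ∀ m : ℕ, ∀ τ ∈ Metric.ball (0 : ℂ) s, ∀ σ ∈ Metric.ball (0 : ℂ) s,
      ‖K₁ τ σ‖ + ‖K₂ τ σ‖ + ‖K τ σ‖ ≤ B * (1 / 2) ^ m := by
    intro m
    induction m with
    | zero =>
      intro τ hτ σ hσ
      simpa using hB τ (hsr hτ) σ (hsr hσ)
    | succ m ih =>
      intro τ hτ σ hσ
      set D := B * (1 / 2) ^ m
      have hD : 0 ≤ D := by positivity
      have e12 : ∀ τ ∈ Metric.ball (0 : ℂ) s, ∀ σ ∈ Metric.ball (0 : ℂ) s, ‖K₁₂ τ σ‖ ≤ C * D :=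
        fun τ hτ σ hσ => (hbd τ (hsr hτ) σ (hsr hσ)).trans
          (mul_le_mul_of_nonneg_left (ih τ hτ σ hσ) hC)
      have e1 : ‖K₁ τ σ‖ ≤ C * D * s := norm_le_of_hasDerivAt_of_zero
        (f := fun σ => K₁ τ σ) (fun x hx => h12 τ (hsr hτ) x (hsr hx)) (hK₁0 τ (hsr hτ))
        (fun x hx => e12 τ hτ x hx) hσ
      have e2 : ‖K₂ τ σ‖ ≤ C * D * s := norm_le_of_hasDerivAt_of_zero
        (f := fun τ => K₂ τ σ) (fun x hx => h21 x (hsr hx) σ (hsr hσ)) (hK₂0 σ (hsr hσ))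
        (fun x hx => e12 x hx σ hσ) hτ
      have e3 : ‖K τ σ‖ ≤ D * s := norm_le_of_hasDerivAt_of_zero
        (f := fun τ => K τ σ) (fun x hx => h1 x (hsr hx) σ (hsr hσ)) (h0l σ (hsr hσ))
        (fun x hx => by
          have := ih x hx σ hσ
          have i2 := norm_nonneg (K₂ x σ)
          have i3 := norm_nonneg (K x σ)
          linarith) hτ
      calc ‖K₁ τ σ‖ + ‖K₂ τ σ‖ + ‖K τ σ‖ ≤ C * D * s + C * D * s + D * s := by linarith
        _ = D * ((2 * C + 1) * s) := by ring
        _ ≤ D * (1 / 2) := mul_le_mul_of_nonneg_left hs2 hD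
        _ = B * (1 / 2) ^ (m + 1) := by simp only [D]; ring
  refine ⟨s, hs, fun τ hτ σ hσ => ?_⟩
  have hlim : Tendsto (fun m : ℕ => B * (1 / 2 : ℝ) ^ m) atTop (𝓝 0) := by
    have := (tendsto_pow_atTop_nhds_zero_of_lt_one (r := (1 / 2 : ℝ)) (by norm_num)
      (by norm_num)).const_mul B
    simpa using this
  have hle : ‖K τ σ‖ ≤ 0 := ge_of_tendsto' hlim fun m => by
    have := hiter m τ hτ σ hσ
    have i1 := norm_nonneg (K₁ τ σ)
    have i2 := norm_nonneg (K₂ τ σ)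
    linarith
  exact norm_le_zero_iff.1 hle

section Leaf

variable {n : ℕ}

theorem hasDerivAt_apply {𝕜 : Type*} [NontriviallyNormedField 𝕜] [NormedAlgebra 𝕜 ℂ]
    {z : 𝕜 → Fin n → ℂ} {z' : Fin n → ℂ} {t : 𝕜} (h : HasDerivAt z z' t) (i : Fin n) :
    HasDerivAt (fun t => z t i) (z' i) t :=
  (hasDerivAt_pi.1 h) i

/-- Let `z(τ)` be a holomorphic curve in the Segre variety `{R(·, p̄) = 0}` of a point `p` of a
Levi-flat hypersurface near `q`, with `z(0) = p`. Then the curve lies in the hypersurface: the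
function `R(z(τ), w(σ))`, with `w(σ)` the conjugate curve, solves a Goursat problem. -/
theorem polarEval_curve_eq_zero {R : MvPolynomial (Fin n ⊕ Fin n) ℂ} (hR : IsRealPolar R)
    {p : Fin n → ℂ}
    (hbd : ∀ M : ℝ, ∃ C : ℝ, 0 ≤ C ∧ ∀ᶠ x : (Fin n → ℂ) × (Fin n → ℂ) in 𝓝 (p, star p), ∀ a β,
      ‖a‖ ≤ M → ‖β‖ ≤ M → ‖polarEval (polarDeriv a 0 (polarDeriv 0 β R)) x.1 x.2‖ ≤
        C * (‖polarEval (polarDeriv a 0 R) x.1 x.2‖ + ‖polarEval (polarDeriv 0 β R) x.1 x.2‖ +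
          ‖polarEval R x.1 x.2‖))
    {D : Set ℂ} (hDo : IsOpen D) (hDc : Convex ℝ D) (h0D : (0 : ℂ) ∈ D) {z : ℂ → Fin n → ℂ}
    (hz : DifferentiableOn ℂ z D) (hz0 : z 0 = p)
    (hzR : ∀ τ ∈ D, polarEval R (z τ) (star p) = 0) {τ : ℂ} (hτ : τ ∈ D) :
    polarEval R (z τ) (star (z τ)) = 0 := by
  have hza : AnalyticOnNhd ℂ z D := hz.analyticOnNhd hDo
  set D' : Set ℂ := {σ | star σ ∈ D}
  have hD'o : IsOpen D' := hDo.preimage continuous_star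
  have hD'c : IsPreconnected D' := by
    have : Convex ℝ D' := hDc.is_linear_preimage (f := (star : ℂ → ℂ))
      ((starL' ℝ : ℂ ≃L[ℝ] ℂ) : ℂ →ₗ[ℝ] ℂ).isLinear
    exact this.isPreconnected
  have h0D' : (0 : ℂ) ∈ D' := by simpa [D'] using h0D
  set w : ℂ → Fin n → ℂ := fun σ => star (z (star σ))
  have hw : DifferentiableOn ℂ w D' := by
    intro σ hσ
    have h1 : DifferentiableAt ℂ z (star σ) := (hza _ hσ).differentiableAt
    have h2 := DifferentiableAt.star_star h1
    rw [star_star] at h2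
    exact h2.differentiableWithinAt
  have hwa : AnalyticOnNhd ℂ w D' := hw.analyticOnNhd hD'o
  have hw0 : w 0 = star p := by simp [w, hz0]
  have hzd : ∀ τ ∈ D, HasDerivAt z (deriv z τ) τ := fun τ hτ =>
    (hza τ hτ).differentiableAt.hasDerivAt
  have hwd : ∀ σ ∈ D', HasDerivAt w (deriv w σ) σ := fun σ hσ =>
    (hwa σ hσ).differentiableAt.hasDerivAt
  have hwR : ∀ σ ∈ D', polarEval R p (w σ) = 0 := by
    intro σ hσ
    have := hR.star_polarEval (z (star σ)) (star p)
    rw [hzR _ hσ, star_star, star_zero] at this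
    exact this.symm
  have hK1 : ∀ (S : MvPolynomial (Fin n ⊕ Fin n) ℂ) (τ σ : ℂ), τ ∈ D →
      HasDerivAt (fun τ => polarEval S (z τ) (w σ))
        (polarEval (polarDeriv (deriv z τ) 0 S) (z τ) (w σ)) τ := fun S τ σ hτ =>
    hasDerivAt_polarEval (hasDerivAt_apply (hzd τ hτ))
      (fun i => by simpa using hasDerivAt_const τ (w σ i)) S
  have hK2 : ∀ (S : MvPolynomial (Fin n ⊕ Fin n) ℂ) (τ σ : ℂ), σ ∈ D' →
      HasDerivAt (fun σ => polarEval S (z τ) (w σ))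
        (polarEval (polarDeriv 0 (deriv w σ) S) (z τ) (w σ)) σ := fun S τ σ hσ =>
    hasDerivAt_polarEval (fun i => by simpa using hasDerivAt_const σ (z τ i))
      (hasDerivAt_apply (hwd σ hσ)) S
  -- the Goursat problem near `0`
  obtain ⟨r', hr', hzero⟩ : ∃ r' > 0, ∀ τ ∈ Metric.ball (0 : ℂ) r', ∀ σ ∈ Metric.ball (0 : ℂ) r',
      polarEval R (z τ) (w σ) = 0 := by
    set M := max ‖deriv z 0‖ ‖deriv w 0‖ + 1
    obtain ⟨C, hC, hbdC⟩ := hbd M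
    have cz : ContinuousAt z 0 := (hza 0 h0D).continuousAt
    have cw : ContinuousAt w 0 := (hwa 0 h0D').continuousAt
    have cz' : ContinuousAt (deriv z) 0 := (hza 0 h0D).deriv.continuousAt
    have cw' : ContinuousAt (deriv w) 0 := (hwa 0 h0D').deriv.continuousAt
    have cfst : Tendsto (fun x : ℂ × ℂ => x.1) (𝓝 (0, 0)) (𝓝 0) := continuous_fst.tendsto (0, 0)
    have csnd : Tendsto (fun x : ℂ × ℂ => x.2) (𝓝 (0, 0)) (𝓝 0) := continuous_snd.tendsto (0, 0)
    have czw : Tendsto (fun x : ℂ × ℂ => (z x.1, w x.2)) (𝓝 (0, 0)) (𝓝 (p, star p)) := by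
      have h1 := (cz.tendsto.comp cfst).prodMk_nhds (cw.tendsto.comp csnd)
      rwa [hz0, hw0] at h1
    have e1 : ∀ᶠ x : ℂ × ℂ in 𝓝 (0, 0), ‖deriv z x.1‖ ≤ M := by
      have h : ‖deriv z 0‖ < M := (le_max_left _ _).trans_lt (lt_add_one _)
      exact (cfst.eventually (cz'.norm.eventually_lt_const h)).mono fun x hx => hx.le
    have e2 : ∀ᶠ x : ℂ × ℂ in 𝓝 (0, 0), ‖deriv w x.2‖ ≤ M := by
      have h : ‖deriv w 0‖ < M := (le_max_right _ _).trans_lt (lt_add_one _)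
      exact (csnd.eventually (cw'.norm.eventually_lt_const h)).mono fun x hx => hx.le
    have hKc : IsCompact (Metric.closedBall (0 : Fin n → ℂ) M) := isCompact_closedBall _ _
    obtain ⟨B1, -, hB1⟩ := exists_bound_near_of_compact (Y := (Fin n → ℂ) × (Fin n → ℂ))
      (continuous_polarDeriv_left (Y := ((Fin n → ℂ) × (Fin n → ℂ)) × (Fin n → ℂ))
        (z := fun x => x.1.1) (ζ := fun x => x.1.2) (a := fun x => x.2)
        (by fun_prop) (by fun_prop) (by fun_prop) R) hKc (p, star p)
    obtain ⟨B2, -, hB2⟩ := exists_bound_near_of_compact (Y := (Fin n → ℂ) × (Fin n → ℂ))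
      (continuous_polarDeriv_right (Y := ((Fin n → ℂ) × (Fin n → ℂ)) × (Fin n → ℂ))
        (z := fun x => x.1.1) (ζ := fun x => x.1.2) (b := fun x => x.2)
        (by fun_prop) (by fun_prop) (by fun_prop) R) hKc (p, star p)
    have hB3 : ∀ᶠ x : (Fin n → ℂ) × (Fin n → ℂ) in 𝓝 (p, star p),
        ‖polarEval R x.1 x.2‖ ≤ ‖polarEval R p (star p)‖ + 1 :=
      ((continuous_polarEval R).norm.continuousAt.eventually_lt_const
        (lt_add_one _)).mono fun x hx => hx.le
    obtain ⟨r, hr, hball⟩ := Metric.eventually_nhds_iff_ball.1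
      ((czw.eventually hbdC).and ((czw.eventually hB1).and ((czw.eventually hB2).and
        ((czw.eventually hB3).and (e1.and (e2.and ((cfst.eventually (hDo.mem_nhds h0D)).and
          (csnd.eventually (hD'o.mem_nhds h0D')))))))))
    have hmem : ∀ τ ∈ Metric.ball (0 : ℂ) r, ∀ σ ∈ Metric.ball (0 : ℂ) r,
        ((τ, σ) : ℂ × ℂ) ∈ Metric.ball ((0, 0) : ℂ × ℂ) r := by
      intro τ hτ σ hσ
      rw [← ball_prod_same]
      exact ⟨hτ, hσ⟩
    have h0 : (0 : ℂ) ∈ Metric.ball (0 : ℂ) r := Metric.mem_ball_self hr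
    refine eq_zero_of_mixedDeriv_bound (K := fun τ σ => polarEval R (z τ) (w σ))
      (K₁ := fun τ σ => polarEval (polarDeriv (deriv z τ) 0 R) (z τ) (w σ))
      (K₂ := fun τ σ => polarEval (polarDeriv 0 (deriv w σ) R) (z τ) (w σ))
      (K₁₂ := fun τ σ => polarEval (polarDeriv (deriv z τ) 0 (polarDeriv 0 (deriv w σ) R))
        (z τ) (w σ)) (r := r) (C := C) (B := B1 + B2 + (‖polarEval R p (star p)‖ + 1)) hr
      (fun τ hτ σ hσ => hK1 R τ σ (hball _ (hmem τ hτ σ hσ)).2.2.2.2.2.2.1)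
      (fun τ hτ σ hσ => hK2 R τ σ (hball _ (hmem τ hτ σ hσ)).2.2.2.2.2.2.2)
      (fun τ hτ σ hσ => ?_)
      (fun τ hτ σ hσ => hK1 (polarDeriv 0 (deriv w σ) R) τ σ
        (hball _ (hmem τ hτ σ hσ)).2.2.2.2.2.2.1)
      (fun σ hσ => ?_) (fun τ hτ => ?_) (fun τ hτ σ hσ => ?_) hC (fun τ hτ σ hσ => ?_)
    · rw [polarDeriv_comm]
      exact hK2 _ τ σ (hball _ (hmem τ hτ σ hσ)).2.2.2.2.2.2.2
    · simp only [hz0]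
      exact hwR σ (hball _ (hmem 0 h0 σ hσ)).2.2.2.2.2.2.2
    · simp only [hw0]
      exact hzR τ (hball _ (hmem τ hτ 0 h0)).2.2.2.2.2.2.1
    · obtain ⟨-, b1, b2, b3, b4, b5, -⟩ := hball _ (hmem τ hτ σ hσ)
      exact add_le_add_three (b1 _ (by simpa using b4)) (b2 _ (by simpa using b5)) b3
    · obtain ⟨b0, -, -, -, b4, b5, -⟩ := hball _ (hmem τ hτ σ hσ)
      exact b0 _ _ b4 b5
  -- identity theorem, one variable at a time
  have hstep : ∀ τ ∈ Metric.ball (0 : ℂ) r', ∀ σ ∈ D', polarEval R (z τ) (w σ) = 0 := by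
    intro τ hτ
    have ha : AnalyticOnNhd ℂ (fun σ => polarEval R (z τ) (w σ)) D' :=
      DifferentiableOn.analyticOnNhd
        (fun σ hσ => (hK2 R τ σ hσ).differentiableAt.differentiableWithinAt) hD'o
    refine fun σ hσ => ha.eqOn_zero_of_preconnected_of_eventuallyEq_zero hD'c h0D' ?_ hσ
    filter_upwards [Metric.ball_mem_nhds (0 : ℂ) hr'] with σ hσ using hzero τ hτ σ hσ
  have hall : ∀ σ ∈ D', ∀ τ ∈ D, polarEval R (z τ) (w σ) = 0 := by
    intro σ hσ
    have ha : AnalyticOnNhd ℂ (fun τ => polarEval R (z τ) (w σ)) D :=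
      DifferentiableOn.analyticOnNhd
        (fun τ hτ => (hK1 R τ σ hτ).differentiableAt.differentiableWithinAt) hDo
    refine fun τ hτ =>
      ha.eqOn_zero_of_preconnected_of_eventuallyEq_zero hDc.isPreconnected h0D ?_ hτ
    filter_upwards [Metric.ball_mem_nhds (0 : ℂ) hr'] with τ hτ using hstep τ hτ σ hσ
  have := hall (star τ) (by simpa [D'] using hτ) τ hτ
  simpa [w] using this

/-- The leaves of a Levi-flat hypersurface near a smooth point `q`: they are the Segre varieties,
written as graphs over a neighbourhood of `q` in the direction `v`. -/
theorem exists_leaf_graph {X : Set (Fin n → ℂ)} (hX : IsLeviFlat X)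
    {R : MvPolynomial (Fin n ⊕ Fin n) ℂ} (hR : IsRealPolar R) {q v : Fin n → ℂ} (hq : q ∈ X)
    (hXR : ∀ᶠ z in 𝓝 q, z ∈ X ↔ polarEval R z (star z) = 0)
    (hv : polarEval (polarDeriv v (star v) R) q (star q) ≠ 0) :
    ∃ r > 0, ∃ ξ : (Fin n → ℂ) × (Fin n → ℂ) → ℂ,
      AnalyticOnNhd ℂ ξ (Metric.ball q r ×ˢ Metric.ball (star q) r) ∧
      (∀ y ∈ Metric.ball q r, ∀ ζ ∈ Metric.ball (star q) r,
        polarEval R (y + ξ (y, ζ) • v) ζ = 0 ∧ polarEval (polarDeriv v 0 R) y ζ ≠ 0) ∧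
      ∀ p ∈ Metric.ball q r, p ∈ X → ξ (p, star p) = 0 ∧
        ∀ y ∈ Metric.ball q r, y + ξ (y, star p) • v ∈ X := by
  have hq0 : polarEval R q (star q) = 0 := hXR.self_of_nhds.1 hq
  have hvv : polarEval (polarDeriv v 0 R) q (star q) ≠ 0 := by
    intro h0
    rw [polarDeriv_eq, polarEval_add, hR.polarDeriv_right, h0] at hv
    simp at hv
  have hp1 : ∀ (u : ((Fin n → ℂ) × (Fin n → ℂ)) × ℂ) (i : Fin n),
      AnalyticAt ℂ (fun u : ((Fin n → ℂ) × (Fin n → ℂ)) × ℂ => u.1.1 i) u := fun u i =>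
    ((ContinuousLinearMap.proj (R := ℂ) (φ := fun _ : Fin n => ℂ) i).comp
      ((ContinuousLinearMap.fst ℂ _ _).comp (ContinuousLinearMap.fst ℂ _ _))).analyticAt u
  have hp2 : ∀ (u : ((Fin n → ℂ) × (Fin n → ℂ)) × ℂ) (i : Fin n),
      AnalyticAt ℂ (fun u : ((Fin n → ℂ) × (Fin n → ℂ)) × ℂ => u.1.2 i) u := fun u i =>
    ((ContinuousLinearMap.proj (R := ℂ) (φ := fun _ : Fin n => ℂ) i).comp
      ((ContinuousLinearMap.snd ℂ _ _).comp (ContinuousLinearMap.fst ℂ _ _))).analyticAt u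
  have hF : AnalyticAt ℂ (fun u : ((Fin n → ℂ) × (Fin n → ℂ)) × ℂ =>
      polarEval R (u.1.1 + u.2 • v) u.1.2) ((q, star q), 0) :=
    analyticAt_polarEval (fun i => (hp1 _ i).add (analyticAt_snd.mul analyticAt_const))
      (fun i => hp2 _ i) R
  have hder : HasDerivAt (fun x : ℂ => polarEval R (q + x • v) (star q))
      (polarEval (polarDeriv v 0 R) q (star q)) 0 := by
    have := hasDerivAt_polarEval (𝕜 := ℂ) (z := fun x : ℂ => q + x • v) (ζ := fun _ => star q)
      (z' := v) (ζ' := 0) (t := 0) (fun i => by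
        simpa using ((hasDerivAt_id (0 : ℂ)).mul_const (v i)).const_add (q i))
      (fun i => by simpa using hasDerivAt_const (0 : ℂ) (star q i)) R
    simpa using this
  obtain ⟨ξ, hξa, hξ0, hξR, hξu⟩ := exists_analytic_implicit (𝕜 := ℂ) hF
    (by simpa using hq0) hder hvv
  obtain ⟨ε, hε, hεu⟩ := Metric.eventually_nhds_iff_ball.1 hξu
  have hcp : Tendsto (fun e : (Fin n → ℂ) × (Fin n → ℂ) => e.1) (𝓝 (q, star q)) (𝓝 q) :=
    continuous_fst.tendsto (q, star q)
  have hcont : ContinuousAt (fun e : (Fin n → ℂ) × (Fin n → ℂ) => e.1 + ξ e • v) (q, star q) :=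
    continuousAt_fst.add (hξa.continuousAt.smul continuousAt_const)
  have hin : ∀ᶠ e in 𝓝 (q, star q), (e.1 + ξ e • v ∈ X ↔
      polarEval R (e.1 + ξ e • v) (star (e.1 + ξ e • v)) = 0) := by
    have h1 := hcont.tendsto
    simp only [hξ0, zero_smul, add_zero] at h1
    exact h1.eventually hXR
  have hreg : ∀ᶠ p in 𝓝 q, (∀ᶠ z in 𝓝 p, z ∈ X ↔ polarEval R z (star z) = 0) ∧
      polarEval (polarDeriv v (star v) R) p (star p) ≠ 0 :=
    hXR.eventually_nhds.and ((continuous_polarEval_star _).continuousAt.eventually_ne hv)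
  obtain ⟨r₁, hr₁, hball⟩ := Metric.eventually_nhds_iff_ball.1
    (hξa.eventually_analyticAt.and (hξR.and (hin.and ((hcp.eventually hreg).and
      ((continuous_polarEval (polarDeriv v 0 R)).continuousAt.eventually_ne hvv)))))
  set r := min r₁ ε
  have hr : 0 < r := lt_min hr₁ hε
  have hmem : ∀ y ∈ Metric.ball q r, ∀ ζ ∈ Metric.ball (star q) r,
      ((y, ζ) : (Fin n → ℂ) × (Fin n → ℂ)) ∈ Metric.ball (q, star q) r₁ := by
    intro y hy ζ hζ
    rw [← ball_prod_same]
    exact ⟨Metric.ball_subset_ball (min_le_left _ _) hy,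
      Metric.ball_subset_ball (min_le_left _ _) hζ⟩
  have hstar : ∀ p ∈ Metric.ball q r, star p ∈ Metric.ball (star q) r := by
    intro p hp
    rw [mem_ball_iff_norm] at hp ⊢
    rwa [← star_sub, norm_star]
  refine ⟨r, hr, ξ, fun e he => (hball _ (hmem _ he.1 _ he.2)).1, fun y hy ζ hζ =>
    ⟨(hball _ (hmem y hy ζ hζ)).2.1, (hball _ (hmem y hy ζ hζ)).2.2.2.2⟩, fun p hp hpX => ?_⟩
  obtain ⟨-, -, -, ⟨hXp, hvp⟩, -⟩ := hball _ (hmem p hp _ (hstar p hp))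
  have hξp : ξ (p, star p) = 0 := by
    refine hεu ((p, star p), 0) ?_ (by simpa using hXp.self_of_nhds.1 hpX)
    rw [← ball_prod_same, ← ball_prod_same]
    exact ⟨⟨Metric.ball_subset_ball (min_le_right _ _) hp,
      Metric.ball_subset_ball (min_le_right _ _) (hstar p hp)⟩, Metric.mem_ball_self hε⟩
  refine ⟨hξp, fun y hy => ?_⟩
  obtain ⟨-, -, hiff, -⟩ := hball _ (hmem y hy _ (hstar p hp))
  refine hiff.2 ?_
  -- the holomorphic curve over the complex line through `p` and `y`
  set Y : ℂ → Fin n → ℂ := fun τ => p + τ • (y - p) with hY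
  have hYc : Continuous Y := by fun_prop
  have hD : Convex ℝ (Y ⁻¹' Metric.ball q r) := by
    intro s hs t ht a b ha hb hab
    have hab' : (a : ℂ) + b = 1 := by exact_mod_cast hab
    have h1 : Y (a • s + b • t) = a • Y s + b • Y t := by
      funext j
      simp only [hY, Pi.add_apply, Pi.smul_apply, Complex.real_smul, smul_eq_mul]
      linear_combination (-(p j)) * hab'
    change Y (a • s + b • t) ∈ Metric.ball q r
    rw [h1]
    exact (convex_ball q r) hs ht ha hb hab
  have hξd : DifferentiableOn ℂ (fun τ => Y τ + ξ (Y τ, star p) • v) (Y ⁻¹' Metric.ball q r) := by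
    intro τ hτ
    have h1 : DifferentiableAt ℂ ξ (Y τ, star p) :=
      (hball _ (hmem _ hτ _ (hstar p hp))).1.differentiableAt
    have h2 : DifferentiableAt ℂ Y τ := by fun_prop
    have h3 : DifferentiableAt ℂ (fun τ => ξ (Y τ, star p)) τ :=
      h1.comp τ (f := fun τ => (Y τ, star p)) (h2.prodMk (differentiableAt_const _))
    exact (h2.add (h3.smul_const v)).differentiableWithinAt
  have h01 : Y 0 = p := by simp [hY]
  have h11 : Y 1 = y := by simp [hY]
  have := polarEval_curve_eq_zero hR (p := p)
    (fun M => exists_mixedDeriv_bound hX hR hpX hXp hvp M)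
    (Metric.isOpen_ball.preimage hYc) hD (show Y 0 ∈ Metric.ball q r by rwa [h01]) hξd
    (by simp [h01, hξp]) (fun τ hτ => (hball _ (hmem _ hτ _ (hstar p hp))).2.1)
    (τ := 1) (show Y 1 ∈ Metric.ball q r by rwa [h11])
  simpa only [h11] using this

end Leaf

section Family

variable {n : ℕ}

/-- The polynomial `R(·, ζ)`. -/
def polarSlice (R : MvPolynomial (Fin n ⊕ Fin n) ℂ) (ζ : Fin n → ℂ) : MvPolynomial (Fin n) ℂ :=
  MvPolynomial.aeval (Sum.elim MvPolynomial.X fun j => MvPolynomial.C (ζ j)) R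

@[simp]
theorem eval_polarSlice (R : MvPolynomial (Fin n ⊕ Fin n) ℂ) (z ζ : Fin n → ℂ) :
    MvPolynomial.eval z (polarSlice R ζ) = polarEval R z ζ := by
  have h : (MvPolynomial.eval z).comp (MvPolynomial.aeval (Sum.elim MvPolynomial.X
      fun j => MvPolynomial.C (ζ j)) : MvPolynomial (Fin n ⊕ Fin n) ℂ →ₐ[ℂ] _).toRingHom =
      MvPolynomial.eval (Sum.elim z ζ) := by
    refine MvPolynomial.ringHom_ext (fun c => by simp) fun j => ?_
    cases j <;> simp
  exact congrArg (fun g => g R) h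

theorem exists_totalDegree_polarSlice_le (R : MvPolynomial (Fin n ⊕ Fin n) ℂ) :
    ∃ D, ∀ ζ, (polarSlice R ζ).totalDegree ≤ D := by
  induction R using MvPolynomial.induction_on with
  | C a =>
    refine ⟨0, fun ζ => ?_⟩
    simp [polarSlice, MvPolynomial.algebraMap_eq]
  | add p q hp hq =>
    obtain ⟨D, hD⟩ := hp
    obtain ⟨D', hD'⟩ := hq
    refine ⟨max D D', fun ζ => ?_⟩
    rw [polarSlice, map_add]
    exact (MvPolynomial.totalDegree_add _ _).trans (max_le_max (hD ζ) (hD' ζ))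
  | mul_X p i hp =>
    obtain ⟨D, hD⟩ := hp
    refine ⟨D + 1, fun ζ => ?_⟩
    rw [polarSlice, map_mul, MvPolynomial.aeval_X]
    refine (MvPolynomial.totalDegree_mul _ _).trans (add_le_add (hD ζ) ?_)
    cases i <;> simp

/-- A one-parameter family of leaves of a Levi-flat hypersurface near the point `q`, written as
graphs `y ↦ y + η s y v` in the direction `v`. The leaf with parameter `s` meets the line
`q + ℂ v` in the point `q + x s v`, and it satisfies a polynomial equation of degree at most `D`. -/
structure IsLeafFamily (X : Set (Fin n → ℂ)) (q v : Fin n → ℂ) (r δ : ℝ)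
    (η : ℝ → (Fin n → ℂ) → ℂ) (x : ℝ → ℂ) (D : ℕ) : Prop where
  r_pos : 0 < r
  δ_pos : 0 < δ
  holomorphic : ∀ s ∈ Set.Ioo (-δ) δ, AnalyticOnNhd ℂ (η s) (Metric.ball q r)
  analytic : ∀ y ∈ Metric.ball q r, AnalyticOnNhd ℝ (fun s => η s y) (Set.Ioo (-δ) δ)
  mem : ∀ s ∈ Set.Ioo (-δ) δ, ∀ y ∈ Metric.ball q r, y + η s y • v ∈ X
  meets : ∀ s ∈ Set.Ioo (-δ) δ, q + x s • v ∈ Metric.ball q r ∧ η s (q + x s • v) = 0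
  injective : Function.Injective x
  transversal : ∃ t : ℂ, q + t • v ∉ X
  exists_equation : ∀ s ∈ Set.Ioo (-δ) δ, ∃ f : MvPolynomial (Fin n) ℂ, f ≠ 0 ∧
    f.totalDegree ≤ D ∧ ∀ y ∈ Metric.ball q r, MvPolynomial.eval (y + η s y • v) f = 0

/-- The leaves through the points of a real curve in `X ∩ (q + ℂ v)` form a leaf family. The leaf
through `p` is the Segre variety `{R(·, p̄) = 0}`, so the degree of `R` bounds the degrees of the
equations. -/
theorem exists_isLeafFamily {X : Set (Fin n → ℂ)} (hX : IsLeviFlat X)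
    {R : MvPolynomial (Fin n ⊕ Fin n) ℂ} (hR : IsRealPolar R) {q v : Fin n → ℂ} (hq : q ∈ X)
    (hXR : ∀ᶠ z in 𝓝 q, z ∈ X ↔ polarEval R z (star z) = 0)
    (hv : polarEval (polarDeriv v (star v) R) q (star q) ≠ 0) :
    ∃ r δ η x D, IsLeafFamily X q v r δ η x D := by
  obtain ⟨r, hr, ξ, hξa, hξR, hξX⟩ := exists_leaf_graph hX hR hq hXR hv
  have hq0 : polarFun R q = 0 := hR.polarFun_eq_zero_iff.2 (hXR.self_of_nhds.1 hq)
  have hfd : fderiv ℝ (polarFun R) q v ≠ 0 := by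
    rw [fderiv_polarFun]
    exact (hR.polarDeriv v).polarFun_eq_zero_iff.not.2 hv
  have hfr : HasFDerivAt (polarFun R) (fderiv ℝ (polarFun R) q) q :=
    (analyticAt_polarFun R q).differentiableAt.hasFDerivAt
  have hder : HasDerivAt (fun x : ℝ => polarFun R (q + (x : ℂ) • v))
      (fderiv ℝ (polarFun R) q v) 0 := by
    have h1 : HasDerivAt (fun x : ℝ => q + (x : ℂ) • v) v 0 := by
      have h : HasDerivAt (fun x : ℝ => (x : ℂ)) 1 0 := Complex.ofRealCLM.hasDerivAt
      simpa using (h.smul_const v).const_add q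
    have hd : HasFDerivAt (polarFun R) (fderiv ℝ (polarFun R) q) (q + ((0 : ℝ) : ℂ) • v) := by
      simpa using hfr
    exact hd.comp_hasDerivAt (0 : ℝ) h1
  -- the curve `q + (θ(s) + i s) v` in the hypersurface
  set L : ℝ × ℝ →L[ℝ] ℂ := Complex.ofRealCLM.comp (ContinuousLinearMap.snd ℝ ℝ ℝ) +
    Complex.I • Complex.ofRealCLM.comp (ContinuousLinearMap.fst ℝ ℝ ℝ)
  have hL : ∀ u, L u = (u.2 : ℂ) + Complex.I * (u.1 : ℂ) := fun u => by simp [L]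
  have hLa : AnalyticAt ℝ (fun u : ℝ × ℝ => q + L u • v) (0, 0) :=
    analyticAt_const.add ((L.analyticAt _).smul analyticAt_const)
  obtain ⟨θ, hθa, hθ0, hθR, -⟩ := exists_analytic_implicit (𝕜 := ℝ) (𝕜' := ℝ)
    (F := fun u : ℝ × ℝ => polarFun R (q + L u • v)) (e₀ := 0) (x₀ := 0)
    ((analyticAt_polarFun R _).comp_of_eq hLa rfl) (by simpa [hL] using hq0)
    (by simpa [hL] using hder) hfd
  set x : ℝ → ℂ := fun s => (θ s : ℂ) + Complex.I * s
  set γ : ℝ → Fin n → ℂ := fun s => q + x s • v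
  have hxa : ∀ s, AnalyticAt ℝ θ s → AnalyticAt ℝ x s := fun s hs =>
    (((Complex.ofRealCLM.analyticAt _).comp_of_eq hs rfl)).add
      (analyticAt_const.mul (Complex.ofRealCLM.analyticAt s))
  have hγa : ∀ s, AnalyticAt ℝ θ s → AnalyticAt ℝ γ s := fun s hs =>
    analyticAt_const.add ((hxa s hs).smul analyticAt_const)
  have hγ0 : γ 0 = q := by simp [γ, x, hθ0]
  have hγt : Tendsto γ (𝓝 0) (𝓝 q) := by
    have := (hγa 0 hθa).continuousAt.tendsto
    rwa [hγ0] at this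
  have hγX : ∀ᶠ s in 𝓝 0, γ s ∈ X := by
    filter_upwards [hθR, hγt.eventually hXR] with s hs1 hs2
    rw [hs2]
    refine hR.polarFun_eq_zero_iff.1 ?_
    simpa [γ, x, hL] using hs1
  obtain ⟨δ, hδ, hball⟩ := Metric.eventually_nhds_iff_ball.1
    (hθa.eventually_analyticAt.and (hγX.and (hγt.eventually (Metric.ball_mem_nhds q hr))))
  have hIoo : ∀ s ∈ Set.Ioo (-δ) δ, s ∈ Metric.ball (0 : ℝ) δ := fun s hs => by
    rw [Real.ball_eq_Ioo]
    simpa using hs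
  have hstar : ∀ s ∈ Set.Ioo (-δ) δ, star (γ s) ∈ Metric.ball (star q) r := by
    intro s hs
    have h : dist (γ s) q < r := (hball s (hIoo s hs)).2.2
    rw [dist_eq_norm] at h
    rw [mem_ball_iff_norm, ← star_sub, norm_star]
    exact h
  obtain ⟨D, hD⟩ := exists_totalDegree_polarSlice_le R
  refine ⟨r, δ, fun s y => ξ (y, star (γ s)), x, D, hr, hδ, fun s hs y hy => ?_,
    fun y hy s hs => ?_,
    fun s hs => (hξX _ (hball s (hIoo s hs)).2.2 (hball s (hIoo s hs)).2.1).2,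
    fun s hs => ⟨(hball s (hIoo s hs)).2.2,
      (hξX _ (hball s (hIoo s hs)).2.2 (hball s (hIoo s hs)).2.1).1⟩,
    fun s t hst => ?_, ?_,
    fun s hs => ⟨polarSlice R (star (γ s)), fun h0 => ?_, hD _, fun y hy => ?_⟩⟩
  · exact (hξa (y, star (γ s)) ⟨hy, hstar s hs⟩).comp_of_eq
      (analyticAt_id.prod analyticAt_const) rfl
  · have h1 : AnalyticAt ℝ (fun s => star (γ s)) s :=
      (((starL' ℝ : (Fin n → ℂ) ≃L[ℝ] (Fin n → ℂ)) :
        (Fin n → ℂ) →L[ℝ] (Fin n → ℂ)).analyticAt (γ s)).comp_of_eq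
        (hγa s (hball s (hIoo s hs)).1) rfl
    exact ((hξa (y, star (γ s)) ⟨hy, hstar s hs⟩).restrictScalars (𝕜 := ℝ)).comp_of_eq
      (analyticAt_const.prod h1) rfl
  · have := congrArg Complex.im hst
    simpa [x] using this
  · by_contra! hall
    have hc : Tendsto (fun x : ℝ => q + (x : ℂ) • v) (𝓝 0) (𝓝 q) := by
      have : Continuous fun x : ℝ => q + (x : ℂ) • v := by fun_prop
      simpa using this.tendsto 0
    have h0 : (fun x : ℝ => polarFun R (q + (x : ℂ) • v)) =ᶠ[𝓝 0] fun _ => 0 := by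
      filter_upwards [hc.eventually hXR] with t ht
      exact hR.polarFun_eq_zero_iff.2 (ht.1 (hall t))
    exact hfd ((hder.congr_of_eventuallyEq h0.symm).unique (hasDerivAt_const 0 0))
  · obtain ⟨-, hne⟩ := hξR q (Metric.mem_ball_self hr) _ (hstar s hs)
    have h1 := hasDerivAt_polarEval (𝕜 := ℂ) (z := fun x : ℂ => q + x • v)
      (ζ := fun _ => star (γ s)) (z' := v) (ζ' := 0) (t := 0) (fun i => by
        simpa using ((hasDerivAt_id (0 : ℂ)).mul_const (v i)).const_add (q i))
      (fun i => by simpa using hasDerivAt_const (0 : ℂ) (star (γ s) i)) R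
    simp only [← eval_polarSlice R, h0, map_zero] at h1
    have h2 := h1.unique (hasDerivAt_const (0 : ℂ) (0 : ℂ))
    rw [zero_smul, add_zero] at h2
    exact hne h2
  · rw [eval_polarSlice]
    exact (hξR y hy _ (hstar s hs)).1

end Family

/-! ### Forms -/

section Forms

variable {N d : ℕ}

/-- The form of degree `d` in `N` variables with coefficients `a`. -/
def formOf (a : Sym (Fin N) d → ℂ) : MvPolynomial (Fin N) ℂ :=
  ∑ α, MvPolynomial.C (a α) * ((α : Multiset (Fin N)).map MvPolynomial.X).prod

@[simp]
theorem eval_formOf (a : Sym (Fin N) d → ℂ) (z : Fin N → ℂ) :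
    MvPolynomial.eval z (formOf a) = ∑ α, a α * monomialValue α z := by
  simp [formOf, monomialValue, map_multiset_prod, Multiset.map_map]

theorem prod_map_X_eq_monomial (s : Multiset (Fin N)) :
    (s.map (MvPolynomial.X (R := ℂ))).prod = MvPolynomial.monomial (Multiset.toFinsupp s) 1 := by
  induction s using Multiset.induction_on with
  | empty => simp
  | cons i s ih =>
    rw [Multiset.map_cons, Multiset.prod_cons, ih, MvPolynomial.X, MvPolynomial.monomial_mul,
      one_mul, ← Multiset.singleton_add, map_add, Multiset.toFinsupp_singleton]

theorem coeff_formOf (a : Sym (Fin N) d → ℂ) (m : Fin N →₀ ℕ) :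
    MvPolynomial.coeff m (formOf a) =
      ∑ α : Sym (Fin N) d, if Multiset.toFinsupp (α : Multiset (Fin N)) = m then a α else 0 := by
  simp only [formOf, prod_map_X_eq_monomial, MvPolynomial.coeff_sum, MvPolynomial.coeff_C_mul,
    MvPolynomial.coeff_monomial, mul_ite, mul_one, mul_zero]

theorem isHomogeneous_formOf (a : Sym (Fin N) d → ℂ) : (formOf a).IsHomogeneous d := by
  refine MvPolynomial.IsHomogeneous.sum _ _ _ fun α _ => ?_
  rw [prod_map_X_eq_monomial, MvPolynomial.C_mul_monomial, mul_one]
  refine MvPolynomial.isHomogeneous_monomial _ ?_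
  have h1 : (Multiset.toFinsupp (α : Multiset (Fin N))).degree =
      (α : Multiset (Fin N)).card := by
    have h : ∀ s : Multiset (Fin N), (Multiset.toFinsupp s).degree = s.card := fun s => by
      induction s using Multiset.induction_on with
      | empty => simp
      | cons i s ih =>
        rw [← Multiset.singleton_add, map_add, map_add, ih, Multiset.toFinsupp_singleton,
          Finsupp.degree_single, Multiset.card_add, Multiset.card_singleton]
    exact h _
  rw [h1]
  exact α.2

theorem coeff_formOf_self (a : Sym (Fin N) d → ℂ) (β : Sym (Fin N) d) :
    MvPolynomial.coeff (Multiset.toFinsupp (β : Multiset (Fin N))) (formOf a) = a β := by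
  rw [coeff_formOf, Finset.sum_eq_single β]
  · simp
  · intro α _ hαβ
    rw [if_neg]
    intro h
    exact hαβ (Subtype.ext (Multiset.toFinsupp.injective h))
  · simp

theorem formOf_ne_zero {a : Sym (Fin N) d → ℂ} (ha : a ≠ 0) : formOf a ≠ 0 := by
  intro h
  apply ha
  funext β
  rw [← coeff_formOf_self a β, h, MvPolynomial.coeff_zero, Pi.zero_apply]

theorem exists_formOf_eq {p : MvPolynomial (Fin N) ℂ} (hp : p.IsHomogeneous d) :
    ∃ a : Sym (Fin N) d → ℂ, formOf a = p := by
  refine ⟨fun α => MvPolynomial.coeff (Multiset.toFinsupp (α : Multiset (Fin N))) p, ?_⟩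
  ext m
  by_cases hm : (Finsupp.toMultiset m).card = d
  · have := coeff_formOf_self (d := d)
      (fun α => MvPolynomial.coeff (Multiset.toFinsupp (α : Multiset (Fin N))) p)
      ⟨Finsupp.toMultiset m, hm⟩
    simpa using this
  · have h1 : ∀ q : MvPolynomial (Fin N) ℂ, q.IsHomogeneous d → MvPolynomial.coeff m q = 0 := by
      intro q hq
      refine hq.coeff_eq_zero fun h => hm ?_
      rw [Finsupp.card_toMultiset]
      exact h
    rw [h1 _ (isHomogeneous_formOf _), h1 _ hp]

end Forms

/-! ### Algebraicity of the leaves -/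

theorem analyticAt_eval {𝕜 E σ : Type*} [NontriviallyNormedField 𝕜] [NormedAlgebra 𝕜 ℂ]
    [NormedAddCommGroup E] [NormedSpace 𝕜 E] {z : E → σ → ℂ} {e : E}
    (hz : ∀ i, AnalyticAt 𝕜 (fun e => z e i) e) (p : MvPolynomial σ ℂ) :
    AnalyticAt 𝕜 (fun e => MvPolynomial.eval (z e) p) e := by
  simpa only [MvPolynomial.aeval_eq_eval] using AnalyticAt.aeval_mvPolynomial hz p

/-- The homogenization of a polynomial of degree at most `D` in the affine chart `i`. -/
theorem exists_homogenization {n D : ℕ} (i : Fin (n + 1)) {f : MvPolynomial (Fin n) ℂ}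
    (hf : f.totalDegree ≤ D) : ∃ h : MvPolynomial (Fin (n + 1)) ℂ, h.IsHomogeneous D ∧
      ∀ w, MvPolynomial.eval (affineLift i w) h = MvPolynomial.eval w f := by
  refine ⟨∑ j ∈ Finset.range (D + 1), MvPolynomial.X i ^ (D - j) *
    MvPolynomial.rename i.succAbove (MvPolynomial.homogeneousComponent j f), ?_, fun w => ?_⟩
  · refine MvPolynomial.IsHomogeneous.sum _ _ _ fun j hj => ?_
    have h1 := ((MvPolynomial.isHomogeneous_X ℂ i).pow (D - j)).mul
      ((MvPolynomial.homogeneousComponent_isHomogeneous j f).rename_isHomogeneous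
        (f := i.succAbove))
    have h2 : 1 * (D - j) + j = D := by
      have := Finset.mem_range.1 hj
      omega
    rwa [h2] at h1
  · have h1 : affineLift i w ∘ i.succAbove = w := by
      funext l
      simp
    simp only [map_sum, map_mul, map_pow, MvPolynomial.eval_X, affineLift_apply_same, one_pow,
      one_mul, MvPolynomial.eval_rename, h1]
    rw [← map_sum]
    congr 1
    conv_rhs => rw [← MvPolynomial.sum_homogeneousComponent f]
    symm
    refine Finset.sum_subset (fun j hj => ?_) fun j _ hj => ?_
    · have := Finset.mem_range.1 hj
      exact Finset.mem_range.2 (by omega)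
    · refine MvPolynomial.homogeneousComponent_eq_zero _ _ ?_
      have : ¬ j < f.totalDegree + 1 := fun h => hj (Finset.mem_range.2 h)
      omega

/-- The parametrization of the cone over the graph `y ↦ y + ξ y v` in the chart `i`. -/
def graphCone {n : ℕ} (i : Fin (n + 1)) (v : Fin n → ℂ) (ξ : (Fin n → ℂ) → ℂ)
    (u : ℂ × (Fin n → ℂ)) : Fin (n + 1) → ℂ :=
  u.1 • affineLift i (u.2 + ξ u.2 • v)

section GraphCone

variable {n : ℕ} {i : Fin (n + 1)} {v q : Fin n → ℂ} {ξ : (Fin n → ℂ) → ℂ} {r : ℝ}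

theorem affineLift_add_smul (i : Fin (n + 1)) (w v : Fin n → ℂ) (t : ℂ) :
    affineLift i (w + t • v) =
      affineLift i w + t • Fin.insertNth (α := fun _ => ℂ) i 0 v := by
  funext j
  refine Fin.succAboveCases i ?_ (fun l => ?_) j <;> simp

theorem analyticAt_affineLift (i : Fin (n + 1)) (w : Fin n → ℂ) :
    AnalyticAt ℂ (affineLift (n := n) i) w := by
  refine analyticAt_pi_iff.2 fun j => ?_
  refine Fin.succAboveCases i ?_ (fun l => ?_) j
  · simpa using analyticAt_const
  · have h : (fun x : Fin n → ℂ => affineLift i x (i.succAbove l)) = fun x => x l :=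
      funext fun x => affineLift_apply_succAbove i x l
    rw [h]
    exact (ContinuousLinearMap.proj (R := ℂ) (φ := fun _ : Fin n => ℂ) l).analyticAt w

theorem analyticAt_graphCone (hξ : AnalyticOnNhd ℂ ξ (Metric.ball q r)) {u : ℂ × (Fin n → ℂ)}
    (hu : u.2 ∈ Metric.ball q r) : AnalyticAt ℂ (graphCone i v ξ) u := by
  have h1 : AnalyticAt ℂ (fun u : ℂ × (Fin n → ℂ) => u.2 + ξ u.2 • v) u :=
    analyticAt_snd.add (((hξ _ hu).comp_of_eq analyticAt_snd rfl).smul analyticAt_const)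
  exact analyticAt_fst.smul ((analyticAt_affineLift i _).comp_of_eq h1 rfl)

/-- The polynomials that vanish on the cone over an irreducible graph form a prime ideal. -/
theorem vanishes_or_vanishes_of_mul (hξ : AnalyticOnNhd ℂ ξ (Metric.ball q r))
    {A B : MvPolynomial (Fin (n + 1)) ℂ}
    (h : ∀ u ∈ univ ×ˢ Metric.ball q r, MvPolynomial.eval (graphCone i v ξ u) (A * B) = 0) :
    (∀ u ∈ univ ×ˢ Metric.ball q r, MvPolynomial.eval (graphCone i v ξ u) A = 0) ∨
      ∀ u ∈ univ ×ˢ Metric.ball q r, MvPolynomial.eval (graphCone i v ξ u) B = 0 := by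
  have ha : ∀ p : MvPolynomial (Fin (n + 1)) ℂ, AnalyticOnNhd ℂ
      (fun u => MvPolynomial.eval (graphCone i v ξ u) p) (univ ×ˢ Metric.ball q r) := fun p u hu =>
    analyticAt_eval (fun j => analyticAt_pi_iff.1 (analyticAt_graphCone hξ hu.2) j) p
  have hc : IsPreconnected ((univ : Set ℂ) ×ˢ Metric.ball q r) :=
    isPreconnected_univ.prod (convex_ball q r).isPreconnected
  by_contra! hAB
  obtain ⟨⟨u, hu, hAu⟩, b, hb, hBb⟩ := hAB
  refine hBb ((ha B).eqOn_zero_of_preconnected_of_eventuallyEq_zero hc hu ?_ hb)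
  have hopen : IsOpen ((univ : Set ℂ) ×ˢ Metric.ball q r) := isOpen_univ.prod Metric.isOpen_ball
  filter_upwards [(ha A u hu).continuousAt.eventually_ne hAu, hopen.mem_nhds hu] with y hy hyD
  have := h y hyD
  rw [map_mul] at this
  exact (mul_eq_zero.1 this).resolve_left hy

/-- The homogeneous components of a polynomial that vanishes on a cone vanish on it. -/
theorem exists_homogeneous_vanishing {p : MvPolynomial (Fin (n + 1)) ℂ} (hp : p ≠ 0)
    (h : ∀ u ∈ univ ×ˢ Metric.ball q r, MvPolynomial.eval (graphCone i v ξ u) p = 0) :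
    ∃ e ≤ p.totalDegree, ∃ b : Sym (Fin (n + 1)) e → ℂ, b ≠ 0 ∧ ∀ y ∈ Metric.ball q r,
      MvPolynomial.eval (affineLift i (y + ξ y • v)) (formOf b) = 0 := by
  obtain ⟨e, he, hne⟩ : ∃ e ≤ p.totalDegree, MvPolynomial.homogeneousComponent e p ≠ 0 := by
    by_contra! hall
    refine hp ?_
    rw [← MvPolynomial.sum_homogeneousComponent p]
    exact Finset.sum_eq_zero fun j hj => hall j (by
      have := Finset.mem_range.1 hj
      omega)
  obtain ⟨b, hb⟩ := exists_formOf_eq (MvPolynomial.homogeneousComponent_isHomogeneous e p)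
  refine ⟨e, he, b, fun h0 => hne ?_, fun y hy => ?_⟩
  · rw [← hb, h0]
    simp [formOf]
  · rw [hb]
    set w := affineLift i (y + ξ y • v)
    set g : Polynomial ℂ := ∑ j ∈ Finset.range (p.totalDegree + 1),
      Polynomial.C (MvPolynomial.eval w (MvPolynomial.homogeneousComponent j p)) *
        Polynomial.X ^ j
    have hg : g = 0 := by
      refine Polynomial.funext fun c => ?_
      have h1 : MvPolynomial.eval (c • w) p = 0 := h (c, y) ⟨mem_univ _, hy⟩
      rw [← MvPolynomial.sum_homogeneousComponent p, map_sum] at h1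
      rw [Polynomial.eval_finsetSum, Polynomial.eval_zero, ← h1]
      refine Finset.sum_congr rfl fun j _ => ?_
      rw [eval_smul_of_isHomogeneous (MvPolynomial.homogeneousComponent_isHomogeneous j p)]
      rw [Polynomial.eval_mul, Polynomial.eval_C, Polynomial.eval_pow, Polynomial.eval_X, mul_comm]
    have h2 := congrArg (fun g => Polynomial.coeff g e) hg
    simpa [g, Polynomial.finsetSum_coeff, Polynomial.coeff_C_mul, Polynomial.coeff_X_pow,
      Finset.sum_ite_eq, Nat.lt_succ_of_le he] using h2

/-- A form of least degree among those that vanish on a graph is irreducible. -/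
theorem irreducible_formOf (hr : 0 < r) (hξ : AnalyticOnNhd ℂ ξ (Metric.ball q r)) {d : ℕ}
    {a : Sym (Fin (n + 1)) d → ℂ} (ha : a ≠ 0)
    (hv : ∀ y ∈ Metric.ball q r, MvPolynomial.eval (affineLift i (y + ξ y • v)) (formOf a) = 0)
    (hmin : ∀ e < d, ∀ b : Sym (Fin (n + 1)) e → ℂ, b ≠ 0 → ¬ ∀ y ∈ Metric.ball q r,
      MvPolynomial.eval (affineLift i (y + ξ y • v)) (formOf b) = 0) :
    0 < d ∧ Irreducible (formOf a) := by
  have hdeg : (formOf a).totalDegree = d :=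
    (isHomogeneous_formOf a).totalDegree (formOf_ne_zero ha)
  have hnc : ∀ c : ℂ, formOf a ≠ MvPolynomial.C c := by
    intro c hc
    have h1 := hv q (Metric.mem_ball_self hr)
    rw [hc, MvPolynomial.eval_C] at h1
    exact formOf_ne_zero ha (by rw [hc, h1, map_zero])
  have hd : 0 < d := by
    refine Nat.pos_of_ne_zero fun h0 => hnc _
      (MvPolynomial.totalDegree_eq_zero_iff_eq_C.1 (hdeg.trans h0))
  have hcone : ∀ u ∈ univ ×ˢ Metric.ball q r,
      MvPolynomial.eval (graphCone i v ξ u) (formOf a) = 0 := fun u hu => by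
    rw [graphCone, eval_smul_of_isHomogeneous (isHomogeneous_formOf a), hv _ hu.2, mul_zero]
  have hunit : ∀ A B : MvPolynomial (Fin (n + 1)) ℂ, formOf a = A * B →
      (∀ u ∈ univ ×ˢ Metric.ball q r, MvPolynomial.eval (graphCone i v ξ u) A = 0) →
      IsUnit B := by
    intro A B hAB hA
    have hA0 : A ≠ 0 := fun h => formOf_ne_zero ha (by rw [hAB, h, zero_mul])
    have hB0 : B ≠ 0 := fun h => formOf_ne_zero ha (by rw [hAB, h, mul_zero])
    obtain ⟨e, he, b, hb, hbv⟩ := exists_homogeneous_vanishing hA0 hA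
    have hed : d ≤ e := by
      by_contra! hlt
      exact hmin e hlt b hb hbv
    rw [hAB, MvPolynomial.totalDegree_mul_of_isDomain hA0 hB0] at hdeg
    have hB : B.totalDegree = 0 := by omega
    rw [MvPolynomial.totalDegree_eq_zero_iff_eq_C] at hB
    rw [hB] at hB0 ⊢
    refine IsUnit.map _ (IsUnit.mk0 _ fun h => hB0 ?_)
    rw [h, map_zero]
  refine ⟨hd, ⟨fun hu => ?_, fun A B hAB => ?_⟩⟩
  · obtain ⟨c, -, hc⟩ := MvPolynomial.isUnit_iff_eq_C_of_isReduced.1 hu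
    exact hnc c hc
  · rcases vanishes_or_vanishes_of_mul hξ (A := A) (B := B) (by rwa [← hAB]) with h | h
    · exact .inr (hunit A B hAB h)
    · exact .inl (hunit B A (by rw [hAB, mul_comm]) h)

/-- The translates of the cone over a graph in the direction of the graph are Zariski dense. -/
theorem eq_zero_of_vanishing_on_translates (hr : 0 < r) {p : MvPolynomial (Fin (n + 1)) ℂ}
    (h : ∀ u ∈ univ ×ˢ Metric.ball q r, ∀ x : ℂ, MvPolynomial.eval
      (graphCone i v ξ u + x • Fin.insertNth (α := fun _ => ℂ) i 0 v) p = 0) : p = 0 := by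
  refine mvPolynomial_eq_zero_of_eventually (w := affineLift i q) ?_
  have h1 : affineLift i q i ≠ 0 := by simp
  have h2 := (analyticAt_dehomog h1).continuousAt.tendsto
  rw [dehomog_affineLift] at h2
  filter_upwards [(continuous_apply i).continuousAt.eventually_ne h1,
    h2.eventually (Metric.ball_mem_nhds q hr)] with Z hZ hZq
  have h3 := h (Z i, dehomog i Z) ⟨mem_univ _, hZq⟩ (-(Z i * ξ (dehomog i Z)))
  have h4 : graphCone i v ξ (Z i, dehomog i Z) +
      (-(Z i * ξ (dehomog i Z))) • Fin.insertNth (α := fun _ => ℂ) i 0 v = Z := by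
    rw [graphCone, affineLift_add_smul, affineLift_dehomog hZ, smul_add, smul_smul, smul_smul,
      mul_inv_cancel₀ hZ, one_smul, add_assoc, ← add_smul, add_neg_cancel, zero_smul, add_zero]
  rwa [h4] at h3

/-- If an irreducible form vanishes on a graph contained in `H`, then its zero set is contained in
the cone over `H`. -/
theorem mem_cone_of_vanishing {H : Set (CP n)} (hH : IsAlgebraic H) (hr : 0 < r)
    (hξ : AnalyticOnNhd ℂ ξ (Metric.ball q r))
    (hmem : ∀ y ∈ Metric.ball q r, chart i (y + ξ y • v) ∈ H) {A : MvPolynomial (Fin (n + 1)) ℂ}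
    (hA : Irreducible A)
    (hv : ∀ u ∈ univ ×ˢ Metric.ball q r, MvPolynomial.eval (graphCone i v ξ u) A = 0)
    {Z : Fin (n + 1) → ℂ} (hZ : MvPolynomial.eval Z A = 0) : Z ∈ cone H := by
  obtain ⟨V, ⟨F, hF⟩, hVc, hHV⟩ := hH
  have hcone : ∀ {z : Fin (n + 1) → ℂ}, z ≠ 0 → z ∈ cone H → z ∈ V := by
    intro z hz hzc
    rw [mem_cone_iff hz, hHV] at hzc
    obtain ⟨z', hz', hV, he⟩ := hzc
    obtain ⟨c, hc⟩ := (Projectivization.mk_eq_mk_iff' ℂ z z' hz hz').1 he.symm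
    rw [← hc]
    exact hVc _ hV c
  have hg : ∀ u ∈ (univ : Set ℂ) ×ˢ Metric.ball q r, graphCone i v ξ u ∈ V := fun u hu =>
    hVc _ (hcone (affineLift_ne_zero i _) (chart_mem_iff.1 (hmem _ hu.2))) _
  intro hZ0
  rw [hHV]
  refine ⟨Z, hZ0, ?_, rfl⟩
  rw [hF]
  intro f hf
  obtain ⟨R, hR⟩ := exists_polarEval_eq f
  have hreal : IsRealPolar R := fun z => by rw [hR, Complex.ofReal_im]
  have hdvd : ∀ D : MvPolynomial (Fin (n + 1)) ℂ,
      (∀ u ∈ univ ×ˢ Metric.ball q r, MvPolynomial.eval (graphCone i v ξ u) D = 0) →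
      MvPolynomial.eval Z D = 0 := by
    intro D hD
    obtain ⟨E, hE⟩ := dvd_of_vanishing hA (M := graphCone i v ξ '' (univ ×ˢ Metric.ball q r))
      (v := Fin.insertNth (α := fun _ => ℂ) i 0 v) (T := univ) (D := D)
      (fun p hp => eq_zero_of_vanishing_on_translates hr fun u hu x =>
        hp _ (mem_image_of_mem _ hu) x (mem_univ _))
      (by rintro _ ⟨u, hu, rfl⟩; exact hv u hu) (by rintro _ ⟨u, hu, rfl⟩; exact hD u hu)
    rw [hE, map_mul, hZ, zero_mul]
  have hpol := polarization (D := (univ : Set ℂ) ×ˢ Metric.ball q r)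
    (isOpen_univ.prod Metric.isOpen_ball) (convex_univ.prod (convex_ball q r))
    (g := graphCone i v ξ) (fun u hu =>
      (analyticAt_graphCone hξ hu.2).differentiableAt.differentiableWithinAt)
    (Q := fun p => polarEval R p.1 p.2) (fun a _ b _ => by
      refine (analyticAt_polarEval (fun j => ?_) (fun j => ?_) R).differentiableAt
      · exact analyticAt_pi_iff.1 analyticAt_fst j
      · exact analyticAt_pi_iff.1 analyticAt_snd j)
    (fun a ha => by
      have h1 := hg a ha
      rw [hF] at h1
      change polarEval R _ (star _) = 0
      rw [hR, h1 f hf, Complex.ofReal_zero])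
  -- extend the vanishing from the leaf to the zero set of `A`, first in `z`, then in `z̄`
  have h1 : ∀ b ∈ (univ : Set ℂ) ×ˢ Metric.ball q r,
      polarEval R Z (star (graphCone i v ξ b)) = 0 := fun b hb => by
    rw [← eval_polarSlice]
    refine hdvd _ fun a ha => ?_
    rw [eval_polarSlice]
    exact hpol a ha b hb
  have h2 : polarEval R Z (star Z) = 0 := by
    rw [← eval_polarSlice]
    refine hdvd _ fun b hb => ?_
    have h3 := hreal.star_polarEval Z (star (graphCone i v ξ b))
    rw [h1 b hb, star_zero, star_star] at h3
    rw [eval_polarSlice, ← h3]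
  rw [hR] at h2
  exact_mod_cast h2

end GraphCone

section AlgebraicLeaves

variable {n : ℕ}

/-- A one-parameter family of complex hypersurfaces contained in `H`: the zero sets of the forms
with coefficients `a s`, which are irreducible, depend analytically on `s` in the open set `I`, and
of which only finitely many have the same zero set. -/
structure AlgebraicLeaves (H : Set (CP n)) (d : ℕ) (I : Set ℝ)
    (a : ℝ → Sym (Fin (n + 1)) d → ℂ) : Prop where
  isOpen : IsOpen I
  nonempty : I.Nonempty
  degree_pos : 0 < d
  analytic : AnalyticOnNhd ℝ a I
  irreducible : ∀ s ∈ I, Irreducible (formOf (a s))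
  mem_cone : ∀ s ∈ I, ∀ Z, MvPolynomial.eval Z (formOf (a s)) = 0 → Z ∈ cone H
  finite : ∀ t ∈ I, {s ∈ I | formOf (a s) ∣ formOf (a t)}.Finite

/-- The leaf with parameter `s` satisfies a homogeneous equation of degree `e`. -/
def HasLeafEquation (i : Fin (n + 1)) (q v : Fin n → ℂ) (r : ℝ) (η : ℝ → (Fin n → ℂ) → ℂ) (e : ℕ)
    (s : ℝ) : Prop :=
  ∃ a : Sym (Fin (n + 1)) e → ℂ, a ≠ 0 ∧ ∀ y ∈ Metric.ball q r,
    MvPolynomial.eval (affineLift i (y + η s y • v)) (formOf a) = 0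

variable {H : Set (CP n)} {i : Fin (n + 1)} {q v : Fin n → ℂ} {r δ : ℝ}
  {η : ℝ → (Fin n → ℂ) → ℂ} {x : ℝ → ℂ} {D : ℕ}

theorem IsLeafFamily.analyticAt_monomialValue (h : IsLeafFamily (chart i ⁻¹' H) q v r δ η x D)
    {s : ℝ} (hs : s ∈ Ioo (-δ) δ) {y : Fin n → ℂ} (hy : y ∈ Metric.ball q r) {e : ℕ}
    (α : Sym (Fin (n + 1)) e) :
    AnalyticAt ℝ (fun s => monomialValue α (affineLift i (y + η s y • v))) s := by
  have h1 : AnalyticAt ℝ (fun s => affineLift i (y + η s y • v)) s :=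
    ((analyticAt_affineLift i _).restrictScalars (𝕜 := ℝ)).comp_of_eq
      (analyticAt_const.add ((h.analytic y hy s hs).smul analyticAt_const)) rfl
  have h2 := analyticAt_eval (fun j => analyticAt_pi_iff.1 h1 j)
    ((α : Multiset (Fin (n + 1))).map MvPolynomial.X).prod
  simpa [monomialValue, map_multiset_prod, Multiset.map_map] using h2

/-- Not satisfying an equation of degree `e` is an open condition on the leaf, by compactness of the
unit sphere of coefficient vectors. -/
theorem IsLeafFamily.eventually_not_hasLeafEquation
    (h : IsLeafFamily (chart i ⁻¹' H) q v r δ η x D) {s : ℝ} (hs : s ∈ Ioo (-δ) δ) {e : ℕ}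
    (hne : ¬ HasLeafEquation i q v r η e s) : ∀ᶠ t in 𝓝 s, ¬ HasLeafEquation i q v r η e t := by
  have hK : IsCompact (Metric.sphere (0 : Sym (Fin (n + 1)) e → ℂ) 1) := isCompact_sphere _ _
  have key := hK.eventually_forall_of_forall_eventually (x₀ := s)
    (P := fun t b => ∃ y ∈ Metric.ball q r,
      ∑ α, b α * monomialValue α (affineLift i (y + η t y • v)) ≠ 0) ?_
  · filter_upwards [key] with t ht
    rintro ⟨a, ha, hv⟩
    obtain ⟨y, hy, hne⟩ := ht (((‖a‖⁻¹ : ℝ) : ℂ) • a) (by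
      rw [mem_sphere_zero_iff_norm, norm_smul, Complex.norm_real, norm_inv, norm_norm,
        inv_mul_cancel₀ (norm_ne_zero_iff.2 ha)])
    refine hne ?_
    have h1 := hv y hy
    rw [eval_formOf] at h1
    simp only [Pi.smul_apply, smul_eq_mul, mul_assoc, ← Finset.mul_sum, h1, mul_zero]
  · intro b hb
    have hb0 : b ≠ 0 := by
      rintro rfl
      simp at hb
    have : ∃ y ∈ Metric.ball q r,
        ∑ α, b α * monomialValue α (affineLift i (y + η s y • v)) ≠ 0 := by
      by_contra! hall
      exact hne ⟨b, hb0, fun y hy => by rw [eval_formOf, hall y hy]⟩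
    obtain ⟨y, hy, hyne⟩ := this
    have hc : ContinuousAt (fun z : ℝ × (Sym (Fin (n + 1)) e → ℂ) =>
        ∑ α, z.2 α * monomialValue α (affineLift i (y + η z.1 y • v))) (s, b) := by
      refine tendsto_finsetSum _ fun α _ => ?_
      have h1 : ContinuousAt (fun z : ℝ × (Sym (Fin (n + 1)) e → ℂ) => z.2 α) (s, b) :=
        ((continuous_apply α).comp continuous_snd).continuousAt
      exact h1.mul ((h.analyticAt_monomialValue hs hy α).continuousAt.comp_of_eq
        continuousAt_fst rfl)
    filter_upwards [hc.eventually_ne hyne] with z hz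
    exact ⟨y, hy, hz⟩

/-- In the interior of the set of parameters of the leaves of least degree, the coefficients of the
equation can be chosen to depend analytically on the parameter. -/
theorem IsLeafFamily.exists_equation_of_minimal_degree
    (h : IsLeafFamily (chart i ⁻¹' H) q v r δ η x D) :
    ∃ (d : ℕ) (J : Set ℝ) (a : ℝ → Sym (Fin (n + 1)) d → ℂ), J ⊆ Ioo (-δ) δ ∧ IsOpen J ∧
      J.Nonempty ∧ AnalyticOnNhd ℝ a J ∧ ∀ s ∈ J, a s ≠ 0 ∧
      (∀ y ∈ Metric.ball q r,
        MvPolynomial.eval (affineLift i (y + η s y • v)) (formOf (a s)) = 0) ∧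
      ∀ e < d, ¬ HasLeafEquation i q v r η e s := by
  have hD : ∀ s ∈ Ioo (-δ) δ, HasLeafEquation i q v r η D s := by
    intro s hs
    obtain ⟨f, hf0, hfD, hf⟩ := h.exists_equation s hs
    obtain ⟨g, hg, hgf⟩ := exists_homogenization i hfD
    obtain ⟨a, rfl⟩ := exists_formOf_eq hg
    refine ⟨a, fun ha => hf0 (MvPolynomial.funext fun w => ?_), fun y hy => by rw [hgf, hf y hy]⟩
    rw [← hgf, ha, eval_formOf]
    simp
  classical
  have hex : ∃ e, ∃ U ⊆ Ioo (-δ) δ, IsOpen U ∧ U.Nonempty ∧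
      ∀ s ∈ U, HasLeafEquation i q v r η e s :=
    ⟨D, _, subset_rfl, isOpen_Ioo, nonempty_Ioo.2 (by linarith [h.δ_pos]), hD⟩
  obtain ⟨d, ⟨U, hU, hUo, hUne, hUd⟩, hmin⟩ :
      ∃ d, (∃ U ⊆ Ioo (-δ) δ, IsOpen U ∧ U.Nonempty ∧ ∀ s ∈ U, HasLeafEquation i q v r η d s) ∧
        ∀ e < d, ¬ ∃ U ⊆ Ioo (-δ) δ, IsOpen U ∧ U.Nonempty ∧
          ∀ s ∈ U, HasLeafEquation i q v r η e s :=
    ⟨Nat.find hex, Nat.find_spec hex, fun e he => Nat.find_min hex he⟩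
  -- `HasLeafEquation` is a closed condition, so the lower degrees can be excluded one after another
  have hshrink : ∀ k ≤ d, ∃ J ⊆ U, IsOpen J ∧ J.Nonempty ∧
      ∀ s ∈ J, ∀ e < k, ¬ HasLeafEquation i q v r η e s := by
    intro k
    induction k with
    | zero => exact fun _ => ⟨U, subset_rfl, hUo, hUne, fun s _ e he => absurd he (by omega)⟩
    | succ k ih =>
      intro hk
      obtain ⟨J, hJU, hJo, hJne, hJ⟩ := ih (by omega)
      have h1 := hmin k (by omega)
      push Not at h1
      obtain ⟨s, hsJ, hs⟩ := h1 J (hJU.trans hU) hJo hJne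
      obtain ⟨J', hJ', hJ'o, hsJ'⟩ := eventually_nhds_iff.1
        (h.eventually_not_hasLeafEquation (hU (hJU hsJ)) hs)
      refine ⟨J ∩ J', fun t ht => hJU ht.1, hJo.inter hJ'o, ⟨s, hsJ, hsJ'⟩, fun t ht e he => ?_⟩
      rcases Nat.lt_succ_iff_lt_or_eq.1 he with he | rfl
      · exact hJ t ht.1 e he
      · exact hJ' t ht.2
  obtain ⟨J, hJU, hJo, ⟨s₀, hs₀⟩, hJ⟩ := hshrink d le_rfl
  obtain ⟨ε, hε, hball⟩ := Metric.isOpen_iff.1 hJo s₀ hs₀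
  have hsub : Metric.ball s₀ ε ⊆ Ioo (-δ) δ := fun s hs => hU (hJU (hball hs))
  -- the extra unknowns `z (.inr α)` and the equation `∑ z (.inl α) * z (.inr α) = 1` express that
  -- the vector of coefficients is not zero
  obtain ⟨J', hJ', hJ'o, hJ'ne, z, hz, hz0⟩ := exists_analytic_section (𝕜 := ℝ)
    (U := Metric.ball s₀ ε) Metric.isOpen_ball (convex_ball s₀ ε).isPreconnected
    ⟨s₀, Metric.mem_ball_self hε⟩ (σ := Sym (Fin (n + 1)) d ⊕ Sym (Fin (n + 1)) d)
    (κ := Option (Metric.ball q r))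
    (F := fun k s z => k.elim (∑ α, z (.inl α) * z (.inr α) - 1)
      fun y => ∑ α, monomialValue α (affineLift i (y.1 + η s y.1 • v)) * z (.inl α))
    (fun k => by
      cases k with
      | none =>
        exact (IsPolyFamily.sum fun α _ =>
          (IsPolyFamily.coord (Sum.inl α)).mul (IsPolyFamily.coord (Sum.inr α))).sub
          (IsPolyFamily.const 1)
      | some y =>
        exact IsPolyFamily.sum fun α _ => (IsPolyFamily.coeff fun s hs =>
          h.analyticAt_monomialValue (hsub hs) y.2 α).mul (IsPolyFamily.coord (Sum.inl α)))
    (fun s hs => by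
      obtain ⟨b, hb, hbv⟩ := hUd s (hJU (hball hs))
      obtain ⟨α, hα⟩ := Function.ne_iff.1 hb
      refine ⟨Sum.elim b (Pi.single α (b α)⁻¹), fun k => ?_⟩
      cases k with
      | none =>
        change ∑ β, b β * (Pi.single α (b α)⁻¹ : Sym (Fin (n + 1)) d → ℂ) β - 1 = 0
        rw [Finset.sum_eq_single α (fun β _ hβ => by simp [hβ]) (by simp), Pi.single_eq_same,
          mul_inv_cancel₀ hα, sub_self]
      | some y =>
        have h1 := hbv y.1 y.2
        rw [eval_formOf] at h1
        simpa [mul_comm] using h1)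
  refine ⟨d, J', fun s α => z s (.inl α), fun s hs => hsub (hJ' hs), hJ'o, hJ'ne, fun s hs => ?_,
    fun s hs => ⟨fun h0 => ?_, fun y hy => ?_, hJ s (hball (hJ' hs))⟩⟩
  · exact analyticAt_pi_iff.2 fun α => analyticAt_pi_iff.1 (hz s hs) (.inl α)
  · have h1 := hz0 s hs none
    have h2 : ∀ α, z s (.inl α) = 0 := fun α => congrFun h0 α
    simp [h2] at h1
  · have h1 := hz0 s hs (some ⟨y, hy⟩)
    rw [eval_formOf]
    simpa [mul_comm] using h1

/-- A Levi-flat hypervariety contains a one-parameter family of algebraic hypersurfaces. -/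
theorem exists_algebraicLeaves (hn : 0 < n) (hH : IsAlgebraicLeviFlatHypervariety H) :
    ∃ d I a, AlgebraicLeaves H d I a := by
  obtain ⟨i, R, q, v, hR, hq, hXR, hv⟩ := exists_regular_point hn hH.algebraic hH.codim_one
  obtain ⟨r, δ, η, x, D, h⟩ := exists_isLeafFamily (hH.leviFlat i) hR hq hXR hv
  obtain ⟨d, J, a, hJδ, hJo, hJne, ha, hJ⟩ := h.exists_equation_of_minimal_degree
  have hirr : ∀ s ∈ J, 0 < d ∧ Irreducible (formOf (a s)) := fun s hs =>
    irreducible_formOf h.r_pos (h.holomorphic s (hJδ hs)) (hJ s hs).1 (hJ s hs).2.1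
      fun e he b hb hbv => (hJ s hs).2.2 e he ⟨b, hb, hbv⟩
  have hcone : ∀ s ∈ J, ∀ Z, MvPolynomial.eval Z (formOf (a s)) = 0 → Z ∈ cone H :=
    fun s hs Z hZ => mem_cone_of_vanishing hH.algebraic h.r_pos (h.holomorphic s (hJδ hs))
      (fun y hy => h.mem s (hJδ hs) y hy) (hirr s hs).2 (fun u hu => by
        rw [graphCone, eval_smul_of_isHomogeneous (isHomogeneous_formOf _), (hJ s hs).2.1 _ hu.2,
          mul_zero]) hZ
  obtain ⟨s₀, hs₀⟩ := hJne
  refine ⟨d, J, a, hJo, ⟨s₀, hs₀⟩, (hirr s₀ hs₀).1, ha, fun s hs => (hirr s hs).2, hcone,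
    fun t ht => ?_⟩
  -- the leaves contained in the zero set of `a t` meet the line `q + ℂ v` in zeros of `a t`
  set g : Polynomial ℂ := (shift (Fin.insertNth (α := fun _ => ℂ) i 0 v) (formOf (a t))).map
    (MvPolynomial.eval (affineLift i q))
  have hg : ∀ c, g.eval c = MvPolynomial.eval (affineLift i (q + c • v)) (formOf (a t)) := by
    intro c
    rw [eval_map_shift, affineLift_add_smul]
  have hg0 : g ≠ 0 := by
    intro h0
    obtain ⟨c, hc⟩ := h.transversal
    exact hc (chart_mem_iff.2 (hcone t ht _ (by rw [← hg, h0, Polynomial.eval_zero])))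
  refine Set.Finite.of_finite_image (f := x) (g.roots.toFinset.finite_toSet.subset ?_)
    h.injective.injOn
  rintro _ ⟨s, ⟨hs, E, hE⟩, rfl⟩
  rw [Finset.mem_coe, Multiset.mem_toFinset, Polynomial.mem_roots hg0, Polynomial.IsRoot.def, hg,
    hE, map_mul]
  obtain ⟨h1, h2⟩ := h.meets s (hJδ hs)
  have h3 := (hJ s hs).2.1 _ h1
  rw [h2, zero_smul, add_zero] at h3
  rw [h3, zero_mul]

end AlgebraicLeaves

/-! ### Linear sections -/

section LinearSections

variable {n m : ℕ}

theorem analyticAt_entry (𝕜 : Type*) [RCLike 𝕜] [NormedAlgebra 𝕜 ℂ] (k : Fin m) (j : Fin (n + 1))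
    (M : Fin m → Fin (n + 1) → ℂ) :
    AnalyticAt 𝕜 (fun M : Fin m → Fin (n + 1) → ℂ => M k j) M :=
  ((ContinuousLinearMap.proj (R := 𝕜) (φ := fun _ : Fin (n + 1) => ℂ) j).comp
    (ContinuousLinearMap.proj (R := 𝕜) (φ := fun _ : Fin m => Fin (n + 1) → ℂ) k)).analyticAt M

/-- If the points of `A` over the parameters `(s, M)` are chosen analytically on the linear subspace
`M Z = 0`, and vary with `s`, then they sweep out a submanifold: with `M` moving in the directions
`ℓ ⊗ eᵢ`, the vector `ℓ` can be recovered from the point. -/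
theorem ContainsSubmanifold.of_linear_sections {𝕜 : Type} [RCLike 𝕜] [NormedAlgebra 𝕜 ℂ]
    [FiniteDimensional 𝕜 ℂ] {P : Type*} [NormedAddCommGroup P] [NormedSpace 𝕜 P]
    [FiniteDimensional 𝕜 P] {A : Set (Fin n → ℂ)} {i : Fin (n + 1)}
    {Z : P × (Fin m → Fin (n + 1) → ℂ) → Fin (n + 1) → ℂ} {s₀ : P}
    {M₀ : Fin m → Fin (n + 1) → ℂ} (hZ : AnalyticAt 𝕜 Z (s₀, M₀)) (hZi : Z (s₀, M₀) i ≠ 0)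
    (hA : ∀ᶠ u in 𝓝 (s₀, M₀), dehomog i (Z u) ∈ A)
    (hM : ∀ᶠ u in 𝓝 (s₀, M₀), ∀ k, ∑ j, u.2 k j * Z u j = 0)
    (hinj : ∀ σ : P, fderiv 𝕜 (fun s => dehomog i (Z (s, M₀))) s₀ σ = 0 → σ = 0) :
    ContainsSubmanifold 𝕜 A (Module.finrank 𝕜 P + Module.finrank 𝕜 (Fin m → ℂ)) := by
  classical
  have hproj : ∀ (j : Fin (n + 1)) Z, AnalyticAt 𝕜 (fun Z : Fin (n + 1) → ℂ => Z j) Z := fun j Z =>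
    (ContinuousLinearMap.proj (R := 𝕜) (φ := fun _ : Fin (n + 1) => ℂ) j).analyticAt Z
  have hda : AnalyticAt 𝕜 (dehomog i) (Z (s₀, M₀)) := analyticAt_pi_iff.2 fun l =>
    (hproj _ _).div (hproj _ _) hZi
  -- the affine map `ℓ ↦ M₀ + ℓ ⊗ eᵢ`
  set L : (Fin m → ℂ) →L[𝕜] (Fin m → Fin (n + 1) → ℂ) :=
    ContinuousLinearMap.pi fun k => ContinuousLinearMap.pi fun j =>
      if j = i then ContinuousLinearMap.proj (R := 𝕜) (φ := fun _ : Fin m => ℂ) k else 0 with hL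
  have hLa : ∀ ℓ k j, L ℓ k j = if j = i then ℓ k else 0 := fun ℓ k j => by
    by_cases h : j = i <;> simp [hL, h]
  set ψ : P × (Fin m → ℂ) → P × (Fin m → Fin (n + 1) → ℂ) := fun u => (u.1, M₀ + L u.2)
  have hψa : AnalyticAt 𝕜 ψ (s₀, 0) :=
    analyticAt_fst.prod (analyticAt_const.add ((L.analyticAt _).comp_of_eq analyticAt_snd rfl))
  have hψ0 : ψ (s₀, 0) = (s₀, M₀) := by simp [ψ]
  have hψt : Tendsto ψ (𝓝 (s₀, 0)) (𝓝 (s₀, M₀)) := by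
    have := hψa.continuousAt.tendsto
    rwa [hψ0] at this
  have hZψ : AnalyticAt 𝕜 (fun u => Z (ψ u)) (s₀, 0) := hZ.comp_of_eq hψa hψ0
  set φ : P × (Fin m → ℂ) → Fin n → ℂ := fun u => dehomog i (Z (ψ u))
  have hφa : AnalyticAt 𝕜 φ (s₀, 0) := hda.comp_of_eq hZψ (by rw [hψ0])
  -- recover `ℓ`
  set g : (Fin n → ℂ) → Fin m → ℂ := fun w k => -∑ j, M₀ k j * affineLift i w j
  have hg : ∀ᶠ u in 𝓝 ((s₀, 0) : P × (Fin m → ℂ)), g (φ u) = u.2 := by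
    have hZi' : ∀ᶠ u in 𝓝 (s₀, M₀), Z u i ≠ 0 :=
      (analyticAt_pi_iff.1 hZ i).continuousAt.eventually_ne hZi
    filter_upwards [hψt.eventually hM, hψt.eventually hZi'] with u hu hui
    funext k
    have h1 := hu k
    simp only [ψ, Pi.add_apply, hLa, add_mul, Finset.sum_add_distrib, ite_mul, zero_mul,
      Finset.sum_ite_eq', Finset.mem_univ, if_true] at h1
    simp only [g, φ]
    rw [affineLift_dehomog hui]
    simp only [Pi.smul_apply, smul_eq_mul, ψ]
    have h2 : ∑ j, M₀ k j * ((Z (u.1, M₀ + L u.2) i)⁻¹ * Z (u.1, M₀ + L u.2) j) =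
        (Z (u.1, M₀ + L u.2) i)⁻¹ * ∑ j, M₀ k j * Z (u.1, M₀ + L u.2) j := by
      rw [Finset.mul_sum]
      exact Finset.sum_congr rfl fun j _ => by ring
    rw [h2, eq_neg_of_add_eq_zero_left h1, mul_neg, neg_neg, mul_comm, mul_assoc]
    rw [mul_inv_cancel₀ hui, mul_one]
  have hga : DifferentiableAt 𝕜 g (φ (s₀, 0)) := by
    refine differentiableAt_pi.2 fun k => DifferentiableAt.neg ?_
    refine DifferentiableAt.fun_sum fun j _ => DifferentiableAt.const_mul ?_ _
    refine Fin.succAboveCases i ?_ (fun l => ?_) j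
    · simp only [affineLift_apply_same]
      exact differentiableAt_const _
    · simp only [affineLift_apply_succAbove]
      exact (ContinuousLinearMap.proj (R := 𝕜) (φ := fun _ : Fin n => ℂ) l).differentiableAt
  have hφd := hφa.differentiableAt.hasFDerivAt
  have hcomp : (fderiv 𝕜 g (φ (s₀, 0))).comp (fderiv 𝕜 φ (s₀, 0)) =
      ContinuousLinearMap.snd 𝕜 P (Fin m → ℂ) := by
    have h1 := hga.hasFDerivAt.comp (s₀, (0 : Fin m → ℂ)) hφd
    have h2 : HasFDerivAt (fun u : P × (Fin m → ℂ) => u.2) (ContinuousLinearMap.snd 𝕜 P _)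
        (s₀, (0 : Fin m → ℂ)) := hasFDerivAt_snd
    exact h1.unique (h2.congr_of_eventuallyEq hg)
  refine ContainsSubmanifold.of_immersion hφa ?_ (hψt.eventually hA) (by simp)
  rw [injective_iff_map_eq_zero]
  rintro ⟨σ, ℓ⟩ h0
  have hℓ : ℓ = 0 := by
    have h1 := congrArg (fun T => T (σ, ℓ)) hcomp
    simp only [ContinuousLinearMap.comp_apply, h0, map_zero, ContinuousLinearMap.coe_snd'] at h1
    exact h1.symm
  subst hℓ
  have h3 : HasFDerivAt (fun s => (s, (0 : Fin m → ℂ))) (ContinuousLinearMap.inl 𝕜 P (Fin m → ℂ))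
      s₀ := hasFDerivAt_prodMk_left s₀ 0
  have h4 := hφd.comp s₀ h3
  have h5 : (φ ∘ fun s => (s, (0 : Fin m → ℂ))) = fun s => dehomog i (Z (s, M₀)) := by
    funext s
    simp [φ, ψ]
  rw [h5] at h4
  rw [hinj σ (by rw [h4.fderiv]; exact h0)]
  rfl

/-- A set that meets the linear subspaces of codimension `m` near a given one in common zeros of a
family of polynomials, and contains all such zeros, has complex dimension at least `m`. -/
theorem le_dimension_of_linear_sections {S : Set (CP n)} {κ : Type*}
    {F : κ → MvPolynomial (Fin (n + 1)) ℂ}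
    (hS : ∀ (Z : Fin (n + 1) → ℂ) (hZ : Z ≠ 0), (∀ k, MvPolynomial.eval Z (F k) = 0) →
      Projectivization.mk ℂ Z hZ ∈ S)
    {U : Set (Fin m → Fin (n + 1) → ℂ)} (hU : IsOpen U) (hne : U.Nonempty)
    (hsol : ∀ M ∈ U, ∃ Z : Fin (n + 1) → ℂ, Z ≠ 0 ∧ (∀ k, MvPolynomial.eval Z (F k) = 0) ∧
      ∀ k, ∑ j, M k j * Z j = 0) :
    ((m : ℕ∞) : WithBot ℕ∞) ≤ dimension ℂ S := by
  classical
  obtain ⟨M₁, hM₁⟩ := hne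
  obtain ⟨ε, hε, hball⟩ := Metric.isOpen_iff.1 hU M₁ hM₁
  obtain ⟨U', hU', hU'o, ⟨M₀, hM₀⟩, z, hz, hz0⟩ := exists_analytic_section (𝕜 := ℂ)
    (U := Metric.ball M₁ ε) Metric.isOpen_ball (convex_ball M₁ ε).isPreconnected
    ⟨M₁, Metric.mem_ball_self hε⟩ (σ := Fin (n + 1) ⊕ Fin (n + 1)) (κ := Option (κ ⊕ Fin m))
    (F := fun o M z => o.elim (∑ j, z (.inl j) * z (.inr j) - 1) fun e => e.elim
      (fun k => MvPolynomial.eval (fun j => z (.inl j)) (F k)) fun k => ∑ j, M k j * z (.inl j))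
    (fun o => by
      rcases o with _ | k | k
      · exact (IsPolyFamily.sum fun j _ =>
          (IsPolyFamily.coord (Sum.inl j)).mul (IsPolyFamily.coord (Sum.inr j))).sub
          (IsPolyFamily.const 1)
      · exact IsPolyFamily.eval (F k) fun j => IsPolyFamily.coord (Sum.inl j)
      · change IsPolyFamily ℂ (Metric.ball M₁ ε) fun (M : Fin m → Fin (n + 1) → ℂ)
          (z : Fin (n + 1) ⊕ Fin (n + 1) → ℂ) => ∑ j, M k j * z (.inl j)
        exact IsPolyFamily.sum fun j _ => (IsPolyFamily.coeff fun M _ =>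
          analyticAt_entry ℂ k j M).mul
          (IsPolyFamily.coord (Sum.inl j)))
    (fun M hM => by
      obtain ⟨Z, hZ, hZF, hZM⟩ := hsol M (hball hM)
      obtain ⟨i, hi⟩ := Function.ne_iff.1 hZ
      refine ⟨Sum.elim Z (Pi.single i (Z i)⁻¹), fun o => ?_⟩
      rcases o with _ | k | k
      · change ∑ j, Z j * (Pi.single i (Z i)⁻¹ : Fin (n + 1) → ℂ) j - 1 = 0
        rw [Finset.sum_eq_single i (fun j _ hj => by simp [hj]) (by simp), Pi.single_eq_same,
          mul_inv_cancel₀ hi, sub_self]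
      · exact hZF k
      · exact hZM k)
  have hnz : ∃ i, z M₀ (.inl i) ≠ 0 := by
    by_contra! hall
    have := hz0 M₀ hM₀ none
    simp [hall] at this
  obtain ⟨i, hi⟩ := hnz
  have hza : AnalyticAt ℂ (fun M j => z M (.inl j)) M₀ :=
    analyticAt_pi_iff.2 fun j => analyticAt_pi_iff.1 (hz M₀ hM₀) (.inl j)
  have hev : ∀ᶠ M in 𝓝 M₀, M ∈ U' ∧ z M (.inl i) ≠ 0 := Filter.Eventually.and (hU'o.mem_nhds hM₀)
    ((analyticAt_pi_iff.1 hza i).continuousAt.eventually_ne hi)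
  have ht : Tendsto (fun u : PUnit.{1} × (Fin m → Fin (n + 1) → ℂ) => u.2) (𝓝 (PUnit.unit, M₀))
      (𝓝 M₀) := continuous_snd.tendsto (PUnit.unit, M₀)
  have key := ContainsSubmanifold.of_linear_sections (𝕜 := ℂ) (P := PUnit.{1})
    (A := chart i ⁻¹' S) (i := i) (Z := fun u j => z u.2 (.inl j)) (s₀ := PUnit.unit) (M₀ := M₀)
    (hza.comp_of_eq analyticAt_snd rfl) hi
    ((ht.eventually hev).mono fun u hu => by
      have hne : (fun j => z u.2 (.inl j)) ≠ 0 := fun h => hu.2 (congrFun h i)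
      rw [mem_preimage, chart_dehomog hne hu.2]
      exact hS _ hne fun k => hz0 u.2 hu.1 (some (.inl k)))
    ((ht.eventually hev).mono fun u hu k => hz0 u.2 hu.1 (some (.inr k)))
    (fun σ _ => Subsingleton.elim _ _)
  rw [Module.finrank_zero_of_subsingleton, zero_add, Module.finrank_fin_fun] at key
  exact le_dimension key

end LinearSections

/-! ### Zero loci of forms -/

section ZeroLocus

variable {n : ℕ} {ι : Type*}

/-- The common zero set in `ℙⁿ` of a family of forms. -/
def zeroLocus (F : ι → MvPolynomial (Fin (n + 1)) ℂ) : Set (CP n) :=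
  {p | ∀ (Z : Fin (n + 1) → ℂ) (hZ : Z ≠ 0), Projectivization.mk ℂ Z hZ = p →
    ∀ k, MvPolynomial.eval Z (F k) = 0}

theorem mk_mem_zeroLocus_iff {F : ι → MvPolynomial (Fin (n + 1)) ℂ} {d : ι → ℕ}
    (hF : ∀ k, (F k).IsHomogeneous (d k)) {Z : Fin (n + 1) → ℂ} {hZ : Z ≠ 0} :
    Projectivization.mk ℂ Z hZ ∈ zeroLocus F ↔ ∀ k, MvPolynomial.eval Z (F k) = 0 := by
  refine ⟨fun h => h Z hZ rfl, fun h Z' hZ' he k => ?_⟩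
  obtain ⟨c, hc⟩ := (Projectivization.mk_eq_mk_iff' ℂ Z' Z hZ' hZ).1 he
  rw [← hc, eval_smul_of_isHomogeneous (hF k), h, mul_zero]

theorem isComplexSubvariety_zeroLocus [Finite ι] {F : ι → MvPolynomial (Fin (n + 1)) ℂ}
    {d : ι → ℕ} (hF : ∀ k, (F k).IsHomogeneous (d k)) : IsComplexSubvariety (zeroLocus F) := by
  intro i w
  obtain ⟨k, ⟨e⟩⟩ := Finite.exists_equiv_fin ι
  refine ⟨k, fun z l => MvPolynomial.eval (affineLift i z) (F (e.symm l)), ?_,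
    Eventually.of_forall fun z => ?_⟩
  · exact analyticAt_pi_iff.2 fun l => analyticAt_eval
      (fun j => analyticAt_pi_iff.1 (analyticAt_affineLift i w) j) _
  · rw [chart_eq_mk, mk_mem_zeroLocus_iff hF]
    exact ⟨fun h => funext fun l => h _, fun h l => by simpa using congrFun h (e l)⟩

/-- By Hilbert's basis theorem, the zero locus of an infinite family of forms is a subvariety. -/
theorem isComplexSubvariety_zeroLocus_of_infinite {F : ι → MvPolynomial (Fin (n + 1)) ℂ}
    {d : ι → ℕ} (hF : ∀ k, (F k).IsHomogeneous (d k)) : IsComplexSubvariety (zeroLocus F) := by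
  obtain ⟨T, hT, hspan⟩ := (Submodule.fg_span_iff_fg_span_finset_subset (range F)).1
    (IsNoetherian.noetherian (Submodule.span (MvPolynomial (Fin (n + 1)) ℂ) (range F)))
  choose κ hκ using fun f : T => hT f.2
  have h : zeroLocus F = zeroLocus fun f : T => F (κ f) := by
    ext p
    refine ⟨fun h Z hZ hp f => h Z hZ hp _, fun h Z hZ hp k => ?_⟩
    have h1 : F k ∈ Submodule.span (MvPolynomial (Fin (n + 1)) ℂ) (T : Set _) := by
      rw [← hspan]
      exact Submodule.subset_span (mem_range_self k)
    have h2 : Submodule.span (MvPolynomial (Fin (n + 1)) ℂ) (T : Set _) ≤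
        RingHom.ker (MvPolynomial.eval Z) := by
      refine Submodule.span_le.2 fun f hf => ?_
      have h3 : MvPolynomial.eval Z (F (κ ⟨f, hf⟩)) = 0 := h Z hZ hp ⟨f, hf⟩
      rwa [hκ] at h3
    exact h2 h1
  rw [h]
  exact isComplexSubvariety_zeroLocus (d := fun f => d (κ f)) fun f => hF _

/-- The zero locus of `r` forms has dimension at least `n - r`. -/
theorem le_dimension_zeroLocus {r : ℕ} (hr : r ≤ n) {F : Fin r → MvPolynomial (Fin (n + 1)) ℂ}
    {d : Fin r → ℕ} (hF : ∀ k, (F k).IsHomogeneous (d k))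
    (h0 : ∀ k, MvPolynomial.eval 0 (F k) = 0) :
    (((n - r : ℕ) : ℕ∞) : WithBot ℕ∞) ≤ dimension ℂ (zeroLocus F) := by
  refine le_dimension_of_linear_sections (m := n - r) (F := F) (U := univ)
    (fun Z hZ h => (mk_mem_zeroLocus_iff hF).2 h) isOpen_univ univ_nonempty fun M _ => ?_
  obtain ⟨Z, hZ, h⟩ := exists_common_zero_ne_zero (N := n + 1) (r := r + (n - r)) (by omega)
    (Fin.addCases F fun k => ∑ j, MvPolynomial.C (M k j) * MvPolynomial.X j) (fun l => by
      refine Fin.addCases (fun k => ?_) (fun k => ?_) l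
      · simpa using h0 k
      · simp)
  refine ⟨Z, hZ, fun k => ?_, fun k => ?_⟩
  · simpa using h (Fin.castAdd _ k)
  · simpa using h (Fin.natAdd r k)

end ZeroLocus

/-! ### Algebraic degenerate singularities -/

section Rank

variable {n m : ℕ} {H : Set (CP n)} {C : Matrix (Sym (Fin (n + 1)) m) (Sym (Fin (n + 1)) m) ℂ}

theorem analyticAt_monomialValue {N m : ℕ} (α : Sym (Fin N) m) (z : Fin N → ℂ) :
    AnalyticAt ℂ (monomialValue α) z := by
  have h : monomialValue α = fun z => MvPolynomial.eval z
      ((α : Multiset (Fin N)).map MvPolynomial.X).prod := funext fun z => by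
    simp [monomialValue, map_multiset_prod, Multiset.map_map]
  rw [h]
  exact analyticAt_eval (fun j => analyticAt_pi_iff.1 analyticAt_id j) _

theorem formOf_sum_smul {N d : ℕ} {κ : Type*} (s : Finset κ) (c : κ → ℂ)
    (a : κ → Sym (Fin N) d → ℂ) (z : Fin N → ℂ) :
    MvPolynomial.eval z (formOf (∑ k ∈ s, c k • a k)) =
      ∑ k ∈ s, c k * MvPolynomial.eval z (formOf (a k)) := by
  simp only [eval_formOf, Finset.sum_apply, Pi.smul_apply, smul_eq_mul, Finset.sum_mul,
    Finset.mul_sum]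
  rw [Finset.sum_comm]
  exact Finset.sum_congr rfl fun k _ => Finset.sum_congr rfl fun α _ => by ring

/-- The points where the holomorphic forms given by the columns of `C` vanish are algebraic
degenerate singularities. -/
theorem isAlgebraicDegenerateSingularity_of_vanishing (hC : IsDefiningPolynomial H C) {p : CP n}
    (h : ∀ (Z : Fin (n + 1) → ℂ) (hZ : Z ≠ 0), Projectivization.mk ℂ Z hZ = p →
      ∀ β, MvPolynomial.eval Z (formOf (C.col β)) = 0) :
    IsAlgebraicDegenerateSingularity H C p := by
  have h1 : ∀ (Z : Fin (n + 1) → ℂ) (hZ : Z ≠ 0), Projectivization.mk ℂ Z hZ = p →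
      ∀ β, ∑ α, C α β * monomialValue α Z = 0 := fun Z hZ hp β => by
    have := h Z hZ hp β
    rwa [eval_formOf] at this
  have h2 : ∀ (Z : Fin (n + 1) → ℂ) (hZ : Z ≠ 0), Projectivization.mk ℂ Z hZ = p →
      ∀ α, ∑ β, C α β * star (monomialValue β Z) = 0 := fun Z hZ hp α => by
    have h3 := congrArg star (h1 Z hZ hp α)
    simp only [star_sum, star_mul', star_zero] at h3
    rw [← h3]
    exact Finset.sum_congr rfl fun β _ => by rw [hC.isHermitian.apply]
  have h4 : ∀ (Z : Fin (n + 1) → ℂ) (hZ : Z ≠ 0), Projectivization.mk ℂ Z hZ = p →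
      ∀ z, bihom C z Z = 0 := fun Z hZ hp z => by
    refine Finset.sum_eq_zero fun α _ => ?_
    have h5 : ∑ β, C α β * monomialValue α z * star (monomialValue β Z) =
        monomialValue α z * ∑ β, C α β * star (monomialValue β Z) := by
      rw [Finset.mul_sum]
      exact Finset.sum_congr rfl fun β _ => by ring
    rw [h5, h2 Z hZ hp, mul_zero]
  constructor
  · induction p using Projectivization.ind with
    | h Z hZ =>
      rw [← mem_cone_iff hZ, hC.zeroSet]
      exact h4 Z hZ rfl Z
  · intro v hv hp
    refine ⟨?_, h4 v hv hp⟩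
    -- the polynomial is a sum of products of two functions that vanish at `v`
    have h5 : (fun z => bihom C z z) = fun z => ∑ α, ∑ β, C α β *
        ((monomialValue α z - monomialValue α v) *
          star (monomialValue β z - monomialValue β v)) := by
      funext z
      have h6 : ∑ α, ∑ β, C α β * monomialValue α z * star (monomialValue β v) = 0 := h4 v hv hp z
      have h7 : ∑ α, ∑ β, C α β * monomialValue α v * star (monomialValue β z) = 0 := by
        rw [Finset.sum_comm]
        refine Finset.sum_eq_zero fun β _ => ?_
        rw [← Finset.sum_mul, h1 v hv hp, zero_mul]
      have h8 : ∑ α, ∑ β, C α β * monomialValue α v * star (monomialValue β v) = 0 := h4 v hv hp v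
      have h9 : ∑ α, ∑ β, C α β * ((monomialValue α z - monomialValue α v) *
          star (monomialValue β z - monomialValue β v)) =
          bihom C z z - ∑ α, ∑ β, C α β * monomialValue α z * star (monomialValue β v) -
          ∑ α, ∑ β, C α β * monomialValue α v * star (monomialValue β z) +
          ∑ α, ∑ β, C α β * monomialValue α v * star (monomialValue β v) := by
        rw [bihom]
        simp only [← Finset.sum_sub_distrib, ← Finset.sum_add_distrib]
        refine Finset.sum_congr rfl fun α _ => Finset.sum_congr rfl fun β _ => ?_
        rw [star_sub]
        ring
      rw [h9, h6, h7, h8]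
      ring
    rw [h5]
    have hd : ∀ α : Sym (Fin (n + 1)) m, HasFDerivAt
        (fun z : Fin (n + 1) → ℂ => monomialValue α z - monomialValue α v)
        (fderiv ℝ (monomialValue α) v) v := fun α =>
      (((analyticAt_monomialValue α v).restrictScalars (𝕜 := ℝ)).differentiableAt.hasFDerivAt
        ).sub_const _
    refine HasFDerivAt.fderiv (HasFDerivAt.congr_fderiv (HasFDerivAt.fun_sum fun α _ =>
      HasFDerivAt.fun_sum fun β _ => (((hd α).mul (hd β).star).const_mul (C α β))) ?_)
    refine Finset.sum_eq_zero fun α _ => Finset.sum_eq_zero fun β _ => ?_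
    ext w
    simp

/-- The forms whose coefficients are the columns of `C` span a space of dimension `C.rank`, so their
common zero locus has dimension at least `n - C.rank`; on it `P(·, p̄)` and the gradient vanish. -/
theorem exists_algebraic_degenerate_subvariety (hC : IsDefiningPolynomial H C)
    (hr : C.rank ≤ n) :
    ∃ S : Set (CP n), IsComplexSubvariety S ∧ S ⊆ H ∧
      (((n - C.rank : ℕ) : ℕ∞) : WithBot ℕ∞) ≤ dimension ℂ S ∧
      ∀ p ∈ S, IsAlgebraicDegenerateSingularity H C p := by
  set W : Submodule ℂ (Sym (Fin (n + 1)) m → ℂ) := Submodule.span ℂ (range C.col)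
  have b : Module.Basis (Fin C.rank) ℂ W :=
    Module.finBasisOfFinrankEq ℂ W C.rank_eq_finrank_span_cols.symm
  set F : Fin C.rank → MvPolynomial (Fin (n + 1)) ℂ := fun k =>
    formOf (b k : Sym (Fin (n + 1)) m → ℂ)
  have hF : ∀ k, (F k).IsHomogeneous m := fun k => isHomogeneous_formOf _
  have hdeg : ∀ p ∈ zeroLocus F, IsAlgebraicDegenerateSingularity H C p := by
    refine fun p hp => isAlgebraicDegenerateSingularity_of_vanishing hC fun Z hZ hZp β => ?_
    have h1 : C.col β = ∑ k, b.repr ⟨C.col β, Submodule.subset_span (mem_range_self β)⟩ k •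
        (b k : Sym (Fin (n + 1)) m → ℂ) := by
      have h2 := congrArg (Subtype.val (p := fun x => x ∈ W))
        (b.sum_repr ⟨C.col β, Submodule.subset_span (mem_range_self β)⟩)
      simpa only [Submodule.coe_sum, Submodule.coe_smul] using h2.symm
    rw [h1, formOf_sum_smul]
    exact Finset.sum_eq_zero fun k _ => by rw [hp Z hZ hZp k, mul_zero]
  refine ⟨zeroLocus F, isComplexSubvariety_zeroLocus hF, fun p hp => (hdeg p hp).1,
    le_dimension_zeroLocus hr hF fun k => ?_, hdeg⟩
  -- for `m = 0` the matrix is zero, because the cone contains the origin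
  have h0 : (0 : Fin (n + 1) → ℂ) ∈ cone H := fun h => absurd rfl h
  rw [hC.zeroSet] at h0
  have key : W ≤ LinearMap.ker (∑ α : Sym (Fin (n + 1)) m,
      monomialValue α (0 : Fin (n + 1) → ℂ) • LinearMap.proj (R := ℂ) (φ := fun _ => ℂ) α) := by
    refine Submodule.span_le.2 ?_
    rintro _ ⟨β, rfl⟩
    simp only [SetLike.mem_coe, LinearMap.mem_ker, LinearMap.sum_apply, LinearMap.smul_apply,
      LinearMap.proj_apply, smul_eq_mul]
    rcases Nat.eq_zero_or_pos m with rfl | hm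
    · have h2 : ∀ α : Sym (Fin (n + 1)) 0, α = β := fun α => Subsingleton.elim _ _
      have h3 : monomialValue β (0 : Fin (n + 1) → ℂ) = 1 := by
        simp [monomialValue, Sym.eq_nil_of_card_zero β]
      have h4 : C β β = 0 := by
        have h5 : bihom C 0 0 = 0 := h0
        rw [bihom, Fintype.sum_eq_single β fun α hα => absurd (h2 α) hα,
          Fintype.sum_eq_single β fun α hα => absurd (h2 α) hα, h3] at h5
        simpa using h5
      rw [Fintype.sum_eq_single β fun α hα => absurd (h2 α) hα]
      simp [Matrix.col, h4]
    · refine Finset.sum_eq_zero fun α _ => ?_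
      have h1 : monomialValue α (0 : Fin (n + 1) → ℂ) = 0 := by
        obtain ⟨j, hj⟩ : ∃ j, j ∈ (α : Multiset (Fin (n + 1))) :=
          Multiset.card_pos_iff_exists_mem.1 (hm.trans_eq α.2.symm)
        exact Multiset.prod_eq_zero (Multiset.mem_map.2 ⟨j, hj, rfl⟩)
      rw [h1, zero_mul]
  have h1 := LinearMap.mem_ker.1 (key (b k).2)
  simp only [LinearMap.sum_apply, LinearMap.smul_apply, LinearMap.proj_apply, smul_eq_mul] at h1
  rw [eval_formOf, ← h1]
  exact Finset.sum_congr rfl fun α _ => mul_comm _ _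

end Rank

/-! ### Points on infinitely many leaves -/

section InfinitelyManyLeaves

variable {N d : ℕ}

theorem formOf_smul (c : ℂ) (a : Sym (Fin N) d → ℂ) :
    formOf (c • a) = MvPolynomial.C c * formOf a := by
  simp only [formOf, Finset.mul_sum, Pi.smul_apply, smul_eq_mul, map_mul, mul_assoc]

theorem formOf_dvd_formOf_iff {a b : Sym (Fin N) d → ℂ} (hb : b ≠ 0) :
    formOf a ∣ formOf b ↔ ∃ c : ℂ, b = c • a := by
  constructor
  · rintro ⟨B, hB⟩
    have hb0 := formOf_ne_zero hb
    have hA0 : formOf a ≠ 0 := fun h => hb0 (by rw [hB, h, zero_mul])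
    have hB0 : B ≠ 0 := fun h => hb0 (by rw [hB, h, mul_zero])
    have h1 := (isHomogeneous_formOf b).totalDegree hb0
    rw [hB, MvPolynomial.totalDegree_mul_of_isDomain hA0 hB0,
      (isHomogeneous_formOf a).totalDegree hA0] at h1
    have h2 : B.totalDegree = 0 := by omega
    rw [MvPolynomial.totalDegree_eq_zero_iff_eq_C] at h2
    refine ⟨MvPolynomial.coeff 0 B, funext fun β => ?_⟩
    rw [← coeff_formOf_self b β, hB, h2, mul_comm, MvPolynomial.coeff_C_mul, coeff_formOf_self]
    simp
  · rintro ⟨c, rfl⟩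
    rw [formOf_smul]
    exact dvd_mul_left _ _

variable {n : ℕ} {H : Set (CP n)} {I : Set ℝ} {a : ℝ → Sym (Fin (n + 1)) d → ℂ}

theorem AlgebraicLeaves.ne_zero (h : AlgebraicLeaves H d I a) {s : ℝ} (hs : s ∈ I) : a s ≠ 0 := by
  intro h0
  have := (h.irreducible s hs).ne_zero
  rw [h0] at this
  simp [formOf] at this

theorem AlgebraicLeaves.dvd_symm (h : AlgebraicLeaves H d I a) {s t : ℝ} (hs : s ∈ I) (ht : t ∈ I)
    (hst : formOf (a s) ∣ formOf (a t)) : formOf (a t) ∣ formOf (a s) :=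
  ((h.irreducible s hs).associated_of_dvd (h.irreducible t ht) hst).symm.dvd

/-- Infinitely many parameters contain any number of parameters with distinct leaves. -/
theorem AlgebraicLeaves.exists_pairwise_not_dvd (h : AlgebraicLeaves H d I a) {T : Set ℝ}
    (hT : T ⊆ I) (hinf : T.Infinite) (k : ℕ) : ∃ s : Fin k → ℝ, (∀ j, s j ∈ T) ∧
      ∀ i j, i ≠ j → ¬ formOf (a (s i)) ∣ formOf (a (s j)) := by
  induction k with
  | zero => exact ⟨Fin.elim0, fun j => j.elim0, fun j => j.elim0⟩
  | succ k ih =>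
    obtain ⟨s, hsT, hs⟩ := ih
    have hfin : (⋃ j, {t ∈ I | formOf (a t) ∣ formOf (a (s j))}).Finite :=
      Set.finite_iUnion fun j => h.finite _ (hT (hsT j))
    obtain ⟨t, htT, ht⟩ := hinf.exists_notMem_finite hfin
    have ht' : ∀ j, ¬ formOf (a t) ∣ formOf (a (s j)) := fun j hj =>
      ht (mem_iUnion.2 ⟨j, hT htT, hj⟩)
    refine ⟨Fin.snoc (α := fun _ => ℝ) s t, fun j => ?_, fun i j => ?_⟩
    · refine Fin.lastCases ?_ (fun j => ?_) j
      · simpa using htT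
      · simpa using hsT j
    · refine Fin.lastCases ?_ (fun i => ?_) i <;> refine Fin.lastCases ?_ (fun j => ?_) j
      · exact fun hne => absurd rfl hne
      · intro _
        simpa using ht' j
      · intro _ hdvd
        simp only [Fin.snoc_castSucc, Fin.snoc_last] at hdvd
        exact ht' i (h.dvd_symm (hT (hsT i)) (hT htT) hdvd)
      · intro hij
        simpa using hs i j fun h => hij (by rw [h])

theorem AlgebraicLeaves.isDegenerateSingularity (h : AlgebraicLeaves H d I a)
    {z : Fin (n + 1) → ℂ} (hz : z ≠ 0)
    (hinf : {s ∈ I | MvPolynomial.eval z (formOf (a s)) = 0}.Infinite) :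
    IsDegenerateSingularity H (Projectivization.mk ℂ z hz) := by
  refine isDegenerateSingularity_of_leaves hz fun k => ?_
  obtain ⟨s, hsT, hs⟩ := h.exists_pairwise_not_dvd (fun s hs => hs.1) hinf (k + 1)
  exact ⟨fun j => formOf (a (s j)), fun _ => d, fun j => isHomogeneous_formOf _,
    fun _ => h.degree_pos, fun j => h.irreducible _ (hsT j).1, hs, fun j => (hsT j).2,
    fun j => h.mem_cone _ (hsT j).1⟩

theorem AlgebraicLeaves.mem_singularSet (h : AlgebraicLeaves H d I a) (hn : 0 < n)
    (hdim : dimension ℝ H = ((2 * n - 1 : ℕ) : ℕ∞)) {s t : ℝ} (hs : s ∈ I) (ht : t ∈ I)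
    (hst : ¬ formOf (a s) ∣ formOf (a t)) {z : Fin (n + 1) → ℂ} (hz : z ≠ 0)
    (hzs : MvPolynomial.eval z (formOf (a s)) = 0) (hzt : MvPolynomial.eval z (formOf (a t)) = 0) :
    Projectivization.mk ℂ z hz ∈ singularSet H :=
  mem_singularSet_of_leaves hn hdim (isHomogeneous_formOf _) (isHomogeneous_formOf _) h.degree_pos
    h.degree_pos (h.irreducible s hs) (h.irreducible t ht) hst (h.mem_cone s hs) (h.mem_cone t ht)
    hz hzs hzt

/-- Being distinct is an open condition on a pair of leaves: it is the nonvanishing of a minor of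
the coefficient vectors. -/
theorem AlgebraicLeaves.eventually_not_dvd (h : AlgebraicLeaves H d I a) {s t : ℝ} (hs : s ∈ I)
    (ht : t ∈ I) (hst : ¬ formOf (a s) ∣ formOf (a t)) :
    ∀ᶠ u : ℝ × ℝ in 𝓝 (s, t), u.1 ∈ I ∧ u.2 ∈ I ∧ ¬ formOf (a u.1) ∣ formOf (a u.2) := by
  obtain ⟨α, β, hαβ⟩ : ∃ α β, a s α * a t β - a s β * a t α ≠ 0 := by
    by_contra! hall
    obtain ⟨α, hα⟩ := Function.ne_iff.1 (h.ne_zero hs)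
    refine hst ((formOf_dvd_formOf_iff (h.ne_zero ht)).2 ⟨a t α / a s α, funext fun β => ?_⟩)
    have hα' : a s α ≠ 0 := hα
    rw [Pi.smul_apply, smul_eq_mul, div_mul_eq_mul_div, eq_div_iff hα']
    linear_combination hall α β
  have h1 : ∀ γ, ContinuousAt (fun u : ℝ × ℝ => a u.1 γ) (s, t) := fun γ =>
    (analyticAt_pi_iff.1 (h.analytic s hs) γ).continuousAt.comp_of_eq continuousAt_fst rfl
  have h2 : ∀ γ, ContinuousAt (fun u : ℝ × ℝ => a u.2 γ) (s, t) := fun γ =>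
    (analyticAt_pi_iff.1 (h.analytic t ht) γ).continuousAt.comp_of_eq continuousAt_snd rfl
  have h3 := (((h1 α).mul (h2 β)).sub ((h1 β).mul (h2 α))).eventually_ne hαβ
  have h4 : ∀ᶠ u : ℝ × ℝ in 𝓝 (s, t), u.1 ∈ I ∧ u.2 ∈ I :=
    (h.isOpen.prod h.isOpen).mem_nhds (⟨hs, ht⟩ : (s, t) ∈ I ×ˢ I)
  filter_upwards [h3, h4] with u hu hI
  refine ⟨hI.1, hI.2, fun hdvd => hu ?_⟩
  obtain ⟨c, hc⟩ := (formOf_dvd_formOf_iff (h.ne_zero hI.2)).1 hdvd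
  simp only [hc, Pi.smul_apply, smul_eq_mul, Pi.mul_apply, Pi.sub_apply]
  ring

end InfinitelyManyLeaves

/-! ### Intersections of two leaves -/

section Intersections

variable {d n m : ℕ} {H : Set (CP n)} {I : Set ℝ} {a : ℝ → Sym (Fin (n + 1)) d → ℂ}

/-- An analytic choice, for parameters `((s, t), M)` in a ball, of a point in the intersection of
the leaves `s` and `t` and the linear subspace `M Z = 0`, inside the chart `i`. -/
structure IsIntersectionFamily (I : Set ℝ) (a : ℝ → Sym (Fin (n + 1)) d → ℂ) (i : Fin (n + 1))
    (u₀ : (ℝ × ℝ) × (Fin m → Fin (n + 1) → ℂ)) (ε : ℝ)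
    (Z : (ℝ × ℝ) × (Fin m → Fin (n + 1) → ℂ) → Fin (n + 1) → ℂ) : Prop where
  pos : 0 < ε
  analytic : AnalyticOnNhd ℝ Z (Metric.ball u₀ ε)
  ne_zero : ∀ u ∈ Metric.ball u₀ ε, Z u i ≠ 0
  fst_mem : ∀ u ∈ Metric.ball u₀ ε, u.1.1 ∈ I
  snd_mem : ∀ u ∈ Metric.ball u₀ ε, u.1.2 ∈ I
  not_dvd : ∀ u ∈ Metric.ball u₀ ε, ¬ formOf (a u.1.1) ∣ formOf (a u.1.2)
  eval_fst : ∀ u ∈ Metric.ball u₀ ε, MvPolynomial.eval (Z u) (formOf (a u.1.1)) = 0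
  eval_snd : ∀ u ∈ Metric.ball u₀ ε, MvPolynomial.eval (Z u) (formOf (a u.1.2)) = 0
  linear : ∀ u ∈ Metric.ball u₀ ε, ∀ k, ∑ j, u.2 k j * Z u j = 0

/-- Two leaves and at most `n - 2` hyperplanes have a common point, and this point can be chosen
analytically in the parameters near general parameters. -/
theorem AlgebraicLeaves.exists_isIntersectionFamily (h : AlgebraicLeaves H d I a)
    (hm : m + 2 ≤ n) : ∃ i u₀ ε Z, IsIntersectionFamily (m := m) I a i u₀ ε Z := by
  classical
  obtain ⟨t₀, ht₀⟩ := h.nonempty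
  obtain ⟨s₀, hs₀, hst⟩ := (infinite_of_mem_nhds t₀ (h.isOpen.mem_nhds ht₀)).exists_notMem_finite
    (h.finite t₀ ht₀)
  obtain ⟨ε, hε, hball⟩ := Metric.eventually_nhds_iff_ball.1
    (h.eventually_not_dvd hs₀ ht₀ fun hd => hst ⟨hs₀, hd⟩)
  set U : Set ((ℝ × ℝ) × (Fin m → Fin (n + 1) → ℂ)) := Metric.ball (s₀, t₀) ε ×ˢ univ with hU
  have hUo : IsOpen U := Metric.isOpen_ball.prod isOpen_univ
  have hcoef1 : ∀ α, AnalyticOnNhd ℝ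
      (fun u : (ℝ × ℝ) × (Fin m → Fin (n + 1) → ℂ) => a u.1.1 α) U := fun α u hu =>
    (analyticAt_pi_iff.1 (h.analytic _ (hball _ hu.1).1) α).comp_of_eq
      (((ContinuousLinearMap.fst ℝ ℝ ℝ).comp
        (ContinuousLinearMap.fst ℝ (ℝ × ℝ) _)).analyticAt u) rfl
  have hcoef2 : ∀ α, AnalyticOnNhd ℝ
      (fun u : (ℝ × ℝ) × (Fin m → Fin (n + 1) → ℂ) => a u.1.2 α) U := fun α u hu =>
    (analyticAt_pi_iff.1 (h.analytic _ (hball _ hu.1).2.1) α).comp_of_eq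
      (((ContinuousLinearMap.snd ℝ ℝ ℝ).comp
        (ContinuousLinearMap.fst ℝ (ℝ × ℝ) _)).analyticAt u) rfl
  have hcoef3 : ∀ k j, AnalyticOnNhd ℝ
      (fun u : (ℝ × ℝ) × (Fin m → Fin (n + 1) → ℂ) => u.2 k j) U := fun k j u _ =>
    (analyticAt_entry ℝ k j u.2).comp_of_eq analyticAt_snd rfl
  have hmono : ∀ α : Sym (Fin (n + 1)) d, IsPolyFamily ℝ U
      fun (_ : (ℝ × ℝ) × (Fin m → Fin (n + 1) → ℂ)) (z : Fin (n + 1) ⊕ Fin (n + 1) → ℂ) =>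
        monomialValue α fun j => z (.inl j) := fun α => by
    have h1 := IsPolyFamily.eval (𝕜 := ℝ) (U := U)
      ((α : Multiset (Fin (n + 1))).map MvPolynomial.X).prod
      (F := fun j _ (z : Fin (n + 1) ⊕ Fin (n + 1) → ℂ) => z (.inl j))
      fun j => IsPolyFamily.coord (Sum.inl j)
    simpa [monomialValue, map_multiset_prod, Multiset.map_map] using h1
  -- the extra unknowns `z (.inr j)` and the equation `∑ z (.inl j) * z (.inr j) = 1` exclude the
  -- solution `0`
  obtain ⟨U', hU', hU'o, ⟨u₀, hu₀⟩, z, hz, hz0⟩ := exists_analytic_section (𝕜 := ℝ) (U := U)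
    hUo ((convex_ball _ _).isPreconnected.prod isPreconnected_univ)
    ⟨((s₀, t₀), 0), Metric.mem_ball_self hε, mem_univ _⟩ (σ := Fin (n + 1) ⊕ Fin (n + 1))
    (κ := Option (Bool ⊕ Fin m))
    (F := fun o u z => o.elim (∑ j, z (.inl j) * z (.inr j) - 1) fun e => e.elim
      (fun b => ∑ α, a (cond b u.1.1 u.1.2) α * monomialValue α fun j => z (.inl j))
      fun k => ∑ j, u.2 k j * z (.inl j))
    (fun o => by
      rcases o with _ | (_ | _) | k
      · exact (IsPolyFamily.sum fun j _ =>
          (IsPolyFamily.coord (Sum.inl j)).mul (IsPolyFamily.coord (Sum.inr j))).sub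
          (IsPolyFamily.const 1)
      · exact IsPolyFamily.sum fun α _ => (IsPolyFamily.coeff (hcoef2 α)).mul (hmono α)
      · exact IsPolyFamily.sum fun α _ => (IsPolyFamily.coeff (hcoef1 α)).mul (hmono α)
      · change IsPolyFamily ℝ U fun (u : (ℝ × ℝ) × (Fin m → Fin (n + 1) → ℂ))
          (z : Fin (n + 1) ⊕ Fin (n + 1) → ℂ) => ∑ j, u.2 k j * z (.inl j)
        exact IsPolyFamily.sum fun j _ => (IsPolyFamily.coeff (hcoef3 k j)).mul
          (IsPolyFamily.coord (Sum.inl j)))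
    (fun u hu => by
      have hform0 : ∀ s, MvPolynomial.eval 0 (formOf (a s)) = 0 := fun s => by
        have := eval_smul_of_isHomogeneous (isHomogeneous_formOf (a s)) 0 0
        rwa [zero_smul, zero_pow h.degree_pos.ne', zero_mul] at this
      obtain ⟨Z, hZ, hZ0⟩ := exists_common_zero_ne_zero (N := n + 1) (r := 2 + m) (by omega)
        (Fin.addCases ![formOf (a u.1.1), formOf (a u.1.2)]
          fun k => ∑ j, MvPolynomial.C (u.2 k j) * MvPolynomial.X j) (fun l => by
          refine Fin.addCases (fun k => ?_) (fun k => ?_) l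
          · fin_cases k
            · simpa using hform0 u.1.1
            · simpa using hform0 u.1.2
          · simp)
      have h1 : MvPolynomial.eval Z (formOf (a u.1.1)) = 0 := by
        have := hZ0 (Fin.castAdd m 0)
        rw [Fin.addCases_left] at this
        exact this
      have h2 : MvPolynomial.eval Z (formOf (a u.1.2)) = 0 := by
        have := hZ0 (Fin.castAdd m 1)
        rw [Fin.addCases_left] at this
        exact this
      obtain ⟨i, hi⟩ := Function.ne_iff.1 hZ
      refine ⟨Sum.elim Z (Pi.single i (Z i)⁻¹), fun o => ?_⟩
      rcases o with _ | (_ | _) | k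
      · change ∑ j, Z j * (Pi.single i (Z i)⁻¹ : Fin (n + 1) → ℂ) j - 1 = 0
        rw [Finset.sum_eq_single i (fun j _ hj => by simp [hj]) (by simp), Pi.single_eq_same,
          mul_inv_cancel₀ hi, sub_self]
      · rwa [eval_formOf] at h2
      · rwa [eval_formOf] at h1
      · simpa using hZ0 (Fin.natAdd 2 k))
  have hnz : ∃ i, z u₀ (.inl i) ≠ 0 := by
    by_contra! hall
    have := hz0 u₀ hu₀ none
    simp [hall] at this
  obtain ⟨i, hi⟩ := hnz
  have hev : ∀ᶠ u in 𝓝 u₀, u ∈ U' ∧ z u (.inl i) ≠ 0 := Filter.Eventually.and (hU'o.mem_nhds hu₀)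
    ((analyticAt_pi_iff.1 (hz u₀ hu₀) (.inl i)).continuousAt.eventually_ne hi)
  obtain ⟨ε', hε', hball'⟩ := Metric.eventually_nhds_iff_ball.1 hev
  exact ⟨i, u₀, ε', fun u j => z u (.inl j),
    { pos := hε'
      analytic := fun u hu => analyticAt_pi_iff.2 fun j =>
        analyticAt_pi_iff.1 (hz u (hball' u hu).1) (.inl j)
      ne_zero := fun u hu => (hball' u hu).2
      fst_mem := fun u hu => (hball _ (hU' (hball' u hu).1).1).1
      snd_mem := fun u hu => (hball _ (hU' (hball' u hu).1).1).2.1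
      not_dvd := fun u hu => (hball _ (hU' (hball' u hu).1).1).2.2
      eval_fst := fun u hu => by
        rw [eval_formOf]
        exact hz0 u (hball' u hu).1 (some (.inl true))
      eval_snd := fun u hu => by
        rw [eval_formOf]
        exact hz0 u (hball' u hu).1 (some (.inl false))
      linear := fun u hu k => hz0 u (hball' u hu).1 (some (.inr k)) }⟩

end Intersections

/-! ### Maps of rank at most one -/

section Fibres

variable {F : Type*} [NormedAddCommGroup F] [NormedSpace ℝ F]

/-- Two vectors in the kernel of a nonzero functional on the plane are proportional. -/
theorem eq_zero_of_mem_ker {L : ℝ × ℝ →L[ℝ] ℝ} {T : ℝ × ℝ →L[ℝ] F} (hL : L ≠ 0) {v w : ℝ × ℝ}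
    (hv : L v = 0) (hw : L w = 0) (hw0 : w ≠ 0) (hTw : T w = 0) : T v = 0 := by
  have hLa : ∀ x : ℝ × ℝ, L x = x.1 * L (1, 0) + x.2 * L (0, 1) := fun x => by
    conv_lhs => rw [show x = x.1 • ((1, 0) : ℝ × ℝ) + x.2 • ((0, 1) : ℝ × ℝ) by ext <;> simp]
    rw [map_add, map_smul, map_smul, smul_eq_mul, smul_eq_mul]
  rw [hLa] at hv hw
  have hdet : v.1 * w.2 = v.2 * w.1 := by
    by_contra hne
    have h1 : (v.1 * w.2 - v.2 * w.1) * L (1, 0) = 0 := by linear_combination w.2 * hv - v.2 * hw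
    have h2 : (v.1 * w.2 - v.2 * w.1) * L (0, 1) = 0 := by linear_combination v.1 * hw - w.1 * hv
    have h3 := (mul_eq_zero.1 h1).resolve_left (sub_ne_zero.2 hne)
    have h4 := (mul_eq_zero.1 h2).resolve_left (sub_ne_zero.2 hne)
    exact hL (ContinuousLinearMap.ext fun x => by rw [hLa, h3, h4]; simp)
  have h1 : w.1 • v = v.1 • w := by
    ext
    · simp [mul_comm]
    · simp only [Prod.smul_snd, smul_eq_mul]
      linarith
  have h2 : w.2 • v = v.2 • w := by
    ext
    · simp only [Prod.smul_fst, smul_eq_mul]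
      linarith
    · simp [mul_comm]
  have h3 : w.1 • T v = 0 := by rw [← map_smul, h1, map_smul, hTw, smul_zero]
  have h4 : w.2 • T v = 0 := by rw [← map_smul, h2, map_smul, hTw, smul_zero]
  rcases smul_eq_zero.1 h3 with h5 | h5
  · rcases smul_eq_zero.1 h4 with h6 | h6
    · exact absurd (Prod.ext h5 h6) hw0
    · exact h6
  · exact h5

/-- An analytic map of the plane whose derivative is nowhere injective has an infinite fibre: it is
constant on the level curves of one of its components. -/
theorem exists_infinite_fibre [CompleteSpace F] {q : ℝ × ℝ → F} {u₀ : ℝ × ℝ} {ε : ℝ} (hε : 0 < ε)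
    (hq : AnalyticOnNhd ℝ q (Metric.ball u₀ ε))
    (hker : ∀ u ∈ Metric.ball u₀ ε, ∃ w, w ≠ 0 ∧ fderiv ℝ q u w = 0) :
    ∃ x ∈ Metric.ball u₀ ε, {u ∈ Metric.ball u₀ ε | q u = q x}.Infinite := by
  by_cases hconst : ∀ u ∈ Metric.ball u₀ ε, fderiv ℝ q u = 0
  · refine ⟨u₀, Metric.mem_ball_self hε, ?_⟩
    refine (infinite_of_mem_nhds u₀ (Metric.ball_mem_nhds u₀ hε)).mono fun u hu => ⟨hu, ?_⟩
    exact Metric.isOpen_ball.is_const_of_fderiv_eq_zero (convex_ball u₀ ε).isPreconnected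
      (fun u hu => (hq u hu).differentiableAt.differentiableWithinAt) hconst hu
      (Metric.mem_ball_self hε)
  push Not at hconst
  obtain ⟨u₁, hu₁, hne⟩ := hconst
  obtain ⟨e, he⟩ : ∃ e, fderiv ℝ q u₁ e ≠ 0 := by
    by_contra! hall
    exact hne (ContinuousLinearMap.ext hall)
  obtain ⟨ℓ, hℓ⟩ : ∃ ℓ : F →L[ℝ] ℝ, ℓ (fderiv ℝ q u₁ e) ≠ 0 := by
    obtain ⟨ℓ, -, hℓ⟩ := exists_dual_vector ℝ _ (norm_ne_zero_iff.2 he)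
    exact ⟨ℓ, by rw [hℓ]; simpa using he⟩
  obtain ⟨w, hw0, hw⟩ := hker u₁ hu₁
  -- the level curve of `ℓ ∘ q` through `u₁`, as a graph over the line in the direction `w`
  have hqd : ∀ u ∈ Metric.ball u₀ ε, HasFDerivAt q (fderiv ℝ q u) u := fun u hu =>
    (hq u hu).differentiableAt.hasFDerivAt
  set G : ℝ × ℝ → ℝ × ℝ := fun x => u₁ + x.1 • w + x.2 • e
  have hGa : AnalyticAt ℝ G (0, 0) :=
    (analyticAt_const.add (analyticAt_fst.smul analyticAt_const)).add
    (analyticAt_snd.smul analyticAt_const)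
  have hG0 : G (0, 0) = u₁ := by simp [G]
  have hder : HasDerivAt (fun x : ℝ => ℓ (q (G (0, x))) - ℓ (q u₁)) (ℓ (fderiv ℝ q u₁ e)) 0 := by
    have h1 : HasDerivAt (fun x : ℝ => G (0, x)) e 0 := by
      have := ((hasDerivAt_id (0 : ℝ)).smul_const e).const_add (u₁ + (0 : ℝ) • w)
      simpa [G] using this
    have h2 : HasFDerivAt q (fderiv ℝ q u₁) (G (0, 0)) := by
      rw [hG0]
      exact hqd u₁ hu₁
    exact (ℓ.hasFDerivAt.comp_hasDerivAt (0 : ℝ) (h2.comp_hasDerivAt (0 : ℝ) h1)).sub_const _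
  obtain ⟨φ, hφa, hφ0, hφ, -⟩ := exists_analytic_implicit (𝕜 := ℝ) (𝕜' := ℝ)
    (F := fun x : ℝ × ℝ => ℓ (q (G x)) - ℓ (q u₁)) (e₀ := 0) (x₀ := 0)
    (((ℓ.analyticAt _).comp_of_eq ((hq u₁ hu₁).comp_of_eq hGa hG0) rfl).sub analyticAt_const)
    (by simp [hG0]) hder hℓ
  set γ : ℝ → ℝ × ℝ := fun τ => G (τ, φ τ)
  have hγ0 : γ 0 = u₁ := by simp [γ, hφ0, hG0]
  have hγc : Tendsto γ (𝓝 0) (𝓝 u₁) := by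
    have h1 : ContinuousAt γ 0 := by
      have h2 : AnalyticAt ℝ (fun τ => (τ, φ τ)) 0 := analyticAt_id.prod hφa
      exact (hGa.comp_of_eq h2 (by simp [hφ0])).continuousAt
    have := h1.tendsto
    rwa [hγ0] at this
  have hLc : ∀ᶠ u in 𝓝 u₁, ℓ.comp (fderiv ℝ q u) ≠ 0 := by
    have h1 : ContinuousAt (fun u => ℓ (fderiv ℝ q u e)) u₁ :=
      ℓ.continuous.continuousAt.comp ((hq u₁ hu₁).fderiv.continuousAt.clm_apply continuousAt_const)
    filter_upwards [h1.eventually_ne hℓ] with u hu h0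
    exact hu (by simpa using congrArg (fun T => T e) h0)
  have hgood : ∀ᶠ τ in 𝓝 (0 : ℝ), AnalyticAt ℝ φ τ ∧ γ τ ∈ Metric.ball u₀ ε ∧
      ℓ.comp (fderiv ℝ q (γ τ)) ≠ 0 ∧ ℓ (q (γ τ)) = ℓ (q u₁) := by
    filter_upwards [hφa.eventually_analyticAt,
      hγc.eventually (Metric.isOpen_ball.mem_nhds hu₁), hγc.eventually hLc, hφ] with τ h1 h2 h3 h4
    exact ⟨h1, h2, h3, sub_eq_zero.1 h4⟩
  obtain ⟨δ, hδ, hball⟩ := Metric.eventually_nhds_iff_ball.1 hgood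
  have hγd : ∀ τ ∈ Metric.ball (0 : ℝ) δ, HasDerivAt γ (w + deriv φ τ • e) τ := by
    intro τ hτ
    have h1 := (hball τ hτ).1.differentiableAt.hasDerivAt
    simpa [γ, G] using (((hasDerivAt_id τ).smul_const w).const_add u₁).fun_add (h1.smul_const e)
  have hqγ : ∀ τ ∈ Metric.ball (0 : ℝ) δ, HasDerivAt (fun τ => q (γ τ)) 0 τ := by
    intro τ hτ
    obtain ⟨-, h2, h3, -⟩ := hball τ hτ
    have h5 := (hqd _ h2).comp_hasDerivAt τ (hγd τ hτ)
    have h6 := ℓ.hasFDerivAt.comp_hasDerivAt τ h5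
    have h7 : (fun τ => ℓ (q (γ τ))) =ᶠ[𝓝 τ] fun _ => ℓ (q u₁) := by
      filter_upwards [Metric.isOpen_ball.mem_nhds hτ] with τ' hτ'
      exact (hball τ' hτ').2.2.2
    have h8 := h6.unique ((hasDerivAt_const τ (ℓ (q u₁))).congr_of_eventuallyEq h7)
    -- the kernel of `dq` lies in that of `d(ℓ ∘ q)`, which is the tangent line of the level curve
    obtain ⟨w', hw'0, hw'⟩ := hker _ h2
    have h9 := eq_zero_of_mem_ker (L := ℓ.comp (fderiv ℝ q (γ τ))) (T := fderiv ℝ q (γ τ)) h3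
      (v := w + deriv φ τ • e) (w := w') h8 (by simp [hw']) hw'0 hw'
    rw [h9] at h5
    exact h5
  have hconst : ∀ τ ∈ Metric.ball (0 : ℝ) δ, q (γ τ) = q u₁ := fun τ hτ => by
    rw [← hγ0]
    exact Metric.isOpen_ball.is_const_of_deriv_eq_zero (convex_ball (0 : ℝ) δ).isPreconnected
      (fun τ hτ => (hqγ τ hτ).differentiableAt.differentiableWithinAt)
      (fun τ hτ => (hqγ τ hτ).deriv) hτ (Metric.mem_ball_self hδ)
  have hinj : Function.Injective γ := by
    intro τ τ' hττ
    have h1 : τ • w + φ τ • e = τ' • w + φ τ' • e := by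
      simpa [γ, G, add_assoc] using hττ
    have h2 := congrArg (fderiv ℝ q u₁) h1
    simp only [map_add, map_smul, hw, smul_zero, zero_add] at h2
    have h3 : φ τ = φ τ' := smul_left_injective ℝ he h2
    rw [h3] at h1
    exact smul_left_injective ℝ hw0 (add_right_cancel h1)
  refine ⟨u₁, hu₁, ((infinite_of_mem_nhds (0 : ℝ) (Metric.ball_mem_nhds _ hδ)).image
    hinj.injOn).mono ?_⟩
  rintro _ ⟨τ, hτ, rfl⟩
  exact ⟨(hball τ hτ).2.1, hconst τ hτ⟩

end Fibres

/-! ### Degenerate singularities -/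

section Degenerate

variable {d n m : ℕ} {H : Set (CP n)} {I : Set ℝ} {a : ℝ → Sym (Fin (n + 1)) d → ℂ}
  {i : Fin (n + 1)} {u₀ : (ℝ × ℝ) × (Fin m → Fin (n + 1) → ℂ)} {ε : ℝ}
  {Z : (ℝ × ℝ) × (Fin m → Fin (n + 1) → ℂ) → Fin (n + 1) → ℂ}

theorem prodMk_mem_ball {α β : Type*} [PseudoMetricSpace α] [PseudoMetricSpace β] {a a₀ : α}
    {b b₀ : β} {ε : ℝ} (ha : a ∈ Metric.ball a₀ ε) (hb : b ∈ Metric.ball b₀ ε) :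
    (a, b) ∈ Metric.ball (a₀, b₀) ε := by
  rw [← ball_prod_same]
  exact ⟨ha, hb⟩

theorem IsIntersectionFamily.Z_ne_zero (h : IsIntersectionFamily I a i u₀ ε Z)
    {u : (ℝ × ℝ) × (Fin m → Fin (n + 1) → ℂ)} (hu : u ∈ Metric.ball u₀ ε) : Z u ≠ 0 := fun h0 =>
  h.ne_zero u hu (congrFun h0 i)

theorem IsIntersectionFamily.chart_mem_singularSet (h : IsIntersectionFamily I a i u₀ ε Z)
    (hL : AlgebraicLeaves H d I a) (hn : 0 < n)
    (hdim : dimension ℝ H = ((2 * n - 1 : ℕ) : ℕ∞))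
    {u : (ℝ × ℝ) × (Fin m → Fin (n + 1) → ℂ)} (hu : u ∈ Metric.ball u₀ ε) :
    chart i (dehomog i (Z u)) ∈ singularSet H := by
  rw [chart_dehomog (h.Z_ne_zero hu) (h.ne_zero u hu)]
  exact hL.mem_singularSet hn hdim (h.fst_mem u hu) (h.snd_mem u hu) (h.not_dvd u hu) _
    (h.eval_fst u hu) (h.eval_snd u hu)

theorem IsIntersectionFamily.analyticAt_dehomog (h : IsIntersectionFamily I a i u₀ ε Z)
    {u : (ℝ × ℝ) × (Fin m → Fin (n + 1) → ℂ)} (hu : u ∈ Metric.ball u₀ ε) :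
    AnalyticAt ℝ (fun u => dehomog i (Z u)) u :=
  ((LeviFlatProj.analyticAt_dehomog (h.ne_zero u hu)).restrictScalars (𝕜 := ℝ)).comp_of_eq
    (h.analytic u hu) rfl

theorem IsIntersectionFamily.analyticAt_dehomog_left (h : IsIntersectionFamily I a i u₀ ε Z)
    {v : ℝ × ℝ} {M : Fin m → Fin (n + 1) → ℂ} (hu : (v, M) ∈ Metric.ball u₀ ε) :
    AnalyticAt ℝ (fun v => dehomog i (Z (v, M))) v :=
  (h.analyticAt_dehomog hu).comp_of_eq (analyticAt_id.prod analyticAt_const) rfl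

/-- If two parameters of an intersection family give the same point, all four leaves pass through
it. -/
theorem IsIntersectionFamily.eval_eq_zero_of_eq (h : IsIntersectionFamily I a i u₀ ε Z)
    {u u' : (ℝ × ℝ) × (Fin m → Fin (n + 1) → ℂ)} (hu : u ∈ Metric.ball u₀ ε)
    (hu' : u' ∈ Metric.ball u₀ ε) (heq : dehomog i (Z u) = dehomog i (Z u')) :
    MvPolynomial.eval (Z u') (formOf (a u.1.1)) = 0 ∧
      MvPolynomial.eval (Z u') (formOf (a u.1.2)) = 0 := by
  have h1 := congrArg (affineLift i) heq
  rw [affineLift_dehomog (h.ne_zero u hu), affineLift_dehomog (h.ne_zero u' hu')] at h1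
  have h2 : (Z u' i * (Z u i)⁻¹) • Z u = Z u' := by
    rw [mul_smul, h1, smul_smul, mul_inv_cancel₀ (h.ne_zero u' hu'), one_smul]
  exact ⟨eval_eq_zero_of_smul_eq (isHomogeneous_formOf _) (h.eval_fst u hu) h2,
    eval_eq_zero_of_smul_eq (isHomogeneous_formOf _) (h.eval_snd u hu) h2⟩

/-- If the singular set has real dimension less than `2n - 2`, the derivative of an intersection
family in the parameters of the two leaves is nowhere injective. -/
theorem IsIntersectionFamily.exists_ker (h : IsIntersectionFamily I a i u₀ ε Z)
    (hL : AlgebraicLeaves H d I a) (hm : m + 2 = n)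
    (hdim : dimension ℝ H = ((2 * n - 1 : ℕ) : ℕ∞))
    (hsing : dimension ℝ (singularSet H) < ((2 * n - 2 : ℕ) : ℕ∞))
    {v : ℝ × ℝ} {M : Fin m → Fin (n + 1) → ℂ} (hu : (v, M) ∈ Metric.ball u₀ ε) :
    ∃ w, w ≠ 0 ∧ fderiv ℝ (fun v => dehomog i (Z (v, M))) v w = 0 := by
  by_contra! hall
  have key := ContainsSubmanifold.of_linear_sections (𝕜 := ℝ) (A := chart i ⁻¹' singularSet H)
    (h.analytic _ hu) (h.ne_zero _ hu)
    (by
      filter_upwards [Metric.isOpen_ball.mem_nhds hu] with u hu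
      exact h.chart_mem_singularSet hL (by omega) hdim hu)
    (by
      filter_upwards [Metric.isOpen_ball.mem_nhds hu] with u hu
      exact h.linear u hu)
    (fun σ hσ => by
      by_contra hσ0
      exact hall σ hσ0 hσ)
  rw [finrank_real_pi_complex, Module.finrank_prod, Module.finrank_self] at key
  have h1 := (le_dimension key).trans_lt hsing
  rw [show 2 * n - 2 = 1 + 1 + 2 * m by omega] at h1
  exact lt_irrefl _ h1

/-- If the singular set has real dimension `2n - 4`, an intersection family does not depend on the
parameters of the two leaves. -/
theorem IsIntersectionFamily.fderiv_eq_zero (h : IsIntersectionFamily I a i u₀ ε Z)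
    (hL : AlgebraicLeaves H d I a) (hm : m + 2 = n)
    (hdim : dimension ℝ H = ((2 * n - 1 : ℕ) : ℕ∞))
    (hsing : dimension ℝ (singularSet H) = ((2 * n - 4 : ℕ) : ℕ∞))
    {v : ℝ × ℝ} {M : Fin m → Fin (n + 1) → ℂ} (hu : (v, M) ∈ Metric.ball u₀ ε) :
    fderiv ℝ (fun v => dehomog i (Z (v, M))) v = 0 := by
  refine ContinuousLinearMap.ext fun w => ?_
  by_contra hw
  set ψ : ℝ × (Fin m → Fin (n + 1) → ℂ) → (ℝ × ℝ) × (Fin m → Fin (n + 1) → ℂ) :=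
    fun x => (v + x.1 • w, x.2)
  have hψa : AnalyticAt ℝ ψ (0, M) :=
    (analyticAt_const.add (analyticAt_fst.smul analyticAt_const)).prod analyticAt_snd
  have hψ0 : ψ (0, M) = (v, M) := by simp [ψ]
  have hψt : ∀ᶠ x in 𝓝 (0, M), ψ x ∈ Metric.ball u₀ ε := by
    refine hψa.continuousAt.eventually ?_
    rw [hψ0]
    exact Metric.isOpen_ball.mem_nhds hu
  have key := ContainsSubmanifold.of_linear_sections (𝕜 := ℝ) (A := chart i ⁻¹' singularSet H)
    (Z := fun x => Z (ψ x)) (i := i) (s₀ := (0 : ℝ)) (M₀ := M)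
    ((h.analytic _ hu).comp_of_eq hψa hψ0) (by rw [hψ0]; exact h.ne_zero _ hu)
    (hψt.mono fun x hx => h.chart_mem_singularSet hL (by omega) hdim hx)
    (hψt.mono fun x hx => h.linear _ hx)
    (fun σ hσ => by
      have h1 : HasFDerivAt (fun v => dehomog i (Z (v, M)))
          (fderiv ℝ (fun v => dehomog i (Z (v, M))) v) (v + (0 : ℝ) • w) := by
        rw [zero_smul, add_zero]
        exact (h.analyticAt_dehomog_left hu).differentiableAt.hasFDerivAt
      have h2 : HasFDerivAt (fun s : ℝ => v + s • w)
          ((ContinuousLinearMap.id ℝ ℝ).smulRight w) (0 : ℝ) :=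
        ((hasFDerivAt_id (0 : ℝ)).smul_const w).const_add v
      have h3 := h1.comp (0 : ℝ) h2
      have h4 : fderiv ℝ (fun s : ℝ => dehomog i (Z (ψ (s, M)))) 0 = _ := h3.fderiv
      rw [h4] at hσ
      simp only [ContinuousLinearMap.comp_apply, ContinuousLinearMap.smulRight_apply,
        ContinuousLinearMap.id_apply, map_smul] at hσ
      exact (smul_eq_zero.1 hσ).resolve_right hw)
  rw [finrank_real_pi_complex, Module.finrank_self] at key
  have h1 := le_dimension key
  rw [hsing] at h1
  have h2 : 1 + 2 * m ≤ 2 * n - 4 := by exact_mod_cast h1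
  omega

/-- The points that two leaves have in common on a fixed linear subspace depend on two real
parameters. If `dim H_sing < 2n - 2`, infinitely many pairs of leaves meet in the same point, and
this point is a degenerate singularity. -/
theorem exists_isDegenerateSingularity (hn : 2 ≤ n) (hH : IsAlgebraicLeviFlatHypervariety H)
    (hsing : dimension ℝ (singularSet H) < ((2 * n - 2 : ℕ) : ℕ∞)) :
    ∃ p, IsDegenerateSingularity H p := by
  obtain ⟨d, I, a, hL⟩ := exists_algebraicLeaves (by omega) hH
  obtain ⟨m, rfl⟩ : ∃ m, n = m + 2 := ⟨n - 2, by omega⟩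
  obtain ⟨i, ⟨v₀, M⟩, ε, Z, h⟩ := hL.exists_isIntersectionFamily (m := m) le_rfl
  have hM : ∀ v ∈ Metric.ball v₀ ε, (v, M) ∈ Metric.ball (v₀, M) ε := fun v hv =>
    prodMk_mem_ball hv (Metric.mem_ball_self h.pos)
  obtain ⟨x, hx, hinf⟩ := exists_infinite_fibre h.pos
    (q := fun v => dehomog i (Z (v, M))) (fun v hv => h.analyticAt_dehomog_left (hM v hv))
    fun v hv => h.exists_ker hL rfl hH.codim_one hsing (hM v hv)
  refine ⟨_, hL.isDegenerateSingularity (h.Z_ne_zero (hM x hx)) fun hfin => hinf ?_⟩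
  refine (hfin.prod hfin).subset fun v hv => ?_
  have h1 := h.eval_eq_zero_of_eq (hM v hv.1) (hM x hx) hv.2
  exact ⟨⟨h.fst_mem _ (hM v hv.1), h1.1⟩, ⟨h.snd_mem _ (hM v hv.1), h1.2⟩⟩

/-- A complex submanifold of dimension `e` is a real submanifold of dimension `2e`. -/
theorem ContainsSubmanifold.real {A : Set (Fin n → ℂ)} {e : ℕ} (h : ContainsSubmanifold ℂ A e) :
    ContainsSubmanifold ℝ A (2 * e) := by
  obtain ⟨k, hk, M, hMA, q, hq, g, hga, hgs, hg⟩ := h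
  rw [Module.finrank_fin_fun] at hk
  have T : (Fin k → ℂ) ≃L[ℝ] (Fin (2 * k) → ℝ) :=
    ContinuousLinearEquiv.ofFinrankEq (by rw [finrank_real_pi_complex, Module.finrank_fin_fun])
  refine ⟨2 * k, by rw [finrank_real_pi_complex]; omega, M, hMA, q, hq, fun z => T (g z),
    ?_, ?_, ?_⟩
  · exact ((T : (Fin k → ℂ) →L[ℝ] (Fin (2 * k) → ℝ)).analyticAt _).comp_of_eq
      (hga.restrictScalars (𝕜 := ℝ)) rfl
  · have h1 := hga.differentiableAt.hasFDerivAt.restrictScalars ℝ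
    have h2 := (T : (Fin k → ℂ) →L[ℝ] (Fin (2 * k) → ℝ)).hasFDerivAt.comp q h1
    have h3 : fderiv ℝ (fun z => T (g z)) q = _ := h2.fderiv
    rw [h3]
    exact T.surjective.comp hgs
  · filter_upwards [hg] with z hz
    rw [hz, map_eq_zero_iff T T.injective]

/-- If `dim H_sing = 2n - 4`, the points of an intersection family lie on a fixed infinite set of
leaves. The common zero locus of these leaves is the subvariety. -/
theorem exists_degenerate_subvariety (hn : 2 ≤ n) (hH : IsAlgebraicLeviFlatHypervariety H)
    (hsing : dimension ℝ (singularSet H) = ((2 * n - 4 : ℕ) : ℕ∞)) :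
    ∃ S : Set (CP n), IsComplexSubvariety S ∧ S ⊆ H ∧
      dimension ℂ S = ((n - 2 : ℕ) : ℕ∞) ∧ ∀ p ∈ S, IsDegenerateSingularity H p := by
  obtain ⟨d, I, a, hL⟩ := exists_algebraicLeaves (by omega) hH
  obtain ⟨m, rfl⟩ : ∃ m, n = m + 2 := ⟨n - 2, by omega⟩
  obtain ⟨i, ⟨⟨s₀, t₀⟩, M₀⟩, ε, Z, h⟩ := hL.exists_isIntersectionFamily (m := m) le_rfl
  have ht₀ : t₀ ∈ Metric.ball t₀ ε := Metric.mem_ball_self h.pos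
  have hs₀ : s₀ ∈ Metric.ball s₀ ε := Metric.mem_ball_self h.pos
  have hmem : ∀ s ∈ Metric.ball s₀ ε, (s, t₀) ∈ Metric.ball (s₀, t₀) ε := fun s hs =>
    prodMk_mem_ball hs ht₀
  set F : Metric.ball s₀ ε → MvPolynomial (Fin (m + 2 + 1)) ℂ := fun s => formOf (a s)
  have hF : ∀ s, (F s).IsHomogeneous d := fun s => isHomogeneous_formOf _
  have hI : Metric.ball s₀ ε ⊆ I := fun s hs =>
    h.fst_mem _ (prodMk_mem_ball (hmem s hs) (Metric.mem_ball_self h.pos))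
  have hinf : (Metric.ball s₀ ε).Infinite :=
    infinite_of_mem_nhds s₀ (Metric.ball_mem_nhds s₀ h.pos)
  have hdeg : ∀ p ∈ zeroLocus F, IsDegenerateSingularity H p := by
    intro p hp
    induction p using Projectivization.ind with
    | h z hz =>
      exact hL.isDegenerateSingularity hz
        (hinf.mono fun s hs => ⟨hI hs, hp z hz rfl ⟨s, hs⟩⟩)
  have hS : zeroLocus F ⊆ singularSet H := by
    intro p hp
    induction p using Projectivization.ind with
    | h z hz =>
      obtain ⟨s, hs, hst⟩ := hinf.exists_notMem_finite (hL.finite s₀ (hI hs₀))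
      exact hL.mem_singularSet (by omega) hH.codim_one (hI hs) (hI hs₀)
        (fun hd => hst ⟨hI hs, hd⟩) hz (hp z hz rfl ⟨s, hs⟩) (hp z hz rfl ⟨s₀, hs₀⟩)
  refine ⟨zeroLocus F, isComplexSubvariety_zeroLocus_of_infinite hF, fun p hp => (hdeg p hp).1,
    le_antisymm ?_ ?_, hdeg⟩
  · refine iSup_le fun j => iSup_le fun e => iSup_le fun he => ?_
    obtain ⟨k, hk, M, hM, hq⟩ := he.real
    have h1 := le_dimension (𝕜 := ℝ) (H := singularSet H) (i := j) (d := 2 * e)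
      ⟨k, hk, M, fun z hz => hS (hM hz), hq⟩
    rw [hsing] at h1
    have h2 : 2 * e ≤ 2 * (m + 2) - 4 := by exact_mod_cast h1
    have h3 : e ≤ m + 2 - 2 := by omega
    exact_mod_cast h3
  · refine le_dimension_of_linear_sections (F := F)
      (fun z hz hz0 => (mk_mem_zeroLocus_iff hF).2 hz0) Metric.isOpen_ball
      ⟨M₀, Metric.mem_ball_self h.pos⟩ fun M hM => ?_
    have hM' : ∀ v ∈ Metric.ball (s₀, t₀) ε, (v, M) ∈ Metric.ball ((s₀, t₀), M₀) ε :=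
      fun v hv => prodMk_mem_ball hv hM
    have hv₀ := Metric.mem_ball_self (x := (s₀, t₀)) h.pos
    refine ⟨Z ((s₀, t₀), M), h.Z_ne_zero (hM' _ hv₀), fun s => ?_, h.linear _ (hM' _ hv₀)⟩
    refine (h.eval_eq_zero_of_eq (hM' _ (hmem s s.2)) (hM' _ hv₀) ?_).1
    exact Metric.isOpen_ball.is_const_of_fderiv_eq_zero
      (f := fun v => dehomog i (Z (v, M))) (convex_ball _ _).isPreconnected
      (fun v hv =>
        (h.analyticAt_dehomog_left (hM' v hv)).differentiableAt.differentiableWithinAt)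
      (fun v hv => h.fderiv_eq_zero hL rfl hH.codim_one hsing (hM' v hv)) (hmem s s.2) hv₀

end Degenerate

end LeviFlatProj

end

theorem theorem1p2 (n : ℕ) (hn : 2 ≤ n) (H : Set (LeviFlatProj.CP n))
    (hH : LeviFlatProj.IsAlgebraicLeviFlatHypervariety H) :
    (∀ (m : ℕ) (C : Matrix (Sym (Fin (n + 1)) m) (Sym (Fin (n + 1)) m) ℂ) (r : ℕ),
      LeviFlatProj.IsDefiningPolynomial H C → C.rank = r → r ≤ n →
        ∃ S : Set (LeviFlatProj.CP n), LeviFlatProj.IsComplexSubvariety S ∧ S ⊆ H ∧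
          ((n - r : ℕ) : ℕ∞) ≤ LeviFlatProj.dimension ℂ S ∧
          ∀ p ∈ S, LeviFlatProj.IsAlgebraicDegenerateSingularity H C p) ∧
    (LeviFlatProj.dimension ℝ (LeviFlatProj.singularSet H) < ((2 * n - 2 : ℕ) : ℕ∞) →
      ∃ p : LeviFlatProj.CP n, LeviFlatProj.IsDegenerateSingularity H p) ∧
    (LeviFlatProj.dimension ℝ (LeviFlatProj.singularSet H) = ((2 * n - 4 : ℕ) : ℕ∞) →
      ∃ S : Set (LeviFlatProj.CP n), LeviFlatProj.IsComplexSubvariety S ∧ S ⊆ H ∧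
        LeviFlatProj.dimension ℂ S = ((n - 2 : ℕ) : ℕ∞) ∧
        ∀ p ∈ S, LeviFlatProj.IsDegenerateSingularity H p) := by
  refine ⟨?_, LeviFlatProj.exists_isDegenerateSingularity hn hH,
    LeviFlatProj.exists_degenerate_subvariety hn hH⟩
  rintro m C r hC rfl hr
  exact LeviFlatProj.exists_algebraic_degenerate_subvariety hC hr
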